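/- **Setting.** Let $M$ be a closed connected oriented three-manifold with a pseudotriangulation (a simplex need not be determined by its vertices) in which the four vertices of every tetrahedron are different. Assign to each vertex $A$ a point $\vec r_A\in\mathbb R^4$ so that no five different vertices lie in one affine hyperplane. Let $l_{AB}>0$ denote edge lengths and $S_{ABC}>0$ areas of two-faces. For two consistently oriented tetrahedra $EABC$ and $ABCD$ with common two-face $ABC$, let $\vartheta_{ABC}$ (modulo $2\pi$) be the exterior dihedral angle at $ABC$ in the four-simplex $ABCDE$, taken with the minus sign if $\det(\overrightarrow{AB},\overrightarrow{AC},\overrightarrow{AD},\overrightarrow{AE})<0$. Consider the sequence of based real vector spaces $$0\to\mathfrak e_4\xrightarrow{f_1}(dx)\xrightarrow{f_2}(dl)\oplus(d\vartheta)\xrightarrow{f_3}(d\omega)\xrightarrow{f_4}(d\rho)\xrightarrow{f_5}(d\alpha)\oplus(d\beta)\to0 .$$ Here $\mathfrak e_4$ consists of the infinitesimal Euclidean motions $(d\vec r,\mathcal A)$ with $d\vec r\in\mathbb R^4$, $\mathcal A\in\mathfrak{so}(4)$; $(dx)$ of the displacements of all vertices; $(dl)$ and $(d\vartheta)$ of the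 changes of all edge lengths and of the angles $\vartheta$ at all two-faces; $(d\omega)$ of infinitesimal rotations $d\omega_{BC}\in\mathfrak{so}(4)$, $d\omega_{BC}\overrightarrow{BC}=0$, $d\omega_{CB}=-d\omega_{BC}$, one for each edge, with components $b'_{34},b'_{42},b'_{23}$ in any positively oriented orthonormal coordinate system with first axis along $\overrightarrow{BC}$; $(d\rho)$ of one matrix $d\rho_A\in\mathfrak{so}(4)$ for each vertex; and $d\alpha\in\mathfrak{so}(4)$, $d\beta\in\mathbb R^4$. Antisymmetric matrices $(a_{ij})$ in $\mathfrak e_4$, $(d\rho)$ and $(d\alpha)$ are given by their entries $a_{ij}$, $i<j$. The maps are: $f_1(d\vec r,\mathcal A)=(d\vec r+\mathcal A\vec r_A)_A$; $f_2$ is the differential of lengths and angles $\vartheta$ as functions of the vertex coordinates; $f_3$ sends $(dl,d\vartheta)$ to the infinitesimal rotations $d\omega_{BC}$ by which a tetrahedron containing $BC$ is displaced when the tetrahedra around $BC$ are put into $\mathbb R^4$ one after another, for one revolution around $BC$, with lengths and angles changed by $(dl,d\vartheta)$; $f_4$ is $d\rho_A=\sum d\omega_{AB}$ over the edges $AB$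 at $A$; $f_5$ is $d\alpha=\sum_A d\rho_A$, $d\beta=\sum_A d\rho_A\vec r_A$. If this sequence is acyclic (exact), its torsion, defined up to sign, is $$\tau=\frac{\operatorname{minor} f_2\cdot\operatorname{minor} f_4}{\operatorname{minor} f_1\cdot\operatorname{minor} f_3\cdot\operatorname{minor} f_5},$$ where the minors are nonzero and the basis of each of the six spaces is divided completely between the rows of the minor of the incoming map and the columns of the minor of the outgoing map. **Theorem 2.** Consider a Pachner move $2\to3$ replacing two adjacent tetrahedra $ABCD$ and $EABC$ by $ABED$, $BCED$ and $CAED$, where the pseudotriangulations before and after the move are both as above (in particular $D\ne E$) and the vertex coordinates are unchanged. The sequence for the pseudotriangulation before the move is acyclic if and only if the one after the move is. If they are acyclic, then under the move $\tau$ is multiplied, up to sign, by $$\frac{2S_{ADE}\cdot 2S_{BDE}\cdot 2S_{CDE}}{l_{DE}^3\cdot 2S_{ABC}} .$$ Consequently, up to sign, $$\tau\cdot\frac{\prod_{\text{edges}}l^3}{\prod_{\text{two-faces}}2S}$$ is invariant under moves $2\leftrightarrow3$. -/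

import Mathlib

open scoped BigOperators

/-- Euclidean four-space. -/
abbrev R4 := EuclideanSpace ℝ (Fin 4)

/-! ### Euclidean quantities -/

/-- The area of the triangle `ABC`. -/
noncomputable def triangleArea (A B C : R4) : ℝ :=
  1 / 2 * dist A B * dist A C * Real.sin (EuclideanGeometry.angle B A C)

/-- The oriented four-volume of the simplex `ABCDE`. -/
noncomputable def orientedVolume (A B C D E : R4) : ℝ :=
  1 / 24 * Matrix.det (Matrix.of ![fun i => B i - A i, fun i => C i - A i,
    fun i => D i - A i, fun i => E i - A i])

/-- The component of the vector `AP` orthogonal to the plane `ABC`. -/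
noncomputable def planePerp (A B C P : R4) : R4 :=
  (Submodule.span ℝ {B - A, C - A})ᗮ.starProjection (P - A)

/-- The inner dihedral angle at the two-face `ABC` of the four-simplex `ABCDE`. -/
noncomputable def innerDihedral (A B C D E : R4) : ℝ :=
  InnerProductGeometry.angle (planePerp A B C D) (planePerp A B C E)

open Classical in
/-- The angle `ϑ` between the tetrahedra `EABC` and `ABCD`: the exterior dihedral angle at `ABC`,
taken with the minus sign if the oriented volume of `ABCDE` is negative. The five points are listed
in the order `E, A, B, C, D`. -/
noncomputable def hingeAngle (q : Fin 5 → R4) : ℝ :=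
  if orientedVolume (q 1) (q 2) (q 3) (q 4) (q 0) < 0 then
    -(Real.pi - innerDihedral (q 1) (q 2) (q 3) (q 4) (q 0))
  else Real.pi - innerDihedral (q 1) (q 2) (q 3) (q 4) (q 0)

/-- `exp (i ϑ)`; the angle `ϑ` itself is only defined modulo `2 π`. -/
noncomputable def hingePhase (q : Fin 5 → R4) : ℂ :=
  Complex.exp (hingeAngle q * Complex.I)

/-- The rate of change `dϑ` of the angle `ϑ` (as a quantity modulo `2 π`) when the points `q` move
with velocities `u`: if `z = exp (i ϑ)` then `dz = i z dϑ`, so `dϑ = Im (conj z * dz)`. -/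
noncomputable def dHingeAngle (q u : Fin 5 → R4) : ℝ :=
  ((starRingEnd ℂ) (hingePhase q) * fderiv ℝ hingePhase q u).im

/-- The rate of change of the distance between `x` and `y`, moving with velocities `u` and `w`. -/
noncomputable def dLength (x y u w : R4) : ℝ :=
  fderiv ℝ (fun q : R4 × R4 => dist q.1 q.2) (x, y) (u, w)

/-! ### Antisymmetric `4 × 4` matrices -/

/-- The index pairs `12, 13, 14, 23, 24, 34`. -/
abbrev IndexPair := {p : Fin 4 × Fin 4 // p.1 < p.2}

/-- The antisymmetric matrix with the entries `a i j` above the diagonal. -/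
def skew (a : IndexPair → ℝ) : Matrix (Fin 4) (Fin 4) ℝ :=
  Matrix.of fun i j =>
    if h : i < j then a ⟨(i, j), h⟩ else if h : j < i then -a ⟨(j, i), h⟩ else 0

/-- The components `b'₃₄, b'₄₂, b'₂₃` of a matrix `B` in the coordinate system whose axes are the
columns of `g`. -/
def rotationComponents (g B : Matrix (Fin 4) (Fin 4) ℝ) : Fin 3 → ℝ :=
  ![(g.transpose * B * g) 2 3, (g.transpose * B * g) 3 1, (g.transpose * B * g) 1 2]

/-- The antisymmetric matrix with `b'₁₂ = b'₁₃ = b'₁₄ = 0` and with the given components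
`b'₃₄, b'₄₂, b'₂₃` in the coordinate system whose axes are the columns of `g`. -/
def rotationOfComponents (g : Matrix (Fin 4) (Fin 4) ℝ) (c : Fin 3 → ℝ) :
    Matrix (Fin 4) (Fin 4) ℝ :=
  g * !![0, 0, 0, 0;
         0, 0, c 2, -c 1;
         0, -c 2, 0, c 0;
         0, c 1, -c 0, 0] * g.transpose

/-! ### Based complexes with six terms and their torsion -/

/-- Five matrices `f₁, …, f₅` between six based real vector spaces. -/
structure BasedComplex (ι₀ ι₁ ι₂ ι₃ ι₄ ι₅ : Type*) where
  f₁ : Matrix ι₁ ι₀ ℝ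
  f₂ : Matrix ι₂ ι₁ ℝ
  f₃ : Matrix ι₃ ι₂ ℝ
  f₄ : Matrix ι₄ ι₃ ℝ
  f₅ : Matrix ι₅ ι₄ ℝ

namespace BasedComplex

variable {ι₀ ι₁ ι₂ ι₃ ι₄ ι₅ : Type*}

/-- Exactness of `0 → ℝ^ι₀ → ℝ^ι₁ → ⋯ → ℝ^ι₅ → 0`; in particular all compositions vanish. -/
def IsAcyclic [Fintype ι₀] [Fintype ι₁] [Fintype ι₂] [Fintype ι₃] [Fintype ι₄]
    (X : BasedComplex ι₀ ι₁ ι₂ ι₃ ι₄ ι₅) : Prop :=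
  Function.Injective X.f₁.mulVec ∧
  Function.Exact X.f₁.mulVec X.f₂.mulVec ∧
  Function.Exact X.f₂.mulVec X.f₃.mulVec ∧
  Function.Exact X.f₃.mulVec X.f₄.mulVec ∧
  Function.Exact X.f₄.mulVec X.f₅.mulVec ∧
  Function.Surjective X.f₅.mulVec

/-- A choice of minors of `f₁, …, f₅`, all nonzero, such that the basis of each of the six spaces
is completely divided between the rows of the minor to its left and the columns of the minor to
its right: `s₁` divides the basis of the second space, and so on. -/
structure TauChain [Fintype ι₀] [DecidableEq ι₀] [Fintype ι₅] [DecidableEq ι₅]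
    (X : BasedComplex ι₀ ι₁ ι₂ ι₃ ι₄ ι₅) where
  n₂ : ℕ
  n₃ : ℕ
  n₄ : ℕ
  s₁ : ι₀ ⊕ Fin n₂ ≃ ι₁
  s₂ : Fin n₂ ⊕ Fin n₃ ≃ ι₂
  s₃ : Fin n₃ ⊕ Fin n₄ ≃ ι₃
  s₄ : Fin n₄ ⊕ ι₅ ≃ ι₄
  minor₁_ne : (X.f₁.submatrix (fun i => s₁ (Sum.inl i)) id).det ≠ 0
  minor₂_ne : (X.f₂.submatrix (fun i => s₂ (Sum.inl i)) (fun j => s₁ (Sum.inr j))).det ≠ 0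
  minor₃_ne : (X.f₃.submatrix (fun i => s₃ (Sum.inl i)) (fun j => s₂ (Sum.inr j))).det ≠ 0
  minor₄_ne : (X.f₄.submatrix (fun i => s₄ (Sum.inl i)) (fun j => s₃ (Sum.inr j))).det ≠ 0
  minor₅_ne : (X.f₅.submatrix id (fun j => s₄ (Sum.inr j))).det ≠ 0

/-- The torsion computed from a choice of minors. -/
noncomputable def TauChain.torsion [Fintype ι₀] [DecidableEq ι₀] [Fintype ι₅] [DecidableEq ι₅]
    {X : BasedComplex ι₀ ι₁ ι₂ ι₃ ι₄ ι₅} (c : X.TauChain) : ℝ :=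
  ((X.f₂.submatrix (fun i => c.s₂ (Sum.inl i)) (fun j => c.s₁ (Sum.inr j))).det *
    (X.f₄.submatrix (fun i => c.s₄ (Sum.inl i)) (fun j => c.s₃ (Sum.inr j))).det) /
  ((X.f₁.submatrix (fun i => c.s₁ (Sum.inl i)) id).det *
    (X.f₃.submatrix (fun i => c.s₃ (Sum.inl i)) (fun j => c.s₂ (Sum.inr j))).det *
    (X.f₅.submatrix id (fun j => c.s₄ (Sum.inr j))).det)

end BasedComplex

/-! ### Pseudotriangulations -/

/-- The cells of a three-dimensional complex glued from tetrahedra. `vert t` lists the vertices of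
the tetrahedron `t` in an order that represents its orientation (only the order up to even
permutations matters), `edge t i j` is its edge joining `vert t i` and `vert t j` for `i ≠ j`,
and `face t i` is its two-face opposite to `vert t i`. Every edge carries an
auxiliary direction, from `tail` to `head`. -/
structure TetComplex (V E F T : Type*) where
  vert : T → Fin 4 → V
  edge : T → Fin 4 → Fin 4 → E
  face : T → Fin 4 → F
  tail : E → V
  head : E → V

namespace TetComplex

variable {V E F T E' F' T' : Type*}

/-- `t` is the oriented tetrahedron `abcd`. -/
def HasTet (K : TetComplex V E F T) (t : T) (a b c d : V) : Prop :=
  ∃ p : Equiv.Perm (Fin 4), Equiv.Perm.sign p = 1 ∧ ∀ k, K.vert t (p k) = ![a, b, c, d] k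

/-- `e` is the edge of `t` joining its vertices `a` and `b`. -/
def HasEdge (K : TetComplex V E F T) (t : T) (a b : V) (e : E) : Prop :=
  ∃ i j : Fin 4, i ≠ j ∧ K.vert t i = a ∧ K.vert t j = b ∧ K.edge t i j = e

/-- `f` is the two-face of `t` opposite to its vertex `a`. -/
def HasFace (K : TetComplex V E F T) (t : T) (a : V) (f : F) : Prop :=
  ∃ i : Fin 4, K.vert t i = a ∧ K.face t i = f

/-- `t` and `t'` have a common two-face. -/
def Adjacent (K : TetComplex V E F T) (t t' : T) : Prop :=
  ∃ i i', K.face t i = K.face t' i'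

/-- `t` and `t'` have a common two-face that contains the vertex `v`. -/
def AdjacentAtVertex (K : TetComplex V E F T) (v : V) (t t' : T) : Prop :=
  ∃ i i', K.face t i = K.face t' i' ∧ ∃ j, j ≠ i ∧ K.vert t j = v

/-- `t` and `t'` have a common two-face that contains the edge `e`. -/
def AdjacentAtEdge (K : TetComplex V E F T) (e : E) (t t' : T) : Prop :=
  ∃ i i', K.face t i = K.face t' i' ∧ ∃ j k, j ≠ i ∧ k ≠ i ∧ j ≠ k ∧ K.edge t j k = e

/-- `K` is a consistently oriented pseudotriangulation of a closed connected three-manifold in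
which every tetrahedron has four different vertices. A simplex need not be determined by its
vertices. -/
structure IsClosedOrientedManifold (K : TetComplex V E F T) : Prop where
  vert_injective : ∀ t, Function.Injective (K.vert t)
  edge_symm : ∀ t i j, K.edge t i j = K.edge t j i
  edge_ends : ∀ t i j, i ≠ j →
    s(K.tail (K.edge t i j), K.head (K.edge t i j)) = s(K.vert t i, K.vert t j)
  vert_surjective : ∀ v, ∃ t i, K.vert t i = v
  edge_surjective : ∀ e, ∃ t i j, i ≠ j ∧ K.edge t i j = e
  /-- every two-face belongs to exactly two tetrahedra (no boundary) -/
  face_two : ∀ f, {p : T × Fin 4 | K.face p.1 p.2 = f}.ncard = 2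
  /-- two tetrahedra with a common two-face `abc` are `zabc` and `abcd` as oriented tetrahedra -/
  face_oriented : ∀ t i t' i', (t, i) ≠ (t', i') → K.face t i = K.face t' i' →
    ∃ a b c, K.HasTet t (K.vert t i) a b c ∧ K.HasTet t' a b c (K.vert t' i')
  /-- and the edges of that two-face coincide -/
  face_edges : ∀ t i t' i', K.face t i = K.face t' i' →
    ∀ j k j' k', j ≠ i → k ≠ i → j ≠ k → K.vert t j = K.vert t' j' → K.vert t k = K.vert t' k' →
      K.edge t j k = K.edge t' j' k'
  /-- the tetrahedra around an edge form one cycle -/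
  edge_link : ∀ e t i j t' i' j', i ≠ j → i' ≠ j' → K.edge t i j = e → K.edge t' i' j' = e →
    Relation.ReflTransGen (K.AdjacentAtEdge e) t t'
  /-- the link of a vertex is a connected closed surface … -/
  vertex_link : ∀ v t i t' i', K.vert t i = v → K.vert t' i' = v →
    Relation.ReflTransGen (K.AdjacentAtVertex v) t t'
  /-- … of Euler characteristic two, that is, a sphere -/
  vertex_link_sphere : ∀ v,
    {e | K.tail e = v ∨ K.head e = v}.ncard + {t | ∃ i, K.vert t i = v}.ncard =
      {f | ∃ t i j, j ≠ i ∧ K.face t i = f ∧ K.vert t j = v}.ncard + 2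
  connected : ∀ t t', Relation.ReflTransGen K.Adjacent t t'

/-- `h` lists vertices `z, a, b, c, d` such that the two tetrahedra containing the two-face `f` are
`zabc` and `abcd` as oriented tetrahedra, with common face `abc`. -/
def IsHinge (K : TetComplex V E F T) (f : F) (h : Fin 5 → V) : Prop :=
  ∃ t t', t ≠ t' ∧ K.HasTet t (h 0) (h 1) (h 2) (h 3) ∧ K.HasTet t' (h 1) (h 2) (h 3) (h 4) ∧
    K.HasFace t (h 0) f ∧ K.HasFace t' (h 4) f

theorem IsClosedOrientedManifold.exists_isHinge {K : TetComplex V E F T}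
    (hK : K.IsClosedOrientedManifold) (f : F) : ∃ h, K.IsHinge f h := by
  obtain ⟨⟨t, i⟩, ⟨t', i'⟩, hne, hset⟩ := Set.ncard_eq_two.1 (hK.face_two f)
  have h1 : K.face t i = f := by
    have : (t, i) ∈ {p : T × Fin 4 | K.face p.1 p.2 = f} := by rw [hset]; simp
    exact this
  have h2 : K.face t' i' = f := by
    have : (t', i') ∈ {p : T × Fin 4 | K.face p.1 p.2 = f} := by rw [hset]; simp
    exact this
  obtain ⟨a, b, c, h3, h4⟩ := hK.face_oriented t i t' i' hne (h1.trans h2.symm)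
  refine ⟨![K.vert t i, a, b, c, K.vert t' i'], t, t', ?_, h3, h4, ⟨i, rfl, h1⟩, ⟨i', rfl, h2⟩⟩
  rintro rfl
  apply hne
  obtain ⟨p, -, hp⟩ := h3
  obtain ⟨q, -, hq⟩ := h4
  have e0 : p 0 = i := hK.vert_injective t (hp 0)
  have e3 : q 3 = i' := hK.vert_injective t (hq 3)
  by_contra hcon
  have hii : i ≠ i' := fun h => hcon (by rw [h])
  obtain ⟨k, rfl⟩ := q.surjective i
  have hk : k ≠ 3 := fun h => hii (by rw [h, e3])
  have key : ∀ m : Fin 4, m ≠ 3 → ∃ l : Fin 4, l ≠ 0 ∧ K.vert t (p l) = K.vert t (q m) := by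
    intro m hm
    fin_cases m
    · exact ⟨1, by decide, (hp 1).trans (hq 0).symm⟩
    · exact ⟨2, by decide, (hp 2).trans (hq 1).symm⟩
    · exact ⟨3, by decide, (hp 3).trans (hq 2).symm⟩
    · exact absurd rfl hm
  obtain ⟨l, hl, hl'⟩ := key k hk
  exact hl (p.injective ((hK.vert_injective t hl').trans e0.symm))

/-- The vertices `z, a, b, c, d` of the two tetrahedra `zabc` and `abcd` that contain the
two-face `f`. -/
noncomputable def hinge (K : TetComplex V E F T) (hK : K.IsClosedOrientedManifold) (f : F) :
    Fin 5 → V :=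
  (hK.exists_isHinge f).choose

/-! ### Geometrization and the complex -/

/-- The coordinates of the vertices are in general position: no five different vertices lie in one
affine hyperplane. -/
def GeneralPosition (r : V → R4) : Prop :=
  ∀ p : Fin 5 → V, Function.Injective p → AffineIndependent ℝ (fun k => r (p k))

/-- The length of an edge. -/
noncomputable def edgeLength (K : TetComplex V E F T) (r : V → R4) (e : E) : ℝ :=
  dist (r (K.tail e)) (r (K.head e))

/-- The area of a two-face. -/
noncomputable def faceArea (K : TetComplex V E F T) (hK : K.IsClosedOrientedManifold)
    (r : V → R4) (f : F) : ℝ :=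
  triangleArea (r (K.hinge hK f 1)) (r (K.hinge hK f 2)) (r (K.hinge hK f 3))

/-- For every edge `BC`, directed from tail to head, the columns of `g e` are the axes of a
positively oriented Euclidean coordinate system whose first axis has the direction of `BC`. -/
def IsFrame (K : TetComplex V E F T) (r : V → R4) (g : E → Matrix (Fin 4) (Fin 4) ℝ) : Prop :=
  ∀ e, g e ∈ Matrix.specialOrthogonalGroup (Fin 4) ℝ ∧
    ∀ i, K.edgeLength r e * g e i 0 = r (K.head e) i - r (K.tail e) i

/-- One revolution around the edge `e = BC`, directed from tail to head, through the `n` oriented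
tetrahedra `t k = A_k A_{k+1} B C`, `0 ≤ k < n`; from `t k` to `t (k+1)` one crosses the two-face
`f k = A_{k+1} B C`. The sequences continue periodically. -/
structure Star (K : TetComplex V E F T) (e : E) where
  n : ℕ
  t : ℕ → T
  a : ℕ → V
  f : ℕ → F
  pos : 0 < n
  tet : ∀ k, K.HasTet (t k) (a k) (a (k + 1)) (K.tail e) (K.head e)
  edge : ∀ k, K.HasEdge (t k) (K.tail e) (K.head e) e
  ne : ∀ k, t k ≠ t (k + 1)
  face_left : ∀ k, K.HasFace (t k) (a k) (f k)
  face_right : ∀ k, K.HasFace (t (k + 1)) (a (k + 2)) (f k)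
  period : t n = t 0
  minimal : ∀ k, 0 < k → k < n → t k ≠ t 0

/-- The vertices `A_k, A_{k+1}, B, C` of the `k`-th tetrahedron of a star. -/
def Star.corner {K : TetComplex V E F T} {e : E} (s : K.Star e) (k : ℕ) : Fin 4 → V :=
  ![s.a k, s.a (k + 1), K.tail e, K.head e]

/-- Under the infinitesimal changes `dl` and `dϑ` of the edge lengths and of the angles, `B` is the
infinitesimal deficit angle around the edge `e = BC`. One puts the tetrahedra of the star into
`ℝ⁴` one after another, up to the first order: the vertices `B`, `C` and `A_0, …, A_{n+1}` get
displacements `vB`, `vC`, `v 0, …, v (n+1)` such that in each tetrahedron the edge lengths change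
by `dl` and between consecutive tetrahedra the angle changes by `dϑ`. After one revolution the
vertices `A_n = A_0` and `A_{n+1} = A_1` have got new displacements, which differ from the old ones
by the infinitesimal rotation `B` around `BC`. -/
def IsDeficit (K : TetComplex V E F T) (r : V → R4) (dl : E → ℝ) (dϑ : F → ℝ) (e : E)
    (B : Matrix (Fin 4) (Fin 4) ℝ) : Prop :=
  ∃ (s : K.Star e) (v : ℕ → R4) (vB vC : R4),
    (∀ k ≤ s.n, ∀ i j ε, K.HasEdge (s.t k) (s.corner k i) (s.corner k j) ε →
      dLength (r (s.corner k i)) (r (s.corner k j))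
        (![v k, v (k + 1), vB, vC] i) (![v k, v (k + 1), vB, vC] j) = dl ε) ∧
    (∀ k < s.n,
      dHingeAngle
        ![r (s.a k), r (s.a (k + 1)), r (K.tail e), r (K.head e), r (s.a (k + 2))]
        ![v k, v (k + 1), vB, vC, v (k + 2)] = dϑ (s.f k)) ∧
    B.transpose = -B ∧
    B.mulVec (fun i => r (K.head e) i - r (K.tail e) i) = 0 ∧
    B.mulVec (fun i => r (s.a 0) i - r (K.tail e) i) = (fun i => v s.n i - v 0 i) ∧
    B.mulVec (fun i => r (s.a 1) i - r (K.tail e) i) = (fun i => v (s.n + 1) i - v 1 i)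

open Classical in
/-- The infinitesimal deficit angle `dω` around the edge `e`, directed from tail to head. -/
noncomputable def deficit (K : TetComplex V E F T) (r : V → R4) (dl : E → ℝ) (dϑ : F → ℝ) (e : E) :
    Matrix (Fin 4) (Fin 4) ℝ :=
  if h : ∃ B, K.IsDeficit r dl dϑ e B then h.choose else 0

/-- The displacements of the vertices when one coordinate of one vertex changes. -/
noncomputable def basisDisplacement [DecidableEq V] (c : V × Fin 4) : V → R4 :=
  Pi.single c.1 (EuclideanSpace.single c.2 1)

/-- The complex `0 → 𝔢₄ → (dx) → (dl ⊕ dϑ) → (dω) → (dρ) → (dα ⊕ dβ) → 0`, in the bases given by the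
coordinates: translations `dr` and matrix entries `a_ij`; vertex coordinates; edge lengths and
angles at two-faces; three components for each edge in the coordinate systems `g`; matrix entries
for each vertex; matrix entries of `dα` and components of `dβ`. Each column is the image of a basis
vector. -/
noncomputable def complex [DecidableEq V] [DecidableEq E] [DecidableEq F]
    (K : TetComplex V E F T) (hK : K.IsClosedOrientedManifold)
    (r : V → R4) (g : E → Matrix (Fin 4) (Fin 4) ℝ) :
    BasedComplex (Fin 4 ⊕ IndexPair) (V × Fin 4) (E ⊕ F) (E × Fin 3) (V × IndexPair)
      (IndexPair ⊕ Fin 4) where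
  f₁ := Matrix.of fun x c =>
    Sum.elim (fun j => if x.2 = j then 1 else 0)
      (fun p => (skew (Pi.single p 1)).mulVec (r x.1) x.2) c
  f₂ := Matrix.of fun x c =>
    Sum.elim
      (fun e => dLength (r (K.tail e)) (r (K.head e))
        (basisDisplacement c (K.tail e)) (basisDisplacement c (K.head e)))
      (fun f => dHingeAngle (fun k => r (K.hinge hK f k))
        (fun k => basisDisplacement c (K.hinge hK f k))) x
  f₃ := Matrix.of fun x c =>
    rotationComponents (g x.1)
      (K.deficit r (fun e => (Pi.single c 1 : E ⊕ F → ℝ) (Sum.inl e))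
        (fun f => (Pi.single c 1 : E ⊕ F → ℝ) (Sum.inr f)) x.1) x.2
  f₄ := Matrix.of fun x c =>
    ((if K.tail c.1 = x.1 then 1 else 0) - (if K.head c.1 = x.1 then 1 else 0)) *
      rotationOfComponents (g c.1) (Pi.single c.2 1) x.2.1.1 x.2.1.2
  f₅ := Matrix.of fun x c =>
    Sum.elim (fun p => if p = c.2 then 1 else 0)
      (fun i => (skew (Pi.single c.2 1)).mulVec (r c.1) i) x

/-! ### The Pachner move `2 → 3` -/

/-- `K'` arises from `K` by a move `2 → 3` in which the adjacent oriented tetrahedra `ABCD` and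
`EABC` are replaced by `ABED`, `BCED` and `CAED`. Here `A, B, C` are `abc 0, abc 1, abc 2`, read
cyclically, and `D, E` are `vD, vE`. The vertices stay the same; a new edge `DE` appears; the
two-face `ABC` disappears, and the new two-faces `ADE, BDE, CDE` appear; all other cells stay. -/
structure Move23 (K : TetComplex V E F T) (K' : TetComplex V E' F' T') where
  abc : Fin 3 → V
  vD : V
  vE : V
  tABCD : T
  tEABC : T
  fABC : F
  hABCD : K.HasTet tABCD (abc 0) (abc 1) (abc 2) vD
  hEABC : K.HasTet tEABC vE (abc 0) (abc 1) (abc 2)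
  face_ABCD : K.HasFace tABCD vD fABC
  face_EABC : K.HasFace tEABC vE fABC
  /-- the edges of `K'`: the old ones, and `DE` (the value at `none`) -/
  edgeMap : Option E ≃ E'
  /-- the two-faces of `K'`: the old ones except `ABC`, and `ADE, BDE, CDE` -/
  faceMap : {f : F // f ≠ fABC} ⊕ Fin 3 ≃ F'
  /-- the tetrahedra of `K'`: the old ones except two, and `ABED, BCED, CAED` -/
  tetMap : {t : T // t ≠ tABCD ∧ t ≠ tEABC} ⊕ Fin 3 ≃ T'
  old_tet : ∀ t a b c d, K.HasTet t.1 a b c d → K'.HasTet (tetMap (Sum.inl t)) a b c d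
  old_edge : ∀ t a b e, K.HasEdge t.1 a b e →
    K'.HasEdge (tetMap (Sum.inl t)) a b (edgeMap (some e))
  old_face : ∀ t a f, K.HasFace t.1 a f.1 →
    K'.HasFace (tetMap (Sum.inl t)) a (faceMap (Sum.inl f))
  new_tet : ∀ i, K'.HasTet (tetMap (Sum.inr i)) (abc i) (abc (i + 1)) vE vD
  new_edge : ∀ i, K'.HasEdge (tetMap (Sum.inr i)) vD vE (edgeMap none)
  new_edge_ABCD : ∀ i a b e, a ≠ abc (i + 2) → b ≠ abc (i + 2) → K.HasEdge tABCD a b e →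
    K'.HasEdge (tetMap (Sum.inr i)) a b (edgeMap (some e))
  new_edge_EABC : ∀ i a b e, a ≠ abc (i + 2) → b ≠ abc (i + 2) → K.HasEdge tEABC a b e →
    K'.HasEdge (tetMap (Sum.inr i)) a b (edgeMap (some e))
  new_face : ∀ i, K'.HasFace (tetMap (Sum.inr i)) (abc (i + 1)) (faceMap (Sum.inr i))
  new_face' : ∀ i, K'.HasFace (tetMap (Sum.inr i)) (abc i) (faceMap (Sum.inr (i + 1)))
  new_face_ABCD : ∀ i f, K.HasFace tABCD (abc (i + 2)) f.1 →
    K'.HasFace (tetMap (Sum.inr i)) vE (faceMap (Sum.inl f))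
  new_face_EABC : ∀ i f, K.HasFace tEABC (abc (i + 2)) f.1 →
    K'.HasFace (tetMap (Sum.inr i)) vD (faceMap (Sum.inl f))

/-- The factor `2 S_ADE · 2 S_BDE · 2 S_CDE / (l_DE³ · 2 S_ABC)`. -/
noncomputable def Move23.factor {K : TetComplex V E F T} {K' : TetComplex V E' F' T'}
    (m : K.Move23 K') (r : V → R4) : ℝ :=
  (2 * triangleArea (r (m.abc 0)) (r m.vD) (r m.vE) *
    (2 * triangleArea (r (m.abc 1)) (r m.vD) (r m.vE)) *
    (2 * triangleArea (r (m.abc 2)) (r m.vD) (r m.vE))) /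
  (dist (r m.vD) (r m.vE) ^ 3 *
    (2 * triangleArea (r (m.abc 0)) (r (m.abc 1)) (r (m.abc 2))))

/-- The factor `∏ l³ / ∏ 2S`, over all edges and all two-faces. -/
noncomputable def weight [Fintype E] [Fintype F] (K : TetComplex V E F T)
    (hK : K.IsClosedOrientedManifold) (r : V → R4) : ℝ :=
  (∏ e, K.edgeLength r e ^ 3) / ∏ f, (2 * K.faceArea hK r f)

end TetComplex

/-! Let `X` and `X'` be the complexes before and after the move. The move adds one edge, hence one
length and three components of a rotation, and replaces one two-face by three, hence adds two
angles. So the third and the fourth space both grow by three dimensions, and the other four spaces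
do not change. The proof constructs an isomorphism onto `X'` from the direct sum of `X` and `0 → ℝ³
→ ℝ³ → 0`, which is the identity outside the third and fourth terms, where it is given by matrices
`P₂` and `P₃`. Such an isomorphism transports exactness and multiplies the torsion by `|det P₂| /
|det P₃|` up to sign (`compare_of_stable_iso`); the second fact follows from an identity for
complementary minors.

The matrix `P₂` rests on the geometry of the five points `A, B, C, D, E`. The nine lengths other
than that of `DE`, together with the angle at `ABC`, can be changed independently
(`exists_displacement_of_inner`), and a displacement changing none of them is a motion on the five
points (`exists_motion_of_inner`). Let `σ` choose, linearly, a displacement of the vertices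
realizing these ten components of `x = (dl, dϑ)`. Then `x - f₂ (σ x)` has ten zero components. The
map `transferLin` sends `f₂ (σ x)` to `f₂' (σ x)` and extends the remainder by zero to the new
cells. The three added basis vectors go to the unit changes of the angles at the new two-faces.

To see that this commutes with `f₃`, note that displacements produce no deficits, neither before nor
after, and that for the remainder the five points stay rigid, so that replacing two tetrahedra by
three does not affect any deficit (`deficit_extend`). Accordingly `P₃` takes the rotations around
the old edges to themselves in new frames, and the three added basis vectors to the `f₃'`-images of
the new angles. These images lie in the kernel of `f₄'`, because a single angle produces the same
rotation around all three sides of its triangle, and the boundary of a closed triangle is zero.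

All this needs `f₃` to be well defined and linear. `IsDeformation.deficit_eq` expresses a deficit as
a sum of contributions of the two-faces crossed around the edge; each contribution is the unique
infinitesimal motion which aligns two adjacent tetrahedra and produces the given change of angle.
Behind the uniqueness, and behind the replacement of outer vertices in the move, are four properties
of the hinge angle: a smooth formula for its phase, invariance under motions, unit speed under
rotation around the two-face, and additivity.

Let `v` be the determinant of the four edge vectors from `E`. Then `|det P₂|` is the rate of change
of the length of `DE` per unit change of the angle at `ABC`, which is `|v| / (2 S_ABC · l_DE)`,
while `|det P₃| = l_DE² |v| / (2 S_ADE · 2 S_BDE · 2 S_CDE)`. In the quotient `v` cancels. -/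

namespace Matrix

/-! ### Complementary minors and invertible submatrices -/

theorem det_mul_det_of_blocks {p q : Type*} [Fintype p] [Fintype q] [DecidableEq p] [DecidableEq q]
    (P : Matrix (p ⊕ q) (p ⊕ q) ℝ) (F₁ : Matrix p p ℝ) (F₂ : Matrix q p ℝ) (G₁ : Matrix q p ℝ)
    (G₂ : Matrix q q ℝ) (h : fromCols G₁ G₂ * (P * fromRows F₁ F₂) = 0) :
    ((P * fromRows F₁ F₂).submatrix Sum.inl id).det *
      ((fromCols G₁ G₂ * P).submatrix id Sum.inr).det = P.det * F₁.det * G₂.det := by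
  obtain ⟨P₁₁, P₁₂, P₂₁, P₂₂, rfl⟩ : ∃ a b c d, P = fromBlocks a b c d :=
    ⟨_, _, _, _, (fromBlocks_toBlocks P).symm⟩
  -- The hypothesis says exactly that the lower left block of this product vanishes. Taking
  -- determinants on both sides turns block triangularity into the identity of minors.
  have key : fromBlocks 1 0 G₁ G₂ * fromBlocks P₁₁ P₁₂ P₂₁ P₂₂ * fromBlocks F₁ 0 F₂ 1 =
      fromBlocks (P₁₁ * F₁ + P₁₂ * F₂) P₁₂ 0 (G₁ * P₁₂ + G₂ * P₂₂) := by
    rw [fromBlocks_mul_fromRows, fromCols_mul_fromRows] at h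
    rw [mul_assoc, fromBlocks_multiply, fromBlocks_multiply]
    simp [h]
  have := congrArg det key
  rw [det_mul, det_mul, det_fromBlocks_zero₁₂, det_fromBlocks_zero₁₂, det_fromBlocks_zero₂₁] at this
  rw [fromBlocks_mul_fromRows, fromCols_mul_fromBlocks]
  have e1 : (fromRows (P₁₁ * F₁ + P₁₂ * F₂) (P₂₁ * F₁ + P₂₂ * F₂)).submatrix Sum.inl id =
    P₁₁ * F₁ + P₁₂ * F₂ := rfl
  have e2 : (fromCols (G₁ * P₁₁ + G₂ * P₂₁) (G₁ * P₁₂ + G₂ * P₂₂)).submatrix id Sum.inr =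
    G₁ * P₁₂ + G₂ * P₂₂ := rfl
  rw [e1, e2, ← this]
  simp
  ring

/-- Complementary minors of two matrices `F` and `G` with `G * P * F = 0`. -/
theorem abs_det_mul_abs_det_complement {ι ι' p q : Type*} [Fintype p] [Fintype q] [DecidableEq p]
    [DecidableEq q] [Fintype ι] [Fintype ι'] [DecidableEq ι]
    (P : Matrix ι' ι ℝ) (F : Matrix ι p ℝ) (G : Matrix q ι' ℝ) (s : p ⊕ q ≃ ι) (s' : p ⊕ q ≃ ι')
    (e : ι ≃ ι') (h : G * (P * F) = 0) :
    |((P * F).submatrix (fun i => s' (Sum.inl i)) id).det| *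
      |((G * P).submatrix id (fun j => s (Sum.inr j))).det| =
    |(P.submatrix e id).det| * |(F.submatrix (fun i => s (Sum.inl i)) id).det| *
      |(G.submatrix id (fun j => s' (Sum.inr j))).det| := by
  have hF : F.submatrix s id = fromRows (F.submatrix (fun i => s (Sum.inl i)) id)
      (F.submatrix (fun i => s (Sum.inr i)) id) := by
    ext (i | i) j <;> rfl
  have hG : G.submatrix id s' = fromCols (G.submatrix id (fun i => s' (Sum.inl i)))
      (G.submatrix id (fun i => s' (Sum.inr i))) := by
    ext i (j | j) <;> rfl
  have hPF : (P * F).submatrix s' id = P.submatrix s' s * F.submatrix s id := by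
    rw [submatrix_mul_equiv]
  have hGP : (G * P).submatrix id s = G.submatrix id s' * P.submatrix s' s := by
    rw [submatrix_mul_equiv]
  have h0 : G.submatrix id s' * (P.submatrix s' s * F.submatrix s id) = 0 := by
    rw [submatrix_mul_equiv, submatrix_mul_equiv, h]; rfl
  have hP : |(P.submatrix s' s).det| = |(P.submatrix e id).det| := by
    have : P.submatrix s' s = (P.submatrix e id).submatrix (s'.trans e.symm) s := by
      ext; simp
    rw [this, abs_det_submatrix_equiv_equiv]
  have := det_mul_det_of_blocks (P.submatrix s' s) _ _ _ _ (hF ▸ hG ▸ h0)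
  rw [← hF, ← hG, ← hPF, ← hGP] at this
  rw [← hP, ← abs_mul, ← abs_mul, ← abs_mul, ← this]
  rfl

/-- Injectivity gives full column rank, so a maximal independent family of rows has as many members
as there are columns and forms an invertible square submatrix. The remaining rows are merely
numbered. -/
theorem exists_equiv_det_submatrix_ne_zero {m n : Type*} [Finite m] [Fintype n] [DecidableEq n]
    (A : Matrix m n ℝ) (hA : Function.Injective A.mulVec) :
    ∃ (k : ℕ) (s : n ⊕ Fin k ≃ m), (A.submatrix (fun i => s (Sum.inl i)) id).det ≠ 0 := by
  classical
  have := Fintype.ofFinite m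
  obtain ⟨κ, a, ha, hspan, hli⟩ := exists_linearIndependent' ℝ A.row
  have hrank : A.rank = Fintype.card n := by
    rw [rank, LinearMap.finrank_range_of_inj (f := A.mulVecLin) hA, Module.finrank_pi]
  have : Finite κ := Finite.of_injective a ha
  have := Fintype.ofFinite κ
  have hcard : Fintype.card κ = Fintype.card n := by
    rw [← hrank, rank_eq_finrank_span_row, ← hspan, finrank_span_eq_card hli]
  have e : n ≃ κ := Fintype.equivOfCardEq hcard.symm
  have hinj : Function.Injective (a ∘ e) := ha.comp e.injective
  refine ⟨Fintype.card ↥(Set.range (a ∘ e))ᶜ, (Equiv.sumCongr (Equiv.ofInjective _ hinj)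
    (Fintype.equivFin _).symm).trans (Equiv.Set.sumCompl _), ?_⟩
  have : (A.submatrix (a ∘ e) id).det ≠ 0 := by
    have h1 : LinearIndependent ℝ (A.submatrix (a ∘ e) id).row := by
      have := hli.comp e e.injective
      exact this
    have := linearIndependent_rows_iff_isUnit.1 h1
    rw [isUnit_iff_isUnit_det] at this
    exact this.ne_zero
  exact this

end Matrix

/-! ### Torsion of based complexes -/

namespace BasedComplex

/-- The `aᵢ` stand for mixed minors, whose columns are chosen for the first complex and whose rows
for the second. Grouping the product `n₁ a₂ a₃ a₄ m₅` in two ways eliminates them, so that none of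
them has to be nonzero. -/
theorem torsion_ratio_of_mixed_minors {a₂ a₃ a₄ m₁ m₂ m₃ m₄ m₅ n₁ n₂ n₃ n₄ n₅ p₂ p₃ : ℝ}
    (k₁ : n₁ * a₂ = m₁ * n₂) (k₂ : a₂ * a₃ = p₂ * m₂ * n₃) (k₃ : a₃ * a₄ = p₃ * m₃ * n₄)
    (k₄ : a₄ * m₅ = m₄ * n₅) (h₁ : m₁ ≠ 0) (h₃ : m₃ ≠ 0) (h₅ : m₅ ≠ 0) (h₁' : n₁ ≠ 0)
    (h₃' : n₃ ≠ 0) (h₅' : n₅ ≠ 0) (hp : p₃ ≠ 0) :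
    n₂ * n₄ / (n₁ * n₃ * n₅) = m₂ * m₄ / (m₁ * m₃ * m₅) * (p₂ / p₃) := by
  have : n₁ * (p₂ * m₂ * n₃) * (m₄ * n₅) = m₁ * n₂ * (p₃ * m₃ * n₄) * m₅ := by
    rw [← k₁, ← k₂, ← k₃, ← k₄]; ring
  rw [div_mul_div_comm, div_eq_div_iff (by positivity) (by positivity)]
  linear_combination -this

variable {ι₀ ι₁ ι₂ ι₃ ι₄ ι₅ : Type*}

/-- One step of elimination: a combination of the chosen columns of `f` clears the coordinates of
`x` in the rows of the invertible minor. The map `g` does not notice, since it kills the image of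
`f`. -/
theorem exists_mulVec_submatrix_eq {ι a b p q : Type*} [Fintype ι] [Fintype a] [Fintype p]
    [Fintype q] [DecidableEq p]
    (f : Matrix ι a ℝ) (g : Matrix b ι ℝ) (hfg : g * f = 0)
    (C : p → a) (s : p ⊕ q ≃ ι) (hdet : (f.submatrix (fun i => s (Sum.inl i)) C).det ≠ 0)
    (x : ι → ℝ) : ∃ (w : p → ℝ) (w' : q → ℝ),
      x - (f.submatrix id C).mulVec w = (fun i => Sum.elim (0 : p → ℝ) w' (s.symm i)) ∧
      g.mulVec x = (g.submatrix id (fun j => s (Sum.inr j))).mulVec w' := by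
  set M := f.submatrix (fun i => s (Sum.inl i)) C with hM
  let w : p → ℝ := M⁻¹.mulVec (fun i => x (s (Sum.inl i)))
  have hw : M.mulVec w = fun i => x (s (Sum.inl i)) := by
    rw [Matrix.mulVec_mulVec, Matrix.mul_nonsing_inv _ (isUnit_iff_ne_zero.2 hdet),
      Matrix.one_mulVec]
  let x' := x - (f.submatrix id C).mulVec w
  have hx' : ∀ i, x' (s (Sum.inl i)) = 0 := by
    intro i
    have := congrFun hw i
    simp only [x', Pi.sub_apply]
    rw [← this]
    exact sub_self _
  have h0 : g * f.submatrix id C = 0 := by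
    have : g * f.submatrix id C = (g * f).submatrix id C := rfl
    rw [this, hfg]; rfl
  refine ⟨w, fun j => x' (s (Sum.inr j)), ?_, ?_⟩
  · ext i
    obtain ⟨i | i, rfl⟩ := s.surjective i
    · simp only [Equiv.symm_apply_apply, Sum.elim_inl]
      exact hx' i
    · simp [x']
  · have : g.mulVec x = g.mulVec x' := by
      simp only [x']
      rw [Matrix.mulVec_sub, Matrix.mulVec_mulVec, h0, Matrix.zero_mulVec, sub_zero]
    rw [this]
    ext i
    simp only [Matrix.mulVec, dotProduct]
    rw [← s.sum_comp, Fintype.sum_sum_type]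
    simp [hx']

/-- A vector supported on the complementary basis elements and killed by `g` is, by exactness and
`hC`, a combination of the chosen columns of `f`. Its coordinates in the rows of the minor are zero,
hence so is the combination. -/
theorem injective_mulVec_submatrix {ι a b p q : Type*} [Fintype ι] [Fintype a] [Fintype p]
    [Fintype q] [DecidableEq p] [DecidableEq q]
    (f : Matrix ι a ℝ) (g : Matrix b ι ℝ) (hfg : Function.Exact f.mulVec g.mulVec)
    (C : p → a) (hC : ∀ y, ∃ w : p → ℝ, f.mulVec y = (f.submatrix id C).mulVec w)
    (s : p ⊕ q ≃ ι) (hdet : (f.submatrix (fun i => s (Sum.inl i)) C).det ≠ 0) :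
    Function.Injective (g.submatrix id (fun j => s (Sum.inr j))).mulVec := by
  have hlin : ∀ (x y : q → ℝ), (g.submatrix id (fun j => s (Sum.inr j))).mulVec x =
      (g.submatrix id (fun j => s (Sum.inr j))).mulVec y → x = y := by
    intro x y hxy
    rw [← sub_eq_zero, ← Matrix.mulVec_sub] at hxy
    rw [← sub_eq_zero]
    set z := x - y
    have h1 : g.mulVec (fun i => Sum.elim (0 : p → ℝ) z (s.symm i)) = 0 := by
      rw [← hxy]
      ext i
      simp only [Matrix.mulVec, dotProduct]
      rw [← s.sum_comp, Fintype.sum_sum_type]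
      simp
    obtain ⟨y, hy⟩ := (hfg _).1 h1
    obtain ⟨w, hw⟩ := hC y
    rw [hw] at hy
    have h2 : (f.submatrix (fun i => s (Sum.inl i)) C).mulVec w = 0 := by
      ext i
      have := congrFun hy (s (Sum.inl i))
      simpa [Matrix.mulVec, dotProduct] using this
    have h3 := Matrix.eq_zero_of_mulVec_eq_zero hdet h2
    ext j
    have := congrFun hy (s (Sum.inr j))
    rw [h3] at this
    simpa using this.symm
  exact fun x y h => hlin x y h

theorem mul_eq_zero_of_exact {ι a b : Type*} [Fintype ι] [Fintype a] [DecidableEq a]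
    {f : Matrix ι a ℝ} {g : Matrix b ι ℝ} (hfg : Function.Exact f.mulVec g.mulVec) : g * f = 0 := by
  ext i j
  have := congrFun ((hfg (f.mulVec (Pi.single j 1))).2 ⟨_, rfl⟩) i
  rw [Matrix.mulVec_mulVec, Matrix.mulVec_single_one] at this
  exact this

/-! ### Existence of nonzero minors -/

section Fintype

variable [Fintype ι₀] [Fintype ι₁] [Fintype ι₂] [Fintype ι₃] [Fintype ι₄] [Fintype ι₅]
variable [DecidableEq ι₀] [DecidableEq ι₅]

/-- The minors are chosen from left to right. At each space the columns left over by the previous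
minor give an injective submatrix with the same image as the whole map, so they contain a next
invertible minor. At the end surjectivity makes the leftover submatrix of `f₅` square. -/
theorem IsAcyclic.nonempty_tauChain {X : BasedComplex ι₀ ι₁ ι₂ ι₃ ι₄ ι₅} (h : X.IsAcyclic) :
    Nonempty X.TauChain := by
  classical
  obtain ⟨h1, h12, h23, h34, h45, h5⟩ := h
  obtain ⟨n₂, s₁, d₁⟩ := X.f₁.exists_equiv_det_submatrix_ne_zero h1
  have C1 : ∀ y, ∃ w : ι₀ → ℝ, X.f₁.mulVec y = (X.f₁.submatrix id id).mulVec w :=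
    fun y => ⟨y, rfl⟩
  have i2 := injective_mulVec_submatrix _ _ h12 id C1 s₁ d₁
  have C2 : ∀ y, ∃ w, X.f₂.mulVec y = (X.f₂.submatrix id (fun j => s₁ (Sum.inr j))).mulVec w :=
    fun y => by
      obtain ⟨_, w, -, hw⟩ :=
        exists_mulVec_submatrix_eq _ _ (mul_eq_zero_of_exact h12) id s₁ d₁ y
      exact ⟨w, hw⟩
  obtain ⟨n₃, s₂, d₂⟩ := Matrix.exists_equiv_det_submatrix_ne_zero _ i2
  have i3 := injective_mulVec_submatrix _ _ h23 _ C2 s₂ d₂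
  have C3 : ∀ y, ∃ w, X.f₃.mulVec y = (X.f₃.submatrix id (fun j => s₂ (Sum.inr j))).mulVec w :=
    fun y => by
      obtain ⟨_, w, -, hw⟩ := exists_mulVec_submatrix_eq _ _ (mul_eq_zero_of_exact h23) _ s₂ d₂ y
      exact ⟨w, hw⟩
  obtain ⟨n₄, s₃, d₃⟩ := Matrix.exists_equiv_det_submatrix_ne_zero _ i3
  have i4 := injective_mulVec_submatrix _ _ h34 _ C3 s₃ d₃
  have C4 : ∀ y, ∃ w, X.f₄.mulVec y = (X.f₄.submatrix id (fun j => s₃ (Sum.inr j))).mulVec w :=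
    fun y => by
      obtain ⟨_, w, -, hw⟩ := exists_mulVec_submatrix_eq _ _ (mul_eq_zero_of_exact h34) _ s₃ d₃ y
      exact ⟨w, hw⟩
  obtain ⟨n₅, s₄, d₄⟩ := Matrix.exists_equiv_det_submatrix_ne_zero _ i4
  have i5 := injective_mulVec_submatrix _ _ h45 _ C4 s₄ d₄
  have j5 : Function.Surjective (X.f₅.submatrix id (fun j => s₄ (Sum.inr j))).mulVec := by
    intro y
    obtain ⟨x, rfl⟩ := h5 y
    obtain ⟨_, w, -, hw⟩ := exists_mulVec_submatrix_eq _ _ (mul_eq_zero_of_exact h45) _ s₄ d₄ x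
    exact ⟨w, hw.symm⟩
  have e : (Fin n₅ → ℝ) ≃ₗ[ℝ] (ι₅ → ℝ) :=
    LinearEquiv.ofBijective (Matrix.mulVecLin _) ⟨i5, j5⟩
  have hc : Fintype.card (Fin n₅) = Fintype.card ι₅ := by
    have := e.finrank_eq
    rwa [Module.finrank_pi, Module.finrank_pi] at this
  let e' : ι₅ ≃ Fin n₅ := (Fintype.equivOfCardEq hc).symm
  refine ⟨⟨n₂, n₃, n₄, s₁, s₂, s₃, (Equiv.sumCongr (Equiv.refl _) e').trans s₄, d₁, d₂, d₃, d₄, ?_⟩⟩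
  have hbij : Function.Injective (X.f₅.submatrix id
      (fun j => ((Equiv.sumCongr (Equiv.refl _) e').trans s₄) (Sum.inr j))).mulVec := by
    intro x y hxy
    have h1 : ∀ z : ι₅ → ℝ, (X.f₅.submatrix id
      (fun j => ((Equiv.sumCongr (Equiv.refl _) e').trans s₄) (Sum.inr j))).mulVec z =
      (X.f₅.submatrix id (fun j => s₄ (Sum.inr j))).mulVec (z ∘ e'.symm) := by
      intro z
      ext i
      simp only [Matrix.mulVec, dotProduct]
      rw [← e'.sum_comp]
      simp
    rw [h1, h1] at hxy
    have := i5 hxy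
    ext j
    have := congrFun this (e' j)
    simpa using this
  have := Matrix.mulVec_injective_iff_isUnit.1 hbij
  rw [Matrix.isUnit_iff_isUnit_det] at this
  exact this.ne_zero

end Fintype

/-- The direct sum of a based complex with `0 → ℝ^κ → ℝ^κ → 0` in the third and fourth terms. -/
def stabilize (X : BasedComplex ι₀ ι₁ ι₂ ι₃ ι₄ ι₅) (κ : Type*) [DecidableEq κ] :
    BasedComplex ι₀ ι₁ (ι₂ ⊕ κ) (ι₃ ⊕ κ) ι₄ ι₅ where
  f₁ := X.f₁
  f₂ := Matrix.fromRows X.f₂ 0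
  f₃ := Matrix.fromBlocks X.f₃ 0 0 1
  f₄ := Matrix.fromCols X.f₄ 0
  f₅ := X.f₅

theorem stabilize_minor₃ (X : BasedComplex ι₀ ι₁ ι₂ ι₃ ι₄ ι₅) {m k n : ℕ} (s₂ : Fin n ⊕ Fin m ≃ ι₂)
    {l : ℕ} (s₃ : Fin m ⊕ Fin l ≃ ι₃) :
    ((X.stabilize (Fin k)).f₃.submatrix
      (fun i : Fin (m + k) => Sum.map (fun j => s₃ (Sum.inl j)) id (finSumFinEquiv.symm i))
      (fun i : Fin (m + k) => Sum.map (fun j => s₂ (Sum.inr j)) id (finSumFinEquiv.symm i))).det =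
    (X.f₃.submatrix (fun i => s₃ (Sum.inl i)) (fun j => s₂ (Sum.inr j))).det := by
  have : ((X.stabilize (Fin k)).f₃.submatrix
      (fun i : Fin (m + k) => Sum.map (fun j => s₃ (Sum.inl j)) id (finSumFinEquiv.symm i))
      (fun i : Fin (m + k) => Sum.map (fun j => s₂ (Sum.inr j)) id (finSumFinEquiv.symm i))) =
      (Matrix.fromBlocks (X.f₃.submatrix (fun i => s₃ (Sum.inl i)) (fun j => s₂ (Sum.inr j)))
        0 0 1).submatrix finSumFinEquiv.symm finSumFinEquiv.symm := by
    ext i j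
    simp only [Matrix.submatrix_apply, stabilize]
    rcases finSumFinEquiv.symm i with i | i <;> rcases finSumFinEquiv.symm j with j | j <;> rfl
  rw [this, Matrix.det_submatrix_equiv_self, Matrix.det_fromBlocks_zero₁₂, Matrix.det_one, mul_one]

/-- The added basis elements join the columns as well as the rows of the third minor, which becomes
block diagonal with an identity block. The other four minors are untouched. -/
theorem exists_tauChain_stabilize [Fintype ι₀] [DecidableEq ι₀] [Fintype ι₅] [DecidableEq ι₅]
    {X : BasedComplex ι₀ ι₁ ι₂ ι₃ ι₄ ι₅} (c : X.TauChain) (k : ℕ) :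
    ∃ c' : (X.stabilize (Fin k)).TauChain, c'.torsion = c.torsion := by
  let s₂' : Fin c.n₂ ⊕ Fin (c.n₃ + k) ≃ ι₂ ⊕ Fin k :=
    (Equiv.sumCongr (Equiv.refl _) finSumFinEquiv.symm).trans
    ((Equiv.sumAssoc _ _ _).symm.trans (Equiv.sumCongr c.s₂ (Equiv.refl _)))
  let s₃' : Fin (c.n₃ + k) ⊕ Fin c.n₄ ≃ ι₃ ⊕ Fin k :=
    (Equiv.sumCongr finSumFinEquiv.symm (Equiv.refl _)).trans
    ((Equiv.sumAssoc _ _ _).trans ((Equiv.sumCongr (Equiv.refl _) (Equiv.sumComm _ _)).trans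
      ((Equiv.sumAssoc _ _ _).symm.trans (Equiv.sumCongr c.s₃ (Equiv.refl _)))))
  have h₂ : (fun j => s₂' (Sum.inr j)) =
      fun i => Sum.map (fun j => c.s₂ (Sum.inr j)) id (finSumFinEquiv.symm i) := by
    ext1 i
    simp only [s₂', Equiv.trans_apply, Equiv.sumCongr_apply, Sum.map_inr]
    rcases finSumFinEquiv.symm i with i | i <;> rfl
  have h₃ : (fun j => s₃' (Sum.inl j)) =
      fun i => Sum.map (fun j => c.s₃ (Sum.inl j)) id (finSumFinEquiv.symm i) := by
    ext1 i
    simp only [s₃', Equiv.trans_apply, Equiv.sumCongr_apply, Sum.map_inl]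
    rcases finSumFinEquiv.symm i with i | i <;> rfl
  have key : ((X.stabilize (Fin k)).f₃.submatrix (fun i => s₃' (Sum.inl i))
      (fun j => s₂' (Sum.inr j))).det =
      (X.f₃.submatrix (fun i => c.s₃ (Sum.inl i)) (fun j => c.s₂ (Sum.inr j))).det := by
    rw [h₂, h₃, stabilize_minor₃]
  refine ⟨⟨c.n₂, c.n₃ + k, c.n₄, c.s₁, s₂', s₃', c.s₄, c.minor₁_ne, c.minor₂_ne,
    key ▸ c.minor₃_ne, c.minor₄_ne, c.minor₅_ne⟩, ?_⟩
  exact congrArg (fun x => _ / (_ * x * _)) key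

/-! ### Torsion under an isomorphism of complexes -/

section Compare

variable [Fintype ι₀] [Fintype ι₁] [Fintype ι₂] [Fintype ι₃] [Fintype ι₄] [Fintype ι₅]
variable [DecidableEq ι₀] [DecidableEq ι₁] [DecidableEq ι₂] [DecidableEq ι₃] [DecidableEq ι₄]
  [DecidableEq ι₅]
variable {ι₂' ι₃' : Type*} [Fintype ι₂'] [Fintype ι₃']

/-- The minor sizes of the two chains agree by counting. The identity of complementary minors is
then used once at each of the four middle spaces: with `P₂` and `P₃` at the third and fourth, and
with the identity matrix at the second and fifth, where it merely compares the two divisions of the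
same basis. -/
theorem abs_torsion_mul_of_chain_map
    (X : BasedComplex ι₀ ι₁ ι₂ ι₃ ι₄ ι₅) (X' : BasedComplex ι₀ ι₁ ι₂' ι₃' ι₄ ι₅)
    (P₂ : Matrix ι₂' ι₂ ℝ) (P₃ : Matrix ι₃' ι₃ ℝ) (e₂ : ι₂ ≃ ι₂') (e₃ : ι₃ ≃ ι₃')
    (h₁ : X'.f₁ = X.f₁) (h₂ : X'.f₂ = P₂ * X.f₂) (h₃ : X'.f₃ * P₂ = P₃ * X.f₃)
    (h₄ : X'.f₄ * P₃ = X.f₄) (h₅ : X'.f₅ = X.f₅)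
    (d₁ : X.f₂ * X.f₁ = 0) (d₂ : X.f₃ * X.f₂ = 0) (d₃ : X.f₄ * X.f₃ = 0) (d₄ : X.f₅ * X.f₄ = 0)
    (hP₃ : (P₃.submatrix e₃ id).det ≠ 0) (c : X.TauChain) (c' : X'.TauChain) :
    |c'.torsion| = |c.torsion| * (|(P₂.submatrix e₂ id).det| / |(P₃.submatrix e₃ id).det|) := by
  obtain ⟨n₂, n₃, n₄, s₁, s₂, s₃, s₄, m₁, m₂, m₃, m₄, m₅⟩ := c
  obtain ⟨n₂', n₃', n₄', s₁', s₂', s₃', s₄', m₁', m₂', m₃', m₄', m₅'⟩ := c'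
  obtain rfl : n₂ = n₂' := by
    have := Fintype.card_congr (s₁.trans s₁'.symm)
    simpa using this
  obtain rfl : n₃ = n₃' := by
    have := Fintype.card_congr ((s₂.trans e₂).trans s₂'.symm)
    simpa using this
  obtain rfl : n₄ = n₄' := by
    have := Fintype.card_congr ((s₃.trans e₃).trans s₃'.symm)
    simpa using this
  have k₁ := Matrix.abs_det_mul_abs_det_complement (1 : Matrix ι₁ ι₁ ℝ) X.f₁
    (X'.f₂.submatrix (fun i => s₂' (Sum.inl i)) id) s₁ s₁' (Equiv.refl _) (by
      rw [Matrix.one_mul]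
      have : X'.f₂.submatrix (fun i => s₂' (Sum.inl i)) id * X.f₁ =
        (X'.f₂ * X.f₁).submatrix (fun i => s₂' (Sum.inl i)) id := rfl
      rw [this, h₂, Matrix.mul_assoc, d₁, Matrix.mul_zero]; rfl)
  have k₂ := Matrix.abs_det_mul_abs_det_complement P₂
    (X.f₂.submatrix id (fun j => s₁ (Sum.inr j)))
    (X'.f₃.submatrix (fun i => s₃' (Sum.inl i)) id) s₂ s₂' e₂ (by
      have : X'.f₃.submatrix (fun i => s₃' (Sum.inl i)) id *
          (P₂ * X.f₂.submatrix id (fun j => s₁ (Sum.inr j))) =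
        (X'.f₃ * (P₂ * X.f₂)).submatrix (fun i => s₃' (Sum.inl i))
          (fun j => s₁ (Sum.inr j)) := rfl
      rw [this, ← Matrix.mul_assoc, h₃, Matrix.mul_assoc, d₂, Matrix.mul_zero]; rfl)
  have k₃ := Matrix.abs_det_mul_abs_det_complement P₃
    (X.f₃.submatrix id (fun j => s₂ (Sum.inr j)))
    (X'.f₄.submatrix (fun i => s₄' (Sum.inl i)) id) s₃ s₃' e₃ (by
      have : X'.f₄.submatrix (fun i => s₄' (Sum.inl i)) id *
          (P₃ * X.f₃.submatrix id (fun j => s₂ (Sum.inr j))) =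
        (X'.f₄ * (P₃ * X.f₃)).submatrix (fun i => s₄' (Sum.inl i))
          (fun j => s₂ (Sum.inr j)) := rfl
      rw [this, ← Matrix.mul_assoc, h₄, d₃]; rfl)
  have k₄ := Matrix.abs_det_mul_abs_det_complement (1 : Matrix ι₄ ι₄ ℝ)
    (X.f₄.submatrix id (fun j => s₃ (Sum.inr j))) X'.f₅ s₄ s₄' (Equiv.refl _) (by
      have : X'.f₅ * ((1 : Matrix ι₄ ι₄ ℝ) * X.f₄.submatrix id (fun j => s₃ (Sum.inr j))) =
        (X'.f₅ * X.f₄).submatrix id (fun j => s₃ (Sum.inr j)) := by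
        rw [Matrix.one_mul]; rfl
      rw [this, h₅, d₄]; rfl)
  simp only [Matrix.one_mul, Matrix.mul_one] at k₁ k₄
  have r₂ : (P₂ * X.f₂.submatrix id (fun j => s₁ (Sum.inr j))).submatrix
      (fun i => s₂' (Sum.inl i)) id =
      (X'.f₂.submatrix (fun i => s₂' (Sum.inl i)) id).submatrix id (fun j => s₁ (Sum.inr j)) := by
    rw [h₂]; rfl
  have r₃ : (P₃ * X.f₃.submatrix id (fun j => s₂ (Sum.inr j))).submatrix
      (fun i => s₃' (Sum.inl i)) id =
      (X'.f₃.submatrix (fun i => s₃' (Sum.inl i)) id * P₂).submatrix id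
        (fun j => s₂ (Sum.inr j)) := by
    have : (X'.f₃.submatrix (fun i => s₃' (Sum.inl i)) id * P₂) =
      (X'.f₃ * P₂).submatrix (fun i => s₃' (Sum.inl i)) id := rfl
    rw [this, h₃]; rfl
  have r₄ : (X.f₄.submatrix id (fun j => s₃ (Sum.inr j))).submatrix
      (fun i => s₄' (Sum.inl i)) id =
      (X'.f₄.submatrix (fun i => s₄' (Sum.inl i)) id * P₃).submatrix id
        (fun j => s₃ (Sum.inr j)) := by
    have : (X'.f₄.submatrix (fun i => s₄' (Sum.inl i)) id * P₃) =
      (X'.f₄ * P₃).submatrix (fun i => s₄' (Sum.inl i)) id := rfl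
    rw [this, h₄]; rfl
  rw [r₂] at k₂
  rw [r₃] at k₃
  rw [r₄] at k₄
  rw [h₅] at k₄ m₅'
  rw [h₁] at m₁'
  simp only [Matrix.submatrix_submatrix, Function.comp_def, id_eq] at k₁ k₂ k₃ k₄
  simp only [TauChain.torsion, abs_div, abs_mul, h₁, h₅]
  have o₁ : |((1 : Matrix ι₁ ι₁ ℝ).submatrix (Equiv.refl ι₁) id).det| = 1 := by
    have : (1 : Matrix ι₁ ι₁ ℝ).submatrix (Equiv.refl ι₁) id = 1 := rfl
    rw [this]; simp
  have o₄ : |((1 : Matrix ι₄ ι₄ ℝ).submatrix (Equiv.refl ι₄) id).det| = 1 := by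
    have : (1 : Matrix ι₄ ι₄ ℝ).submatrix (Equiv.refl ι₄) id = 1 := rfl
    rw [this]; simp
  rw [o₁] at k₁
  rw [o₄] at k₄
  simp only [Matrix.submatrix, id_eq] at k₁ k₂ k₃ k₄ m₁ m₂ m₃ m₄ m₅ m₁' m₂' m₃' m₄' m₅' hP₃ ⊢
  rw [← abs_ne_zero] at m₁ m₂ m₃ m₄ m₅ m₁' m₂' m₃' m₄' m₅' hP₃
  rw [one_mul] at k₁ k₄
  exact torsion_ratio_of_mixed_minors k₁ k₂ k₃ k₄ m₁ m₃ m₅ m₁' m₃' m₅' hP₃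

end Compare

/-! ### Exactness under stabilization and isomorphism -/

section Acyclic

variable [Fintype ι₀] [Fintype ι₁] [Fintype ι₂] [Fintype ι₃] [Fintype ι₄]
variable {ι₂' ι₃' : Type*} [Fintype ι₂'] [Fintype ι₃']

theorem sumElim_eq_zero_iff {α κ : Type*} (x : α → ℝ) (y : κ → ℝ) :
    Sum.elim x y = 0 ↔ x = 0 ∧ y = 0 := by
  rw [funext_iff, funext_iff, funext_iff, Sum.forall]
  rfl

theorem forall_sumElim_iff {α κ : Type*} (p : (α ⊕ κ → ℝ) → Prop) :
    (∀ z, p z) ↔ ∀ x y, p (Sum.elim x y) := by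
  refine ⟨fun h x y => h _, fun h z => ?_⟩
  have := h (z ∘ Sum.inl) (z ∘ Sum.inr)
  rwa [Sum.elim_comp_inl_inr] at this

/-- The added summand is exact by itself: the extra coordinates in the third term are detected by
`f₃`, and those in the fourth term are all attained by it. -/
theorem isAcyclic_stabilize (X : BasedComplex ι₀ ι₁ ι₂ ι₃ ι₄ ι₅) (κ : Type*) [Fintype κ]
    [DecidableEq κ] : (X.stabilize κ).IsAcyclic ↔ X.IsAcyclic := by
  have h2 : ∀ x, (Matrix.fromRows X.f₂ (0 : Matrix κ ι₁ ℝ)).mulVec x =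
      Sum.elim (X.f₂.mulVec x) 0 := by
    intro x
    rw [Matrix.fromRows_mulVec, Matrix.zero_mulVec]
  have h3 : ∀ x y, (Matrix.fromBlocks X.f₃ 0 0 (1 : Matrix κ κ ℝ)).mulVec (Sum.elim x y) =
      Sum.elim (X.f₃.mulVec x) y := by
    intro x y
    simp [Matrix.fromBlocks_mulVec]
  have h4 : ∀ x y, (Matrix.fromCols X.f₄ (0 : Matrix ι₄ κ ℝ)).mulVec (Sum.elim x y) =
      X.f₄.mulVec x := by
    intro x y
    simp
  have e₁ : Function.Exact X.f₁.mulVec (X.stabilize κ).f₂.mulVec ↔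
      Function.Exact X.f₁.mulVec X.f₂.mulVec := by
    refine forall_congr' fun x => ?_
    rw [show (X.stabilize κ).f₂.mulVec x = _ from h2 x, sumElim_eq_zero_iff]
    simp
  have e₂ : Function.Exact (X.stabilize κ).f₂.mulVec (X.stabilize κ).f₃.mulVec ↔
      Function.Exact X.f₂.mulVec X.f₃.mulVec := by
    unfold Function.Exact
    rw [forall_sumElim_iff]
    refine forall_congr' fun x => ⟨fun h => ?_, fun h y => ?_⟩
    · have := h 0
      rw [show (X.stabilize κ).f₃.mulVec (Sum.elim x 0) = _ from h3 x 0, sumElim_eq_zero_iff] at this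
      simp only [and_true] at this
      rw [this, Set.mem_range, Set.mem_range]
      refine exists_congr fun w => ?_
      rw [show (X.stabilize κ).f₂.mulVec w = _ from h2 w, Sum.elim_eq_iff]
      simp
    · rw [show (X.stabilize κ).f₃.mulVec (Sum.elim x y) = _ from h3 x y, sumElim_eq_zero_iff, h, Set.mem_range,
        Set.mem_range, ← exists_and_right]
      refine exists_congr fun w => ?_
      rw [show (X.stabilize κ).f₂.mulVec w = _ from h2 w, Sum.elim_eq_iff, eq_comm (a := y)]
  have e₃ : Function.Exact (X.stabilize κ).f₃.mulVec (X.stabilize κ).f₄.mulVec ↔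
      Function.Exact X.f₃.mulVec X.f₄.mulVec := by
    unfold Function.Exact
    rw [forall_sumElim_iff]
    have hr : ∀ x y, Sum.elim x y ∈ Set.range (X.stabilize κ).f₃.mulVec ↔
        x ∈ Set.range X.f₃.mulVec := by
      intro x y
      refine ⟨?_, ?_⟩
      · rintro ⟨w, hw⟩
        rw [← Sum.elim_comp_inl_inr w, show (X.stabilize κ).f₃.mulVec (Sum.elim _ _) = _ from
          h3 _ _, Sum.elim_eq_iff] at hw
        exact ⟨_, hw.1⟩
      · rintro ⟨w, rfl⟩
        exact ⟨Sum.elim w y, h3 w y⟩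
    refine forall_congr' fun x => ⟨fun h => ?_, fun h y => ?_⟩
    · rw [← hr x 0, ← h 0, show (X.stabilize κ).f₄.mulVec (Sum.elim x 0) = _ from h4 x 0]
    · rw [hr, show (X.stabilize κ).f₄.mulVec (Sum.elim x y) = _ from h4 x y, h]
  have e₄ : Function.Exact (X.stabilize κ).f₄.mulVec X.f₅.mulVec ↔
      Function.Exact X.f₄.mulVec X.f₅.mulVec := by
    refine forall_congr' fun x => iff_congr Iff.rfl ⟨?_, ?_⟩
    · rintro ⟨w, rfl⟩
      rw [← Sum.elim_comp_inl_inr w]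
      exact ⟨_, (h4 _ _).symm⟩
    · rintro ⟨w, rfl⟩
      exact ⟨Sum.elim w 0, h4 w 0⟩
  have hf₁ : (X.stabilize κ).f₁ = X.f₁ := rfl
  have hf₅ : (X.stabilize κ).f₅ = X.f₅ := rfl
  rw [IsAcyclic, IsAcyclic, hf₁, hf₅, e₁, e₂, e₃, e₄]

theorem isAcyclic_iff_of_bijective
    (X : BasedComplex ι₀ ι₁ ι₂ ι₃ ι₄ ι₅) (X' : BasedComplex ι₀ ι₁ ι₂' ι₃' ι₄ ι₅)
    (P₂ : Matrix ι₂' ι₂ ℝ) (P₃ : Matrix ι₃' ι₃ ℝ)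
    (hP₂ : Function.Bijective P₂.mulVec) (hP₃ : Function.Bijective P₃.mulVec)
    (h₁ : X'.f₁ = X.f₁) (h₂ : X'.f₂ = P₂ * X.f₂) (h₃ : X'.f₃ * P₂ = P₃ * X.f₃)
    (h₄ : X'.f₄ * P₃ = X.f₄) (h₅ : X'.f₅ = X.f₅) : X.IsAcyclic ↔ X'.IsAcyclic := by
  have k₂ : ∀ x, X'.f₂.mulVec x = P₂.mulVec (X.f₂.mulVec x) := by
    intro x; rw [h₂, Matrix.mulVec_mulVec]
  have k₃ : ∀ x, X'.f₃.mulVec (P₂.mulVec x) = P₃.mulVec (X.f₃.mulVec x) := by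
    intro x; rw [Matrix.mulVec_mulVec, h₃, Matrix.mulVec_mulVec]
  have k₄ : ∀ x, X'.f₄.mulVec (P₃.mulVec x) = X.f₄.mulVec x := by
    intro x; rw [Matrix.mulVec_mulVec, h₄]
  have z₂ : ∀ x, P₂.mulVec x = 0 ↔ x = 0 := fun x =>
    ⟨fun h => hP₂.1 (h.trans (Matrix.mulVec_zero P₂).symm), fun h => by rw [h, Matrix.mulVec_zero]⟩
  have z₃ : ∀ x, P₃.mulVec x = 0 ↔ x = 0 := fun x =>
    ⟨fun h => hP₃.1 (h.trans (Matrix.mulVec_zero P₃).symm), fun h => by rw [h, Matrix.mulVec_zero]⟩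
  have e₁ : Function.Exact X.f₁.mulVec X.f₂.mulVec ↔ Function.Exact X'.f₁.mulVec X'.f₂.mulVec := by
    simp only [Function.Exact, k₂, z₂, h₁]
  have e₂ : Function.Exact X.f₂.mulVec X.f₃.mulVec ↔ Function.Exact X'.f₂.mulVec X'.f₃.mulVec := by
    simp only [Function.Exact]
    rw [hP₂.2.forall]
    refine forall_congr' fun x => ?_
    rw [k₃, z₃]
    refine iff_congr Iff.rfl ?_
    simp only [Set.mem_range, k₂, hP₂.1.eq_iff]
  have e₃ : Function.Exact X.f₃.mulVec X.f₄.mulVec ↔ Function.Exact X'.f₃.mulVec X'.f₄.mulVec := by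
    simp only [Function.Exact]
    rw [hP₃.2.forall]
    refine forall_congr' fun x => ?_
    rw [k₄]
    refine iff_congr Iff.rfl ?_
    simp only [Set.mem_range, hP₂.2.exists, k₃, hP₃.1.eq_iff]
  have e₄ : Function.Exact X.f₄.mulVec X.f₅.mulVec ↔ Function.Exact X'.f₄.mulVec X'.f₅.mulVec := by
    simp only [Function.Exact, Set.mem_range, hP₃.2.exists, k₄, h₅]
  rw [IsAcyclic, IsAcyclic, e₁, e₂, e₃, e₄, h₁, h₅]

theorem bijective_mulVec_of_det_ne_zero {a b : Type*} [Fintype a] [DecidableEq a] [Fintype b]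
    (P : Matrix b a ℝ) (e : a ≃ b) (h : (P.submatrix e id).det ≠ 0) :
    Function.Bijective P.mulVec := by
  have hu : IsUnit (P.submatrix e id) := by
    rw [Matrix.isUnit_iff_isUnit_det]
    exact isUnit_iff_ne_zero.2 h
  have h3 : Function.Bijective (fun x : b → ℝ => x ∘ e) :=
    (e.arrowCongr (Equiv.refl ℝ)).symm.bijective
  exact (h3.of_comp_iff' P.mulVec).1
    ⟨Matrix.mulVec_injective_of_isUnit hu, Matrix.mulVec_surjective_iff_isUnit.2 hu⟩

end Acyclic

/-- Two complexes that become isomorphic after adding `0 → ℝ^k → ℝ^k → 0` to the first one. -/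
theorem compare_of_stable_iso [Fintype ι₀] [Fintype ι₁] [Fintype ι₂] [Fintype ι₃] [Fintype ι₄]
    [Fintype ι₅] [DecidableEq ι₀] [DecidableEq ι₁] [DecidableEq ι₂] [DecidableEq ι₃]
    [DecidableEq ι₄] [DecidableEq ι₅] {ι₂' ι₃' : Type*} [Fintype ι₂'] [Fintype ι₃'] {k : ℕ}
    (X : BasedComplex ι₀ ι₁ ι₂ ι₃ ι₄ ι₅) (X' : BasedComplex ι₀ ι₁ ι₂' ι₃' ι₄ ι₅)
    (P₂ : Matrix ι₂' (ι₂ ⊕ Fin k) ℝ) (P₃ : Matrix ι₃' (ι₃ ⊕ Fin k) ℝ)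
    (e₂ : ι₂ ⊕ Fin k ≃ ι₂') (e₃ : ι₃ ⊕ Fin k ≃ ι₃')
    (h₁ : X'.f₁ = X.f₁) (h₂ : X'.f₂ = P₂ * Matrix.fromRows X.f₂ 0)
    (h₃ : X'.f₃ * P₂ = P₃ * Matrix.fromBlocks X.f₃ 0 0 1)
    (h₄ : X'.f₄ * P₃ = Matrix.fromCols X.f₄ 0) (h₅ : X'.f₅ = X.f₅)
    (hP₂ : (P₂.submatrix e₂ id).det ≠ 0) (hP₃ : (P₃.submatrix e₃ id).det ≠ 0) :
    (X.IsAcyclic ↔ X'.IsAcyclic) ∧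
    (X.IsAcyclic → Nonempty X.TauChain ∧ Nonempty X'.TauChain ∧
      ∀ (c : X.TauChain) (c' : X'.TauChain), |c'.torsion| =
        |c.torsion| * (|(P₂.submatrix e₂ id).det| / |(P₃.submatrix e₃ id).det|)) := by
  have hiff : X.IsAcyclic ↔ X'.IsAcyclic :=
    (isAcyclic_stabilize X (Fin k)).symm.trans (isAcyclic_iff_of_bijective _ _ P₂ P₃
      (bijective_mulVec_of_det_ne_zero P₂ e₂ hP₂) (bijective_mulVec_of_det_ne_zero P₃ e₃ hP₃)
      h₁ h₂ h₃ h₄ h₅)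
  refine ⟨hiff, fun hX => ⟨hX.nonempty_tauChain, (hiff.1 hX).nonempty_tauChain, fun c c' => ?_⟩⟩
  obtain ⟨c₁, hc₁⟩ := exists_tauChain_stabilize c k
  obtain ⟨-, h12, h23, h34, h45, -⟩ := (isAcyclic_stabilize X (Fin k)).2 hX
  rw [← hc₁]
  exact abs_torsion_mul_of_chain_map (X.stabilize (Fin k)) X' P₂ P₃ e₂ e₃ h₁ h₂ h₃ h₄ h₅
    (mul_eq_zero_of_exact h12) (mul_eq_zero_of_exact h23) (mul_eq_zero_of_exact h34)
    (mul_eq_zero_of_exact h45) hP₃ c₁ c'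

end BasedComplex

/-! ### Volumes, Gram determinants and the dual of a bivector -/

/-- The determinant of four vectors. -/
noncomputable def vol4 (b c d e : R4) : ℝ :=
  Matrix.det (Matrix.of ![fun i => b i, fun i => c i, fun i => d i, fun i => e i])

/-- The Gram determinant of two vectors. -/
noncomputable def gram2 (b c : R4) : ℝ := inner ℝ b b * inner ℝ c c - inner ℝ b c ^ 2

/-- The product of `gram2 b c` and the inner product of the components of `d` and `e` orthogonal to
`b` and `c`. -/
noncomputable def gram3 (b c d e : R4) : ℝ :=
  gram2 b c * inner ℝ d e - (inner ℝ d b * inner ℝ c c - inner ℝ d c * inner ℝ b c) * inner ℝ b e -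
    (inner ℝ d c * inner ℝ b b - inner ℝ d b * inner ℝ b c) * inner ℝ c e

/-- The matrix of the bivector dual to `b ∧ c`. -/
noncomputable def dualBivector (b c : R4) : Matrix (Fin 4) (Fin 4) ℝ :=
  !![0, -(b 2 * c 3 - b 3 * c 2), b 1 * c 3 - b 3 * c 1, -(b 1 * c 2 - b 2 * c 1);
     b 2 * c 3 - b 3 * c 2, 0, -(b 0 * c 3 - b 3 * c 0), b 0 * c 2 - b 2 * c 0;
     -(b 1 * c 3 - b 3 * c 1), b 0 * c 3 - b 3 * c 0, 0, -(b 0 * c 1 - b 1 * c 0);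
     b 1 * c 2 - b 2 * c 1, -(b 0 * c 2 - b 2 * c 0), b 0 * c 1 - b 1 * c 0, 0]

/-- The product of `gram2 b c` and the component of `d` orthogonal to `b` and `c`. -/
noncomputable def scaledPerp (b c d : R4) : R4 :=
  gram2 b c • d - (inner ℝ d b * inner ℝ c c - inner ℝ d c * inner ℝ b c) • b -
    (inner ℝ d c * inner ℝ b b - inner ℝ d b * inner ℝ b c) • c

theorem R4.inner_eq (x y : R4) : inner ℝ x y = x 0 * y 0 + x 1 * y 1 + x 2 * y 2 + x 3 * y 3 := by
  simp [PiLp.inner_apply, Fin.sum_univ_four, mul_comm]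

theorem vol4_eq (b c d e : R4) : vol4 b c d e =
    (b 0 * c 1 - b 1 * c 0) * (d 2 * e 3 - d 3 * e 2) -
    (b 0 * c 2 - b 2 * c 0) * (d 1 * e 3 - d 3 * e 1) +
    (b 0 * c 3 - b 3 * c 0) * (d 1 * e 2 - d 2 * e 1) +
    (b 1 * c 2 - b 2 * c 1) * (d 0 * e 3 - d 3 * e 0) -
    (b 1 * c 3 - b 3 * c 1) * (d 0 * e 2 - d 2 * e 0) +
    (b 2 * c 3 - b 3 * c 2) * (d 0 * e 1 - d 1 * e 0) := by
  simp [vol4, Matrix.det_succ_row_zero, Fin.sum_univ_succ, Fin.succAbove]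
  ring

theorem dualBivector_apply (b c x : R4) :
    (dualBivector b c).toEuclideanLin x = WithLp.toLp 2
      ![-(b 2 * c 3 - b 3 * c 2) * x 1 + (b 1 * c 3 - b 3 * c 1) * x 2 -
          (b 1 * c 2 - b 2 * c 1) * x 3,
        (b 2 * c 3 - b 3 * c 2) * x 0 - (b 0 * c 3 - b 3 * c 0) * x 2 +
          (b 0 * c 2 - b 2 * c 0) * x 3,
        -(b 1 * c 3 - b 3 * c 1) * x 0 + (b 0 * c 3 - b 3 * c 0) * x 1 -
          (b 0 * c 1 - b 1 * c 0) * x 3,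
        (b 1 * c 2 - b 2 * c 1) * x 0 - (b 0 * c 2 - b 2 * c 0) * x 1 +
          (b 0 * c 1 - b 1 * c 0) * x 2] := by
  rw [Matrix.toLpLin_apply]
  congr 1
  ext i
  fin_cases i <;> simp [dualBivector, Matrix.mulVec, dotProduct, Fin.sum_univ_four] <;> ring

theorem dualBivector_transpose (b c : R4) : (dualBivector b c).transpose = -dualBivector b c := by
  ext i j
  fin_cases i <;> fin_cases j <;> simp [dualBivector]

/-- This characterizes `dualBivector b c`: it represents the alternating form obtained from the
volume by fixing its first two arguments. Most properties below are properties of the volume read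
through it. -/
theorem inner_dualBivector (b c d e : R4) :
    inner ℝ e ((dualBivector b c).toEuclideanLin d) = vol4 b c d e := by
  rw [R4.inner_eq, vol4_eq, dualBivector_apply]
  simp
  ring

theorem dualBivector_left (b c : R4) : (dualBivector b c).toEuclideanLin b = 0 := by
  rw [dualBivector_apply]
  ext i
  fin_cases i <;> simp <;> ring

theorem dualBivector_right (b c : R4) : (dualBivector b c).toEuclideanLin c = 0 := by
  rw [dualBivector_apply]
  ext i
  fin_cases i <;> simp <;> ring

/-- On the plane orthogonal to `b` and `c` the dual bivector is a quarter turn multiplied by the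
area of the parallelogram on `b` and `c`, and on their span it is zero. -/
theorem dualBivector_dualBivector (b c d : R4) :
    (dualBivector b c).toEuclideanLin ((dualBivector b c).toEuclideanLin d) =
      -scaledPerp b c d := by
  rw [dualBivector_apply, dualBivector_apply, scaledPerp]
  simp only [gram2, R4.inner_eq]
  ext i
  fin_cases i <;> simp <;> ring

theorem inner_scaledPerp (b c d e : R4) : inner ℝ (scaledPerp b c d) e = gram3 b c d e := by
  simp only [scaledPerp, gram3, inner_sub_left, real_inner_smul_left]

theorem gram3_comm (b c d e : R4) : gram3 b c d e = gram3 b c e d := by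
  simp only [gram3, gram2, R4.inner_eq]
  ring

theorem gram3_left (b c d : R4) : gram3 b c d b = 0 := by
  simp only [gram3, gram2]
  rw [real_inner_comm b c]
  ring

theorem gram3_right (b c d : R4) : gram3 b c d c = 0 := by
  simp only [gram3, gram2]
  ring

theorem inner_dualBivector_left (b c d : R4) :
    inner ℝ b ((dualBivector b c).toEuclideanLin d) = 0 := by
  rw [inner_dualBivector, vol4_eq]; ring

theorem inner_dualBivector_right (b c d : R4) :
    inner ℝ c ((dualBivector b c).toEuclideanLin d) = 0 := by
  rw [inner_dualBivector, vol4_eq]; ring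

theorem inner_dualBivector_self (b c d : R4) :
    inner ℝ d ((dualBivector b c).toEuclideanLin d) = 0 := by
  rw [inner_dualBivector, vol4_eq]; ring

theorem inner_dualBivector_dualBivector (b c d e : R4) :
    inner ℝ ((dualBivector b c).toEuclideanLin d) ((dualBivector b c).toEuclideanLin e) =
      gram3 b c d e := by
  rw [dualBivector_apply, dualBivector_apply]
  simp only [gram3, gram2, R4.inner_eq]
  simp
  ring

theorem gram3_dualBivector (b c d e : R4) :
    gram3 b c ((dualBivector b c).toEuclideanLin d) e = gram2 b c * vol4 b c d e := by
  have h1 := inner_dualBivector_left b c d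
  have h2 := inner_dualBivector_right b c d
  have h3 := inner_dualBivector b c d e
  rw [real_inner_comm] at h1 h2 h3
  simp only [gram3, h1, h2, h3]
  ring

theorem eq_zero_of_inner_eq_zero {b c d e z : R4} (h : vol4 b c d e ≠ 0) (hb : inner ℝ b z = 0)
    (hc : inner ℝ c z = 0) (hd : inner ℝ d z = 0) (he : inner ℝ e z = 0) : z = 0 := by
  have := Matrix.eq_zero_of_mulVec_eq_zero (v := fun i => z i) h (by
    rw [R4.inner_eq] at hb hc hd he
    ext i
    fin_cases i <;> simpa [Matrix.mulVec, dotProduct, Fin.sum_univ_four])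
  ext i
  exact congrFun this i

theorem vol4_dualBivector (b c d : R4) :
    vol4 b c d ((dualBivector b c).toEuclideanLin d) = gram3 b c d d := by
  rw [← inner_dualBivector, inner_dualBivector_dualBivector]

/-- Expansion of a vector in the plane orthogonal to `b` and `c`. -/
theorem gram3_mul_gram3 {b c d : R4} (h : gram3 b c d d ≠ 0) (v w : R4) :
    gram3 b c d d * gram3 b c v w =
      gram3 b c d v * gram3 b c d w + gram2 b c * (vol4 b c d v * vol4 b c d w) := by
  set M := (dualBivector b c).toEuclideanLin
  have hMd : ∀ e, inner ℝ e (M d) = vol4 b c d e := inner_dualBivector b c d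
  -- In the plane orthogonal to `b, c`, the component of `d` and the vector `M d` form an orthogonal
  -- basis, and this is the expansion of the component of `v` in it. It is verified by pairing with
  -- the basis `b, c, d, M d` of the whole space.
  have hz : gram3 b c d d • scaledPerp b c v - gram3 b c d v • scaledPerp b c d -
      (gram2 b c * vol4 b c d v) • M d = 0 := by
    have h' : vol4 b c d (M d) ≠ 0 := by rwa [vol4_dualBivector]
    refine eq_zero_of_inner_eq_zero h' ?_ ?_ ?_ ?_
    · rw [real_inner_comm]
      simp only [inner_sub_left, real_inner_smul_left, inner_scaledPerp, gram3_left]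
      rw [real_inner_comm, inner_dualBivector_left]; ring
    · rw [real_inner_comm]
      simp only [inner_sub_left, real_inner_smul_left, inner_scaledPerp, gram3_right]
      rw [real_inner_comm, inner_dualBivector_right]; ring
    · rw [real_inner_comm]
      simp only [inner_sub_left, real_inner_smul_left, inner_scaledPerp]
      rw [real_inner_comm, inner_dualBivector_self, gram3_comm b c v d]; ring
    · rw [real_inner_comm]
      simp only [inner_sub_left, real_inner_smul_left, inner_scaledPerp]
      rw [inner_dualBivector_dualBivector, gram3_comm b c v, gram3_dualBivector,
        gram3_comm b c d (M d), gram3_dualBivector]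
      have : vol4 b c d d = 0 := by rw [vol4_eq]; ring
      rw [this]; ring
  have := congrArg (fun z => inner ℝ z w) hz
  simp only [inner_sub_left, real_inner_smul_left, inner_scaledPerp, inner_zero_left] at this
  rw [real_inner_comm, hMd] at this
  linarith

/-- The expansion `gram3_mul_gram3` applied to the quarter turn of `v` in place of `v`: inner
products become volumes, and a common factor `gram2 b c` is cancelled. The two identities are the
addition formulas for cosine and sine in the orthogonal plane. -/
theorem gram3_mul_vol4 {b c d : R4} (h : gram3 b c d d ≠ 0) (hG : gram2 b c ≠ 0) (v w : R4) :
    gram3 b c d d * vol4 b c v w =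
      gram3 b c d v * vol4 b c d w - gram3 b c d w * vol4 b c d v := by
  have h1 := gram3_mul_gram3 h ((dualBivector b c).toEuclideanLin v) w
  rw [gram3_dualBivector, gram3_comm b c d ((dualBivector b c).toEuclideanLin v),
    gram3_dualBivector, ← inner_dualBivector b c d ((dualBivector b c).toEuclideanLin v),
    inner_dualBivector_dualBivector] at h1
  have h2 : vol4 b c v d = -vol4 b c d v := by rw [vol4_eq, vol4_eq]; ring
  rw [h2, gram3_comm b c v d] at h1
  apply mul_left_cancel₀ hG
  linarith

theorem gram2_nonneg (b c : R4) : 0 ≤ gram2 b c := by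
  have := real_inner_mul_inner_self_le b c
  rw [gram2]; nlinarith

theorem norm_scaledPerp_sq (b c d : R4) :
    ‖scaledPerp b c d‖ ^ 2 = gram2 b c * gram3 b c d d := by
  rw [← real_inner_self_eq_norm_sq, inner_scaledPerp, gram3_comm, ← inner_scaledPerp,
    inner_scaledPerp]
  simp only [scaledPerp, gram3, gram2, R4.inner_eq]
  simp
  ring

theorem gram2_pos {b c : R4} (h : LinearIndependent ℝ ![b, c]) : 0 < gram2 b c := by
  rw [LinearIndependent.pair_iff] at h
  refine lt_of_le_of_ne (gram2_nonneg b c) fun h0 => ?_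
  -- The squared norm of this vector is `inner ℝ c c * gram2 b c`.
  have h1 : inner ℝ c c • b + (-inner ℝ b c) • c = 0 := by
    rw [← norm_eq_zero, ← sq_eq_zero_iff, ← real_inner_self_eq_norm_sq]
    simp only [inner_add_left, inner_add_right, real_inner_smul_left, real_inner_smul_right]
    rw [gram2] at h0
    rw [real_inner_comm b c] 
    linear_combination -(inner ℝ c c) * h0
  have h2 := (h _ _ h1).1
  rw [inner_self_eq_zero] at h2
  have := (h 0 1 (by simp [h2])).2
  exact one_ne_zero this

/-- The vector `scaledPerp b c d` is nonzero, as its coefficient at `d` is `gram2 b c`, and its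
squared norm is the product of the two Gram quantities. -/
theorem gram3_pos {b c d : R4} (h : LinearIndependent ℝ ![b, c, d]) :
    0 < gram2 b c ∧ 0 < gram3 b c d d := by
  have h2 : LinearIndependent ℝ ![b, c] := by
    have := h.comp (Fin.castSucc : Fin 2 → Fin 3) (Fin.castSucc_injective 2)
    convert this using 1
    ext i : 1
    fin_cases i <;> rfl
  have hG := gram2_pos h2
  refine ⟨hG, ?_⟩
  have h3 : scaledPerp b c d ≠ 0 := by
    intro h0
    rw [Fintype.linearIndependent_iff] at h
    have := h ![-(inner ℝ d b * inner ℝ c c - inner ℝ d c * inner ℝ b c),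
      -(inner ℝ d c * inner ℝ b b - inner ℝ d b * inner ℝ b c), gram2 b c] (by
        rw [Fin.sum_univ_three, ← h0, scaledPerp]
        simp only [Matrix.cons_val_zero, Matrix.cons_val_one, Matrix.cons_val]
        module) 2
    exact hG.ne' this
  have h4 : 0 < ‖scaledPerp b c d‖ ^ 2 := by positivity
  rw [norm_scaledPerp_sq] at h4
  exact pos_of_mul_pos_right h4 hG.le

/-! ### The phase of a hinge -/

/-- The first and the last vertex of a hinge do not lie in the plane of its two-face. -/
def HingeRegular (q : Fin 5 → R4) : Prop :=
  0 < gram2 (q 2 - q 1) (q 3 - q 1) ∧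
  0 < gram3 (q 2 - q 1) (q 3 - q 1) (q 4 - q 1) (q 4 - q 1) ∧
  0 < gram3 (q 2 - q 1) (q 3 - q 1) (q 0 - q 1) (q 0 - q 1)

/-- The hinge phase in terms of inner products and the volume. -/
noncomputable def gramPhase (b c d e : R4) : ℂ :=
  ((-gram3 b c d e : ℝ) + (√(gram2 b c) * vol4 b c d e : ℝ) * Complex.I) /
    (√(gram3 b c d d) * √(gram3 b c e e) : ℝ)

theorem orientedVolume_eq (a b c d e : R4) :
    orientedVolume a b c d e = 1 / 24 * vol4 (b - a) (c - a) (d - a) (e - a) := by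
  simp only [orientedVolume, vol4, PiLp.sub_apply]

theorem sub_inv_smul_scaledPerp_mem (u v w : R4) (h : gram2 u v ≠ 0) :
    w - (gram2 u v)⁻¹ • scaledPerp u v w ∈ Submodule.span ℝ {u, v} := by
  rw [Submodule.mem_span_pair]
  refine ⟨(gram2 u v)⁻¹ * (inner ℝ w u * inner ℝ v v - inner ℝ w v * inner ℝ u v),
    (gram2 u v)⁻¹ * (inner ℝ w v * inner ℝ u u - inner ℝ w u * inner ℝ u v), ?_⟩
  rw [scaledPerp, smul_sub, smul_sub, smul_smul, inv_mul_cancel₀ h, mul_smul, mul_smul]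
  module

theorem planePerp_eq {a b c : R4} (p : R4) (h : 0 < gram2 (b - a) (c - a)) :
    planePerp a b c p = (gram2 (b - a) (c - a))⁻¹ • scaledPerp (b - a) (c - a) (p - a) := by
  rw [planePerp]
  set u := b - a
  set v := c - a
  set w := p - a
  refine Submodule.eq_starProjection_of_mem_of_inner_eq_zero ?_ ?_
  · rw [Submodule.mem_orthogonal]
    intro y hy
    obtain ⟨s, t, rfl⟩ := Submodule.mem_span_pair.1 hy
    rw [real_inner_comm, real_inner_smul_left, inner_add_right, real_inner_smul_right,
      real_inner_smul_right, inner_scaledPerp, inner_scaledPerp, gram3_left, gram3_right]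
    simp
  · intro y hy
    rw [Submodule.mem_orthogonal] at hy
    exact hy _ (sub_inv_smul_scaledPerp_mem u v w h.ne')

/-- The cosine of the inner dihedral angle is a quotient of Gram quantities. Its sine is nonnegative
and so yields only the absolute value of the volume; the sign convention in `hingeAngle` restores
the sign. The result has no case distinction. -/
theorem hingePhase_eq {q : Fin 5 → R4} (h : HingeRegular q) :
    hingePhase q = gramPhase (q 2 - q 1) (q 3 - q 1) (q 4 - q 1) (q 0 - q 1) := by
  obtain ⟨hG, hd, he⟩ := h
  rw [hingePhase, hingeAngle, orientedVolume_eq, innerDihedral, planePerp_eq _ hG,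
    planePerp_eq _ hG]
  set b := q 2 - q 1
  set c := q 3 - q 1
  set d := q 4 - q 1
  set e := q 0 - q 1
  rw [InnerProductGeometry.angle_smul_left_of_pos _ _ (inv_pos.2 hG),
    InnerProductGeometry.angle_smul_right_of_pos _ _ (inv_pos.2 hG)]
  set φ := InnerProductGeometry.angle (scaledPerp b c d) (scaledPerp b c e) with hφ
  set D := √(gram3 b c d d) * √(gram3 b c e e) with hD
  have hDpos : 0 < D := by positivity
  have hD2 : D ^ 2 = gram3 b c d d * gram3 b c e e := by
    rw [hD, mul_pow, Real.sq_sqrt hd.le, Real.sq_sqrt he.le]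
  have hn : ‖scaledPerp b c d‖ * ‖scaledPerp b c e‖ = gram2 b c * D := by
    have h1 : (‖scaledPerp b c d‖ * ‖scaledPerp b c e‖) ^ 2 = (gram2 b c * D) ^ 2 := by
      rw [mul_pow, norm_scaledPerp_sq, norm_scaledPerp_sq, mul_pow, hD2]; ring
    exact (pow_left_inj₀ (by positivity) (by positivity) two_ne_zero).1 h1
  have hin : inner ℝ (scaledPerp b c d) (scaledPerp b c e) = gram2 b c * gram3 b c d e := by
    nth_rewrite 2 [scaledPerp]
    simp only [inner_sub_right, real_inner_smul_right, inner_scaledPerp, gram3_left, gram3_right]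
    ring
  have hcos : Real.cos φ = gram3 b c d e / D := by
    rw [hφ, InnerProductGeometry.cos_angle, hn, hin, mul_div_mul_left _ _ hG.ne']
  have hsin : Real.sin φ = |√(gram2 b c) * vol4 b c d e / D| := by
    rw [← abs_of_nonneg (InnerProductGeometry.sin_angle_nonneg (scaledPerp b c d)
      (scaledPerp b c e)), ← sq_eq_sq_iff_abs_eq_abs, ← hφ, Real.sin_sq, hcos, div_pow, div_pow,
      mul_pow (√(gram2 b c)), Real.sq_sqrt hG.le, hD2]
    have := gram3_mul_gram3 hd.ne' e e
    field_simp
    linear_combination this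
  have hgoal : gramPhase b c d e = (-Real.cos φ : ℝ) + (√(gram2 b c) * vol4 b c d e / D : ℝ) *
      Complex.I := by
    rw [gramPhase, hcos, ← hD]
    push_cast
    ring
  have hexp : ∀ θ : ℝ, Complex.exp (θ * Complex.I) = (Real.cos θ : ℝ) + (Real.sin θ : ℝ) *
      Complex.I := by
    intro θ
    rw [Complex.exp_mul_I, Complex.ofReal_cos, Complex.ofReal_sin]
  rw [hgoal, hexp]
  split_ifs with hV
  · have hV' : √(gram2 b c) * vol4 b c d e / D < 0 := by
      have : vol4 b c d e < 0 := by linarith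
      have h2 : 0 < √(gram2 b c) := Real.sqrt_pos.2 hG
      exact div_neg_of_neg_of_pos (mul_neg_of_pos_of_neg h2 this) hDpos
    rw [Real.cos_neg, Real.sin_neg, Real.cos_pi_sub, Real.sin_pi_sub, hsin, abs_of_neg hV', neg_neg]
  · have hV' : 0 ≤ √(gram2 b c) * vol4 b c d e / D := by
      have : 0 ≤ vol4 b c d e := by linarith
      positivity
    rw [Real.cos_pi_sub, Real.sin_pi_sub, hsin, abs_of_nonneg hV']

theorem HingeRegular.eventually {q : Fin 5 → R4} (h : HingeRegular q) :
    ∀ᶠ p in nhds q, HingeRegular p := by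
  have hc : ∀ f : (Fin 5 → R4) → ℝ, Continuous f → 0 < f q → ∀ᶠ p in nhds q, 0 < f p :=
    fun f hf h0 => (isOpen_lt continuous_const hf).mem_nhds h0
  obtain ⟨h1, h2, h3⟩ := h
  refine (hc (fun q => gram2 (q 2 - q 1) (q 3 - q 1)) ?_ h1).and
    ((hc (fun q => gram3 (q 2 - q 1) (q 3 - q 1) (q 4 - q 1) (q 4 - q 1)) ?_ h2).and
    (hc (fun q => gram3 (q 2 - q 1) (q 3 - q 1) (q 0 - q 1) (q 0 - q 1)) ?_ h3))
  all_goals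
    simp only [gram3, gram2]
    fun_prop

/-- The definition of the angle jumps where the volume vanishes, but `gramPhase` is differentiable
there. This matters because the two outer vertices of a hinge may coincide, in which case the phase
is `-1`. -/
theorem differentiableAt_hingePhase {q : Fin 5 → R4} (h : HingeRegular q) :
    DifferentiableAt ℝ hingePhase q := by
  have h1 : hingePhase =ᶠ[nhds q] fun q =>
      gramPhase (q 2 - q 1) (q 3 - q 1) (q 4 - q 1) (q 0 - q 1) :=
    h.eventually.mono fun p hp => hingePhase_eq hp
  refine DifferentiableAt.congr_of_eventuallyEq ?_ h1
  obtain ⟨h1, h2, h3⟩ := h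
  have hG : DifferentiableAt ℝ (fun q : Fin 5 → R4 => gram2 (q 2 - q 1) (q 3 - q 1)) q := by
    simp only [gram2, R4.inner_eq]; fun_prop
  have hdd : DifferentiableAt ℝ (fun q : Fin 5 → R4 =>
      gram3 (q 2 - q 1) (q 3 - q 1) (q 4 - q 1) (q 4 - q 1)) q := by
    simp only [gram3, gram2, R4.inner_eq]; fun_prop
  have hee : DifferentiableAt ℝ (fun q : Fin 5 → R4 =>
      gram3 (q 2 - q 1) (q 3 - q 1) (q 0 - q 1) (q 0 - q 1)) q := by
    simp only [gram3, gram2, R4.inner_eq]; fun_prop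
  have hde : DifferentiableAt ℝ (fun q : Fin 5 → R4 =>
      gram3 (q 2 - q 1) (q 3 - q 1) (q 4 - q 1) (q 0 - q 1)) q := by
    simp only [gram3, gram2, R4.inner_eq]; fun_prop
  have hV : DifferentiableAt ℝ (fun q : Fin 5 → R4 =>
      vol4 (q 2 - q 1) (q 3 - q 1) (q 4 - q 1) (q 0 - q 1)) q := by
    simp only [vol4_eq]; fun_prop
  have hof : ∀ f : (Fin 5 → R4) → ℝ, DifferentiableAt ℝ f q →
      DifferentiableAt ℝ (fun q => (f q : ℂ)) q := fun f hf =>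
    Complex.ofRealCLM.differentiableAt.comp q hf
  simp only [gramPhase]
  have hD := hof (fun q => √(gram3 (q 2 - q 1) (q 3 - q 1) (q 4 - q 1) (q 4 - q 1)) *
    √(gram3 (q 2 - q 1) (q 3 - q 1) (q 0 - q 1) (q 0 - q 1)))
    ((hdd.sqrt h2.ne').mul (hee.sqrt h3.ne'))
  have hN := (hof (fun q => -gram3 (q 2 - q 1) (q 3 - q 1) (q 4 - q 1) (q 0 - q 1)) hde.neg).add
    ((hof (fun q => √(gram2 (q 2 - q 1) (q 3 - q 1)) *
      vol4 (q 2 - q 1) (q 3 - q 1) (q 4 - q 1) (q 0 - q 1))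
      ((hG.sqrt h1.ne').mul hV)).mul_const Complex.I)
  simp only [div_eq_mul_inv]
  refine hN.mul (hD.inv ?_)
  have : 0 < √(gram3 (q 2 - q 1) (q 3 - q 1) (q 4 - q 1) (q 4 - q 1)) *
    √(gram3 (q 2 - q 1) (q 3 - q 1) (q 0 - q 1) (q 0 - q 1)) := by positivity
  exact_mod_cast this.ne'

/-! ### The differential of the hinge angle -/

theorem conj_hingePhase_mul_self (q : Fin 5 → R4) :
    (starRingEnd ℂ) (hingePhase q) * hingePhase q = 1 := by
  rw [← Complex.normSq_eq_conj_mul_self, Complex.normSq_eq_norm_sq, hingePhase,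
    Complex.norm_exp_ofReal_mul_I]
  simp

/-- `dHingeAngle q` as a linear map. -/
noncomputable def dHingeLin (q : Fin 5 → R4) : (Fin 5 → R4) →ₗ[ℝ] ℝ :=
  Complex.imLm ∘ₗ LinearMap.mulLeft ℝ ((starRingEnd ℂ) (hingePhase q)) ∘ₗ
    (fderiv ℝ hingePhase q).toLinearMap

theorem dHingeAngle_add (q u w : Fin 5 → R4) :
    dHingeAngle q (u + w) = dHingeAngle q u + dHingeAngle q w := (dHingeLin q).map_add u w

theorem dHingeAngle_sub (q u w : Fin 5 → R4) :
    dHingeAngle q (u - w) = dHingeAngle q u - dHingeAngle q w := (dHingeLin q).map_sub u w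

theorem dHingeAngle_smul (q u : Fin 5 → R4) (c : ℝ) :
    dHingeAngle q (c • u) = c * dHingeAngle q u := (dHingeLin q).map_smul c u

theorem dHingeAngle_zero (q : Fin 5 → R4) : dHingeAngle q 0 = 0 := (dHingeLin q).map_zero

theorem hasDerivAt_hingePhase_line {q : Fin 5 → R4} (h : HingeRegular q) (u : Fin 5 → R4) :
    HasDerivAt (fun t : ℝ => hingePhase (q + t • u)) (fderiv ℝ hingePhase q u) 0 :=
  (differentiableAt_hingePhase h).hasFDerivAt.hasLineDerivAt u

theorem HingeRegular.eventually_line {q : Fin 5 → R4} (h : HingeRegular q) (u : Fin 5 → R4) :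
    ∀ᶠ t : ℝ in nhds 0, HingeRegular (q + t • u) := by
  have hc : Continuous fun t : ℝ => q + t • u := by fun_prop
  have := hc.tendsto 0
  simp only [zero_smul, add_zero] at this
  exact this.eventually h.eventually

theorem dHingeAngle_eq_of_hasDerivAt {q u : Fin 5 → R4} (h : HingeRegular q) {c : ℝ}
    (hd : HasDerivAt (fun t : ℝ => hingePhase (q + t • u)) (hingePhase q * (c * Complex.I)) 0) :
    dHingeAngle q u = c := by
  rw [dHingeAngle, (hasDerivAt_hingePhase_line h u).unique hd, ← mul_assoc,
    conj_hingePhase_mul_self]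
  simp

theorem gramPhase_congr {b c d e : R4} (N N' : R4 → R4)
    (hN : ∀ x y, inner ℝ (N x) (N y) = inner ℝ (N' x) (N' y))
    (hV : ∀ b c d e, vol4 (N b) (N c) (N d) (N e) = vol4 (N' b) (N' c) (N' d) (N' e)) :
    gramPhase (N b) (N c) (N d) (N e) = gramPhase (N' b) (N' c) (N' d) (N' e) := by
  simp only [gramPhase, gram3, gram2, hN, hV]

theorem vol4_toEuclideanLin (N : Matrix (Fin 4) (Fin 4) ℝ) (b c d e : R4) :
    vol4 (N.toEuclideanLin b) (N.toEuclideanLin c) (N.toEuclideanLin d) (N.toEuclideanLin e) =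
      N.det * vol4 b c d e := by
  have : Matrix.of ![fun i => N.toEuclideanLin b i, fun i => N.toEuclideanLin c i,
      fun i => N.toEuclideanLin d i, fun i => N.toEuclideanLin e i] =
      Matrix.of ![fun i => b i, fun i => c i, fun i => d i, fun i => e i] * N.transpose := by
    ext i j
    rw [Matrix.mul_apply]
    fin_cases i <;> simp [Matrix.toLpLin_apply, Matrix.mulVec, dotProduct, mul_comm]
  rw [vol4, this, Matrix.det_mul, Matrix.det_transpose, mul_comm]
  rfl

theorem inner_toEuclideanLin (S : Matrix (Fin 4) (Fin 4) ℝ) (x y : R4) :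
    inner ℝ x (S.toEuclideanLin y) = inner ℝ (S.transpose.toEuclideanLin x) y := by
  simp [R4.inner_eq, Matrix.toLpLin_apply, Matrix.mulVec, dotProduct, Fin.sum_univ_four]
  ring

theorem inner_skew {S : Matrix (Fin 4) (Fin 4) ℝ} (hS : S.transpose = -S) (x y : R4) :
    inner ℝ x (S.toEuclideanLin y) = -inner ℝ (S.toEuclideanLin x) y := by
  rw [inner_toEuclideanLin, hS, map_neg, LinearMap.neg_apply, inner_neg_left]

theorem inner_skew_self {S : Matrix (Fin 4) (Fin 4) ℝ} (hS : S.transpose = -S) (x : R4) :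
    inner ℝ x (S.toEuclideanLin x) = 0 := by
  have := inner_skew hS x x
  rw [real_inner_comm] at this
  rw [real_inner_comm]; linarith

/-- The hinge angle does not change under infinitesimal motions. -/
theorem dHingeAngle_motion {q : Fin 5 → R4} (h : HingeRegular q) {S : Matrix (Fin 4) (Fin 4) ℝ}
    (hS : S.transpose = -S) (v : R4) :
    dHingeAngle q (fun k => v + S.toEuclideanLin (q k)) = 0 := by
  set u : Fin 5 → R4 := fun k => v + S.toEuclideanLin (q k)
  -- The matrix `1 + t S` is orthogonal only to first order, but the inner products it induces and
  -- its determinant are even functions of `t`. Hence so is the phase along this line, and its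
  -- derivative at zero vanishes; no exponential of `S` is needed.
  let N : ℝ → Matrix (Fin 4) (Fin 4) ℝ := fun t => 1 + t • S
  have hN : ∀ t x, (N t).toEuclideanLin x = x + t • S.toEuclideanLin x := by
    intro t x
    simp only [N, map_add, map_smul, LinearMap.add_apply, LinearMap.smul_apply]
    rw [Matrix.toLpLin_one]; rfl
  have hdiff : ∀ t i, (q + t • u) i - (q + t • u) 1 = (N t).toEuclideanLin (q i - q 1) := by
    intro t i
    rw [hN, map_sub]
    simp only [Pi.add_apply, Pi.smul_apply, u]
    module
  have hin : ∀ t x y, inner ℝ ((N t).toEuclideanLin x) ((N t).toEuclideanLin y) =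
      inner ℝ ((N (-t)).toEuclideanLin x) ((N (-t)).toEuclideanLin y) := by
    intro t x y
    simp only [hN, inner_add_left, inner_add_right, real_inner_smul_left, real_inner_smul_right,
      inner_skew hS, map_smul]
    ring
  have hdet : ∀ t, (N t).det = (N (-t)).det := by
    intro t
    rw [← Matrix.det_transpose]
    congr 1
    simp [N, hS]
  have heven : (fun t : ℝ => hingePhase (q + t • u)) =ᶠ[nhds 0]
      fun t => hingePhase (q + (-t) • u) := by
    have h1 := h.eventually_line u
    have h2 : ∀ᶠ t : ℝ in nhds 0, HingeRegular (q + (-t) • u) := by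
      have : Filter.Tendsto (fun t : ℝ => -t) (nhds 0) (nhds 0) := by
        simpa using (continuous_neg (G := ℝ)).tendsto 0
      exact this.eventually h1
    filter_upwards [h1, h2] with t ht ht'
    rw [hingePhase_eq ht, hingePhase_eq ht']
    simp only [hdiff]
    exact gramPhase_congr _ _ (hin t) fun b c d e => by
      rw [vol4_toEuclideanLin, vol4_toEuclideanLin, hdet]
  have h1 := hasDerivAt_hingePhase_line h u
  have h2 : HasDerivAt (fun t : ℝ => hingePhase (q + (-t) • u)) (-fderiv ℝ hingePhase q u) 0 := by
    have h3 : HasDerivAt (fun t : ℝ => hingePhase (q + t • u)) (fderiv ℝ hingePhase q u) (-0) := by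
      simpa using h1
    have h4 := h3.scomp (0 : ℝ) (hasDerivAt_neg (0 : ℝ))
    rw [neg_one_smul] at h4
    exact h4
  have h3 := (h1.congr_of_eventuallyEq heven.symm).unique h2
  have h4 : fderiv ℝ hingePhase q u = 0 := self_eq_neg.1 h3
  rw [dHingeAngle, h4]; simp

/-- The generator of rotations with unit speed around the plane spanned by `b` and `c`. -/
noncomputable def planeRotation (b c : R4) : Matrix (Fin 4) (Fin 4) ℝ :=
  (√(gram2 b c))⁻¹ • dualBivector b c

theorem planeRotation_apply (b c x : R4) : (planeRotation b c).toEuclideanLin x =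
    (√(gram2 b c))⁻¹ • (dualBivector b c).toEuclideanLin x := by
  rw [planeRotation, map_smul]; rfl

theorem planeRotation_transpose (b c : R4) :
    (planeRotation b c).transpose = -planeRotation b c := by
  rw [planeRotation, Matrix.transpose_smul, dualBivector_transpose, smul_neg]

theorem planeRotation_left (b c : R4) : (planeRotation b c).toEuclideanLin b = 0 := by
  rw [planeRotation_apply, dualBivector_left, smul_zero]

theorem planeRotation_right (b c : R4) : (planeRotation b c).toEuclideanLin c = 0 := by
  rw [planeRotation_apply, dualBivector_right, smul_zero]

theorem gram3_add_left (b c d d' e : R4) :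
    gram3 b c (d + d') e = gram3 b c d e + gram3 b c d' e := by
  simp only [gram3, inner_add_left]; ring

theorem gram3_smul_left (b c d e : R4) (s : ℝ) : gram3 b c (s • d) e = s * gram3 b c d e := by
  simp only [gram3, real_inner_smul_left]; ring

theorem gram3_add_right (b c d e e' : R4) :
    gram3 b c d (e + e') = gram3 b c d e + gram3 b c d e' := by
  simp only [gram3, inner_add_right]; ring

theorem gram3_smul_right (b c d e : R4) (s : ℝ) : gram3 b c d (s • e) = s * gram3 b c d e := by
  simp only [gram3, real_inner_smul_right]; ring

theorem vol4_add_smul (b c d d' e : R4) (s : ℝ) :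
    vol4 b c (d + s • d') e = vol4 b c d e + s * vol4 b c d' e := by
  simp only [vol4_eq, PiLp.add_apply, PiLp.smul_apply, smul_eq_mul]; ring

/-- The angle grows with unit speed when the last vertex rotates around the two-face. -/
theorem dHingeAngle_rotation {q : Fin 5 → R4} (h : HingeRegular q) :
    dHingeAngle q (Pi.single 4
      ((planeRotation (q 2 - q 1) (q 3 - q 1)).toEuclideanLin (q 4 - q 1))) = 1 := by
  refine dHingeAngle_eq_of_hasDerivAt h ?_
  set v := (planeRotation (q 2 - q 1) (q 3 - q 1)).toEuclideanLin (q 4 - q 1) with hv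
  have hphase := hingePhase_eq h
  have hev := h.eventually_line (Pi.single 4 v)
  obtain ⟨hG, hd, he⟩ := h
  have hs : ∀ t : ℝ, (q + t • (Pi.single 4 v : Fin 5 → R4)) 0 = q 0 ∧
      (q + t • (Pi.single 4 v : Fin 5 → R4)) 1 = q 1 ∧
      (q + t • (Pi.single 4 v : Fin 5 → R4)) 2 = q 2 ∧
      (q + t • (Pi.single 4 v : Fin 5 → R4)) 3 = q 3 ∧
      (q + t • (Pi.single 4 v : Fin 5 → R4)) 4 = q 4 + t • v := by
    intro t
    simp
  have hd' : ∀ t : ℝ, q 4 + t • v - q 1 = (q 4 - q 1) + t • v := fun t => by module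
  rw [hphase]
  set b := q 2 - q 1
  set c := q 3 - q 1
  set d := q 4 - q 1
  set e := q 0 - q 1
  set s := √(gram2 b c) with hsdef
  have hspos : 0 < s := Real.sqrt_pos.2 hG
  have hs2 : gram2 b c = s * s := (Real.mul_self_sqrt hG.le).symm
  rw [planeRotation_apply, ← hsdef] at hv
  have g1 : gram3 b c v e = s * vol4 b c d e := by
    rw [hv, gram3_smul_left, gram3_dualBivector, hs2]; field_simp
  have g2 : gram3 b c v d = 0 := by
    rw [hv, gram3_smul_left, gram3_dualBivector, vol4_eq]; ring
  have g3 : gram3 b c v v = gram3 b c d d := by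
    rw [hv, gram3_smul_left, gram3_dualBivector, ← hv]
    rw [hv, ← inner_dualBivector, real_inner_smul_left, inner_dualBivector_dualBivector, hs2]
    field_simp
  have g4 : s * vol4 b c v e = -gram3 b c d e := by
    rw [← inner_dualBivector, hv, map_smul, real_inner_smul_right, dualBivector_dualBivector,
      inner_neg_right, real_inner_comm, inner_scaledPerp]
    field_simp
  -- Since `v` is the quarter turn of the orthogonal component of `d`, moving along the straight
  -- line `d + t v` multiplies the phase by the unit complex number in the direction of `1 + t i`.
  have key : ∀ t : ℝ, gramPhase b c (d + t • v) e =
      gramPhase b c d e * ((1 + t * Complex.I) * ((√(1 + t ^ 2))⁻¹ : ℝ)) := by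
    intro t
    have k1 : gram3 b c (d + t • v) (d + t • v) = gram3 b c d d * (1 + t ^ 2) := by
      rw [gram3_add_left, gram3_add_right, gram3_add_right, gram3_smul_left, gram3_smul_left,
        gram3_smul_right, gram3_smul_right, gram3_comm b c d v, g2, g3]
      ring
    have k2 : gram3 b c (d + t • v) e = gram3 b c d e + t * (s * vol4 b c d e) := by
      rw [gram3_add_left, gram3_smul_left, g1]
    have k3 : s * vol4 b c (d + t • v) e = s * vol4 b c d e - t * gram3 b c d e := by
      rw [vol4_add_smul, mul_add, mul_left_comm, g4]; ring
    have hI : (Complex.I) * Complex.I = -1 := Complex.I_mul_I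
    rw [gramPhase, gramPhase, k1, k2, ← hsdef, k3, Real.sqrt_mul hd.le]
    have n1 : (√(gram3 b c d d) : ℂ) ≠ 0 := by exact_mod_cast (Real.sqrt_pos.2 hd).ne'
    have n2 : (√(gram3 b c e e) : ℂ) ≠ 0 := by exact_mod_cast (Real.sqrt_pos.2 he).ne'
    have n3 : (√(1 + t ^ 2) : ℂ) ≠ 0 := by
      exact_mod_cast (Real.sqrt_pos.2 (by positivity : 0 < 1 + t ^ 2)).ne'
    push_cast
    field_simp
    linear_combination (-(t : ℂ) * (s : ℂ) * (vol4 b c d e : ℂ)) * hI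
  have hderiv : HasDerivAt (fun t : ℝ => gramPhase b c d e *
      ((1 + t * Complex.I) * ((√(1 + t ^ 2))⁻¹ : ℝ))) (gramPhase b c d e *
        (((1 : ℝ) : ℂ) * Complex.I)) 0 := by
    refine HasDerivAt.const_mul _ ?_
    have d1 : HasDerivAt (fun t : ℝ => (1 : ℂ) + t * Complex.I) (Complex.I) 0 := by
      have := ((hasDerivAt_id (0 : ℝ)).ofReal_comp.mul_const Complex.I).const_add (1 : ℂ)
      simpa using this
    have d2 : HasDerivAt (fun t : ℝ => (√(1 + t ^ 2))⁻¹) 0 0 := by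
      have h0 : HasDerivAt (fun t : ℝ => 1 + t ^ 2) 0 0 := by
        simpa using (hasDerivAt_pow 2 (0 : ℝ)).const_add 1
      have h1 := (h0.sqrt (by simp)).inv (by simp)
      have h2 : -(0 / (2 * √(1 + (0 : ℝ) ^ 2))) / √(1 + (0 : ℝ) ^ 2) ^ 2 = 0 := by simp
      rw [h2] at h1
      exact h1
    have h1 := d1.mul d2.ofReal_comp
    have h2 : Complex.I * (((√(1 + (0 : ℝ) ^ 2))⁻¹ : ℝ) : ℂ) +
        (1 + ((0 : ℝ) : ℂ) * Complex.I) * ((0 : ℝ) : ℂ) = ((1 : ℝ) : ℂ) * Complex.I := by simp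
    rw [h2] at h1
    exact h1
  refine hderiv.congr_of_eventuallyEq ?_
  filter_upwards [hev] with t ht
  rw [hingePhase_eq ht]
  obtain ⟨e0, e1, e2, e3, e4⟩ := hs t
  rw [e0, e1, e2, e3, e4, hd', ← key]

/-! ### Symmetries and additivity of the hinge angle -/

theorem span_pair_rotate {E : Type*} [AddCommGroup E] [Module ℝ E] (a b c : E) :
    Submodule.span ℝ {c - b, a - b} = Submodule.span ℝ {b - a, c - a} := by
  apply le_antisymm <;> rw [Submodule.span_le, Set.insert_subset_iff, Set.singleton_subset_iff] <;>
    constructor <;> rw [SetLike.mem_coe, Submodule.mem_span_pair]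
  · exact ⟨-1, 1, by module⟩
  · exact ⟨-1, 0, by module⟩
  · exact ⟨0, -1, by module⟩
  · exact ⟨1, -1, by module⟩

/-- A change of base point within the triangle alters the vector to `p` by a vector of the plane,
which the projection kills. -/
theorem planePerp_rotate (a b c p : R4) : planePerp b c a p = planePerp a b c p := by
  simp only [planePerp, span_pair_rotate]
  have h : p - b = (p - a) - (b - a) := by module
  rw [h, map_sub, sub_eq_self, Submodule.starProjection_apply_eq_zero_iff,
    Submodule.orthogonal_orthogonal]
  exact span_pair_rotate a b c ▸ Submodule.subset_span (Set.mem_insert _ _)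

theorem planePerp_swap (a b c p : R4) : planePerp a c b p = planePerp a b c p := by
  simp only [planePerp, Set.pair_comm (c - a) (b - a)]

theorem hingePhase_rotate (z a b c d : R4) :
    hingePhase ![z, b, c, a, d] = hingePhase ![z, a, b, c, d] := by
  have hV : orientedVolume b c a d z = orientedVolume a b c d z := by
    simp only [orientedVolume_eq, vol4_eq, PiLp.sub_apply]; ring
  have hD : innerDihedral b c a d z = innerDihedral a b c d z := by
    simp only [innerDihedral, planePerp_rotate]
  simp only [hingePhase, hingeAngle]
  simp [hV, hD]

/-- Passing through the two-face in the opposite direction exchanges the outer vertices and reverses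
the triangle. The two sign changes of the volume cancel. -/
theorem hingePhase_reverse (z a b c d : R4) :
    hingePhase ![d, a, c, b, z] = hingePhase ![z, a, b, c, d] := by
  have hV : orientedVolume a c b z d = orientedVolume a b c d z := by
    simp only [orientedVolume_eq, vol4_eq, PiLp.sub_apply]; ring
  have hD : innerDihedral a c b z d = innerDihedral a b c d z := by
    simp only [innerDihedral, planePerp_swap a b c]
    exact InnerProductGeometry.angle_comm _ _
  simp only [hingePhase, hingeAngle]
  simp [hV, hD]

theorem dHingeAngle_comp_perm (σ : Equiv.Perm (Fin 5))
    (hσ : ∀ q, hingePhase (q ∘ σ) = hingePhase q) (q u : Fin 5 → R4) :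
    dHingeAngle (q ∘ σ) (u ∘ σ) = dHingeAngle q u := by
  let L : (Fin 5 → R4) ≃L[ℝ] (Fin 5 → R4) :=
    (LinearEquiv.funCongrLeft ℝ R4 σ).toContinuousLinearEquiv
  have h1 : hingePhase ∘ L = hingePhase := funext hσ
  have h2 := L.comp_right_fderiv (f := hingePhase) (x := q)
  rw [h1] at h2
  rw [dHingeAngle, dHingeAngle, hσ, h2]
  rfl

theorem dHingeAngle_rotate (z a b c d z' a' b' c' d' : R4) :
    dHingeAngle ![z, b, c, a, d] ![z', b', c', a', d'] =
      dHingeAngle ![z, a, b, c, d] ![z', a', b', c', d'] := by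
  obtain ⟨σ, hσ⟩ : ∃ σ : Equiv.Perm (Fin 5), ∀ i, σ i = ![0, 2, 3, 1, 4] i :=
    ⟨⟨![0, 2, 3, 1, 4], ![0, 3, 1, 2, 4], by decide, by decide⟩, fun _ => rfl⟩
  have hs : ∀ z a b c d : R4, ![z, a, b, c, d] ∘ σ = ![z, b, c, a, d] := by
    intro z a b c d
    ext i : 1
    rw [Function.comp_apply, hσ]
    fin_cases i <;> simp
  have := dHingeAngle_comp_perm σ (fun q => by
    obtain ⟨z, a, b, c, d, rfl⟩ : ∃ z a b c d, q = ![z, a, b, c, d] :=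
      ⟨q 0, q 1, q 2, q 3, q 4, by ext i : 1; fin_cases i <;> rfl⟩
    rw [hs, hingePhase_rotate]) ![z, a, b, c, d] ![z', a', b', c', d']
  rwa [hs, hs] at this

theorem dHingeAngle_reverse (z a b c d z' a' b' c' d' : R4) :
    dHingeAngle ![d, a, c, b, z] ![d', a', c', b', z'] =
      dHingeAngle ![z, a, b, c, d] ![z', a', b', c', d'] := by
  obtain ⟨σ, hσ⟩ : ∃ σ : Equiv.Perm (Fin 5), ∀ i, σ i = ![4, 1, 3, 2, 0] i :=
    ⟨⟨![4, 1, 3, 2, 0], ![4, 1, 3, 2, 0], by decide, by decide⟩, fun _ => rfl⟩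
  have hs : ∀ z a b c d : R4, ![z, a, b, c, d] ∘ σ = ![d, a, c, b, z] := by
    intro z a b c d
    ext i : 1
    rw [Function.comp_apply, hσ]
    fin_cases i <;> simp
  have := dHingeAngle_comp_perm σ (fun q => by
    obtain ⟨z, a, b, c, d, rfl⟩ : ∃ z a b c d, q = ![z, a, b, c, d] :=
      ⟨q 0, q 1, q 2, q 3, q 4, by ext i : 1; fin_cases i <;> rfl⟩
    rw [hs, hingePhase_reverse]) ![z, a, b, c, d] ![z', a', b', c', d']
  rwa [hs, hs] at this

/-- In the plane orthogonal to `b, c` the directed angles from `z` to `y` and from `y` to `x` add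
up, so the phases multiply. The minus sign arises because exterior angles are used: each is the
supplement of an inner one, and one `π` is left over. -/
theorem gramPhase_mul_gramPhase {b c x y z : R4} (hG : 0 < gram2 b c)
    (hy : 0 < gram3 b c y y) :
    gramPhase b c y x * gramPhase b c z y = -gramPhase b c z x := by
  have h1 := gram3_mul_gram3 hy.ne' x z
  have h2 := gram3_mul_vol4 hy.ne' hG.ne' z x
  have h3 : vol4 b c z y = -vol4 b c y z := by rw [vol4_eq, vol4_eq]; ring
  have hs : √(gram2 b c) * √(gram2 b c) = gram2 b c := Real.mul_self_sqrt hG.le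
  have hys : √(gram3 b c y y) * √(gram3 b c y y) = gram3 b c y y := Real.mul_self_sqrt hy.le
  rw [gram3_comm b c x z] at h1
  have h1' := congrArg (Complex.ofReal) h1
  have h2' := congrArg (Complex.ofReal) h2
  have hs' := congrArg (Complex.ofReal) hs
  have hys' := congrArg (Complex.ofReal) hys
  have hI := Complex.I_mul_I
  push_cast at h1' h2' hs' hys'
  have key : ((-gram3 b c y x : ℝ) + (√(gram2 b c) * vol4 b c y x : ℝ) * Complex.I) *
      ((-gram3 b c z y : ℝ) + (√(gram2 b c) * vol4 b c z y : ℝ) * Complex.I) =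
      -(gram3 b c y y * ((-gram3 b c z x : ℝ) + (√(gram2 b c) * vol4 b c z x : ℝ) * Complex.I)) := by
    rw [h3, gram3_comm b c z y]
    push_cast
    linear_combination -h1' + Complex.I * (√(gram2 b c) : ℂ) * h2' +
      (vol4 b c y x : ℂ) * (vol4 b c y z : ℂ) * hs' -
      (√(gram2 b c) : ℂ) * (√(gram2 b c) : ℂ) * (vol4 b c y x : ℂ) * (vol4 b c y z : ℂ) * hI
  have ny : (gram3 b c y y : ℂ) ≠ 0 := by exact_mod_cast hy.ne'
  rw [gramPhase, gramPhase, gramPhase, div_mul_div_comm, key]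
  have hden : ((√(gram3 b c y y) * √(gram3 b c x x) : ℝ) : ℂ) *
      ((√(gram3 b c z z) * √(gram3 b c y y) : ℝ) : ℂ) =
      gram3 b c y y * ((√(gram3 b c z z) * √(gram3 b c x x) : ℝ) : ℂ) := by
    rw [← hys']
    push_cast
    ring
  rw [hden, neg_div, mul_div_mul_left _ _ ny]

/-- The velocity of a curve on the unit circle is tangent to it, that is, a real multiple of `i`
times the position. -/
theorem deriv_eq_of_norm_eq_one {f : ℝ → ℂ} {f' : ℂ} (hf : HasDerivAt f f' 0)
    (h : ∀ p, ‖f p‖ = 1) :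
    f' = f 0 * ((((starRingEnd ℂ) (f 0) * f').im : ℝ) * Complex.I) := by
  have h1 := hf.norm_sq
  have h2 : (fun t : ℝ => ‖f t‖ ^ 2) = fun _ => 1 := by
    funext t
    rw [h, one_pow]
  rw [h2] at h1
  have h3 := h1.unique (hasDerivAt_const (0 : ℝ) (1 : ℝ))
  simp only [mul_eq_zero, OfNat.ofNat_ne_zero, false_or, Complex.inner] at h3
  have h4 : (starRingEnd ℂ) (f 0) * f' =
      (((starRingEnd ℂ) (f 0) * f').im : ℝ) * Complex.I := by
    apply Complex.ext
    · rw [mul_comm] at h3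
      simpa using h3
    · simp
  have h5 : f 0 * (starRingEnd ℂ) (f 0) = 1 := by
    rw [Complex.mul_conj, Complex.normSq_eq_norm_sq, h]; simp
  rw [← h4, ← mul_assoc, h5, one_mul]

theorem fderiv_hingePhase {q : Fin 5 → R4} (h : HingeRegular q) (u : Fin 5 → R4) :
    fderiv ℝ hingePhase q u = hingePhase q * (dHingeAngle q u * Complex.I) := by
  have h1 := deriv_eq_of_norm_eq_one (hasDerivAt_hingePhase_line h u)
    (fun p => by rw [hingePhase, Complex.norm_exp_ofReal_mul_I])
  simp only [zero_smul, add_zero] at h1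
  rw [dHingeAngle]
  exact h1

theorem hasDerivAt_neg_mul {f g k : ℝ → ℂ} {a b : ℝ} (hf : HasDerivAt f (f 0 * (a * Complex.I)) 0)
    (hg : HasDerivAt g (g 0 * (b * Complex.I)) 0) (hk : ∀ᶠ t in nhds 0, k t = -(f t * g t)) :
    HasDerivAt k (k 0 * ((a + b : ℝ) * Complex.I)) 0 := by
  refine ((hf.mul hg).neg.congr_of_eventuallyEq hk).congr_deriv ?_
  rw [hk.self_of_nhds]
  push_cast
  ring

theorem HingeRegular.trans {z a b c d w : R4} (h : HingeRegular ![z, a, b, c, d])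
    (h' : HingeRegular ![d, a, b, c, w]) : HingeRegular ![z, a, b, c, w] := by
  simp only [HingeRegular, Matrix.cons_val_zero, Matrix.cons_val_one, Matrix.cons_val] at h h' ⊢
  exact ⟨h.1, h'.2.1, h.2.2⟩

/-- Logarithmic differentiation of the product formula for phases; the constant `π` disappears. This
additivity is what allows an outer vertex of a hinge to be exchanged for another one. -/
theorem dHingeAngle_trans {z a b c d w : R4} (h : HingeRegular ![z, a, b, c, d])
    (h' : HingeRegular ![d, a, b, c, w]) (z' a' b' c' d' w' : R4) :
    dHingeAngle ![z, a, b, c, w] ![z', a', b', c', w'] =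
      dHingeAngle ![z, a, b, c, d] ![z', a', b', c', d'] +
      dHingeAngle ![d, a, b, c, w] ![d', a', b', c', w'] := by
  refine dHingeAngle_eq_of_hasDerivAt (h.trans h') ?_
  have hs : ∀ (t : ℝ) (z a b c d z' a' b' c' d' : R4), ![z, a, b, c, d] + t • ![z', a', b', c', d'] =
      ![z + t • z', a + t • a', b + t • b', c + t • c', d + t • d'] := by
    intro t z a b c d z' a' b' c' d'
    simp
  have hmul : ∀ z a b c d w : R4, HingeRegular ![z, a, b, c, d] → HingeRegular ![d, a, b, c, w] →
      hingePhase ![z, a, b, c, w] =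
        -(hingePhase ![z, a, b, c, d] * hingePhase ![d, a, b, c, w]) := by
    intro z a b c d w h h'
    rw [hingePhase_eq h, hingePhase_eq h', hingePhase_eq (h.trans h')]
    obtain ⟨h1, h2, -⟩ := h
    simp only [Matrix.cons_val_zero, Matrix.cons_val_one, Matrix.cons_val] at h1 h2 ⊢
    have := gramPhase_mul_gramPhase (x := z - a) (z := w - a) h1 h2
    rw [← neg_eq_iff_eq_neg] at this
    exact this.symm
  have k1 := hasDerivAt_hingePhase_line h ![z', a', b', c', d']
  have k2 := hasDerivAt_hingePhase_line h' ![d', a', b', c', w']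
  rw [fderiv_hingePhase h] at k1
  rw [fderiv_hingePhase h'] at k2
  have h0 : ∀ q u : Fin 5 → R4, hingePhase q = hingePhase (q + (0 : ℝ) • u) := by
    intro q u
    rw [zero_smul, add_zero]
  rw [h0 _ ![z', a', b', c', d']] at k1
  rw [h0 _ ![d', a', b', c', w']] at k2
  rw [h0 _ ![z', a', b', c', w']]
  refine hasDerivAt_neg_mul k1 k2 ?_
  filter_upwards [h.eventually_line ![z', a', b', c', d'],
    h'.eventually_line ![d', a', b', c', w']] with t ht ht'
  rw [hs] at ht ht'
  rw [hs, hs, hs]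
  exact hmul _ _ _ _ _ _ ht ht'

/-! ### The differential of a length -/

/-- Differentiating the square of the distance, a quadratic function along a line, avoids the square
root. -/
theorem dLength_eq {x y : R4} (h : x ≠ y) (u w : R4) :
    dLength x y u w = inner ℝ (x - y) (u - w) / dist x y := by
  have hxy : x - y ≠ 0 := sub_ne_zero.2 h
  have hd : DifferentiableAt ℝ (fun q : R4 × R4 => ‖q.1 - q.2‖) (x, y) :=
    DifferentiableAt.norm ℝ (by fun_prop) hxy
  have h1 := (hd.hasFDerivAt.hasLineDerivAt (u, w))
  have h2 : HasDerivAt (fun t : ℝ => ‖(x + t • u) - (y + t • w)‖ ^ 2)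
      (2 * inner ℝ (x - y) (u - w)) 0 := by
    have h3 : HasDerivAt (fun t : ℝ => (x + t • u) - (y + t • w)) (u - w) 0 := by
      have a1 := ((hasDerivAt_id (0 : ℝ)).smul_const u).const_add x
      have a2 := ((hasDerivAt_id (0 : ℝ)).smul_const w).const_add y
      have a3 := a1.sub a2
      rw [one_smul, one_smul] at a3
      exact a3
    have := h3.norm_sq
    simpa using this
  have h3 := h1.pow 2
  have h4 := h3.unique h2
  simp only [dLength, dist_eq_norm]
  rw [eq_div_iff (norm_ne_zero_iff.2 hxy)]
  simp at h4
  linarith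

/-! ### Infinitesimal rigidity of tetrahedra in four-space -/

theorem exists_inner_eq {b c d e : R4} (h : vol4 b c d e ≠ 0) (x y z w : ℝ) :
    ∃ v : R4, inner ℝ b v = x ∧ inner ℝ c v = y ∧ inner ℝ d v = z ∧ inner ℝ e v = w := by
  set A := Matrix.of ![fun i => b i, fun i => c i, fun i => d i, fun i => e i] with hA
  have hu : IsUnit A.det := isUnit_iff_ne_zero.2 h
  have key : A.mulVec (A⁻¹.mulVec ![x, y, z, w]) = ![x, y, z, w] := by
    rw [Matrix.mulVec_mulVec, Matrix.mul_nonsing_inv _ hu, Matrix.one_mulVec]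
  refine ⟨WithLp.toLp 2 (A⁻¹.mulVec ![x, y, z, w]), ?_, ?_, ?_, ?_⟩
  · simpa [hA, R4.inner_eq, Matrix.mulVec, dotProduct, Fin.sum_univ_four] using congrFun key 0
  · simpa [hA, R4.inner_eq, Matrix.mulVec, dotProduct, Fin.sum_univ_four] using congrFun key 1
  · simpa [hA, R4.inner_eq, Matrix.mulVec, dotProduct, Fin.sum_univ_four] using congrFun key 2
  · simpa [hA, R4.inner_eq, Matrix.mulVec, dotProduct, Fin.sum_univ_four] using congrFun key 3

/-- The vectors, as rows of `A`, form a basis, so `A * S * Aᵀ = β` can be solved, and the solution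
inherits antisymmetry from `β`. -/
theorem exists_skew_bilinear {b c d e : R4} (h : vol4 b c d e ≠ 0)
    {β : Matrix (Fin 4) (Fin 4) ℝ} (hβ : β.transpose = -β) :
    ∃ S : Matrix (Fin 4) (Fin 4) ℝ, S.transpose = -S ∧
      ∀ i j, inner ℝ (![b, c, d, e] i) (S.toEuclideanLin (![b, c, d, e] j)) = β i j := by
  set A := Matrix.of ![fun i => b i, fun i => c i, fun i => d i, fun i => e i] with hA
  have hu : IsUnit A.det := isUnit_iff_ne_zero.2 h
  refine ⟨A⁻¹ * β * A⁻¹.transpose, ?_, fun i j => ?_⟩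
  · simp only [Matrix.transpose_mul, Matrix.transpose_transpose, hβ]
    simp [Matrix.mul_assoc]
  · set S := A⁻¹ * β * A⁻¹.transpose with hS
    have h1 : A * S * A.transpose = β := by
      rw [hS, Matrix.mul_assoc A⁻¹, Matrix.mul_nonsing_inv_cancel_left _ _ hu, Matrix.mul_assoc,
        ← Matrix.transpose_mul, Matrix.mul_nonsing_inv _ hu, Matrix.transpose_one, Matrix.mul_one]
    have h2 : inner ℝ (![b, c, d, e] i) (S.toEuclideanLin (![b, c, d, e] j)) =
        (A * S * A.transpose) i j := by
      have hr : ∀ k l, A k l = (![b, c, d, e] k) l := by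
        intro k l
        fin_cases k <;> rfl
      rw [R4.inner_eq]
      simp only [Matrix.mul_apply, Matrix.transpose_apply, hr, Matrix.toLpLin_apply, Matrix.mulVec,
        dotProduct, Fin.sum_univ_four]
      ring
    rw [h2, h1]

/-- The prescribed images fix the bilinear form on all pairs from the basis `b, c, d, e` except `(e,
e)`, where antisymmetry requires zero; the hypotheses are the consistency of these values. The last
column is forced by antisymmetry, and `e` serves only to complete a basis. -/
theorem exists_skew {b c d e : R4} (h : vol4 b c d e ≠ 0) {x y z : R4} (h₁ : inner ℝ b x = 0)
    (h₂ : inner ℝ c y = 0) (h₃ : inner ℝ d z = 0) (h₁₂ : inner ℝ b y + inner ℝ c x = 0)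
    (h₁₃ : inner ℝ b z + inner ℝ d x = 0) (h₂₃ : inner ℝ c z + inner ℝ d y = 0) :
    ∃ S : Matrix (Fin 4) (Fin 4) ℝ, S.transpose = -S ∧ S.toEuclideanLin b = x ∧
      S.toEuclideanLin c = y ∧ S.toEuclideanLin d = z := by
  obtain ⟨S, hS, hb⟩ := exists_skew_bilinear h (β := !![0, inner ℝ b y, inner ℝ b z, -inner ℝ e x;
    inner ℝ c x, 0, inner ℝ c z, -inner ℝ e y; inner ℝ d x, inner ℝ d y, 0, -inner ℝ e z;
    inner ℝ e x, inner ℝ e y, inner ℝ e z, 0]) (by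
      ext i j
      fin_cases i <;> fin_cases j <;> simp <;> linarith)
  refine ⟨S, hS, ?_, ?_, ?_⟩ <;> rw [← sub_eq_zero] <;> refine eq_zero_of_inner_eq_zero h ?_ ?_ ?_ ?_
  all_goals rw [inner_sub_right, sub_eq_zero]
  · rw [h₁]; exact hb 0 0
  · exact hb 1 0
  · exact hb 2 0
  · exact hb 3 0
  · exact hb 0 1
  · rw [h₂]; exact hb 1 1
  · exact hb 2 1
  · exact hb 3 1
  · exact hb 0 2
  · exact hb 1 2
  · rw [h₃]; exact hb 2 2
  · exact hb 3 2

/-- The image of the fourth basis vector is orthogonal to the three vectors in the kernel, and to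
the fourth vector itself by antisymmetry. -/
theorem skew_eq_zero {b c d e : R4} (h : vol4 b c d e ≠ 0) {S : Matrix (Fin 4) (Fin 4) ℝ}
    (hS : S.transpose = -S) (hb : S.toEuclideanLin b = 0) (hc : S.toEuclideanLin c = 0)
    (hd : S.toEuclideanLin d = 0) : S = 0 := by
  have hk : ∀ x y, S.toEuclideanLin x = 0 → inner ℝ x (S.toEuclideanLin y) = 0 := by
    intro x y hx
    rw [inner_skew hS, hx, inner_zero_left, neg_zero]
  have he : S.toEuclideanLin e = 0 :=
    eq_zero_of_inner_eq_zero h (hk _ _ hb) (hk _ _ hc) (hk _ _ hd) (inner_skew_self hS e)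
  have : S.toEuclideanLin = 0 := by
    ext1 x
    exact eq_zero_of_inner_eq_zero h (hk _ _ hb) (hk _ _ hc) (hk _ _ hd) (hk _ _ he)
  simpa using this

/-- The orthogonal complement of three independent vectors is a line, and the quarter turn of `d`
spans it. -/
theorem eq_smul_dualBivector {b c d w : R4} (h : 0 < gram3 b c d d) (hb : inner ℝ b w = 0)
    (hc : inner ℝ c w = 0) (hd : inner ℝ d w = 0) :
    ∃ s : ℝ, w = s • (dualBivector b c).toEuclideanLin d := by
  refine ⟨inner ℝ ((dualBivector b c).toEuclideanLin d) w / gram3 b c d d, ?_⟩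
  rw [← sub_eq_zero]
  have hV : vol4 b c d ((dualBivector b c).toEuclideanLin d) ≠ 0 := by
    rw [vol4_dualBivector]; exact h.ne'
  refine eq_zero_of_inner_eq_zero hV ?_ ?_ ?_ ?_ <;> rw [inner_sub_right, real_inner_smul_right]
  · rw [hb, inner_dualBivector_left]; ring
  · rw [hc, inner_dualBivector_right]; ring
  · rw [hd, inner_dualBivector_self]; ring
  · rw [inner_dualBivector_dualBivector]; field_simp; ring

/-- The four points do not lie in a plane. -/
def TetRegular (a b c d : R4) : Prop := ∃ e, vol4 (b - a) (c - a) (d - a) e ≠ 0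

theorem linearIndependent_of_vol4_ne_zero {b c d e : R4} (h : vol4 b c d e ≠ 0) :
    LinearIndependent ℝ ![b, c, d] := by
  rw [Fintype.linearIndependent_iff]
  intro g hg
  rw [Fin.sum_univ_three] at hg
  simp only [Matrix.cons_val_zero, Matrix.cons_val_one, Matrix.cons_val] at hg
  have hd : ∀ x y z : ℝ, ∃ v, inner ℝ b v = x ∧ inner ℝ c v = y ∧ inner ℝ d v = z := fun x y z => by
    obtain ⟨v, h1, h2, h3, -⟩ := exists_inner_eq h x y z 0
    exact ⟨v, h1, h2, h3⟩
  obtain ⟨v, h1, h2, h3⟩ := hd (g 0) (g 1) (g 2)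
  have := congrArg (fun w => inner ℝ w v) hg
  simp only [inner_add_left, real_inner_smul_left, h1, h2, h3, inner_zero_left] at this
  have e0 : g 0 = 0 := by nlinarith [sq_nonneg (g 0), sq_nonneg (g 1), sq_nonneg (g 2)]
  have e1 : g 1 = 0 := by nlinarith [sq_nonneg (g 0), sq_nonneg (g 1), sq_nonneg (g 2)]
  have e2 : g 2 = 0 := by nlinarith [sq_nonneg (g 0), sq_nonneg (g 1), sq_nonneg (g 2)]
  intro i
  fin_cases i
  exacts [e0, e1, e2]

theorem TetRegular.gram_pos {a b c d : R4} (h : TetRegular a b c d) :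
    0 < gram2 (b - a) (c - a) ∧ 0 < gram3 (b - a) (c - a) (d - a) (d - a) := by
  obtain ⟨e, he⟩ := h
  exact gram3_pos (linearIndependent_of_vol4_ne_zero he)

theorem hingeRegular_of_tetRegular {z a b c d : R4} (h : TetRegular a b c z)
    (h' : TetRegular a b c d) : HingeRegular ![z, a, b, c, d] := by
  simp only [HingeRegular, Matrix.cons_val_zero, Matrix.cons_val_one, Matrix.cons_val]
  exact ⟨h.gram_pos.1, h'.gram_pos.2, h.gram_pos.2⟩

/-- A displacement of the vertices of a tetrahedron that preserves the edge lengths is an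
infinitesimal motion. -/
theorem TetRegular.exists_motion {a b c d : R4} (h : TetRegular a b c d) {a' b' c' d' : R4}
    (hab : inner ℝ (a - b) (a' - b') = 0) (hac : inner ℝ (a - c) (a' - c') = 0)
    (had : inner ℝ (a - d) (a' - d') = 0) (hbc : inner ℝ (b - c) (b' - c') = 0)
    (hbd : inner ℝ (b - d) (b' - d') = 0) (hcd : inner ℝ (c - d) (c' - d') = 0) :
    ∃ (v : R4) (S : Matrix (Fin 4) (Fin 4) ℝ), S.transpose = -S ∧
      a' = v + S.toEuclideanLin a ∧ b' = v + S.toEuclideanLin b ∧ c' = v + S.toEuclideanLin c ∧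
      d' = v + S.toEuclideanLin d := by
  obtain ⟨e, he⟩ := h
  simp only [inner_sub_left, inner_sub_right] at hab hac had hbc hbd hcd
  obtain ⟨S, hS, h1, h2, h3⟩ := exists_skew he (x := b' - a') (y := c' - a') (z := d' - a')
    (by simp only [inner_sub_left, inner_sub_right]; linarith)
    (by simp only [inner_sub_left, inner_sub_right]; linarith)
    (by simp only [inner_sub_left, inner_sub_right]; linarith)
    (by simp only [inner_sub_left, inner_sub_right]; linarith)
    (by simp only [inner_sub_left, inner_sub_right]; linarith)
    (by simp only [inner_sub_left, inner_sub_right]; linarith)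
  rw [map_sub] at h1 h2 h3
  refine ⟨a' - S.toEuclideanLin a, S, hS, ?_, ?_, ?_, ?_⟩
  · module
  · rw [sub_add_comm, eq_comm, ← sub_eq_zero, ← sub_eq_zero.2 h1]; module
  · rw [sub_add_comm, eq_comm, ← sub_eq_zero, ← sub_eq_zero.2 h2]; module
  · rw [sub_add_comm, eq_comm, ← sub_eq_zero, ← sub_eq_zero.2 h3]; module

/-- An infinitesimal motion is determined by the displacements of the vertices of a
tetrahedron. -/
theorem TetRegular.motion_eq_zero {a b c d : R4} (h : TetRegular a b c d) {v : R4}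
    {S : Matrix (Fin 4) (Fin 4) ℝ} (hS : S.transpose = -S)
    (ha : v + S.toEuclideanLin a = 0) (hb : v + S.toEuclideanLin b = 0)
    (hc : v + S.toEuclideanLin c = 0) (hd : v + S.toEuclideanLin d = 0) : v = 0 ∧ S = 0 := by
  obtain ⟨e, he⟩ := h
  have hk : ∀ x, v + S.toEuclideanLin x = 0 → S.toEuclideanLin (x - a) = 0 := by
    intro x hx
    rw [map_sub, ← sub_eq_zero.2 (hx.trans ha.symm)]; module
  have hS0 := skew_eq_zero he hS (hk b hb) (hk c hc) (hk d hd)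
  refine ⟨?_, hS0⟩
  rw [hS0] at ha
  simpa using ha

/-- The edge lengths of a tetrahedron can be changed arbitrarily. -/
theorem TetRegular.exists_displacement {a b c d : R4} (h : TetRegular a b c d)
    (ab ac ad bc bd cd : ℝ) : ∃ a' b' c' d' : R4,
      inner ℝ (a - b) (a' - b') = ab ∧ inner ℝ (a - c) (a' - c') = ac ∧
      inner ℝ (a - d) (a' - d') = ad ∧ inner ℝ (b - c) (b' - c') = bc ∧
      inner ℝ (b - d) (b' - d') = bd ∧ inner ℝ (c - d) (c' - d') = cd := by
  obtain ⟨e, he⟩ := h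
  -- With `a` kept at rest the system becomes triangular: the inner products of each displacement
  -- with its own and later edge vectors are chosen freely, and those with earlier ones are solved
  -- from the lengths of the opposite edges.
  obtain ⟨x, x1, x2, x3, -⟩ := exists_inner_eq he ab 0 0 0
  obtain ⟨y, y1, y2, y3, -⟩ := exists_inner_eq he (ab + ac - bc) ac 0 0
  obtain ⟨z, z1, z2, z3, -⟩ := exists_inner_eq he (ab + ad - bd) (ac + ad - cd) ad 0
  refine ⟨0, x, y, z, ?_⟩
  have e1 : a - b = -(b - a) := by module
  have e2 : a - c = -(c - a) := by module
  have e3 : a - d = -(d - a) := by module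
  have e4 : b - c = (b - a) - (c - a) := by module
  have e5 : b - d = (b - a) - (d - a) := by module
  have e6 : c - d = (c - a) - (d - a) := by module
  rw [e4, e5, e6, e1, e2, e3]
  set p := b - a
  set q := c - a
  set s := d - a
  simp only [inner_neg_left, inner_sub_left, inner_sub_right, inner_zero_right, x1, x2, x3, y1, y2,
    y3, z1, z2, z3]
  refine ⟨?_, ?_, ?_, ?_, ?_, ?_⟩ <;> ring

theorem skew_smul_planeRotation (b c : R4) (s : ℝ) :
    (s • planeRotation b c).transpose = -(s • planeRotation b c) := by
  rw [Matrix.transpose_smul, planeRotation_transpose, smul_neg]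

/-! ### Transitions between adjacent tetrahedra -/

/-- The vertices of two tetrahedra `p₀p₁p₂p₃` and `p₁p₂p₃p₄` have displacements `u` and `u'`. The
motion `x ↦ v + S x`, added to `u'`, makes `u'` agree with `u` on the common face, and makes `θ` the
change of the angle between the tetrahedra. -/
def IsTransition (p u u' : Fin 5 → R4) (θ : ℝ) (v : R4) (S : Matrix (Fin 4) (Fin 4) ℝ) : Prop :=
  S.transpose = -S ∧ v + S.toEuclideanLin (p 1) = u 1 - u' 1 ∧
  v + S.toEuclideanLin (p 2) = u 2 - u' 2 ∧ v + S.toEuclideanLin (p 3) = u 3 - u' 3 ∧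
  dHingeAngle p ![u 0, u 1, u 2, u 3, u' 4 + (v + S.toEuclideanLin (p 4))] = θ

theorem dHingeAngle_add_last (p u : Fin 5 → R4) (w : R4) :
    dHingeAngle p ![u 0, u 1, u 2, u 3, u 4 + w] = dHingeAngle p u + dHingeAngle p (Pi.single 4 w) := by
  rw [← dHingeAngle_add]
  congr 1
  ext i : 1
  fin_cases i <;> simp

/-- Equal changes of the three lengths in the common face provide a motion aligning that face. It
may still be composed with a rotation around the face, which changes the angle with unit speed, and
so the angle can be corrected to any value. -/
theorem exists_isTransition {p : Fin 5 → R4} (hp : HingeRegular p)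
    (hT : TetRegular (p 1) (p 2) (p 3) (p 4)) {u u' : Fin 5 → R4}
    (h₁₂ : inner ℝ (p 1 - p 2) (u 1 - u 2) = inner ℝ (p 1 - p 2) (u' 1 - u' 2))
    (h₁₃ : inner ℝ (p 1 - p 3) (u 1 - u 3) = inner ℝ (p 1 - p 3) (u' 1 - u' 3))
    (h₂₃ : inner ℝ (p 2 - p 3) (u 2 - u 3) = inner ℝ (p 2 - p 3) (u' 2 - u' 3)) (θ : ℝ) :
    ∃ v S, IsTransition p u u' θ v S := by
  obtain ⟨e, he⟩ := hT
  set a := p 1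
  set b := p 2
  set c := p 3
  set d := p 4
  set x := u 1 - u' 1 with hx
  set y := u 2 - u' 2 with hy
  set z := u 3 - u' 3 with hz
  have k12 : inner ℝ (b - a) (y - x) = 0 := by
    rw [← sub_eq_zero, ← inner_sub_right] at h₁₂
    rw [← h₁₂, ← inner_neg_neg]; congr 1 <;> (try simp only [hx, hy]) <;> module
  have k13 : inner ℝ (c - a) (z - x) = 0 := by
    rw [← sub_eq_zero, ← inner_sub_right] at h₁₃
    rw [← h₁₃, ← inner_neg_neg]; congr 1 <;> (try simp only [hx, hz]) <;> module
  have k23 : inner ℝ (b - a) (z - x) + inner ℝ (c - a) (y - x) = 0 := by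
    have : inner ℝ (b - c) (y - z) = 0 := by
      rw [← sub_eq_zero, ← inner_sub_right] at h₂₃
      rw [← h₂₃]; congr 1; simp only [hy, hz]; module
    have e1 : b - c = (b - a) - (c - a) := by module
    have e2 : y - z = (y - x) - (z - x) := by module
    rw [e1, e2, inner_sub_left, inner_sub_right (b - a), inner_sub_right (c - a), k12, k13] at this
    linarith
  -- An auxiliary value for `S (d - a)`, chosen only to satisfy antisymmetry against `b - a`, `c -
  -- a` and `d - a`. The remaining freedom is used up later by the rotation around the face.
  obtain ⟨w, w1, w2, w3, -⟩ := exists_inner_eq he (-inner ℝ (d - a) (y - x))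
    (-inner ℝ (d - a) (z - x)) 0 0
  obtain ⟨S, hS, s1, s2, -⟩ := exists_skew he k12 k13 w3 k23 (by linarith) (by linarith)
  set J := planeRotation (b - a) (c - a)
  set θ₀ := dHingeAngle p ![u 0, u 1, u 2, u 3, u' 4 + (x + S.toEuclideanLin (d - a))] with hθ₀
  have hJ : ∀ (s : ℝ) (q : R4), x - (S + s • J).toEuclideanLin a + (S + s • J).toEuclideanLin q =
      x + S.toEuclideanLin (q - a) + s • J.toEuclideanLin (q - a) := by
    intro s q
    simp only [map_add, map_smul, LinearMap.add_apply, LinearMap.smul_apply, map_sub]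
    module
  refine ⟨x - (S + (θ - θ₀) • J).toEuclideanLin a, S + (θ - θ₀) • J, ?_, ?_, ?_, ?_, ?_⟩
  · rw [Matrix.transpose_add, hS, skew_smul_planeRotation, neg_add]
  · rw [hJ, sub_self, map_zero, map_zero, smul_zero, add_zero, add_zero]
  · rw [hJ, s1, planeRotation_left]; module
  · rw [hJ, s2, planeRotation_right]; module
  · rw [hJ, ← add_assoc]
    have := dHingeAngle_add_last p ![u 0, u 1, u 2, u 3, u' 4 + (x + S.toEuclideanLin (d - a))]
      ((θ - θ₀) • J.toEuclideanLin (d - a))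
    simp only [Matrix.cons_val_zero, Matrix.cons_val_one, Matrix.cons_val] at this
    rw [this, ← hθ₀, Pi.single_smul, dHingeAngle_smul, dHingeAngle_rotation hp]
    ring

/-- The orthogonality conditions leave only the direction of rotation around the face, and along it
the angle has nonzero speed. -/
theorem eq_zero_of_dHingeAngle_single {p : Fin 5 → R4} (hp : HingeRegular p) {w : R4}
    (h₂ : inner ℝ (p 2 - p 1) w = 0) (h₃ : inner ℝ (p 3 - p 1) w = 0)
    (h₄ : inner ℝ (p 4 - p 1) w = 0) (h : dHingeAngle p (Pi.single 4 w) = 0) : w = 0 := by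
  obtain ⟨s, rfl⟩ := eq_smul_dualBivector hp.2.1 h₂ h₃ h₄
  have hG : √(gram2 (p 2 - p 1) (p 3 - p 1)) ≠ 0 := (Real.sqrt_pos.2 hp.1).ne'
  have h1 : s • (dualBivector (p 2 - p 1) (p 3 - p 1)).toEuclideanLin (p 4 - p 1) =
      (s * √(gram2 (p 2 - p 1) (p 3 - p 1))) •
        (planeRotation (p 2 - p 1) (p 3 - p 1)).toEuclideanLin (p 4 - p 1) := by
    rw [planeRotation_apply, smul_smul, mul_assoc, mul_inv_cancel₀ hG, mul_one]
  rw [h1, Pi.single_smul, dHingeAngle_smul, dHingeAngle_rotation hp, mul_one] at h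
  rw [h1, h, zero_smul]

/-- The difference of the two motions fixes the common face, so it moves the last vertex
orthogonally to the tetrahedron, and the equality of angles excludes this. A motion fixing all four
vertices of a tetrahedron vanishes. -/
theorem IsTransition.unique {p : Fin 5 → R4} (hp : HingeRegular p)
    (hT : TetRegular (p 1) (p 2) (p 3) (p 4)) {u u' : Fin 5 → R4} {θ : ℝ} {v w : R4}
    {S R : Matrix (Fin 4) (Fin 4) ℝ} (h : IsTransition p u u' θ v S)
    (h' : IsTransition p u u' θ w R) : v = w ∧ S = R := by
  obtain ⟨hS, h1, h2, h3, h4⟩ := h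
  obtain ⟨hR, k1, k2, k3, k4⟩ := h'
  have hQ : (S - R).transpose = -(S - R) := by
    rw [Matrix.transpose_sub, hS, hR]; abel
  have m : ∀ x, (v - w) + (S - R).toEuclideanLin x =
      (v + S.toEuclideanLin x) - (w + R.toEuclideanLin x) := by
    intro x
    rw [map_sub, LinearMap.sub_apply]; abel
  have m1 : (v - w) + (S - R).toEuclideanLin (p 1) = 0 := by rw [m, h1, k1, sub_self]
  have m2 : (v - w) + (S - R).toEuclideanLin (p 2) = 0 := by rw [m, h2, k2, sub_self]
  have m3 : (v - w) + (S - R).toEuclideanLin (p 3) = 0 := by rw [m, h3, k3, sub_self]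
  have d : ∀ x, (v - w) + (S - R).toEuclideanLin x = (S - R).toEuclideanLin (x - p 1) := by
    intro x
    rw [map_sub (S - R).toEuclideanLin, ← sub_eq_zero, ← m1]; abel
  have m4 : (v - w) + (S - R).toEuclideanLin (p 4) = 0 := by
    refine eq_zero_of_dHingeAngle_single hp ?_ ?_ ?_ ?_
    · rw [d, inner_skew hQ, ← d, m2, inner_zero_left, neg_zero]
    · rw [d, inner_skew hQ, ← d, m3, inner_zero_left, neg_zero]
    · rw [d, inner_skew_self hQ]
    · have := dHingeAngle_add_last p ![u 0, u 1, u 2, u 3, u' 4 + (w + R.toEuclideanLin (p 4))]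
        ((v - w) + (S - R).toEuclideanLin (p 4))
      simp only [Matrix.cons_val_zero, Matrix.cons_val_one, Matrix.cons_val] at this
      rw [k4, add_assoc (u' 4), m, add_sub_cancel, h4] at this
      rw [m]; linarith
  obtain ⟨e1, e2⟩ := hT.motion_eq_zero hQ m1 m2 m3 m4
  exact ⟨sub_eq_zero.1 e1, sub_eq_zero.1 e2⟩

/-- Together with `IsTransition.smul` and uniqueness, this makes transition rotations linear in the
data, and hence later the deficits. -/
theorem IsTransition.add {p u u' w w' : Fin 5 → R4} {θ η : ℝ} {v x : R4}
    {S R : Matrix (Fin 4) (Fin 4) ℝ} (h : IsTransition p u u' θ v S)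
    (h' : IsTransition p w w' η x R) :
    IsTransition p (u + w) (u' + w') (θ + η) (v + x) (S + R) := by
  obtain ⟨hS, h1, h2, h3, h4⟩ := h
  obtain ⟨hR, k1, k2, k3, k4⟩ := h'
  have m : ∀ y, (v + x) + (S + R).toEuclideanLin y =
      (v + S.toEuclideanLin y) + (x + R.toEuclideanLin y) := by
    intro y
    rw [map_add, LinearMap.add_apply]; abel
  refine ⟨?_, ?_, ?_, ?_, ?_⟩
  · rw [Matrix.transpose_add, hS, hR]; abel
  · rw [m, h1, k1, Pi.add_apply, Pi.add_apply]; abel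
  · rw [m, h2, k2, Pi.add_apply, Pi.add_apply]; abel
  · rw [m, h3, k3, Pi.add_apply, Pi.add_apply]; abel
  · rw [← h4, ← k4, ← dHingeAngle_add, m]
    congr 1
    ext i : 1
    fin_cases i <;> simp
    abel

theorem IsTransition.smul {p u u' : Fin 5 → R4} {θ : ℝ} {v : R4}
    {S : Matrix (Fin 4) (Fin 4) ℝ} (h : IsTransition p u u' θ v S) (s : ℝ) :
    IsTransition p (s • u) (s • u') (s * θ) (s • v) (s • S) := by
  obtain ⟨hS, h1, h2, h3, h4⟩ := h
  have m : ∀ y, s • v + (s • S).toEuclideanLin y = s • (v + S.toEuclideanLin y) := by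
    intro y
    rw [map_smul, LinearMap.smul_apply, smul_add]
  refine ⟨?_, ?_, ?_, ?_, ?_⟩
  · rw [Matrix.transpose_smul, hS, smul_neg]
  · rw [m, h1, smul_sub]; rfl
  · rw [m, h2, smul_sub]; rfl
  · rw [m, h3, smul_sub]; rfl
  · rw [← h4, ← dHingeAngle_smul, m]
    congr 1
    ext i : 1
    fin_cases i <;> simp

/-! ### Cells of oriented pseudotriangulations -/

theorem perm_four_eq_one : ∀ σ : Equiv.Perm (Fin 4),
    Equiv.Perm.sign σ = 1 → σ 2 = 2 → σ 3 = 3 → σ = 1 := by decide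

theorem perm_four_swap : ∀ σ : Equiv.Perm (Fin 4),
    Equiv.Perm.sign σ = 1 → σ 0 = 1 → σ 2 = 2 → σ 3 = 3 → False := by decide

theorem perm_four_cyclic : ∀ σ : Equiv.Perm (Fin 4), Equiv.Perm.sign σ = 1 → σ 0 = 0 →
    (σ 1 = 1 ∧ σ 2 = 2 ∧ σ 3 = 3) ∨ (σ 1 = 2 ∧ σ 2 = 3 ∧ σ 3 = 1) ∨
      (σ 1 = 3 ∧ σ 2 = 1 ∧ σ 3 = 2) := by decide

namespace TetComplex

variable {V E F T E' F' T' : Type*} {K : TetComplex V E F T} {K' : TetComplex V E' F' T'}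

theorem HasTet.of_perm {t : T} {a b c d : V} (h : K.HasTet t a b c d) (σ : Equiv.Perm (Fin 4))
    (hσ : Equiv.Perm.sign σ = 1) {i j k l : Fin 4} (hi : σ 0 = i) (hj : σ 1 = j) (hk : σ 2 = k)
    (hl : σ 3 = l) :
    K.HasTet t (![a, b, c, d] i) (![a, b, c, d] j) (![a, b, c, d] k) (![a, b, c, d] l) := by
  obtain ⟨p, hp, h⟩ := h
  subst hi hj hk hl
  refine ⟨p * σ, by rw [map_mul, hp, hσ, one_mul], fun k => ?_⟩
  rw [Equiv.Perm.mul_apply, h]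
  fin_cases k <;> rfl

theorem HasTet.rotate {t : T} {a b c d : V} (h : K.HasTet t a b c d) : K.HasTet t a c d b :=
  h.of_perm (Equiv.swap 1 2 * Equiv.swap 2 3) (by decide) (i := 0) (j := 2) (k := 3) (l := 1)
    (by decide) (by decide) (by decide) (by decide)

theorem HasTet.rotate_left {t : T} {a b c d : V} (h : K.HasTet t a b c d) : K.HasTet t b c a d :=
  h.of_perm (Equiv.swap 0 1 * Equiv.swap 1 2) (by decide) (i := 1) (j := 2) (k := 0) (l := 3)
    (by decide) (by decide) (by decide) (by decide)

theorem HasTet.swap_swap {t : T} {a b c d : V} (h : K.HasTet t a b c d) : K.HasTet t b a d c :=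
  h.of_perm (Equiv.swap 0 1 * Equiv.swap 2 3) (by decide) (i := 1) (j := 0) (k := 3) (l := 2)
    (by decide) (by decide) (by decide) (by decide)

theorem HasTet.injective {t : T} {a b c d : V} (h : K.HasTet t a b c d)
    (hK : K.IsClosedOrientedManifold) : Function.Injective ![a, b, c, d] := by
  obtain ⟨p, -, h⟩ := h
  intro i j hij
  rw [← h, ← h] at hij
  exact p.injective (hK.vert_injective t hij)

theorem HasTet.ne {t : T} {a b c d : V} (h : K.HasTet t a b c d)
    (hK : K.IsClosedOrientedManifold) : a ≠ b ∧ a ≠ c ∧ a ≠ d ∧ b ≠ c ∧ b ≠ d ∧ c ≠ d := by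
  have := h.injective hK
  refine ⟨this.ne (a₁ := 0) (a₂ := 1) (by decide), this.ne (a₁ := 0) (a₂ := 2) (by decide),
    this.ne (a₁ := 0) (a₂ := 3) (by decide), this.ne (a₁ := 1) (a₂ := 2) (by decide),
    this.ne (a₁ := 1) (a₂ := 3) (by decide), this.ne (a₁ := 2) (a₂ := 3) (by decide)⟩

theorem HasTet.exists_perm {t : T} {a b c d a' b' c' d' : V} (h : K.HasTet t a b c d)
    (h' : K.HasTet t a' b' c' d') : ∃ σ : Equiv.Perm (Fin 4), Equiv.Perm.sign σ = 1 ∧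
      ∀ k, ![a', b', c', d'] k = ![a, b, c, d] (σ k) := by
  obtain ⟨p, hp, h⟩ := h
  obtain ⟨q, hq, h'⟩ := h'
  refine ⟨p⁻¹ * q, by rw [map_mul, map_inv, hp, hq]; rfl, fun k => ?_⟩
  rw [← h, ← h', Equiv.Perm.mul_apply, ← Equiv.Perm.mul_apply p, mul_inv_cancel, Equiv.Perm.one_apply]

theorem HasTet.eq_of_last {t : T} {a b a' b' c d : V} (hK : K.IsClosedOrientedManifold)
    (h : K.HasTet t a b c d) (h' : K.HasTet t a' b' c d) : a = a' ∧ b = b' := by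
  obtain ⟨σ, hσ, e⟩ := h.exists_perm h'
  have hi := h.injective hK
  have e2 : σ 2 = 2 := (hi (a₁ := 2) (e 2)).symm
  have e3 : σ 3 = 3 := (hi (a₁ := 3) (e 3)).symm
  rw [perm_four_eq_one σ hσ e2 e3] at e
  exact ⟨(e 0).symm, (e 1).symm⟩

theorem HasTet.not_swap {t : T} {a b c d : V} (hK : K.IsClosedOrientedManifold)
    (h : K.HasTet t a b c d) (h' : K.HasTet t b a c d) : False := by
  obtain ⟨σ, hσ, e⟩ := h.exists_perm h'
  have hi := h.injective hK
  exact perm_four_swap σ hσ (hi (a₁ := 1) (e 0)).symm (hi (a₁ := 2) (e 2)).symm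
    (hi (a₁ := 3) (e 3)).symm

/-- An even permutation of four places which fixes the first is a power of a three-cycle. -/
theorem HasTet.cyclic {t : T} {a b c d x y z : V} (hK : K.IsClosedOrientedManifold)
    (h : K.HasTet t a b c d) (h' : K.HasTet t a x y z) :
    (x = b ∧ y = c ∧ z = d) ∨ (x = c ∧ y = d ∧ z = b) ∨ (x = d ∧ y = b ∧ z = c) := by
  obtain ⟨σ, hσ, e⟩ := h.exists_perm h'
  have hi := h.injective hK
  have e0 : σ 0 = 0 := (hi (a₁ := 0) (e 0)).symm
  have e1 : x = ![a, b, c, d] (σ 1) := e 1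
  have e2 : y = ![a, b, c, d] (σ 2) := e 2
  have e3 : z = ![a, b, c, d] (σ 3) := e 3
  rcases perm_four_cyclic σ hσ e0 with ⟨h1, h2, h3⟩ | ⟨h1, h2, h3⟩ | ⟨h1, h2, h3⟩ <;>
    rw [h1] at e1 <;> rw [h2] at e2 <;> rw [h3] at e3
  · exact Or.inl ⟨e1, e2, e3⟩
  · exact Or.inr (Or.inl ⟨e1, e2, e3⟩)
  · exact Or.inr (Or.inr ⟨e1, e2, e3⟩)

theorem HasTet.replace {t : T} {t' : T'} {a b c d x y z a' : V} (hK : K.IsClosedOrientedManifold)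
    (h : K.HasTet t a b c d) (h' : K.HasTet t a x y z) (k : K'.HasTet t' a' b c d) :
    K'.HasTet t' a' x y z := by
  rcases h.cyclic hK h' with ⟨rfl, rfl, rfl⟩ | ⟨rfl, rfl, rfl⟩ | ⟨rfl, rfl, rfl⟩
  · exact k
  · exact k.rotate
  · exact k.rotate.rotate

theorem HasTet.replace_last {t : T} {t' : T'} {a b c d x y z d' : V}
    (hK : K.IsClosedOrientedManifold)
    (h : K.HasTet t a b c d) (h' : K.HasTet t a x y z) (k : K'.HasTet t' b c d d') :
    K'.HasTet t' x y z d' := by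
  rcases h.cyclic hK h' with ⟨rfl, rfl, rfl⟩ | ⟨rfl, rfl, rfl⟩ | ⟨rfl, rfl, rfl⟩
  · exact k
  · exact k.rotate_left
  · exact k.rotate_left.rotate_left

theorem HasTet.exists_vert {t : T} {a b c d : V} (h : K.HasTet t a b c d) :
    (∃ i, K.vert t i = a) ∧ (∃ i, K.vert t i = b) ∧ (∃ i, K.vert t i = c) ∧
      ∃ i, K.vert t i = d := by
  obtain ⟨p, -, h⟩ := h
  exact ⟨⟨_, h 0⟩, ⟨_, h 1⟩, ⟨_, h 2⟩, ⟨_, h 3⟩⟩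

theorem HasTet.vert_mem {t : T} {a b c d : V} (h : K.HasTet t a b c d) {x : V}
    (hx : ∃ i, K.vert t i = x) : x = a ∨ x = b ∨ x = c ∨ x = d := by
  obtain ⟨p, -, h⟩ := h
  obtain ⟨i, rfl⟩ := hx
  obtain ⟨k, rfl⟩ := p.surjective i
  rw [h]
  fin_cases k <;> simp

theorem exists_hasTet (K : TetComplex V E F T) (t : T) :
    K.HasTet t (K.vert t 0) (K.vert t 1) (K.vert t 2) (K.vert t 3) :=
  ⟨1, by simp, fun k => by fin_cases k <;> rfl⟩

/-! #### Edges -/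

theorem HasEdge.symm {t : T} {a b : V} {e : E} (hK : K.IsClosedOrientedManifold)
    (h : K.HasEdge t a b e) : K.HasEdge t b a e := by
  obtain ⟨i, j, hij, ha, hb, he⟩ := h
  exact ⟨j, i, hij.symm, hb, ha, by rw [hK.edge_symm, he]⟩

theorem HasEdge.unique {t : T} {a b : V} {e e' : E} (hK : K.IsClosedOrientedManifold)
    (h : K.HasEdge t a b e) (h' : K.HasEdge t a b e') : e = e' := by
  obtain ⟨i, j, -, rfl, rfl, rfl⟩ := h
  obtain ⟨i', j', -, h1, h2, rfl⟩ := h'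
  rw [hK.vert_injective t h1, hK.vert_injective t h2]

theorem HasEdge.exists_vert {t : T} {a b : V} {e : E} (h : K.HasEdge t a b e) :
    (∃ i, K.vert t i = a) ∧ ∃ i, K.vert t i = b := by
  obtain ⟨i, j, -, h1, h2, -⟩ := h
  exact ⟨⟨i, h1⟩, j, h2⟩

theorem HasEdge.ne {t : T} {a b : V} {e : E} (hK : K.IsClosedOrientedManifold)
    (h : K.HasEdge t a b e) : a ≠ b := by
  obtain ⟨i, j, hij, rfl, rfl, -⟩ := h
  exact (hK.vert_injective t).ne hij

theorem exists_hasEdge {t : T} {a b : V} (ha : ∃ i, K.vert t i = a) (hb : ∃ i, K.vert t i = b)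
    (hab : a ≠ b) : ∃ e, K.HasEdge t a b e := by
  obtain ⟨i, rfl⟩ := ha
  obtain ⟨j, rfl⟩ := hb
  exact ⟨_, i, j, fun h => hab (by rw [h]), rfl, rfl, rfl⟩

theorem HasEdge.ends {t : T} {a b : V} {e : E} (hK : K.IsClosedOrientedManifold)
    (h : K.HasEdge t a b e) :
    (K.tail e = a ∧ K.head e = b) ∨ (K.tail e = b ∧ K.head e = a) := by
  obtain ⟨i, j, hij, rfl, rfl, rfl⟩ := h
  have := hK.edge_ends t i j hij
  rwa [Sym2.eq_iff] at this

theorem HasEdge.tail_head {t : T} {a b : V} {e : E} (hK : K.IsClosedOrientedManifold)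
    (h : K.HasEdge t a b e) : K.HasEdge t (K.tail e) (K.head e) e := by
  rcases h.ends hK with ⟨h1, h2⟩ | ⟨h1, h2⟩
  · rwa [h1, h2]
  · rw [h1, h2]; exact h.symm hK

theorem exists_hasEdge_tail_head (hK : K.IsClosedOrientedManifold) (e : E) :
    ∃ t, K.HasEdge t (K.tail e) (K.head e) e := by
  obtain ⟨t, i, j, hij, rfl⟩ := hK.edge_surjective e
  exact ⟨t, HasEdge.tail_head hK ⟨i, j, hij, rfl, rfl, rfl⟩⟩

theorem tail_ne_head (hK : K.IsClosedOrientedManifold) (e : E) : K.tail e ≠ K.head e := by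
  obtain ⟨t, h⟩ := exists_hasEdge_tail_head hK e
  exact h.ne hK

/-- The oriented tetrahedron with two prescribed different vertices in the last two places. -/
theorem exists_hasTet_of_ne {t : T} {a b : V} (ha : ∃ i, K.vert t i = a) (hb : ∃ i, K.vert t i = b)
    (hab : a ≠ b) : ∃ x y, K.HasTet t x y a b := by
  have key : ∀ i j : Fin 4, i ≠ j → ∃ σ : Equiv.Perm (Fin 4), Equiv.Perm.sign σ = 1 ∧
    σ 2 = i ∧ σ 3 = j := by decide
  obtain ⟨i, rfl⟩ := ha
  obtain ⟨j, rfl⟩ := hb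
  obtain ⟨σ, hσ, rfl, rfl⟩ := key i j fun h => hab (by rw [h])
  exact ⟨_, _, σ, hσ, fun k => by fin_cases k <;> rfl⟩

/-- The oriented tetrahedron with a prescribed vertex in the first place. -/
theorem exists_hasTet_of_vert {t : T} {a : V} (ha : ∃ i, K.vert t i = a) :
    ∃ x y z, K.HasTet t a x y z := by
  have key : ∀ i : Fin 4, ∃ σ : Equiv.Perm (Fin 4), Equiv.Perm.sign σ = 1 ∧ σ 0 = i := by decide
  obtain ⟨i, rfl⟩ := ha
  obtain ⟨σ, hσ, rfl⟩ := key i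
  exact ⟨_, _, _, σ, hσ, fun k => by fin_cases k <;> rfl⟩

/-! #### Faces -/

theorem HasFace.unique {t : T} {a : V} {f f' : F} (hK : K.IsClosedOrientedManifold)
    (h : K.HasFace t a f) (h' : K.HasFace t a f') : f = f' := by
  obtain ⟨i, rfl, rfl⟩ := h
  obtain ⟨j, h1, rfl⟩ := h'
  rw [hK.vert_injective t h1]

theorem HasFace.exists_vert {t : T} {a : V} {f : F} (h : K.HasFace t a f) :
    ∃ i, K.vert t i = a := by
  obtain ⟨i, h, -⟩ := h
  exact ⟨i, h⟩

theorem exists_hasFace {t : T} {a : V} (ha : ∃ i, K.vert t i = a) : ∃ f, K.HasFace t a f := by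
  obtain ⟨i, rfl⟩ := ha
  exact ⟨_, i, rfl, rfl⟩

/-- A tetrahedron is not glued to itself: the orientation condition would force the vertex opposite
one side to be one of the three vertices of that side, or the two opposite vertices to coincide. -/
theorem HasFace.vert_unique {t : T} {a b : V} {f : F} (hK : K.IsClosedOrientedManifold)
    (h : K.HasFace t a f) (h' : K.HasFace t b f) : a = b := by
  obtain ⟨i, rfl, hi⟩ := h
  obtain ⟨j, rfl, hj⟩ := h'
  by_contra hne
  obtain ⟨x, y, z, h1, h2⟩ := hK.face_oriented t i t j (fun h => hne (by rw [(Prod.mk.inj h).2]))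
    (hi.trans hj.symm)
  obtain ⟨n1, n2, n3, -⟩ := h1.ne hK
  rcases h2.vert_mem ⟨i, rfl⟩ with h | h | h | h
  · exact n1 h
  · exact n2 h
  · exact n3 h
  · exact hne h

/-- A two-face has only two sides, and the sides at `t` and `t'` exhaust them. -/
theorem HasFace.three {t t' t'' : T} {a a' a'' : V} {f : F} (hK : K.IsClosedOrientedManifold)
    (h : K.HasFace t a f) (h' : K.HasFace t' a' f) (h'' : K.HasFace t'' a'' f) (hne : t ≠ t') :
    t'' = t ∨ t'' = t' := by
  obtain ⟨i, rfl, hi⟩ := h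
  obtain ⟨i', rfl, hi'⟩ := h'
  obtain ⟨i'', rfl, hi''⟩ := h''
  obtain ⟨x, y, -, hs⟩ := Set.ncard_eq_two.1 (hK.face_two f)
  have m : ∀ p : T × Fin 4, K.face p.1 p.2 = f → p = x ∨ p = y := by
    intro p hp
    have : p ∈ {p : T × Fin 4 | K.face p.1 p.2 = f} := hp
    rw [hs] at this
    exact this
  have hh : (t, i) ≠ (t', i') := fun h => hne (Prod.mk.inj h).1
  rcases m (t, i) hi with h1 | h1 <;> rcases m (t', i') hi' with h2 | h2 <;>
    rcases m (t'', i'') hi'' with h3 | h3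
  · exact absurd (h1.trans h2.symm) hh
  · exact absurd (h1.trans h2.symm) hh
  · exact Or.inl (Prod.mk.inj (h3.trans h1.symm)).1
  · exact Or.inr (Prod.mk.inj (h3.trans h2.symm)).1
  · exact Or.inr (Prod.mk.inj (h3.trans h2.symm)).1
  · exact Or.inl (Prod.mk.inj (h3.trans h1.symm)).1
  · exact absurd (h1.trans h2.symm) hh
  · exact absurd (h1.trans h2.symm) hh

theorem exists_hasFace_ne (hK : K.IsClosedOrientedManifold) (t : T) (f : F) :
    ∃ t' a', t ≠ t' ∧ K.HasFace t' a' f := by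
  obtain ⟨p, s, s', hne, -, -, h1, h2⟩ := hK.exists_isHinge f
  by_cases hs : t = s
  · exact ⟨s', _, hs ▸ hne, h2⟩
  · exact ⟨s, _, hs, h1⟩

/-- The two-face `f` with vertices `a, b, c` is common to the different tetrahedra `t = zabc` and
`t' = abcd`. -/
structure IsHingeAt (K : TetComplex V E F T) (f : F) (t t' : T) (z a b c d : V) : Prop where
  ne : t ≠ t'
  tet : K.HasTet t z a b c
  tet' : K.HasTet t' a b c d
  face : K.HasFace t z f
  face' : K.HasFace t' d f

theorem IsHingeAt.rotate {f : F} {t t' : T} {z a b c d : V} (h : K.IsHingeAt f t t' z a b c d) :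
    K.IsHingeAt f t t' z b c a d :=
  ⟨h.ne, h.tet.rotate, h.tet'.rotate_left, h.face, h.face'⟩

theorem IsHingeAt.reverse {f : F} {t t' : T} {z a b c d : V} (h : K.IsHingeAt f t t' z a b c d) :
    K.IsHingeAt f t' t d a c b z :=
  ⟨h.ne.symm, h.tet'.swap_swap.rotate_left.swap_swap, h.tet.swap_swap.rotate,
    h.face', h.face⟩

theorem HasFace.isHingeAt {t t' : T} {z a b c d : V} {f : F} (hK : K.IsClosedOrientedManifold)
    (hz : K.HasFace t z f) (hd : K.HasFace t' d f) (hne : t ≠ t') (ht : K.HasTet t z a b c) :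
    K.IsHingeAt f t t' z a b c d := by
  refine ⟨hne, ht, ?_, hz, hd⟩
  obtain ⟨i, rfl, hi⟩ := hz
  obtain ⟨j, rfl, hj⟩ := hd
  obtain ⟨x, y, w, h1, h2⟩ := hK.face_oriented t i t' j (fun h => hne (Prod.mk.inj h).1)
    (hi.trans hj.symm)
  exact h1.replace_last hK ht h2

theorem HasFace.hasEdge {t t' : T} {a a' x y : V} {e : E} {f : F}
    (hK : K.IsClosedOrientedManifold) (h : K.HasFace t a f) (h' : K.HasFace t' a' f)
    (hx : x ≠ a) (hy : y ≠ a) (he : K.HasEdge t x y e) : K.HasEdge t' x y e := by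
  by_cases hne : t = t'
  · subst hne
    exact he
  obtain ⟨p, q, w, ht⟩ := exists_hasTet_of_vert h.exists_vert
  have hh := HasFace.isHingeAt hK h h' hne ht
  have key : ∀ u, (∃ i, K.vert t i = u) → u ≠ a → ∃ i, K.vert t' i = u := by
    intro u hu hua
    obtain ⟨h1, h2, h3, -⟩ := hh.tet'.exists_vert
    rcases ht.vert_mem hu with rfl | rfl | rfl | rfl
    · exact absurd rfl hua
    all_goals assumption
  obtain ⟨j', hj'⟩ := key x he.exists_vert.1 hx
  obtain ⟨k', hk'⟩ := key y he.exists_vert.2 hy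
  obtain ⟨i, rfl, hi⟩ := h
  obtain ⟨i', rfl, hi'⟩ := h'
  obtain ⟨j, k, hjk, rfl, rfl, rfl⟩ := he
  have := hK.face_edges t i t' i' (hi.trans hi'.symm) j k j' k' (fun h => hx (by rw [h]))
    (fun h => hy (by rw [h])) hjk hj'.symm hk'.symm
  exact ⟨j', k', fun h => hjk (hK.vert_injective t (by rw [← hj', ← hk', h])), hj', hk', this.symm⟩

/-! #### Crossing the two-faces around an edge -/

/-- In a revolution around the edge `e`, one crosses the two-face `f` from the tetrahedron
`t = zaBC` to `t' = aBCd`, where `e = BC`. -/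
structure IsCrossing (K : TetComplex V E F T) (e : E) (f : F) (t t' : T) (z a d : V) : Prop
    extends K.IsHingeAt f t t' z a (K.tail e) (K.head e) d where
  edge : K.HasEdge t (K.tail e) (K.head e) e

theorem IsCrossing.edge' {e : E} {f : F} {t t' : T} {z a d : V} (hK : K.IsClosedOrientedManifold)
    (h : K.IsCrossing e f t t' z a d) : K.HasEdge t' (K.tail e) (K.head e) e := by
  obtain ⟨-, h1, h2, -⟩ := h.tet.ne hK
  exact h.face.hasEdge hK h.face' h1.symm h2.symm h.edge

theorem IsCrossing.tet_next {e : E} {f : F} {t t' : T} {z a d : V}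
    (h : K.IsCrossing e f t t' z a d) : K.HasTet t' a d (K.tail e) (K.head e) :=
  h.tet'.rotate.rotate

theorem exists_isCrossing_of_tet {e : E} {t : T} {z a : V} (hK : K.IsClosedOrientedManifold)
    (h : K.HasTet t z a (K.tail e) (K.head e)) (he : K.HasEdge t (K.tail e) (K.head e) e) :
    ∃ f t' d, K.IsCrossing e f t t' z a d := by
  obtain ⟨f, hf⟩ := exists_hasFace h.exists_vert.1
  obtain ⟨t', d, hne, hf'⟩ := exists_hasFace_ne hK t f
  exact ⟨f, t', d, HasFace.isHingeAt hK hf hf' hne h, he⟩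

/-- The orientation and the directed edge determine the order of the other two vertices, hence the
side through which one leaves the tetrahedron. With `prev_unique` this makes the passage around an
edge a partial bijection. -/
theorem IsCrossing.next_unique {e : E} {f f' : F} {t t' t'' : T} {z a d z' a' d' : V}
    (hK : K.IsClosedOrientedManifold) (h : K.IsCrossing e f t t' z a d)
    (h' : K.IsCrossing e f' t t'' z' a' d') :
    f = f' ∧ t' = t'' ∧ z = z' ∧ a = a' ∧ d = d' := by
  obtain ⟨rfl, rfl⟩ := h.tet.eq_of_last hK h'.tet
  obtain rfl := h.face.unique hK h'.face
  obtain rfl : t' = t'' := by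
    rcases h.face.three hK h.face' h'.face' h.ne with h1 | h1
    · exact absurd h1.symm h'.ne
    · exact h1.symm
  exact ⟨rfl, rfl, rfl, rfl, h.face'.vert_unique hK h'.face'⟩

theorem IsCrossing.prev_unique {e : E} {f f' : F} {t s t' : T} {z a d z' a' d' : V}
    (hK : K.IsClosedOrientedManifold) (h : K.IsCrossing e f t t' z a d)
    (h' : K.IsCrossing e f' s t' z' a' d') :
    f = f' ∧ t = s ∧ z = z' ∧ a = a' ∧ d = d' := by
  obtain ⟨rfl, rfl⟩ := h.tet_next.eq_of_last hK h'.tet_next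
  obtain rfl := h.face'.unique hK h'.face'
  obtain rfl : t = s := by
    rcases h.face'.three hK h.face h'.face h.ne.symm with h1 | h1
    · exact absurd h1 h'.ne
    · exact h1.symm
  exact ⟨rfl, rfl, h.face.vert_unique hK h'.face, rfl, rfl⟩

/-- The only alternative is to traverse the same two-face in the opposite sense. Around a directed
edge this would give the second tetrahedron both orientations. -/
theorem IsCrossing.unique {e : E} {f : F} {t s t' s' : T} {z a d z' a' d' : V}
    (hK : K.IsClosedOrientedManifold) (h : K.IsCrossing e f t t' z a d)
    (h' : K.IsCrossing e f s s' z' a' d') :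
    t = s ∧ t' = s' ∧ z = z' ∧ a = a' ∧ d = d' := by
  rcases h.face.three hK h.face' h'.face h.ne with rfl | rfl
  · obtain ⟨-, h1, h2, h3, h4⟩ := h.next_unique hK h'
    exact ⟨rfl, h1, h2, h3, h4⟩
  · exfalso
    obtain rfl := h.face'.vert_unique hK h'.face
    have h1 := h'.tet
    have h2 := h.tet_next
    obtain ⟨n1, n2, n3, n4, n5, n6⟩ := h1.ne hK
    obtain ⟨m1, m2, m3, m4, m5, m6⟩ := h2.ne hK
    rcases h1.vert_mem h2.exists_vert.1 with rfl | rfl | rfl | rfl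
    · exact m1 rfl
    · exact h1.not_swap hK h2
    · exact m2 rfl
    · exact m3 rfl

theorem Star.isCrossing {e : E} (s : K.Star e) (k : ℕ) :
    K.IsCrossing e (s.f k) (s.t k) (s.t (k + 1)) (s.a k) (s.a (k + 1)) (s.a (k + 2)) :=
  ⟨⟨s.ne k, s.tet k, (s.tet (k + 1)).rotate, s.face_left k, s.face_right k⟩, s.edge k⟩

/-- Crossing to the next tetrahedron is an injective self-map of a finite set of pairs of a
tetrahedron and an ordering of its outer vertices. Every orbit is therefore periodic, and the star
is one period. -/
theorem exists_star [Finite T] [Finite V] (hK : K.IsClosedOrientedManifold) (e : E) :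
    Nonempty (K.Star e) := by
  let S := {p : T × V × V // K.HasTet p.1 p.2.1 p.2.2 (K.tail e) (K.head e) ∧
    K.HasEdge p.1 (K.tail e) (K.head e) e}
  have ex : ∀ p : S, ∃ f t' d, K.IsCrossing e f p.1.1 t' p.1.2.1 p.1.2.2 d := fun p =>
    exists_isCrossing_of_tet hK p.2.1 p.2.2
  choose nf nt nd hn using ex
  let next : S → S := fun p => ⟨(nt p, p.1.2.2, nd p), (hn p).tet_next, (hn p).edge' hK⟩
  have hinj : Function.Injective next := by
    intro p q hpq
    have h0 : (nt p, p.1.2.2, nd p) = (nt q, q.1.2.2, nd q) := congrArg Subtype.val hpq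
    obtain ⟨h1, h2, h3⟩ : nt p = nt q ∧ p.1.2.2 = q.1.2.2 ∧ nd p = nd q := by
      simpa using h0
    have c1 := hn p
    rw [h1] at c1
    obtain ⟨-, e1, e2, e3, -⟩ := c1.prev_unique hK (hn q)
    exact Subtype.ext (Prod.ext e1 (Prod.ext e2 e3))
  obtain ⟨t, he⟩ := exists_hasEdge_tail_head hK e
  obtain ⟨x, y, ht⟩ := exists_hasTet_of_ne he.exists_vert.1 he.exists_vert.2 (he.ne hK)
  let p₀ : S := ⟨(t, x, y), ht, he⟩
  have hs : ∀ k, next^[k + 1] p₀ = next (next^[k] p₀) := fun k => Function.iterate_succ_apply' _ _ _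
  refine ⟨⟨Function.minimalPeriod next p₀, fun k => (next^[k] p₀).1.1,
    fun k => (next^[k] p₀).1.2.1, fun k => nf (next^[k] p₀),
    Function.minimalPeriod_pos_of_mem_periodicPts (hinj.mem_periodicPts p₀), fun k => ?_,
    fun k => (next^[k] p₀).2.2, fun k => ?_, fun k => (hn _).face, fun k => ?_, ?_, ?_⟩⟩
  · rw [hs]; exact (next^[k] p₀).2.1
  · rw [hs]; exact (hn _).ne
  · rw [hs (k + 1), hs k]; exact (hn _).face'
  · rw [Function.iterate_minimalPeriod]; rfl
  -- The tetrahedron alone determines the state, since its orientation fixes the outer vertices in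
  -- order. So a repeated tetrahedron would already be a period.
  · intro k h0 hk h
    have : next^[k] p₀ = p₀ := by
      have h' : (next^[k] p₀).1.1 = p₀.1.1 := h
      have h1 := (next^[k] p₀).2.1
      rw [h'] at h1
      obtain ⟨e1, e2⟩ := h1.eq_of_last hK p₀.2.1
      exact Subtype.ext (Prod.ext h' (Prod.ext e1 e2))
    exact absurd (Function.IsPeriodicPt.minimalPeriod_le h0 this) (not_le.2 hk)

theorem Star.corner_eq {e : E} (hK : K.IsClosedOrientedManifold) (s : K.Star e) {j k : ℕ}
    (h : s.t j = s.t k) :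
    s.f j = s.f k ∧ s.t (j + 1) = s.t (k + 1) ∧ s.a j = s.a k ∧ s.a (j + 1) = s.a (k + 1) := by
  have h1 := s.isCrossing j
  rw [h] at h1
  obtain ⟨e1, e2, e3, e4, -⟩ := h1.next_unique hK (s.isCrossing k)
  exact ⟨e1, e2, e3, e4⟩

theorem Star.prev_eq {e : E} (hK : K.IsClosedOrientedManifold) (s : K.Star e) {j k : ℕ}
    (h : s.t (j + 1) = s.t (k + 1)) : s.t j = s.t k := by
  have h1 := s.isCrossing j
  rw [h] at h1
  exact (h1.prev_unique hK (s.isCrossing k)).2.1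

theorem Star.t_add {e : E} (hK : K.IsClosedOrientedManifold) (s : K.Star e) (k : ℕ) :
    s.t (k + s.n) = s.t k := by
  induction k with
  | zero => rw [zero_add, s.period]
  | succ k ih => rw [add_right_comm]; exact (s.corner_eq hK ih).2.1

/-- A repetition can be moved back to the start of the sequence through predecessors, where it
contradicts minimality of the period. -/
theorem Star.t_injOn {e : E} (hK : K.IsClosedOrientedManifold) (s : K.Star e) {j k : ℕ}
    (hj : j < s.n) (hk : k < s.n) (h : s.t j = s.t k) : j = k := by
  have key : ∀ j m, s.t (j + m) = s.t j → s.t m = s.t 0 := by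
    intro j
    induction j with
    | zero => intro m h; rwa [zero_add] at h
    | succ j ih =>
      intro m h
      rw [add_right_comm] at h
      exact ih m (s.prev_eq hK h)
  rcases lt_trichotomy j k with hjk | hjk | hjk
  · exact absurd (key j (k - j) (by rw [Nat.add_sub_cancel' hjk.le, h]))
      (s.minimal _ (by omega) (by omega))
  · exact hjk
  · exact absurd (key k (j - k) (by rw [Nat.add_sub_cancel' hjk.le, h]))
      (s.minimal _ (by omega) (by omega))

/-- The tetrahedra around an edge are connected through two-faces containing it, and each of them
has only two such two-faces. So a neighbour of a member of the star is its successor or its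
predecessor. -/
theorem Star.exists_eq_t_of_hasEdge {e : E} (hK : K.IsClosedOrientedManifold) (s : K.Star e) {t : T}
    {x y : V} (h : K.HasEdge t x y e) : ∃ k, t = s.t k := by
  obtain ⟨i, j, hij, -, -, he⟩ := h
  obtain ⟨i₀, j₀, hij₀, h1, h2, he₀⟩ := s.edge 0
  have := hK.edge_link e _ _ _ _ _ _ hij₀ hij he₀ he
  clear he
  induction this with
  | refl => exact ⟨0, rfl⟩
  | @tail b c _ hbc ih =>
    obtain ⟨k, rfl⟩ := ih
    obtain ⟨l, l', hf, p, q, hp, hq, hpq, hpe⟩ := hbc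
    by_cases hne : c = s.t k
    · exact ⟨k, hne⟩
    have hE : K.HasEdge (s.t k) (K.vert (s.t k) p) (K.vert (s.t k) q) e := ⟨p, q, hpq, rfl, rfl, hpe⟩
    have hl : K.vert (s.t k) l = s.a k ∨ K.vert (s.t k) l = s.a (k + 1) := by
      have hp' := (hK.vert_injective (s.t k)).ne hp
      have hq' := (hK.vert_injective (s.t k)).ne hq
      rcases (s.tet k).vert_mem ⟨l, rfl⟩ with h | h | h | h
      · exact Or.inl h
      · exact Or.inr h
      all_goals
        exfalso
        rcases hE.ends hK with ⟨h1, h2⟩ | ⟨h1, h2⟩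
        all_goals simp_all
    have hcf : K.HasFace c (K.vert c l') (K.face (s.t k) l) := ⟨l', rfl, hf.symm⟩
    rcases hl with hl | hl
    · have := HasFace.unique hK ⟨l, hl, rfl⟩ (s.face_left k)
      rw [this] at hcf
      rcases (s.isCrossing k).face.three hK (s.isCrossing k).face' hcf (s.ne k) with h | h
      · exact absurd h hne
      · exact ⟨k + 1, h⟩
    -- Adding a period before subtracting one gives a predecessor even for `k = 0`.
    · obtain ⟨m, hm⟩ : ∃ m, s.t (m + 1) = s.t k :=
        ⟨k + s.n - 1, by rw [Nat.sub_add_cancel (by have := s.pos; omega), s.t_add hK]⟩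
      have hc := s.isCrossing m
      rw [hm] at hc
      have e1 := hc.tet_next.eq_of_last hK (s.tet k)
      have := HasFace.unique hK ⟨l, hl.trans e1.2.symm, rfl⟩ hc.face'
      rw [this] at hcf
      rcases hc.face.three hK hc.face' hcf hc.ne with h | h
      · exact ⟨m, h⟩
      · exact absurd h hne

theorem Star.exists_lt_of_isCrossing {e : E} (hK : K.IsClosedOrientedManifold) (s : K.Star e)
    {f : F} {t t' : T} {z a d : V} (h : K.IsCrossing e f t t' z a d) : ∃ k < s.n, s.f k = f := by
  obtain ⟨k, rfl⟩ := s.exists_eq_t_of_hasEdge hK h.edge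
  have hm : ∀ k, s.t (k % s.n) = s.t k := by
    intro k
    induction k using Nat.strong_induction_on with
    | _ k ih =>
      by_cases hk : k < s.n
      · rw [Nat.mod_eq_of_lt hk]
      · rw [← Nat.sub_add_cancel (not_lt.1 hk), Nat.add_mod_right, s.t_add hK]
        exact ih _ (by have := s.pos; omega)
  refine ⟨k % s.n, Nat.mod_lt _ s.pos, ?_⟩
  rw [(s.corner_eq hK (hm k)).1]
  exact ((s.isCrossing k).next_unique hK h).1

/-- A sum over the faces crossed in one revolution around an edge. -/
theorem Star.sum_faces {M : Type*} [AddCommMonoid M] [Fintype F] {e : E}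
    (hK : K.IsClosedOrientedManifold) (s : K.Star e) (w : F → M)
    (hw : ∀ f, (¬ ∃ t t' z a d, K.IsCrossing e f t t' z a d) → w f = 0) :
    ∑ k ∈ Finset.range s.n, w (s.f k) = ∑ f, w f := by
  classical
  have hinj : Set.InjOn s.f (Finset.range s.n : Set ℕ) := by
    intro j hj k hk h
    rw [Finset.coe_range, Set.mem_Iio] at hj hk
    have h1 := s.isCrossing j
    rw [h] at h1
    exact s.t_injOn hK hj hk (h1.unique hK (s.isCrossing k)).1
  rw [← Finset.sum_image hinj]
  refine Finset.sum_subset (Finset.subset_univ _) fun f _ hf => hw f ?_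
  rintro ⟨t, t', z, a, d, h⟩
  obtain ⟨k, hk, rfl⟩ := s.exists_lt_of_isCrossing hK h
  exact hf (Finset.mem_image_of_mem _ (Finset.mem_range.2 hk))

end TetComplex

/-! ### The deficit as a sum over two-faces -/

theorem dLength_comm {x y : R4} (h : x ≠ y) (u w : R4) : dLength x y u w = dLength y x w u := by
  rw [dLength_eq h, dLength_eq h.symm, dist_comm, ← inner_neg_neg, neg_sub, neg_sub]

theorem dLength_eq_iff {x y : R4} (h : x ≠ y) {u w u' w' : R4} :
    dLength x y u w = dLength x y u' w' ↔ inner ℝ (x - y) (u - w) = inner ℝ (x - y) (u' - w') := by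
  rw [dLength_eq h, dLength_eq h, div_left_inj' (dist_ne_zero.2 h)]

theorem dLength_add {x y : R4} (h : x ≠ y) (u w u' w' : R4) :
    dLength x y (u + u') (w + w') = dLength x y u w + dLength x y u' w' := by
  rw [dLength_eq h, dLength_eq h, dLength_eq h, ← add_div, ← inner_add_right]
  congr 2
  abel

theorem dLength_smul {x y : R4} (h : x ≠ y) (s : ℝ) (u w : R4) :
    dLength x y (s • u) (s • w) = s * dLength x y u w := by
  rw [dLength_eq h, dLength_eq h, ← smul_sub, inner_smul_right, mul_div_assoc]

theorem dLength_zero {x y : R4} : dLength x y 0 0 = 0 :=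
  (fderiv ℝ (fun q : R4 × R4 => dist q.1 q.2) (x, y)).map_zero

theorem dLength_motion {x y : R4} (h : x ≠ y) {S : Matrix (Fin 4) (Fin 4) ℝ}
    (hS : S.transpose = -S) (v : R4) :
    dLength x y (v + S.toEuclideanLin x) (v + S.toEuclideanLin y) = 0 := by
  rw [dLength_eq h, add_sub_add_left_eq_sub, ← map_sub, inner_skew_self hS, zero_div]

theorem dHingeAngle_add_motion {q : Fin 5 → R4} (h : HingeRegular q)
    {S : Matrix (Fin 4) (Fin 4) ℝ} (hS : S.transpose = -S) (v : R4) (u : Fin 5 → R4) :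
    dHingeAngle q (fun k => u k + (v + S.toEuclideanLin (q k))) = dHingeAngle q u := by
  have := dHingeAngle_add q u (fun k => v + S.toEuclideanLin (q k))
  rw [dHingeAngle_motion h hS, add_zero] at this
  exact this

theorem TetRegular.ne {a b c d : R4} (h : TetRegular a b c d) :
    a ≠ b ∧ a ≠ c ∧ a ≠ d ∧ b ≠ c ∧ b ≠ d ∧ c ≠ d := by
  obtain ⟨e, he⟩ := h
  have hl := linearIndependent_of_vol4_ne_zero he
  have h0 := hl.ne_zero 0
  have h1 := hl.ne_zero 1
  have h2 := hl.ne_zero 2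
  have h01 := hl.injective.ne (a₁ := 0) (a₂ := 1) (by decide)
  have h02 := hl.injective.ne (a₁ := 0) (a₂ := 2) (by decide)
  have h12 := hl.injective.ne (a₁ := 1) (a₂ := 2) (by decide)
  simp only [Matrix.cons_val_zero, Matrix.cons_val_one, Matrix.cons_val, ne_eq, sub_eq_zero,
    sub_left_inj] at h0 h1 h2 h01 h02 h12
  exact ⟨Ne.symm h0, Ne.symm h1, Ne.symm h2, h01, h02, h12⟩

/-- Any four different vertices are affinely independent. -/
def TetGeneric {V : Type*} (r : V → R4) : Prop :=
  ∀ p : Fin 4 → V, Function.Injective p → TetRegular (r (p 0)) (r (p 1)) (r (p 2)) (r (p 3))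

namespace TetComplex

variable {V E F T E' F' T' : Type*} {K : TetComplex V E F T} {K' : TetComplex V E' F' T'}
  {r : V → R4}

theorem HasTet.tetRegular {t : T} {a b c d : V} (h : K.HasTet t a b c d)
    (hK : K.IsClosedOrientedManifold) (hr : TetGeneric r) :
    TetRegular (r a) (r b) (r c) (r d) := hr ![a, b, c, d] (h.injective hK)

theorem HasEdge.point_ne {t : T} {a b : V} {e : E} (h : K.HasEdge t a b e)
    (hK : K.IsClosedOrientedManifold) (hr : TetGeneric r) : r a ≠ r b := by
  obtain ⟨x, y, ht⟩ := exists_hasTet_of_ne h.exists_vert.1 h.exists_vert.2 (h.ne hK)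
  exact (ht.tetRegular hK hr).ne.2.2.2.2.2

theorem injective_of_ne_last {a b c d : V} (h : Function.Injective ![d, a, b, c]) :
    Function.Injective ![a, b, c, d] := by
  have e : ![a, b, c, d] = ![d, a, b, c] ∘ finRotate 4 := by
    ext i; fin_cases i <;> rfl
  rw [e]
  exact h.comp (Equiv.injective _)

theorem IsHingeAt.tetRegular {f : F} {t t' : T} {z a b c d : V} (h : K.IsHingeAt f t t' z a b c d)
    (hK : K.IsClosedOrientedManifold) (hr : TetGeneric r) :
    TetRegular (r a) (r b) (r c) (r z) :=
  hr ![a, b, c, z] (injective_of_ne_last (h.tet.injective hK))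

theorem IsHingeAt.hingeRegular {f : F} {t t' : T} {z a b c d : V}
    (h : K.IsHingeAt f t t' z a b c d) (hK : K.IsClosedOrientedManifold) (hr : TetGeneric r) :
    HingeRegular (r ∘ ![z, a, b, c, d]) := by
  have := hingeRegular_of_tetRegular (h.tetRegular hK hr) (h.tet'.tetRegular hK hr)
  convert this using 1
  ext k : 1
  fin_cases k <;> rfl

/-- Displacements `u t` of the vertices of each tetrahedron `t` which change the edge lengths by
`dl`, and the infinitesimal rotations `W e f` which, on crossing a two-face `f` around an edge `e`,
align the displacements of the adjacent tetrahedra so that the angle changes by `dϑ`. -/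
structure IsDeformation (K : TetComplex V E F T) (r : V → R4) (dl : E → ℝ) (dϑ : F → ℝ)
    (u : T → V → R4) (W : E → F → Matrix (Fin 4) (Fin 4) ℝ) : Prop where
  length : ∀ t a b ε, K.HasEdge t a b ε → dLength (r a) (r b) (u t a) (u t b) = dl ε
  transition : ∀ e f t t' z a d, K.IsCrossing e f t t' z a d →
    ∃ v, IsTransition (r ∘ ![z, a, K.tail e, K.head e, d]) (u t ∘ ![z, a, K.tail e, K.head e, d])
      (u t' ∘ ![z, a, K.tail e, K.head e, d]) (dϑ f) v (W e f)
  zero : ∀ e f, (¬ ∃ t t' z a d, K.IsCrossing e f t t' z a d) → W e f = 0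

/-- Correct the displacement of the `k`-th tetrahedron by the sum of the transition motions met so
far. The corrected displacements agree on the crossed two-faces and have the required angles, and
after a full revolution the accumulated motion is the deficit. Motions affect neither lengths nor
angles. -/
theorem IsDeformation.exists_isDeficit {dl : E → ℝ} {dϑ : F → ℝ} {u : T → V → R4}
    {W : E → F → Matrix (Fin 4) (Fin 4) ℝ} (h : K.IsDeformation r dl dϑ u W)
    (hK : K.IsClosedOrientedManifold) (hr : TetGeneric r) {e : E} (s : K.Star e) :
    K.IsDeficit r dl dϑ e (∑ k ∈ Finset.range s.n, W e (s.f k)) := by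
  choose c hc using fun k => h.transition _ _ _ _ _ _ _ (s.isCrossing k)
  let M : ℕ → Matrix (Fin 4) (Fin 4) ℝ := fun k => ∑ j ∈ Finset.range k, W e (s.f j)
  let C : ℕ → R4 := fun k => ∑ j ∈ Finset.range k, c j
  let w : ℕ → V → R4 := fun k x => u (s.t k) x + (C k + (M k).toEuclideanLin (r x))
  have hM : ∀ k, (M k).transpose = -(M k) := by
    intro k
    simp only [M, Matrix.transpose_sum, ← Finset.sum_neg_distrib]
    exact Finset.sum_congr rfl fun j _ => (hc j).1
  have hstep : ∀ k x, u (s.t k) x - u (s.t (k + 1)) x = c k + (W e (s.f k)).toEuclideanLin (r x) →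
      w (k + 1) x = w k x := by
    intro k x hx
    simp only [w, C, M, Finset.sum_range_succ, map_add, LinearMap.add_apply]
    rw [← sub_eq_zero] at hx ⊢
    rw [← neg_eq_zero, ← hx]
    abel
  have hA : ∀ k, w (k + 1) (s.a (k + 1)) = w k (s.a (k + 1)) := fun k =>
    hstep _ _ (hc k).2.1.symm
  have hB : ∀ k, w k (K.tail e) = w 0 (K.tail e) := by
    intro k
    induction k with
    | zero => rfl
    | succ k ih => rw [← ih]; exact hstep _ _ (hc k).2.2.1.symm
  have hC : ∀ k, w k (K.head e) = w 0 (K.head e) := by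
    intro k
    induction k with
    | zero => rfl
    | succ k ih => rw [← ih]; exact hstep _ _ (hc k).2.2.2.1.symm
  have hv : ∀ k i, ![w k (s.a k), w (k + 1) (s.a (k + 1)), w 0 (K.tail e), w 0 (K.head e)] i =
      w k (s.corner k i) := by
    intro k i
    fin_cases i
    · rfl
    · exact hA k
    · exact (hB k).symm
    · exact (hC k).symm
  have e1 := s.corner_eq hK s.period
  have hcl : ∀ x, w s.n x - w 0 x = C s.n + (M s.n).toEuclideanLin (r x) := by
    intro x
    simp only [w, s.period, C, M, Finset.range_zero, Finset.sum_empty, map_zero,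
      LinearMap.zero_apply]
    abel
  have hn : ∀ x, (M s.n).toEuclideanLin (r x - r (K.tail e)) = w s.n x - w 0 x := by
    intro x
    have := hcl (K.tail e)
    rw [hB, sub_self] at this
    rw [hcl, map_sub, ← sub_eq_zero, ← neg_eq_zero]
    rw [this]; abel
  have hmv : ∀ x, (M s.n).mulVec (fun i => r x i - r (K.tail e) i) =
      fun i => w s.n x i - w 0 x i := by
    intro x
    ext i
    have := congrArg (fun z : R4 => z i) (hn x)
    rw [Matrix.toLpLin_apply] at this
    exact this
  refine ⟨s, fun k => w k (s.a k), w 0 (K.tail e), w 0 (K.head e), ?_, ?_, hM s.n, ?_, ?_, ?_⟩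
  · intro k _ i j ε hε
    rw [hv, hv]
    have hne := hε.point_ne hK hr
    rw [← h.length _ _ _ _ hε]
    simp only [w]
    rw [dLength_add hne, dLength_motion hne (hM k), add_zero]
  · intro k _
    have h1 := (hc k).2.2.2.2
    rw [← h1, ← dHingeAngle_add_motion ((s.isCrossing k).hingeRegular hK hr) (hM k) (C k)]
    congr 1
    · ext l : 1
      fin_cases l <;> rfl
    · ext l : 1
      fin_cases l
      · rfl
      · exact hA k
      · exact (hB k).symm
      · exact (hC k).symm
      · change w (k + 2) (s.a (k + 2)) = u (s.t (k + 1)) (s.a (k + 2)) +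
            (c k + (W e (s.f k)).toEuclideanLin (r (s.a (k + 2)))) +
            (C k + (M k).toEuclideanLin (r (s.a (k + 2))))
        refine (hA (k + 1)).trans ?_
        simp only [w, C, M, Finset.sum_range_succ, map_add, LinearMap.add_apply, add_assoc,
          Nat.reduceAdd]
        abel
  · rw [hmv, hC]; ext i; simp
  · rw [hmv]
    simp only [zero_add] at e1
    simp only [e1.2.2.1]
  · rw [hmv]
    have h1 := hA s.n
    simp only [zero_add] at e1
    rw [e1.2.2.2] at h1
    simp only [zero_add, e1.2.2.2, h1, hA 0]

/-- In any admissible development the displacement of the `k`-th tetrahedron differs from `u` by a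
motion with rotational part `N k`, because the lengths agree. By uniqueness of transitions the
increments of `N` are the `W e (s.f k)`, and their sum telescopes. Neither the star nor the
development influences the result. -/
theorem IsDeficit.eq_sum {dl : E → ℝ} {dϑ : F → ℝ} {u : T → V → R4}
    {W : E → F → Matrix (Fin 4) (Fin 4) ℝ} (h : K.IsDeformation r dl dϑ u W) [Fintype F]
    (hK : K.IsClosedOrientedManifold) (hr : TetGeneric r) {e : E} {B : Matrix (Fin 4) (Fin 4) ℝ}
    (hB : K.IsDeficit r dl dϑ e B) : B = ∑ f, W e f := by
  obtain ⟨s, v, vB, vC, hl, hθ, hBt, hBC, hB0, hB1⟩ := hB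
  rw [← s.sum_faces hK _ (h.zero e)]
  let y : ℕ → Fin 4 → R4 := fun k => ![v k, v (k + 1), vB, vC]
  have ex : ∀ k, ∃ m N, k ≤ s.n → N.transpose = -N ∧
      ∀ i, y k i = u (s.t k) (s.corner k i) + (m + Matrix.toEuclideanLin N (r (s.corner k i))) := by
    intro k
    by_cases hk : k ≤ s.n
    swap
    · exact ⟨0, 0, fun h => absurd h hk⟩
    have key : ∀ i j, i ≠ j → inner ℝ (r (s.corner k i) - r (s.corner k j))
        ((y k i - u (s.t k) (s.corner k i)) - (y k j - u (s.t k) (s.corner k j))) = 0 := by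
      intro i j hij
      have hT := s.tet k
      have hc : ∀ i, ∃ l, K.vert (s.t k) l = s.corner k i := by
        obtain ⟨h1, h2, h3, h4⟩ := hT.exists_vert
        intro i
        fin_cases i <;> assumption
      obtain ⟨ε, hε⟩ := exists_hasEdge (hc i) (hc j) ((hT.injective hK).ne hij)
      have h1 := hl k hk i j ε hε
      rw [← h.length _ _ _ _ hε, dLength_eq_iff (hε.point_ne hK hr), ← sub_eq_zero,
        ← inner_sub_right] at h1
      rw [← h1]
      congr 1
      simp only [y]
      abel
    obtain ⟨m, N, hN, h0, h1, h2, h3⟩ := ((s.tet k).tetRegular hK hr).exists_motion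
      (key 0 1 (by decide)) (key 0 2 (by decide)) (key 0 3 (by decide)) (key 1 2 (by decide))
      (key 1 3 (by decide)) (key 2 3 (by decide))
    refine ⟨m, N, fun _ => ⟨hN, fun i => ?_⟩⟩
    rw [← sub_eq_iff_eq_add']
    fin_cases i
    · exact h0
    · exact h1
    · exact h2
    · exact h3
  choose m N hmN using ex
  have hw : ∀ k < s.n, N (k + 1) - N k = W e (s.f k) := by
    intro k hk
    obtain ⟨hN, h0⟩ := hmN k hk.le
    obtain ⟨hN', h1⟩ := hmN (k + 1) hk
    obtain ⟨c, hc⟩ := h.transition _ _ _ _ _ _ _ (s.isCrossing k)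
    have hreg := (s.isCrossing k).hingeRegular hK hr
    have hd : ∀ x, (m (k + 1) - m k) + (N (k + 1) - N k).toEuclideanLin x =
        (m (k + 1) + (N (k + 1)).toEuclideanLin x) - (m k + (N k).toEuclideanLin x) := by
      intro x
      rw [map_sub, LinearMap.sub_apply]
      abel
    have hcom : ∀ x (y₀ : R4), y₀ = u (s.t k) x + (m k + (N k).toEuclideanLin (r x)) →
        y₀ = u (s.t (k + 1)) x + (m (k + 1) + (N (k + 1)).toEuclideanLin (r x)) →
        (m (k + 1) - m k) + (N (k + 1) - N k).toEuclideanLin (r x) =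
          u (s.t k) x - u (s.t (k + 1)) x := by
      intro x y₀ hy hy'
      rw [hd, sub_eq_sub_iff_add_eq_add, add_comm, ← hy', hy]
    refine (IsTransition.unique hreg ((s.isCrossing k).tet'.tetRegular hK hr)
      (v := m (k + 1) - m k) ⟨?_, ?_, ?_, ?_, ?_⟩ hc).2
    · rw [Matrix.transpose_sub, hN, hN']; abel
    · exact hcom _ _ (h0 1) (h1 0)
    · exact hcom _ _ (h0 2) (h1 2)
    · exact hcom _ _ (h0 3) (h1 3)
    · rw [← hθ k hk, ← dHingeAngle_add_motion hreg hN (m k)]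
      congr 1
      · ext l : 1
        fin_cases l <;> rfl
      · ext l : 1
        fin_cases l
        · exact (h0 0).symm
        · exact (h0 1).symm
        · exact (h0 2).symm
        · exact (h0 3).symm
        · change u (s.t (k + 1)) (s.a (k + 2)) + ((m (k + 1) - m k) +
            (N (k + 1) - N k).toEuclideanLin (r (s.a (k + 2)))) +
            (m k + (N k).toEuclideanLin (r (s.a (k + 2)))) = v (k + 2)
          rw [hd, add_assoc, sub_add_cancel]
          exact (h1 1).symm
  rw [← Finset.sum_congr rfl fun k hk => hw k (Finset.mem_range.1 hk), Finset.sum_range_sub]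
  obtain ⟨hN, h0⟩ := hmN 0 (Nat.zero_le _)
  obtain ⟨hN', h1⟩ := hmN s.n le_rfl
  have e1 := s.corner_eq hK s.period
  simp only [zero_add] at e1
  have hBv : ∀ x, B.toEuclideanLin (r x - r (K.tail e)) =
      WithLp.toLp 2 (B.mulVec fun i => r x i - r (K.tail e) i) := by
    intro x
    rw [Matrix.toLpLin_apply]
    rfl
  have hd : ∀ x, (m 0 - m s.n - B.toEuclideanLin (r (K.tail e))) +
      (B - (N s.n - N 0)).toEuclideanLin x = B.toEuclideanLin (x - r (K.tail e)) -
        ((m s.n + (N s.n).toEuclideanLin x) - (m 0 + (N 0).toEuclideanLin x)) := by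
    intro x
    simp only [map_sub, LinearMap.sub_apply]
    abel
  have key : ∀ x (z z' : R4), z = u (s.t 0) x + (m 0 + (N 0).toEuclideanLin (r x)) →
      z' = u (s.t s.n) x + (m s.n + (N s.n).toEuclideanLin (r x)) →
      B.toEuclideanLin (r x - r (K.tail e)) = z' - z →
      (m 0 - m s.n - B.toEuclideanLin (r (K.tail e))) +
        (B - (N s.n - N 0)).toEuclideanLin (r x) = 0 := by
    intro x z z' hz hz' hB
    rw [hd, hB, hz, hz', s.period]
    abel
  -- Both `B` and `N s.n - N 0` describe how the first tetrahedron returns after the revolution; a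
  -- motion is determined by its values on that tetrahedron.
  have := (((s.tet 0).tetRegular hK hr).motion_eq_zero
    (v := m 0 - m s.n - B.toEuclideanLin (r (K.tail e)))
    (S := B - (N s.n - N 0)) ?_ ?_ ?_ ?_ ?_).2
  · rwa [sub_eq_zero] at this
  · simp only [Matrix.transpose_sub, hBt, hN, hN']; abel
  · refine key _ (v 0) (v s.n) (h0 0) ?_ ?_
    · rw [← e1.2.2.1]; exact h1 0
    · rw [hBv, hB0]; rfl
  · refine key _ (v 1) (v (s.n + 1)) (h0 1) ?_ ?_
    · rw [zero_add, ← e1.2.2.2]; exact h1 1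
    · rw [hBv, zero_add, hB1]; rfl
  · refine key _ vB vB (h0 2) (h1 2) ?_
    rw [sub_self, map_zero, sub_self]
  · refine key _ vC vC (h0 3) (h1 3) ?_
    rw [hBv, hBC, sub_self]; rfl

/-- Existence and uniqueness together make the choice in the definition of `deficit` harmless. From
here on a deficit is computed from any convenient deformation. -/
theorem IsDeformation.deficit_eq [Fintype F] [Finite V] [Finite T] {dl : E → ℝ} {dϑ : F → ℝ}
    {u : T → V → R4} {W : E → F → Matrix (Fin 4) (Fin 4) ℝ} (h : K.IsDeformation r dl dϑ u W)
    (hK : K.IsClosedOrientedManifold) (hr : TetGeneric r) (e : E) :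
    K.deficit r dl dϑ e = ∑ f, W e f := by
  obtain ⟨s⟩ := exists_star hK e
  have hex : ∃ B, K.IsDeficit r dl dϑ e B := ⟨_, h.exists_isDeficit hK hr s⟩
  rw [deficit, dif_pos hex]
  exact hex.choose_spec.eq_sum h hK hr

end TetComplex

/-! ### Linearity of the deficit -/

namespace TetComplex

variable {V E F T E' F' T' : Type*} {K : TetComplex V E F T} {K' : TetComplex V E' F' T'}
  {r : V → R4}

/-- The admissible listings of the vertices at a two-face are related by cyclic rotation of the
triangle and reversal of the crossing. So angle and area need to be checked under these two
operations only, whatever listing `hinge` has chosen. -/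
theorem IsHingeAt.induction {f : F} {t t' s s' : T} {z a b c d z' a' b' c' d' : V}
    (hK : K.IsClosedOrientedManifold) (h : K.IsHingeAt f t t' z a b c d)
    (h' : K.IsHingeAt f s s' z' a' b' c' d') {P : V → V → V → V → V → Prop}
    (rotate : ∀ z a b c d, P z a b c d → P z b c a d)
    (reverse : ∀ z a b c d, P z a b c d → P d a c b z) (hP : P z a b c d) : P z' a' b' c' d' := by
  have key : ∀ {z a b c d t'}, K.IsHingeAt f s t' z a b c d → P z a b c d → P z' a' b' c' d' := by
    intro z a b c d t' h hP
    obtain rfl := h.face.vert_unique hK h'.face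
    obtain rfl : t' = s' := by
      rcases h.face.three hK h.face' h'.face' h.ne with h1 | h1
      · exact absurd h1.symm h'.ne
      · exact h1.symm
    obtain rfl := h.face'.vert_unique hK h'.face'
    rcases h.tet.cyclic hK h'.tet with ⟨rfl, rfl, rfl⟩ | ⟨rfl, rfl, rfl⟩ | ⟨rfl, rfl, rfl⟩
    · exact hP
    · exact rotate _ _ _ _ _ hP
    · exact rotate _ _ _ _ _ (rotate _ _ _ _ _ hP)
  rcases h.face.three hK h.face' h'.face h.ne with rfl | rfl
  · exact key h hP
  · exact key h.reverse (reverse _ _ _ _ _ hP)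

theorem exists_isHingeAt_hinge (hK : K.IsClosedOrientedManifold) (f : F) :
    ∃ t t', K.IsHingeAt f t t' (K.hinge hK f 0) (K.hinge hK f 1) (K.hinge hK f 2) (K.hinge hK f 3)
      (K.hinge hK f 4) := by
  obtain ⟨t, t', h1, h2, h3, h4, h5⟩ := (hK.exists_isHinge f).choose_spec
  exact ⟨t, t', h1, h2, h3, h4, h5⟩

theorem comp_vec_five {α β : Type*} (u : α → β) (z a b c d : α) :
    u ∘ ![z, a, b, c, d] = ![u z, u a, u b, u c, u d] := by
  ext k : 1
  fin_cases k <;> rfl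

/-- The change of the angle at a two-face can be computed from any listing of the vertices. -/
theorem IsHingeAt.dHingeAngle_eq {f : F} {t t' : T} {z a b c d : V}
    (hK : K.IsClosedOrientedManifold) (h : K.IsHingeAt f t t' z a b c d) (u : V → R4) :
    dHingeAngle (fun k => r (K.hinge hK f k)) (fun k => u (K.hinge hK f k)) =
      dHingeAngle (r ∘ ![z, a, b, c, d]) (u ∘ ![z, a, b, c, d]) := by
  obtain ⟨s, s', hs⟩ := exists_isHingeAt_hinge hK f
  refine hs.induction hK h (P := fun z a b c d => _ = dHingeAngle (r ∘ ![z, a, b, c, d])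
    (u ∘ ![z, a, b, c, d])) ?_ ?_ ?_
  · intro z a b c d h
    rw [h]
    simp only [comp_vec_five]
    exact (dHingeAngle_rotate ..).symm
  · intro z a b c d h
    rw [h]
    simp only [comp_vec_five]
    exact (dHingeAngle_reverse ..).symm
  · congr 1 <;> ext k : 1 <;> fin_cases k <;> rfl

/-- Tetrahedra are treated separately. No compatibility between neighbours is asked for, since the
transitions take care of it. -/
theorem exists_length (hK : K.IsClosedOrientedManifold) (hr : TetGeneric r) (dl : E → ℝ) :
    ∃ u : T → V → R4, ∀ t a b ε, K.HasEdge t a b ε →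
      dLength (r a) (r b) (u t a) (u t b) = dl ε := by
  classical
  have ex : ∀ t, ∃ w : Fin 4 → R4, ∀ i j, i ≠ j →
      dLength (r (K.vert t i)) (r (K.vert t j)) (w i) (w j) = dl (K.edge t i j) := by
    intro t
    have hT := (exists_hasTet K t).tetRegular hK hr
    have hne := hT.ne
    let l : Fin 4 → Fin 4 → ℝ := fun i j =>
      dl (K.edge t i j) * dist (r (K.vert t i)) (r (K.vert t j))
    obtain ⟨a', b', c', d', h1, h2, h3, h4, h5, h6⟩ :=
      hT.exists_displacement (l 0 1) (l 0 2) (l 0 3) (l 1 2) (l 1 3) (l 2 3)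
    have key : ∀ i j : Fin 4, ∀ x y : R4, r (K.vert t i) ≠ r (K.vert t j) →
        inner ℝ (r (K.vert t i) - r (K.vert t j)) (x - y) = l i j →
        dLength (r (K.vert t i)) (r (K.vert t j)) x y = dl (K.edge t i j) ∧
          dLength (r (K.vert t j)) (r (K.vert t i)) y x = dl (K.edge t j i) := by
      intro i j x y hij h
      rw [dLength_comm hij.symm, hK.edge_symm t j i, dLength_eq hij, h]
      simp only [l]
      rw [mul_div_cancel_right₀ _ (dist_ne_zero.2 hij)]
      exact ⟨rfl, rfl⟩
    refine ⟨![a', b', c', d'], ?_⟩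
    have k1 := key 0 1 a' b' hne.1 h1
    have k2 := key 0 2 a' c' hne.2.1 h2
    have k3 := key 0 3 a' d' hne.2.2.1 h3
    have k4 := key 1 2 b' c' hne.2.2.2.1 h4
    have k5 := key 1 3 b' d' hne.2.2.2.2.1 h5
    have k6 := key 2 3 c' d' hne.2.2.2.2.2 h6
    intro i j hij
    fin_cases i <;> fin_cases j
    · exact absurd rfl hij
    · exact k1.1
    · exact k2.1
    · exact k3.1
    · exact k1.2
    · exact absurd rfl hij
    · exact k4.1
    · exact k5.1
    · exact k2.2
    · exact k4.2
    · exact absurd rfl hij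
    · exact k6.1
    · exact k3.2
    · exact k5.2
    · exact k6.2
    · exact absurd rfl hij
  choose w hw using ex
  refine ⟨fun t x => if h : ∃ i, K.vert t i = x then w t h.choose else 0, ?_⟩
  have hv : ∀ t i, (if h : ∃ j, K.vert t j = K.vert t i then w t h.choose else 0) = w t i := by
    intro t i
    have h : ∃ j, K.vert t j = K.vert t i := ⟨i, rfl⟩
    rw [dif_pos h, hK.vert_injective t h.choose_spec]
  rintro t a b ε ⟨i, j, hij, rfl, rfl, rfl⟩
  beta_reduce
  rw [hv, hv]
  exact hw t i j hij

/-- Neighbours share the edges of their common face, so the face has the same changes of lengths on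
both sides and a transition exists. The crossing of a given two-face around a given edge is unique,
so one matrix suffices for each pair. -/
theorem exists_isDeformation (hK : K.IsClosedOrientedManifold) (hr : TetGeneric r) {dl : E → ℝ}
    (dϑ : F → ℝ) {u : T → V → R4} (hu : ∀ t a b ε, K.HasEdge t a b ε →
      dLength (r a) (r b) (u t a) (u t b) = dl ε) : ∃ W, K.IsDeformation r dl dϑ u W := by
  classical
  have ex : ∀ e f, ∃ W : Matrix (Fin 4) (Fin 4) ℝ, (∀ t t' z a d, K.IsCrossing e f t t' z a d →
      ∃ v, IsTransition (r ∘ ![z, a, K.tail e, K.head e, d])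
        (u t ∘ ![z, a, K.tail e, K.head e, d])
        (u t' ∘ ![z, a, K.tail e, K.head e, d]) (dϑ f) v W) ∧
      ((¬ ∃ t t' z a d, K.IsCrossing e f t t' z a d) → W = 0) := by
    intro e f
    by_cases h : ∃ t t' z a d, K.IsCrossing e f t t' z a d
    swap
    · exact ⟨0, fun t t' z a d hc => absurd ⟨t, t', z, a, d, hc⟩ h, fun _ => rfl⟩
    obtain ⟨t, t', z, a, d, hc⟩ := h
    have hlen : ∀ x y, (∃ i, K.vert t i = x) → (∃ i, K.vert t i = y) → x ≠ y → x ≠ z → y ≠ z →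
        inner ℝ (r x - r y) (u t x - u t y) = inner ℝ (r x - r y) (u t' x - u t' y) := by
      intro x y hx hy hxy hxz hyz
      obtain ⟨ε, hε⟩ := exists_hasEdge hx hy hxy
      rw [← dLength_eq_iff (hε.point_ne hK hr), hu t _ _ _ hε,
        hu t' _ _ _ (hc.face.hasEdge hK hc.face' hxz hyz hε)]
    obtain ⟨n1, n2, n3, n4, n5, n6⟩ := hc.tet.ne hK
    obtain ⟨-, m1, m2, m3⟩ := hc.tet.exists_vert
    obtain ⟨v, S, hS⟩ := exists_isTransition (hc.hingeRegular hK hr) (hc.tet'.tetRegular hK hr)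
      (u := u t ∘ ![z, a, K.tail e, K.head e, d]) (u' := u t' ∘ ![z, a, K.tail e, K.head e, d])
      (hlen _ _ m1 m2 n4 n1.symm n2.symm) (hlen _ _ m1 m3 n5 n1.symm n3.symm)
      (hlen _ _ m2 m3 n6 n2.symm n3.symm) (dϑ f)
    refine ⟨S, fun s s' z' a' d' hc' => ?_, fun hn => absurd ⟨t, t', z, a, d, hc⟩ hn⟩
    obtain ⟨rfl, rfl, rfl, rfl, rfl⟩ := hc.unique hK hc'
    exact ⟨v, hS⟩
  choose W hW using ex
  exact ⟨W, hu, fun e f => (hW e f).1, fun e f => (hW e f).2⟩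

theorem IsDeformation.add {dl dl' : E → ℝ} {dϑ dϑ' : F → ℝ} {u u' : T → V → R4}
    {W W' : E → F → Matrix (Fin 4) (Fin 4) ℝ} (hK : K.IsClosedOrientedManifold)
    (hr : TetGeneric r) (h : K.IsDeformation r dl dϑ u W) (h' : K.IsDeformation r dl' dϑ' u' W') :
    K.IsDeformation r (dl + dl') (dϑ + dϑ') (u + u') (W + W') := by
  refine ⟨fun t a b ε hε => ?_, fun e f t t' z a d hc => ?_, fun e f hn => ?_⟩
  · rw [Pi.add_apply, Pi.add_apply, Pi.add_apply, Pi.add_apply, dLength_add (hε.point_ne hK hr),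
      h.length _ _ _ _ hε, h'.length _ _ _ _ hε]
  · obtain ⟨v, hv⟩ := h.transition e f t t' z a d hc
    obtain ⟨v', hv'⟩ := h'.transition e f t t' z a d hc
    exact ⟨v + v', hv.add hv'⟩
  · simp [h.zero e f hn, h'.zero e f hn]

theorem IsDeformation.smul {dl : E → ℝ} {dϑ : F → ℝ} {u : T → V → R4}
    {W : E → F → Matrix (Fin 4) (Fin 4) ℝ} (hK : K.IsClosedOrientedManifold)
    (hr : TetGeneric r) (h : K.IsDeformation r dl dϑ u W) (s : ℝ) :
    K.IsDeformation r (s • dl) (s • dϑ) (s • u) (s • W) := by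
  refine ⟨fun t a b ε hε => ?_, fun e f t t' z a d hc => ?_, fun e f hn => ?_⟩
  · rw [Pi.smul_apply, Pi.smul_apply, Pi.smul_apply, Pi.smul_apply,
      dLength_smul (hε.point_ne hK hr), h.length _ _ _ _ hε, smul_eq_mul]
  · obtain ⟨v, hv⟩ := h.transition e f t t' z a d hc
    exact ⟨s • v, hv.smul s⟩
  · simp [h.zero e f hn]

/-- The deficits as a linear function of the changes of lengths and angles. -/
noncomputable def deficitLin [Fintype F] [Finite V] [Finite T] (hK : K.IsClosedOrientedManifold)
    (hr : TetGeneric r) (e : E) : (E ⊕ F → ℝ) →ₗ[ℝ] Matrix (Fin 4) (Fin 4) ℝ where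
  toFun x := K.deficit r (x ∘ Sum.inl) (x ∘ Sum.inr) e
  map_add' x y := by
    obtain ⟨u, hu⟩ := exists_length hK hr (x ∘ Sum.inl)
    obtain ⟨w, hw⟩ := exists_length hK hr (y ∘ Sum.inl)
    obtain ⟨W, hW⟩ := exists_isDeformation hK hr (x ∘ Sum.inr) hu
    obtain ⟨W', hW'⟩ := exists_isDeformation hK hr (y ∘ Sum.inr) hw
    rw [hW.deficit_eq hK hr, hW'.deficit_eq hK hr]
    have := (hW.add hK hr hW').deficit_eq hK hr e
    simp only [Pi.add_apply, Finset.sum_add_distrib] at this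
    exact this
  map_smul' s x := by
    obtain ⟨u, hu⟩ := exists_length hK hr (x ∘ Sum.inl)
    obtain ⟨W, hW⟩ := exists_isDeformation hK hr (x ∘ Sum.inr) hu
    rw [hW.deficit_eq hK hr]
    have := (hW.smul hK hr s).deficit_eq hK hr e
    simp only [Pi.smul_apply, ← Finset.smul_sum] at this
    exact this

/-- A deficit is an infinitesimal rotation around the edge. -/
theorem deficit_spec [Fintype F] [Finite V] [Finite T] (hK : K.IsClosedOrientedManifold)
    (hr : TetGeneric r) (dl : E → ℝ) (dϑ : F → ℝ) (e : E) :
    (K.deficit r dl dϑ e).transpose = -K.deficit r dl dϑ e ∧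
      (K.deficit r dl dϑ e).toEuclideanLin (r (K.head e) - r (K.tail e)) = 0 := by
  obtain ⟨u, hu⟩ := exists_length hK hr dl
  obtain ⟨W, hW⟩ := exists_isDeformation hK hr dϑ hu
  obtain ⟨s⟩ := exists_star hK e
  have hex : ∃ B, K.IsDeficit r dl dϑ e B := ⟨_, hW.exists_isDeficit hK hr s⟩
  rw [deficit, dif_pos hex]
  obtain ⟨s, v, vB, vC, -, -, h1, h2, -⟩ := hex.choose_spec
  refine ⟨h1, ?_⟩
  rw [Matrix.toLpLin_apply]
  exact congrArg (WithLp.toLp 2) h2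

/-- A displacement of the vertices does not change the deficits. -/
theorem deficit_displacement [Fintype F] [Finite V] [Finite T] (hK : K.IsClosedOrientedManifold)
    (hr : TetGeneric r) (y : V → R4) (e : E) :
    K.deficit r (fun e => dLength (r (K.tail e)) (r (K.head e)) (y (K.tail e)) (y (K.head e)))
      (fun f => dHingeAngle (fun k => r (K.hinge hK f k)) (fun k => y (K.hinge hK f k))) e = 0 := by
  have : K.IsDeformation r
      (fun e => dLength (r (K.tail e)) (r (K.head e)) (y (K.tail e)) (y (K.head e)))
      (fun f => dHingeAngle (fun k => r (K.hinge hK f k)) (fun k => y (K.hinge hK f k)))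
      (fun _ => y) 0 := by
    refine ⟨fun t a b ε hε => ?_, fun e f t t' z a d hc => ⟨0, ?_⟩, fun e f hn => rfl⟩
    · rcases hε.ends hK with ⟨h1, h2⟩ | ⟨h1, h2⟩
      · rw [h1, h2]
      · rw [h1, h2, dLength_comm (hε.point_ne hK hr)]
    · refine ⟨by simp, by simp, by simp, by simp, ?_⟩
      rw [hc.toIsHingeAt.dHingeAngle_eq hK]
      congr 1
      ext k : 1
      fin_cases k <;> simp
  rw [this.deficit_eq hK hr]
  simp

open Classical in
/-- The deficits produced by a change of the angle at one two-face are rotations around it. -/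
theorem isDeformation_single (hK : K.IsClosedOrientedManifold) (hr : TetGeneric r) (f₀ : F) :
    ∃ W, K.IsDeformation r 0 (Pi.single f₀ 1) 0 W ∧ (∀ e f, f ≠ f₀ → W e f = 0) ∧
      ∀ e t t' z a d, K.IsCrossing e f₀ t t' z a d →
        W e f₀ = planeRotation (r (K.tail e) - r a) (r (K.head e) - r a) := by
  have hl : ∀ t a b ε, K.HasEdge t a b ε →
      dLength (r a) (r b) ((0 : T → V → R4) t a) ((0 : T → V → R4) t b) = (0 : E → ℝ) ε :=
    fun t a b ε _ => dLength_zero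
  obtain ⟨W, hW⟩ := exists_isDeformation hK hr (Pi.single f₀ 1) hl
  have key : ∀ {e f t t' z a d v S}, K.IsCrossing e f t t' z a d →
      IsTransition (r ∘ ![z, a, K.tail e, K.head e, d])
        ((0 : T → V → R4) t ∘ ![z, a, K.tail e, K.head e, d])
        ((0 : T → V → R4) t' ∘ ![z, a, K.tail e, K.head e, d])
        ((Pi.single f₀ 1 : F → ℝ) f) v S → W e f = S := by
    intro e f t t' z a d v S hc hS
    obtain ⟨w, hw⟩ := hW.transition _ _ _ _ _ _ _ hc
    exact (hw.unique (hc.hingeRegular hK hr) (hc.tet'.tetRegular hK hr) hS).2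
  refine ⟨W, hW, fun e f hf => ?_, fun e t t' z a d hc => ?_⟩
  · by_cases hc : ∃ t t' z a d, K.IsCrossing e f t t' z a d
    · obtain ⟨t, t', z, a, d, hc⟩ := hc
      refine key hc (v := 0) ⟨by simp, by simp, by simp, by simp, ?_⟩
      rw [Pi.single_eq_of_ne hf]
      convert dHingeAngle_zero _
      ext k : 1
      fin_cases k <;> simp
    · exact hW.zero e f hc
  · set J := planeRotation (r (K.tail e) - r a) (r (K.head e) - r a) with hJ
    have hm : ∀ x, -J.toEuclideanLin (r a) + J.toEuclideanLin x = J.toEuclideanLin (x - r a) := by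
      intro x
      rw [map_sub]; abel
    -- With all tetrahedra at rest, the transition is the unit-speed rotation `x ↦ J (x - a)` around
    -- the two-face.
    refine key hc (v := -J.toEuclideanLin (r a)) ⟨planeRotation_transpose _ _, ?_, ?_, ?_, ?_⟩
    · exact (neg_add_cancel _).trans (sub_zero _).symm
    · refine (hm _).trans ((planeRotation_left _ _).trans (sub_zero _).symm)
    · refine (hm _).trans ((planeRotation_right _ _).trans (sub_zero _).symm)
    · rw [Pi.single_eq_same, hm, ← dHingeAngle_rotation (hc.hingeRegular hK hr)]
      congr 1
      ext k : 1
      fin_cases k <;> simp [hJ]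

/-- Orient the tetrahedron so that the edge comes last. If the vertex opposite `f` then comes first,
one leaves through `f`; if it comes second, one enters through `f`, and the crossing starts from the
neighbour. -/
theorem isCrossing_of_hasEdge {f : F} {t : T} {z x y : V} {e : E} (hK : K.IsClosedOrientedManifold)
    (hf : K.HasFace t z f) (hx : x ≠ z) (hy : y ≠ z) (he : K.HasEdge t x y e) :
    ∃ t t' z a d, K.IsCrossing e f t t' z a d := by
  obtain ⟨t', d, hne, hf'⟩ := exists_hasFace_ne hK t f
  have he' := he.tail_head hK
  have hz : K.tail e ≠ z ∧ K.head e ≠ z := by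
    rcases he.ends hK with ⟨h1, h2⟩ | ⟨h1, h2⟩ <;> rw [h1, h2] <;> exact ⟨by assumption, by assumption⟩
  obtain ⟨p, q, ht⟩ := exists_hasTet_of_ne he'.exists_vert.1 he'.exists_vert.2 (he'.ne hK)
  rcases ht.vert_mem hf.exists_vert with rfl | rfl | h | h
  · exact ⟨t, t', z, q, d, hf.isHingeAt hK hf' hne ht, he'⟩
  · have := (hf.isHingeAt hK hf' hne ht.swap_swap).reverse
    exact ⟨t', t, d, p, z, this, hf.hasEdge hK hf' hz.1 hz.2 he'⟩
  · exact absurd h.symm hz.1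
  · exact absurd h.symm hz.2

end TetComplex

/-! ### Rotations in frames -/

theorem toEuclideanLin_mul (A B : Matrix (Fin 4) (Fin 4) ℝ) (x : R4) :
    (A * B).toEuclideanLin x = A.toEuclideanLin (B.toEuclideanLin x) := by
  simp only [Matrix.toLpLin_apply, Matrix.mulVec_mulVec]

theorem matrix_apply_eq_inner (A : Matrix (Fin 4) (Fin 4) ℝ) (i j : Fin 4) :
    A i j = inner ℝ (EuclideanSpace.single i 1) (A.toEuclideanLin (EuclideanSpace.single j 1)) := by
  rw [EuclideanSpace.inner_single_left, Matrix.toLpLin_apply]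
  simp [Matrix.mulVec_single]

theorem ext_inner_toEuclideanLin {A B : Matrix (Fin 4) (Fin 4) ℝ}
    (h : ∀ x y : R4, inner ℝ x (A.toEuclideanLin y) = inner ℝ x (B.toEuclideanLin y)) : A = B := by
  ext i j
  rw [matrix_apply_eq_inner A, matrix_apply_eq_inner B, h]

/-- The inner product and the volume, which together determine the dual bivector, are invariant
under rotations. -/
theorem conj_dualBivector {N : Matrix (Fin 4) (Fin 4) ℝ} (hN : N * N.transpose = 1)
    (hd : N.det = 1) (b c : R4) :
    N * dualBivector b c * N.transpose = dualBivector (N.toEuclideanLin b) (N.toEuclideanLin c) := by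
  refine ext_inner_toEuclideanLin fun x y => ?_
  have h1 : ∀ z, N.toEuclideanLin (N.transpose.toEuclideanLin z) = z := by
    intro z
    rw [← toEuclideanLin_mul, hN]
    simp
  rw [toEuclideanLin_mul, toEuclideanLin_mul, inner_dualBivector, ← h1 x, ← h1 y,
    vol4_toEuclideanLin, hd, one_mul, ← inner_dualBivector, inner_toEuclideanLin, h1, h1]

theorem dualBivector_smul_right (b c : R4) (s : ℝ) :
    dualBivector b (s • c) = s • dualBivector b c := by
  ext i j
  fin_cases i <;> fin_cases j <;> simp [dualBivector] <;> ring

theorem orthogonal_of_mem {g : Matrix (Fin 4) (Fin 4) ℝ}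
    (hg : g ∈ Matrix.specialOrthogonalGroup (Fin 4) ℝ) :
    g * g.transpose = 1 ∧ g.transpose * g = 1 ∧ g.det = 1 := by
  rw [Matrix.mem_specialOrthogonalGroup_iff] at hg
  have h1 : g * g.transpose = 1 := (Matrix.mem_orthogonalGroup_iff (Fin 4) ℝ).1 hg.1
  exact ⟨h1, mul_eq_one_comm.1 h1, hg.2⟩

theorem rotationOfComponents_eq {g : Matrix (Fin 4) (Fin 4) ℝ}
    (hg : g ∈ Matrix.specialOrthogonalGroup (Fin 4) ℝ) (c : Fin 3 → ℝ) :
    rotationOfComponents g c = dualBivector (g.toEuclideanLin (WithLp.toLp 2 ![0, c 0, c 1, c 2]))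
      (g.toEuclideanLin (EuclideanSpace.single 0 1)) := by
  obtain ⟨h1, -, h3⟩ := orthogonal_of_mem hg
  rw [← conj_dualBivector h1 h3, rotationOfComponents]
  congr 2
  ext i j
  fin_cases i <;> fin_cases j <;> simp [dualBivector]

/-- By covariance one may pass to the frame, where `c` lies along the first axis and the entries can
be read off. -/
theorem rotationComponents_dualBivector {g : Matrix (Fin 4) (Fin 4) ℝ}
    (hg : g ∈ Matrix.specialOrthogonalGroup (Fin 4) ℝ) {b c : R4} {l : ℝ}
    (hc : g.transpose.toEuclideanLin c = l • EuclideanSpace.single 0 1) (k : Fin 3) :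
    rotationComponents g (dualBivector b c) k = l * g.transpose.toEuclideanLin b k.succ := by
  obtain ⟨h1, h2, h3⟩ := orthogonal_of_mem hg
  have := conj_dualBivector (N := g.transpose) (by rwa [Matrix.transpose_transpose])
    (by rwa [Matrix.det_transpose]) b c
  rw [Matrix.transpose_transpose, hc, dualBivector_smul_right] at this
  rw [rotationComponents, this]
  fin_cases k <;> simp [dualBivector]

theorem skew_eq_of_column_zero {A : Matrix (Fin 4) (Fin 4) ℝ} (hA : A.transpose = -A)
    (h0 : ∀ i, A i 0 = 0) {c : Fin 3 → ℝ} (hc : c = ![A 2 3, A 3 1, A 1 2]) :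
    !![0, 0, 0, 0; 0, 0, c 2, -c 1; 0, -c 2, 0, c 0; 0, c 1, -c 0, 0] = A := by
  subst hc
  have hs : ∀ i j, A j i = -A i j := fun i j => congrFun (congrFun hA i) j
  have hd : ∀ i, A i i = 0 := fun i => by linarith [hs i i]
  ext i j
  fin_cases i <;> fin_cases j
  · exact (h0 0).symm
  · simpa [h0] using (hs 1 0).symm
  · simpa [h0] using (hs 2 0).symm
  · simpa [h0] using (hs 3 0).symm
  · exact (h0 1).symm
  · exact (hd 1).symm
  · rfl
  · exact (hs 3 1).symm
  · exact (h0 2).symm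
  · exact (hs 1 2).symm
  · exact (hd 2).symm
  · rfl
  · exact (h0 3).symm
  · rfl
  · exact (hs 2 3).symm
  · exact (hd 3).symm

theorem rotationOfComponents_rotationComponents {g B : Matrix (Fin 4) (Fin 4) ℝ}
    (hg : g ∈ Matrix.specialOrthogonalGroup (Fin 4) ℝ) (hB : B.transpose = -B)
    (h : B.toEuclideanLin (g.toEuclideanLin (EuclideanSpace.single 0 1)) = 0) :
    rotationOfComponents g (rotationComponents g B) = B := by
  obtain ⟨h1, h2, -⟩ := orthogonal_of_mem hg
  have hA : (g.transpose * B * g).transpose = -(g.transpose * B * g) := by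
    rw [Matrix.transpose_mul, Matrix.transpose_mul, Matrix.transpose_transpose, hB]
    simp [Matrix.mul_assoc]
  have h0 : ∀ i, (g.transpose * B * g) i 0 = 0 := by
    intro i
    rw [matrix_apply_eq_inner (g.transpose * B * g), toEuclideanLin_mul, toEuclideanLin_mul, h, map_zero,
      inner_zero_right]
  have : g * (g.transpose * B * g) * g.transpose = B := by
    rw [Matrix.mul_assoc, Matrix.mul_assoc, h1, Matrix.mul_one, ← Matrix.mul_assoc, h1,
      Matrix.one_mul]
  conv_rhs => rw [← this]
  rw [rotationOfComponents, skew_eq_of_column_zero hA h0 (c := rotationComponents g B) rfl]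

theorem rotationComponents_add (g B B' : Matrix (Fin 4) (Fin 4) ℝ) :
    rotationComponents g (B + B') = rotationComponents g B + rotationComponents g B' := by
  ext k
  fin_cases k <;> simp [rotationComponents, Matrix.mul_add, Matrix.add_mul]

theorem rotationComponents_smul (g B : Matrix (Fin 4) (Fin 4) ℝ) (s : ℝ) :
    rotationComponents g (s • B) = s • rotationComponents g B := by
  ext k
  fin_cases k <;> simp [rotationComponents]

theorem rotationOfComponents_add (g : Matrix (Fin 4) (Fin 4) ℝ) (c c' : Fin 3 → ℝ) :
    rotationOfComponents g (c + c') = rotationOfComponents g c + rotationOfComponents g c' := by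
  rw [rotationOfComponents, rotationOfComponents, rotationOfComponents, ← Matrix.add_mul,
    ← Matrix.mul_add]
  congr 2
  ext i j
  fin_cases i <;> fin_cases j <;> simp <;> ring

theorem rotationOfComponents_smul (g : Matrix (Fin 4) (Fin 4) ℝ) (c : Fin 3 → ℝ) (s : ℝ) :
    rotationOfComponents g (s • c) = s • rotationOfComponents g c := by
  rw [rotationOfComponents, rotationOfComponents, ← Matrix.smul_mul, ← Matrix.mul_smul]
  congr 2
  ext i j
  fin_cases i <;> fin_cases j <;> simp

/-- The change of coordinates between two frames with the same first axis, up to sign. -/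
def frameMatrix (g g' : Matrix (Fin 4) (Fin 4) ℝ) : Matrix (Fin 3) (Fin 3) ℝ :=
  (g'.transpose * g).submatrix Fin.succ Fin.succ

/-- The rotation is the dual of its component vector and the first axis. Replacing `g` by `g'`
multiplies the axis by `ε`, which the factor `ε` on the left absorbs, and expresses the component
vector in the new axes. -/
theorem rotationComponents_smul_rotationOfComponents {g g' : Matrix (Fin 4) (Fin 4) ℝ}
    (hg : g ∈ Matrix.specialOrthogonalGroup (Fin 4) ℝ)
    (hg' : g' ∈ Matrix.specialOrthogonalGroup (Fin 4) ℝ) {ε : ℝ} (h : ∀ i, g' i 0 = ε * g i 0)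
    (c : Fin 3 → ℝ) :
    rotationComponents g' (ε • rotationOfComponents g c) = (frameMatrix g g').mulVec c := by
  obtain ⟨h1, h2, h3⟩ := orthogonal_of_mem hg'
  have e0 : ε • g.toEuclideanLin (EuclideanSpace.single 0 1) =
      g'.toEuclideanLin (EuclideanSpace.single 0 1) := by
    ext i
    simp [Matrix.toLpLin_apply, h]
  have e1 : g'.transpose.toEuclideanLin (g'.toEuclideanLin (EuclideanSpace.single 0 1)) =
      (1 : ℝ) • EuclideanSpace.single 0 1 := by
    rw [← toEuclideanLin_mul, h2]
    simp
  ext k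
  rw [rotationOfComponents_eq hg, ← dualBivector_smul_right, e0,
    rotationComponents_dualBivector hg' e1, one_mul, ← toEuclideanLin_mul, Matrix.toLpLin_apply]
  simp [frameMatrix, Matrix.mulVec, dotProduct, Fin.sum_univ_succ]

theorem abs_det_frameMatrix {g g' : Matrix (Fin 4) (Fin 4) ℝ}
    (hg : g ∈ Matrix.specialOrthogonalGroup (Fin 4) ℝ)
    (hg' : g' ∈ Matrix.specialOrthogonalGroup (Fin 4) ℝ) {ε : ℝ} (hε : |ε| = 1)
    (h : ∀ i, g' i 0 = ε * g i 0) : |(frameMatrix g g').det| = 1 := by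
  obtain ⟨h1, h2, h3⟩ := orthogonal_of_mem hg
  obtain ⟨k1, k2, k3⟩ := orthogonal_of_mem hg'
  have hε2 : ε * ε = 1 := by rw [← abs_mul_abs_self, hε, one_mul]
  have hcol : ∀ i, (g'.transpose * g) i 0 = ε * (1 : Matrix (Fin 4) (Fin 4) ℝ) i 0 := by
    intro i
    rw [← k2, Matrix.mul_apply, Matrix.mul_apply, Finset.mul_sum]
    refine Finset.sum_congr rfl fun j _ => ?_
    rw [h]
    linear_combination (-(g'.transpose i j) * g j 0) * hε2
  have hd : (g'.transpose * g).det = 1 := by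
    rw [Matrix.det_mul, Matrix.det_transpose, k3, h3, one_mul]
  -- The first column of `g'ᵀ g` is `ε` times a unit vector, so the expansion has a single term,
  -- with minor `frameMatrix g g'`.
  rw [Matrix.det_succ_column_zero, Fin.sum_univ_succ, hcol] at hd
  rw [Finset.sum_eq_zero, add_zero] at hd
  · have : ε * (frameMatrix g g').det = 1 := by
      rw [← hd]
      simp [frameMatrix, Fin.succAbove_zero]
    have h5 := congrArg abs this
    rwa [abs_mul, hε, one_mul, abs_one] at h5
  · intro i _
    rw [hcol]
    simp

/-! ### The maps of the complex -/

namespace TetComplex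

variable {V E F T E' F' T' : Type*} {K : TetComplex V E F T} {K' : TetComplex V E' F' T'}
  {r : V → R4}

/-- The displacements of the vertices with given coordinates. -/
noncomputable def displacement (y : V × Fin 4 → ℝ) (x : V) : R4 :=
  WithLp.toLp 2 fun i => y (x, i)

theorem sum_smul_basisDisplacement [Fintype V] [DecidableEq V] (y : V × Fin 4 → ℝ) :
    ∑ c, y c • basisDisplacement c = displacement y := by
  ext x i
  rw [Finset.sum_apply, WithLp.ofLp_sum, Finset.sum_apply]
  rw [Finset.sum_eq_single (x, i)]
  · simp [basisDisplacement, displacement]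
  · rintro ⟨x', i'⟩ - hne
    by_cases hx : x = x'
    · subst hx
      have : i ≠ i' := fun h => hne (by rw [h])
      simp [basisDisplacement, this]
    · simp [basisDisplacement, hx]
  · simp

theorem linear_displacement [Fintype V] [DecidableEq V] (L : (V → R4) →ₗ[ℝ] ℝ)
    (y : V × Fin 4 → ℝ) : ∑ c, L (basisDisplacement c) * y c = L (displacement y) := by
  rw [← sum_smul_basisDisplacement, map_sum]
  exact Finset.sum_congr rfl fun c _ => by rw [map_smul, smul_eq_mul, mul_comm]

theorem IsFrame.direction {g : E → Matrix (Fin 4) (Fin 4) ℝ} (hg : K.IsFrame r g) (e : E) :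
    r (K.head e) - r (K.tail e) =
      K.edgeLength r e • (g e).toEuclideanLin (EuclideanSpace.single 0 1) := by
  ext i
  have := (hg e).2 i
  simp [Matrix.toLpLin_apply, this]

theorem edgeLength_pos (hK : K.IsClosedOrientedManifold) (hr : TetGeneric r) (e : E) :
    0 < K.edgeLength r e := by
  obtain ⟨t, h⟩ := exists_hasEdge_tail_head hK e
  exact dist_pos.2 (h.point_ne hK hr)

theorem deficit_eq_rotationOfComponents [Finite V] [Finite T] [Fintype F] (hK : K.IsClosedOrientedManifold)
    (hr : TetGeneric r) {g : E → Matrix (Fin 4) (Fin 4) ℝ} (hg : K.IsFrame r g) (dl : E → ℝ)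
    (dϑ : F → ℝ) (e : E) :
    rotationOfComponents (g e) (rotationComponents (g e) (K.deficit r dl dϑ e)) =
      K.deficit r dl dϑ e := by
  obtain ⟨h1, h2⟩ := deficit_spec hK hr dl dϑ e
  refine rotationOfComponents_rotationComponents (hg e).1 h1 ?_
  rw [hg.direction, map_smul] at h2
  exact (smul_eq_zero.1 h2).resolve_left (edgeLength_pos hK hr e).ne'

section

variable [DecidableEq V] [DecidableEq E] [DecidableEq F]

theorem complex_f₂_mulVec_inl [Fintype V] (hK : K.IsClosedOrientedManifold)
    (g : E → Matrix (Fin 4) (Fin 4) ℝ) (y : V × Fin 4 → ℝ) (e : E) :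
    (K.complex hK r g).f₂.mulVec y (Sum.inl e) =
      dLength (r (K.tail e)) (r (K.head e)) (displacement y (K.tail e))
        (displacement y (K.head e)) :=
  linear_displacement
    ((fderiv ℝ (fun q : R4 × R4 => dist q.1 q.2) (r (K.tail e), r (K.head e))).toLinearMap ∘ₗ
      (LinearMap.proj (K.tail e)).prod (LinearMap.proj (K.head e))) y

theorem complex_f₂_mulVec_inr [Fintype V] (hK : K.IsClosedOrientedManifold)
    (g : E → Matrix (Fin 4) (Fin 4) ℝ) (y : V × Fin 4 → ℝ) (f : F) :
    (K.complex hK r g).f₂.mulVec y (Sum.inr f) =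
      dHingeAngle (fun k => r (K.hinge hK f k)) (fun k => displacement y (K.hinge hK f k)) :=
  linear_displacement (dHingeLin (fun k => r (K.hinge hK f k)) ∘ₗ
    LinearMap.funLeft ℝ R4 (K.hinge hK f)) y

/-- The columns of `f₃` are deficits for unit changes only; the linearity in `deficitLin` extends
this to arbitrary changes. -/
theorem complex_f₃_mulVec [Finite V] [Finite T] [Fintype E] [Fintype F] (hK : K.IsClosedOrientedManifold)
    (hr : TetGeneric r)
    (g : E → Matrix (Fin 4) (Fin 4) ℝ) (x : E ⊕ F → ℝ) (e : E) (k : Fin 3) :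
    (K.complex hK r g).f₃.mulVec x (e, k) =
      rotationComponents (g e) (K.deficit r (x ∘ Sum.inl) (x ∘ Sum.inr) e) k := by
  let L : (E ⊕ F → ℝ) →ₗ[ℝ] ℝ :=
    { toFun := fun x => rotationComponents (g e) (deficitLin hK hr e x) k
      map_add' := fun x y => by rw [map_add, rotationComponents_add]; rfl
      map_smul' := fun s x => by rw [map_smul, rotationComponents_smul]; rfl }
  have hx : x = ∑ c, x c • (Pi.single c 1 : E ⊕ F → ℝ) := by
    ext i
    simp [Finset.sum_apply, Pi.single_apply]
  change _ = L x
  rw [hx, map_sum, ← hx]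
  exact Finset.sum_congr rfl fun c _ => by
    rw [map_smul, smul_eq_mul, mul_comm]
    rfl

theorem complex_f₄_mulVec [Fintype E] (hK : K.IsClosedOrientedManifold)
    (g : E → Matrix (Fin 4) (Fin 4) ℝ) (w : E × Fin 3 → ℝ) (x : V) (p : IndexPair) :
    (K.complex hK r g).f₄.mulVec w (x, p) =
      ∑ e, ((if K.tail e = x then 1 else 0) - (if K.head e = x then 1 else 0)) *
        rotationOfComponents (g e) (fun k => w (e, k)) p.1.1 p.1.2 := by
  rw [Matrix.mulVec, dotProduct, Fintype.sum_prod_type]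
  refine Finset.sum_congr rfl fun e _ => ?_
  have hw : (fun k => w (e, k)) = ∑ k, w (e, k) • (Pi.single k 1 : Fin 3 → ℝ) := by
    ext i
    simp [Finset.sum_apply, Pi.single_apply]
  let L : (Fin 3 → ℝ) →ₗ[ℝ] ℝ :=
    { toFun := fun c => rotationOfComponents (g e) c p.1.1 p.1.2
      map_add' := fun c c' => by rw [rotationOfComponents_add]; rfl
      map_smul' := fun s c => by rw [rotationOfComponents_smul]; rfl }
  change _ = _ * L (fun k => w (e, k))
  rw [hw, map_sum, Finset.mul_sum]
  refine Finset.sum_congr rfl fun k _ => ?_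
  rw [map_smul, smul_eq_mul]
  change _ * L (Pi.single k 1) * _ = _
  ring

theorem complex_f₃_mul_f₂ [Fintype V] [Fintype E] [Fintype F] [Finite T] (hK : K.IsClosedOrientedManifold)
    (hr : TetGeneric r) (g : E → Matrix (Fin 4) (Fin 4) ℝ) (y : V × Fin 4 → ℝ) :
    (K.complex hK r g).f₃.mulVec ((K.complex hK r g).f₂.mulVec y) = 0 := by
  ext ⟨e, k⟩
  rw [complex_f₃_mulVec hK hr]
  have h := deficit_displacement hK hr (displacement y) e
  have h1 : (K.complex hK r g).f₂.mulVec y ∘ Sum.inl = fun e =>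
      dLength (r (K.tail e)) (r (K.head e)) (displacement y (K.tail e))
        (displacement y (K.head e)) := funext fun e => complex_f₂_mulVec_inl hK g y e
  have h2 : (K.complex hK r g).f₂.mulVec y ∘ Sum.inr = fun f =>
      dHingeAngle (fun k => r (K.hinge hK f k)) (fun k => displacement y (K.hinge hK f k)) :=
    funext fun f => complex_f₂_mulVec_inr hK g y f
  rw [h1, h2, h]
  fin_cases k <;> simp [rotationComponents]

end

end TetComplex

/-! ### General position -/

theorem vol4_ne_zero_of_linearIndependent {b c d e : R4} (h : LinearIndependent ℝ ![b, c, d, e]) :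
    vol4 b c d e ≠ 0 := by
  have h1 : LinearIndependent ℝ
      ((WithLp.linearEquiv 2 ℝ (Fin 4 → ℝ)).toLinearMap ∘ ![b, c, d, e]) :=
    h.map' _ (LinearEquiv.ker _)
  have h2 : ((WithLp.linearEquiv 2 ℝ (Fin 4 → ℝ)).toLinearMap ∘ ![b, c, d, e]) =
      (Matrix.of ![fun i => b i, fun i => c i, fun i => d i, fun i => e i]).row := by
    ext i j
    fin_cases i <;> rfl
  rw [h2, Matrix.linearIndependent_rows_iff_isUnit, Matrix.isUnit_iff_isUnit_det] at h1
  exact h1.ne_zero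

theorem TetComplex.GeneralPosition.vol4_ne_zero {V : Type*} {r : V → R4}
    (hr : TetComplex.GeneralPosition r) {p : Fin 5 → V} (hp : Function.Injective p) :
    vol4 (r (p 1) - r (p 0)) (r (p 2) - r (p 0)) (r (p 3) - r (p 0)) (r (p 4) - r (p 0)) ≠ 0 := by
  have h := (affineIndependent_iff_linearIndependent_vsub ℝ _ (0 : Fin 5)).1 (hr p hp)
  let j : Fin 4 → {i : Fin 5 // i ≠ 0} := fun k => ⟨k.succ, Fin.succ_ne_zero k⟩
  have hj : Function.Injective j := fun k l hkl => Fin.succ_injective _ (congrArg Subtype.val hkl)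
  have h1 := h.comp j hj
  have e : ![r (p 1) - r (p 0), r (p 2) - r (p 0), r (p 3) - r (p 0), r (p 4) - r (p 0)] =
      (fun i : {i : Fin 5 // i ≠ 0} => r (p i) -ᵥ r (p 0)) ∘ j := by
    ext k : 1
    fin_cases k <;> rfl
  refine vol4_ne_zero_of_linearIndependent ?_
  rw [e]
  exact h1

/-- General position speaks about five points and is empty for fewer vertices. Given five different
vertices somewhere, at least one lies outside a given quadruple and completes it to a simplex of
nonzero volume. -/
theorem TetComplex.GeneralPosition.tetGeneric {V : Type*} {r : V → R4}
    (hr : TetComplex.GeneralPosition r) {q : Fin 5 → V} (hq : Function.Injective q) :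
    TetGeneric r := by
  intro p hp
  obtain ⟨k, hk⟩ : ∃ k, ∀ i, q k ≠ p i := by
    by_contra hcon
    push Not at hcon
    choose s hs using hcon
    have : Function.Injective s := fun k l h => hq (by rw [hs, hs, h])
    exact absurd (Fintype.card_le_of_injective s this) (by simp)
  obtain ⟨s, hs, h0, h1, h2, h3⟩ : ∃ s : Fin 5 → V, Function.Injective s ∧ s 0 = p 0 ∧
      s 1 = p 1 ∧ s 2 = p 2 ∧ s 3 = p 3 := by
    refine ⟨Fin.snoc p (q k), ?_, rfl, rfl, rfl, rfl⟩
    rw [Fin.snoc_injective_iff]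
    exact ⟨hp, fun ⟨i, hi⟩ => hk i hi.symm⟩
  have := hr.vol4_ne_zero hs
  rw [h0, h1, h2, h3] at this
  exact ⟨_, this⟩

/-! ### Replacing the outer vertices of a hinge -/

section

variable {V : Type*} {r : V → R4}

/-- The inverse motion realigns the second tetrahedron with the first. Subtracting a global motion
leaves the angle alone, so the reversed hinge has the same change of angle. -/
theorem IsTransition.reverse {z a b c d : V} (h : HingeRegular (r ∘ ![z, a, b, c, d]))
    {w w' : V → R4} {θ : ℝ} {v : R4} {S : Matrix (Fin 4) (Fin 4) ℝ}
    (hS : IsTransition (r ∘ ![d, a, c, b, z]) (w ∘ ![d, a, c, b, z]) (w' ∘ ![d, a, c, b, z]) θ v S) :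
    IsTransition (r ∘ ![z, a, b, c, d]) (w' ∘ ![z, a, b, c, d]) (w ∘ ![z, a, b, c, d]) θ (-v)
      (-S) := by
  obtain ⟨h0, h1, h2, h3, h4⟩ := hS
  have e : ∀ x, -v + (-S).toEuclideanLin x = -(v + S.toEuclideanLin x) := by
    intro x
    rw [map_neg, LinearMap.neg_apply]; abel
  have k1 : v + S.toEuclideanLin (r a) = w a - w' a := h1
  have k2 : v + S.toEuclideanLin (r c) = w c - w' c := h2
  have k3 : v + S.toEuclideanLin (r b) = w b - w' b := h3
  refine ⟨by rw [Matrix.transpose_neg, h0], ?_, ?_, ?_, ?_⟩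
  · exact (e _).trans ((congrArg Neg.neg k1).trans (neg_sub _ _))
  · exact (e _).trans ((congrArg Neg.neg k3).trans (neg_sub _ _))
  · exact (e _).trans ((congrArg Neg.neg k2).trans (neg_sub _ _))
  · rw [← h4, ← dHingeAngle_add_motion h h0 v, TetComplex.comp_vec_five, TetComplex.comp_vec_five r, e]
    refine Eq.trans ?_ (dHingeAngle_reverse (r z) (r a) (r b) (r c) (r d)
      (w' z + (v + S.toEuclideanLin (r z))) (w a) (w b) (w c) (w d)).symm
    congr 1
    ext l : 1
    fin_cases l
    · rfl
    · exact (congrArg (w' a + ·) k1).trans (add_sub_cancel _ _)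
    · exact (congrArg (w' b + ·) k3).trans (add_sub_cancel _ _)
    · exact (congrArg (w' c + ·) k2).trans (add_sub_cancel _ _)
    · exact neg_add_cancel_right _ _

/-- The angle at the hinge with `z` is the sum of the angle at the hinge from `z` to `y` and the old
one. In the former everything is at rest, so it does not change. -/
theorem IsTransition.replace_left {y z a b c d : V} (hy : HingeRegular (r ∘ ![y, a, b, c, d]))
    (hz : HingeRegular (r ∘ ![z, a, b, c, y]))
    {w w₁ w' : V → R4} {θ : ℝ} {v : R4} {S : Matrix (Fin 4) (Fin 4) ℝ}
    (hw : ∀ x, w x = 0) (hw₁ : ∀ x, w₁ x = 0)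
    (hS : IsTransition (r ∘ ![y, a, b, c, d]) (w ∘ ![y, a, b, c, d]) (w' ∘ ![y, a, b, c, d]) θ v S) :
    IsTransition (r ∘ ![z, a, b, c, d]) (w₁ ∘ ![z, a, b, c, d]) (w' ∘ ![z, a, b, c, d]) θ v S := by
  obtain ⟨h0, h1, h2, h3, h4⟩ := hS
  refine ⟨h0, ?_, ?_, ?_, ?_⟩
  · exact h1.trans (congrArg (· - w' a) ((hw a).trans (hw₁ a).symm))
  · exact h2.trans (congrArg (· - w' b) ((hw b).trans (hw₁ b).symm))
  · exact h3.trans (congrArg (· - w' c) ((hw c).trans (hw₁ c).symm))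
  · rw [← h4]
    simp only [TetComplex.comp_vec_five] at hy hz ⊢
    simp only [Matrix.cons_val_zero, Matrix.cons_val_one, Matrix.cons_val, hw, hw₁]
    rw [dHingeAngle_trans hz hy 0 0 0 0 0]
    rw [show (![0, 0, 0, 0, 0] : Fin 5 → R4) = 0 by ext k : 1; fin_cases k <;> rfl,
      dHingeAngle_zero, zero_add]

/-- Reverse the hinge, replace its left vertex, and reverse back. -/
theorem IsTransition.replace_right {y z a b c d : V}
    (hd : HingeRegular (r ∘ ![z, a, b, c, d])) (hyd : HingeRegular (r ∘ ![d, a, c, b, y]))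
    (hy : HingeRegular (r ∘ ![y, a, c, b, z]))
    {w w' w₁ : V → R4} {θ : ℝ} {v : R4} {S : Matrix (Fin 4) (Fin 4) ℝ}
    (hw : ∀ x, w' x = 0) (hw₁ : ∀ x, w₁ x = 0)
    (hS : IsTransition (r ∘ ![z, a, b, c, y]) (w ∘ ![z, a, b, c, y]) (w' ∘ ![z, a, b, c, y]) θ v S) :
    IsTransition (r ∘ ![z, a, b, c, d]) (w ∘ ![z, a, b, c, d]) (w₁ ∘ ![z, a, b, c, d]) θ v S := by
  have h1 := hS.reverse (z := y) (d := z) hy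
  have h2 := h1.replace_left hy hyd hw hw₁
  have h3 := h2.reverse (z := z) (d := d) hd
  rwa [neg_neg, neg_neg] at h3

theorem hingeRegular_comp {z a b c d : V} (h : TetRegular (r a) (r b) (r c) (r z))
    (h' : TetRegular (r a) (r b) (r c) (r d)) : HingeRegular (r ∘ ![z, a, b, c, d]) := by
  rw [TetComplex.comp_vec_five]
  exact hingeRegular_of_tetRegular h h'

end

namespace TetComplex

variable {V E F T E' F' T' : Type*} {K : TetComplex V E F T} {K' : TetComplex V E' F' T'}
  {r : V → R4}

theorem HasTet.swap_pairs {t : T} {a b c d : V} (h : K.HasTet t a b c d) : K.HasTet t c d a b :=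
  h.of_perm (Equiv.swap 0 2 * Equiv.swap 1 3) (by decide) (i := 2) (j := 3) (k := 0) (l := 1)
    (by decide) (by decide) (by decide) (by decide)

namespace Move23

variable (m : K.Move23 K')

/-! ### The cells of the move `2 → 3` -/

theorem vD_ne_vE (hK' : K'.IsClosedOrientedManifold) : m.vD ≠ m.vE :=
  ((m.new_tet 0).ne hK').2.2.2.2.2.symm

theorem injective_five (hK : K.IsClosedOrientedManifold) (hK' : K'.IsClosedOrientedManifold) :
    Function.Injective ![m.vE, m.abc 0, m.abc 1, m.abc 2, m.vD] := by
  obtain ⟨h1, h2, h3, h4, h5, h6⟩ := m.hABCD.ne hK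
  obtain ⟨k1, k2, k3, -⟩ := m.hEABC.ne hK
  have hD := m.vD_ne_vE hK'
  intro i j hij
  fin_cases i <;> fin_cases j <;> simp_all

theorem abc_injective (hK : K.IsClosedOrientedManifold) : Function.Injective m.abc := by
  obtain ⟨h1, h2, h3, h4, h5, h6⟩ := m.hABCD.ne hK
  intro i j hij
  fin_cases i <;> fin_cases j <;> simp_all

theorem abc_ne (hK : K.IsClosedOrientedManifold) (i : Fin 3) : m.abc i ≠ m.vD ∧ m.abc i ≠ m.vE := by
  obtain ⟨h1, h2, h3, h4, h5, h6⟩ := m.hABCD.ne hK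
  obtain ⟨k1, k2, k3, -⟩ := m.hEABC.ne hK
  fin_cases i
  · exact ⟨h3, k1.symm⟩
  · exact ⟨h5, k2.symm⟩
  · exact ⟨h6, k3.symm⟩

theorem hasTet_tABCD (i : Fin 3) :
    K.HasTet m.tABCD (m.abc i) (m.abc (i + 1)) (m.abc (i + 2)) m.vD := by
  fin_cases i
  · exact m.hABCD
  · exact m.hABCD.rotate_left
  · exact m.hABCD.rotate_left.rotate_left

theorem hasTet_tEABC (i : Fin 3) :
    K.HasTet m.tEABC m.vE (m.abc i) (m.abc (i + 1)) (m.abc (i + 2)) := by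
  fin_cases i
  · exact m.hEABC
  · exact m.hEABC.rotate
  · exact m.hEABC.rotate.rotate

/-- One of the two tetrahedra which the move removes. -/
def Removed (t : T) : Prop := t = m.tABCD ∨ t = m.tEABC

theorem tABCD_ne_tEABC (hK : K.IsClosedOrientedManifold) (hK' : K'.IsClosedOrientedManifold) :
    m.tABCD ≠ m.tEABC := by
  intro h
  have h1 := m.face_EABC
  rw [← h] at h1
  exact m.vD_ne_vE hK' (m.face_ABCD.vert_unique hK h1)

theorem removed_of_hasFace (hK : K.IsClosedOrientedManifold) (hK' : K'.IsClosedOrientedManifold)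
    {t : T} {a : V} (h : K.HasFace t a m.fABC) : m.Removed t :=
  m.face_ABCD.three hK m.face_EABC h (m.tABCD_ne_tEABC hK hK')

theorem exists_vert_old (t : {t : T // t ≠ m.tABCD ∧ t ≠ m.tEABC})
    {x : V} : (∃ i, K'.vert (m.tetMap (Sum.inl t)) i = x) ↔ ∃ i, K.vert t.1 i = x := by
  have h := exists_hasTet K t.1
  have h' := m.old_tet t _ _ _ _ h
  constructor
  · intro hx
    rcases h'.vert_mem hx with rfl | rfl | rfl | rfl <;> exact ⟨_, rfl⟩
  · rintro ⟨i, rfl⟩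
    obtain ⟨h1, h2, h3, h4⟩ := h'.exists_vert
    fin_cases i <;> assumption

theorem edge_old (hK' : K'.IsClosedOrientedManifold)
    {t : {t : T // t ≠ m.tABCD ∧ t ≠ m.tEABC}} {x y : V} {ε : E'}
    (h : K'.HasEdge (m.tetMap (Sum.inl t)) x y ε) :
    ∃ e, K.HasEdge t.1 x y e ∧ ε = m.edgeMap (some e) := by
  obtain ⟨e, he⟩ := exists_hasEdge ((m.exists_vert_old t).1 h.exists_vert.1)
    ((m.exists_vert_old t).1 h.exists_vert.2) (h.ne hK')
  exact ⟨e, he, h.unique hK' (m.old_edge _ _ _ _ he)⟩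

/-- Two vertices cannot exhaust the three vertices `A, B, C`. Each new tetrahedron omits one of
these, so every edge of a removed tetrahedron lies in some new one. -/
theorem exists_abc_ne (hK : K.IsClosedOrientedManifold) (a b : V) :
    ∃ i, a ≠ m.abc (i + 2) ∧ b ≠ m.abc (i + 2) := by
  by_contra hcon
  push Not at hcon
  have hi := m.abc_injective hK
  have h0 := hcon 0
  have h1 := hcon 1
  have h2 := hcon 2
  simp only [zero_add] at h0
  rw [show (1 : Fin 3) + 2 = 0 from rfl] at h1
  rw [show (2 : Fin 3) + 2 = 1 from rfl] at h2
  have n01 := hi.ne (a₁ := 0) (a₂ := 1) (by decide)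
  have n02 := hi.ne (a₁ := 0) (a₂ := 2) (by decide)
  have n12 := hi.ne (a₁ := 1) (a₂ := 2) (by decide)
  by_cases k0 : a = m.abc 2 <;> by_cases k1 : a = m.abc 0 <;> by_cases k2 : a = m.abc 1 <;> simp_all

theorem exists_edge_lift (hK : K.IsClosedOrientedManifold) {t : T} {a b : V} {e : E}
    (h : K.HasEdge t a b e) : ∃ t', K'.HasEdge t' a b (m.edgeMap (some e)) := by
  obtain ⟨i, h1, h2⟩ := m.exists_abc_ne hK a b
  by_cases hD : t = m.tABCD
  · subst hD
    exact ⟨_, m.new_edge_ABCD i _ _ _ h1 h2 h⟩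
  by_cases hE : t = m.tEABC
  · subst hE
    exact ⟨_, m.new_edge_EABC i _ _ _ h1 h2 h⟩
  exact ⟨_, m.old_edge ⟨t, hD, hE⟩ _ _ _ h⟩

theorem ends_some (hK : K.IsClosedOrientedManifold) (hK' : K'.IsClosedOrientedManifold) (e : E) :
    (K'.tail (m.edgeMap (some e)) = K.tail e ∧ K'.head (m.edgeMap (some e)) = K.head e) ∨
    (K'.tail (m.edgeMap (some e)) = K.head e ∧ K'.head (m.edgeMap (some e)) = K.tail e) := by
  obtain ⟨t, h⟩ := exists_hasEdge_tail_head hK e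
  obtain ⟨t', h'⟩ := m.exists_edge_lift hK h
  exact h'.ends hK'

theorem ends_none (hK' : K'.IsClosedOrientedManifold) :
    (K'.tail (m.edgeMap none) = m.vD ∧ K'.head (m.edgeMap none) = m.vE) ∨
    (K'.tail (m.edgeMap none) = m.vE ∧ K'.head (m.edgeMap none) = m.vD) :=
  (m.new_edge 0).ends hK'

/-- A pair of vertices avoiding `E` lies in `ABCD`, and a pair avoiding `D` lies in `EABC`. The only
pair avoiding neither is `D, E`. -/
theorem edge_new (hK : K.IsClosedOrientedManifold) (hK' : K'.IsClosedOrientedManifold) {i : Fin 3}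
    {x y : V} {ε : E'} (h : K'.HasEdge (m.tetMap (Sum.inr i)) x y ε) :
    ε = m.edgeMap none ∨ ∃ t e, m.Removed t ∧ K.HasEdge t x y e ∧ ε = m.edgeMap (some e) := by
  have hi := m.abc_injective hK
  have hv : ∀ z, (∃ j, K'.vert (m.tetMap (Sum.inr i)) j = z) → z ≠ m.abc (i + 2) ∧
      (z ≠ m.vE → ∃ j, K.vert m.tABCD j = z) ∧ (z ≠ m.vD → ∃ j, K.vert m.tEABC j = z) := by
    intro z hz
    obtain ⟨h1, h2, -, h4⟩ := (m.hasTet_tABCD i).exists_vert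
    obtain ⟨k1, k2, k3, -⟩ := (m.hasTet_tEABC i).exists_vert
    rcases (m.new_tet i).vert_mem hz with rfl | rfl | rfl | rfl
    · exact ⟨hi.ne ((show ∀ i : Fin 3, i ≠ i + 2 by decide) i), fun _ => h1, fun _ => k2⟩
    · exact ⟨hi.ne ((show ∀ i : Fin 3, i + 1 ≠ i + 2 by decide) i), fun _ => h2, fun _ => k3⟩
    · exact ⟨(m.abc_ne hK _).2.symm, fun h => absurd rfl h, fun _ => k1⟩
    · exact ⟨(m.abc_ne hK _).1.symm, fun _ => h4, fun h => absurd rfl h⟩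
  obtain ⟨x1, x2, x3⟩ := hv x h.exists_vert.1
  obtain ⟨y1, y2, y3⟩ := hv y h.exists_vert.2
  have hne := h.ne hK'
  by_cases hE : x ≠ m.vE ∧ y ≠ m.vE
  · obtain ⟨e, he⟩ := exists_hasEdge (x2 hE.1) (y2 hE.2) hne
    exact Or.inr ⟨_, e, Or.inl rfl, he, h.unique hK' (m.new_edge_ABCD i _ _ _ x1 y1 he)⟩
  by_cases hD : x ≠ m.vD ∧ y ≠ m.vD
  · obtain ⟨e, he⟩ := exists_hasEdge (x3 hD.1) (y3 hD.2) hne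
    exact Or.inr ⟨_, e, Or.inr rfl, he, h.unique hK' (m.new_edge_EABC i _ _ _ x1 y1 he)⟩
  left
  have hDE := m.vD_ne_vE hK'
  have : (x = m.vD ∧ y = m.vE) ∨ (x = m.vE ∧ y = m.vD) := by
    by_cases q1 : x = m.vE <;> by_cases q2 : y = m.vE <;> by_cases q3 : x = m.vD <;>
      by_cases q4 : y = m.vD <;> simp_all
  rcases this with ⟨rfl, rfl⟩ | ⟨rfl, rfl⟩
  · exact h.unique hK' (m.new_edge i)
  · exact h.unique hK' ((m.new_edge i).symm hK')

theorem new_face'' (i : Fin 3) :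
    K'.HasFace (m.tetMap (Sum.inr (i + 2))) (m.abc (i + 2)) (m.faceMap (Sum.inr i)) := by
  have := m.new_face' (i + 2)
  rwa [(show ∀ i : Fin 3, i + 2 + 1 = i by decide) i] at this

theorem new_of_hasFace_inr (hK' : K'.IsClosedOrientedManifold) {t' : T'} {a : V} {i : Fin 3}
    (h : K'.HasFace t' a (m.faceMap (Sum.inr i))) : ∃ j, t' = m.tetMap (Sum.inr j) := by
  have hne : m.tetMap (Sum.inr i) ≠ m.tetMap (Sum.inr (i + 2)) := by
    intro h
    have := Sum.inr_injective (m.tetMap.injective h)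
    exact (show ∀ i : Fin 3, i ≠ i + 2 by decide) i this
  rcases (m.new_face i).three hK' (m.new_face'' i) h hne with h | h
  · exact ⟨_, h⟩
  · exact ⟨_, h⟩

/-- The side `a` of the tetrahedron `t'` after the move comes from the side `b` of the tetrahedron
`t` before the move. -/
structure IsParent (t' : T') (a : V) (t : T) (b : V) : Prop where
  cases : ((∃ ht, t' = m.tetMap (Sum.inl ⟨t, ht⟩)) ∧ a = b) ∨
    ((∃ i, t' = m.tetMap (Sum.inr i)) ∧ m.Removed t)
  tet : ∀ x y z, K'.HasTet t' a x y z → K.HasTet t b x y z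
  edge : ∀ x y e, x ≠ b → y ≠ b → K.HasEdge t x y e → K'.HasEdge t' x y (m.edgeMap (some e))

/-- A side of an old tetrahedron is its own parent. In the `i`-th new tetrahedron the sides opposite
`abc i` and `abc (i + 1)` are new two-faces, and the other two come from the removed tetrahedra. -/
theorem exists_isParent (hK : K.IsClosedOrientedManifold) (hK' : K'.IsClosedOrientedManifold)
    {t' : T'} {a : V} {f : {f : F // f ≠ m.fABC}} (h : K'.HasFace t' a (m.faceMap (Sum.inl f))) :
    ∃ t b, K.HasFace t b f.1 ∧ m.IsParent t' a t b := by
  obtain ⟨s, rfl⟩ := m.tetMap.surjective t'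
  rcases s with t | i
  · refine ⟨t.1, a, ?_, Or.inl ⟨⟨t.2, rfl⟩, rfl⟩, ?_, ?_⟩
    · obtain ⟨f₀, hf₀⟩ := exists_hasFace ((m.exists_vert_old t).1 h.exists_vert)
      have hne : f₀ ≠ m.fABC := by
        rintro rfl
        rcases m.removed_of_hasFace hK hK' hf₀ with h | h
        · exact t.2.1 h
        · exact t.2.2 h
      have := h.unique hK' (m.old_face t a ⟨f₀, hne⟩ hf₀)
      rw [Sum.inl_injective (m.faceMap.injective this)]
      exact hf₀
    · intro x y z hT
      obtain ⟨x', y', z', hT'⟩ := exists_hasTet_of_vert ((m.exists_vert_old t).1 h.exists_vert)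
      exact (m.old_tet t _ _ _ _ hT').replace hK' hT hT'
    · intro x y e _ _ he
      exact m.old_edge t _ _ _ he
  · have hinr : ∀ j, K'.HasFace (m.tetMap (Sum.inr i)) a (m.faceMap (Sum.inr j)) → False := by
      intro j hj
      have := m.faceMap.injective (h.unique hK' hj)
      simp at this
    have hface : ∀ {t b c}, K.HasFace t b m.fABC → b ≠ c → ∀ {f}, K.HasFace t c f →
        f ≠ m.fABC := by
      rintro t b c hb hbc f hc rfl
      exact hbc (hb.vert_unique hK hc)
    rcases (m.new_tet i).vert_mem h.exists_vert with rfl | rfl | rfl | rfl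
    · exact (hinr _ (m.new_face' i)).elim
    · exact (hinr _ (m.new_face i)).elim
    -- The side opposite `E` is the side of `ABCD` opposite the vertex `abc (i + 2)` which the new
    -- tetrahedron omits. The side opposite `D` comes in the same way from `EABC`.
    · have hT := m.hasTet_tABCD i
      obtain ⟨f₀, hf₀⟩ := exists_hasFace hT.exists_vert.2.2.1
      have hne := hface m.face_ABCD (m.abc_ne hK (i + 2)).1.symm hf₀
      refine ⟨m.tABCD, m.abc (i + 2), ?_, Or.inr ⟨⟨i, rfl⟩, Or.inl rfl⟩, ?_, ?_⟩
      · have := h.unique hK' (m.new_face_ABCD i ⟨f₀, hne⟩ hf₀)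
        rw [Sum.inl_injective (m.faceMap.injective this)]
        exact hf₀
      · intro x y z hx
        exact (m.new_tet i).swap_pairs.rotate.rotate.replace hK' hx hT.swap_pairs.rotate.rotate
      · intro x y e hx hy he
        exact m.new_edge_ABCD i _ _ _ hx hy he
    · have hT := m.hasTet_tEABC i
      obtain ⟨f₀, hf₀⟩ := exists_hasFace hT.exists_vert.2.2.2
      have hne := hface m.face_EABC (m.abc_ne hK (i + 2)).2.symm hf₀
      refine ⟨m.tEABC, m.abc (i + 2), ?_, Or.inr ⟨⟨i, rfl⟩, Or.inr rfl⟩, ?_, ?_⟩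
      · have := h.unique hK' (m.new_face_EABC i ⟨f₀, hne⟩ hf₀)
        rw [Sum.inl_injective (m.faceMap.injective this)]
        exact hf₀
      · intro x y z hx
        have h1 : K'.HasTet (m.tetMap (Sum.inr i)) m.vD m.vE (m.abc (i + 1)) (m.abc i) :=
          (m.new_tet i).swap_pairs.swap_swap
        have h2 : K.HasTet m.tEABC (m.abc (i + 2)) m.vE (m.abc (i + 1)) (m.abc i) := 
          hT.swap_pairs.swap_swap.rotate.rotate
        exact h1.replace hK' hx h2
      · intro x y e hx hy he
        exact m.new_edge_EABC i _ _ _ hx hy he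

theorem exists_isHingeAt_parent (hK : K.IsClosedOrientedManifold)
    (hK' : K'.IsClosedOrientedManifold) {f : {f : F // f ≠ m.fABC}} {t t' : T'} {z a b c d : V}
    (h : K'.IsHingeAt (m.faceMap (Sum.inl f)) t t' z a b c d) :
    ∃ s s' z₀ d₀, K.IsHingeAt f.1 s s' z₀ a b c d₀ ∧ m.IsParent t z s z₀ ∧
      m.IsParent t' d s' d₀ := by
  obtain ⟨s, z₀, h1, h2⟩ := m.exists_isParent hK hK' h.face
  obtain ⟨s', d₀, h3, h4⟩ := m.exists_isParent hK hK' h.face'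
  have hT := h2.tet _ _ _ h.tet
  refine ⟨s, s', z₀, d₀, HasFace.isHingeAt hK h1 h3 ?_ hT, h2, h4⟩
  -- If both parents were the same tetrahedron, the two outer vertices would coincide as well, and
  -- that tetrahedron would have both orientations.
  rintro rfl
  obtain rfl := h1.vert_unique hK h3
  have hT' := h4.tet _ _ _ h.tet'.swap_swap.rotate_left.swap_swap
  exact hT.swap_pairs.not_swap hK hT'.swap_pairs

end Move23

theorem IsCrossing.hasEdge_of_hasFace {e : E} {f : F} {t t' s : T} {z a d y : V}
    (hK : K.IsClosedOrientedManifold) (h : K.IsCrossing e f t t' z a d) (hf : K.HasFace s y f) :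
    K.HasEdge s (K.tail e) (K.head e) e ∧ K.tail e ≠ y ∧ K.head e ≠ y := by
  rcases h.face.three hK h.face' hf h.ne with rfl | rfl
  · obtain rfl := hf.vert_unique hK h.face
    obtain ⟨-, h1, h2, -⟩ := h.tet.ne hK
    exact ⟨h.edge, h1.symm, h2.symm⟩
  · obtain rfl := hf.vert_unique hK h.face'
    obtain ⟨-, -, -, -, h1, h2⟩ := h.tet'.ne hK
    exact ⟨h.edge' hK, h1, h2⟩

end TetComplex

namespace TetComplex

variable {V E F T E' F' T' : Type*} {K : TetComplex V E F T} {K' : TetComplex V E' F' T'}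
  {r : V → R4}

/-! ### Deficits before and after the move -/

theorem IsHingeAt.tetRegular' {f : F} {t t' : T} {z a b c d : V} (h : K.IsHingeAt f t t' z a b c d)
    (hK : K.IsClosedOrientedManifold) (hr : TetGeneric r) :
    TetRegular (r a) (r b) (r c) (r d) := h.tet'.tetRegular hK hr

namespace Move23

variable (m : K.Move23 K')

/-- The changes of lengths after the move: the same as before, and zero for `DE`. -/
def extendEdges (dl : E → ℝ) (e' : E') : ℝ := (m.edgeMap.symm e').elim 0 dl

/-- The changes of angles after the move: the same as before, and zero for `ADE, BDE, CDE`. -/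
def extendFaces (dϑ : F → ℝ) (f' : F') : ℝ :=
  Sum.elim (fun f => dϑ f.1) 0 (m.faceMap.symm f')

@[simp] theorem extendEdges_some (dl : E → ℝ) (e : E) :
    m.extendEdges dl (m.edgeMap (some e)) = dl e := by
  simp [extendEdges]

@[simp] theorem extendEdges_none (dl : E → ℝ) : m.extendEdges dl (m.edgeMap none) = 0 := by
  simp [extendEdges]

@[simp] theorem extendFaces_inl (dϑ : F → ℝ) (f : {f : F // f ≠ m.fABC}) :
    m.extendFaces dϑ (m.faceMap (Sum.inl f)) = dϑ f.1 := by
  simp [extendFaces]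

@[simp] theorem extendFaces_inr (dϑ : F → ℝ) (i : Fin 3) :
    m.extendFaces dϑ (m.faceMap (Sum.inr i)) = 0 := by
  simp [extendFaces]

/-- Displacements after the move: the same as before for the old tetrahedra, zero for the new ones. -/
def extendTets (u : T → V → R4) (t' : T') : V → R4 :=
  Sum.elim (fun t => u t.1) 0 (m.tetMap.symm t')

@[simp] theorem extendTets_inl (u : T → V → R4) (t) :
    m.extendTets u (m.tetMap (Sum.inl t)) = u t.1 := by
  simp [extendTets]

@[simp] theorem extendTets_inr (u : T → V → R4) (i : Fin 3) :
    m.extendTets u (m.tetMap (Sum.inr i)) = 0 := by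
  simp [extendTets]

open Classical in
/-- The sign which compares the direction of an edge before and after the move. -/
noncomputable def edgeSign (e : E) : ℝ :=
  if K'.tail (m.edgeMap (some e)) = K.tail e then 1 else -1

/-- Rotations after the move: the same as before, up to the directions of edges. -/
noncomputable def extendRotations (W : E → F → Matrix (Fin 4) (Fin 4) ℝ) (e' : E') (f' : F') :
    Matrix (Fin 4) (Fin 4) ℝ :=
  (m.edgeMap.symm e').elim 0 fun e =>
    Sum.elim (fun f => m.edgeSign e • W e f.1) 0 (m.faceMap.symm f')

@[simp] theorem extendRotations_some_inl (W : E → F → Matrix (Fin 4) (Fin 4) ℝ) (e : E)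
    (f : {f : F // f ≠ m.fABC}) :
    m.extendRotations W (m.edgeMap (some e)) (m.faceMap (Sum.inl f)) = m.edgeSign e • W e f.1 := by
  simp [extendRotations]

@[simp] theorem extendRotations_inr (W : E → F → Matrix (Fin 4) (Fin 4) ℝ) (e' : E') (i : Fin 3) :
    m.extendRotations W e' (m.faceMap (Sum.inr i)) = 0 := by
  obtain ⟨e, rfl⟩ := m.edgeMap.surjective e'
  cases e <;> simp [extendRotations]

@[simp] theorem extendRotations_none (W : E → F → Matrix (Fin 4) (Fin 4) ℝ) (f' : F') :
    m.extendRotations W (m.edgeMap none) f' = 0 := by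
  simp [extendRotations]

theorem IsParent.extendTets {m : K.Move23 K'} {u : T → V → R4}
    (hu : ∀ t, m.Removed t → u t = 0) {t' : T'} {a : V} {t : T} {b : V} (h : m.IsParent t' a t b) :
    (m.extendTets u t' = u t ∧ a = b) ∨ (m.extendTets u t' = 0 ∧ u t = 0) := by
  rcases h.cases with ⟨⟨ht, rfl⟩, hab⟩ | ⟨⟨i, rfl⟩, ht⟩
  · exact Or.inl ⟨by simp, hab⟩
  · exact Or.inr ⟨by simp, hu t ht⟩

/-- Replacing the outer vertices of a hinge, and the corresponding displacements. -/
theorem isTransition_of_parents {m : K.Move23 K'} (hK : K.IsClosedOrientedManifold)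
    (hK' : K'.IsClosedOrientedManifold) (hr : TetGeneric r) {u : T → V → R4}
    (hu : ∀ t, m.Removed t → u t = 0) {s s' : T} {t t' : T'} {f : F} {f' : F'} {a b c y z d x : V}
    (h : K.IsHingeAt f s s' y a b c x) (h' : K'.IsHingeAt f' t t' z a b c d)
    (hz : m.IsParent t z s y) (hd : m.IsParent t' d s' x) {θ : ℝ} {v : R4}
    {S : Matrix (Fin 4) (Fin 4) ℝ}
    (hS : IsTransition (r ∘ ![y, a, b, c, x]) (u s ∘ ![y, a, b, c, x]) (u s' ∘ ![y, a, b, c, x])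
      θ v S) :
    IsTransition (r ∘ ![z, a, b, c, d]) (m.extendTets u t ∘ ![z, a, b, c, d])
      (m.extendTets u t' ∘ ![z, a, b, c, d]) θ v S := by
  have ry := h.tetRegular hK hr
  have rx := h.tetRegular' hK hr
  have rz := h'.tetRegular hK' hr
  have rd := h'.tetRegular' hK' hr
  have ry' := h.reverse.tetRegular' hK hr
  have rx' := h.reverse.tetRegular hK hr
  have rz' := h'.reverse.tetRegular' hK' hr
  have rd' := h'.reverse.tetRegular hK' hr
  have h1 : IsTransition (r ∘ ![z, a, b, c, x]) (m.extendTets u t ∘ ![z, a, b, c, x])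
      (u s' ∘ ![z, a, b, c, x]) θ v S := by
    rcases hz.extendTets hu with ⟨e1, rfl⟩ | ⟨e1, e2⟩
    · rw [e1]; exact hS
    · refine hS.replace_left (hingeRegular_comp ry rx) (hingeRegular_comp rz ry) ?_ ?_
      · intro w; rw [e2]; rfl
      · intro w; rw [e1]; rfl
  rcases hd.extendTets hu with ⟨e1, rfl⟩ | ⟨e1, e2⟩
  · rw [e1]; exact h1
  · refine h1.replace_right (hingeRegular_comp rz rd) (hingeRegular_comp rd' rx')
      (hingeRegular_comp rx' rz') ?_ ?_
    · intro w; rw [e2]; rfl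
    · intro w; rw [e1]; rfl

/-- Old two-faces keep their vertices, but an outer vertex may change from one point of `A, B, C, D,
E` to another. All removed and new tetrahedra are at rest, so the same transition still works by
`isTransition_of_parents`. At the new two-faces both sides are at rest and the transition is zero.
-/
theorem isDeformation_extend (hK : K.IsClosedOrientedManifold) (hK' : K'.IsClosedOrientedManifold)
    (hr : TetGeneric r) {dl : E → ℝ} {dϑ : F → ℝ} {u : T → V → R4}
    {W : E → F → Matrix (Fin 4) (Fin 4) ℝ} (h : K.IsDeformation r dl dϑ u W)
    (hdl : ∀ t a b e, m.Removed t → K.HasEdge t a b e → dl e = 0)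
    (hu : ∀ t, m.Removed t → u t = 0) :
    K'.IsDeformation r (m.extendEdges dl) (m.extendFaces dϑ) (m.extendTets u)
      (m.extendRotations W) := by
  refine ⟨?_, ?_, ?_⟩
  · intro t' a b ε hε
    obtain ⟨s, rfl⟩ := m.tetMap.surjective t'
    rcases s with t | i
    · obtain ⟨e, he, rfl⟩ := m.edge_old hK' hε
      rw [extendTets_inl, extendEdges_some]
      exact h.length _ _ _ _ he
    · rw [extendTets_inr, Pi.zero_apply, Pi.zero_apply, dLength_zero]
      rcases m.edge_new hK hK' hε with rfl | ⟨t, e, ht, he, rfl⟩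
      · rw [extendEdges_none]
      · rw [extendEdges_some, hdl t _ _ e ht he]
  · have hzero : ∀ {e' f' t t' z a d}, K'.IsCrossing e' f' t t' z a d →
        (∃ i, t = m.tetMap (Sum.inr i)) → (∃ i, t' = m.tetMap (Sum.inr i)) →
        ∃ v, IsTransition (r ∘ ![z, a, K'.tail e', K'.head e', d])
          (m.extendTets u t ∘ ![z, a, K'.tail e', K'.head e', d])
          (m.extendTets u t' ∘ ![z, a, K'.tail e', K'.head e', d]) 0 v 0 := by
      rintro e' f' t t' z a d hc ⟨i, rfl⟩ ⟨j, rfl⟩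
      refine ⟨0, by simp, by simp, by simp, by simp, ?_⟩
      convert dHingeAngle_zero _
      ext k : 1
      fin_cases k <;> simp
    intro e' f' t t' z a d hc
    obtain ⟨o, rfl⟩ := m.edgeMap.surjective e'
    obtain ⟨q, rfl⟩ := m.faceMap.surjective f'
    rcases q with f | i
    swap
    · rw [extendFaces_inr, extendRotations_inr]
      exact hzero hc (m.new_of_hasFace_inr hK' hc.face) (m.new_of_hasFace_inr hK' hc.face')
    rcases o with _ | e
    -- Only new tetrahedra contain `DE`, and their sides through `DE` are new two-faces. So no old
    -- two-face is crossed around it.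
    · have hnew : ∀ {t x y}, K'.HasEdge t x y (m.edgeMap none) →
          ∃ i, t = m.tetMap (Sum.inr i) := by
        intro t x y ht
        obtain ⟨s, rfl⟩ := m.tetMap.surjective t
        rcases s with t | i
        · obtain ⟨e, -, he⟩ := m.edge_old hK' ht
          have := m.edgeMap.injective he
          simp at this
        · exact ⟨i, rfl⟩
      exfalso
      obtain ⟨i, rfl⟩ := hnew hc.edge
      have hz : z ≠ m.vE ∧ z ≠ m.vD := by
        obtain ⟨-, n1, n2, -⟩ := hc.tet.ne hK'
        rcases m.ends_none hK' with ⟨h1, h2⟩ | ⟨h1, h2⟩ <;> rw [h1] at n1 <;> rw [h2] at n2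
        · exact ⟨n2, n1⟩
        · exact ⟨n1, n2⟩
      have hinr : ∀ j, ¬ K'.HasFace (m.tetMap (Sum.inr i)) z (m.faceMap (Sum.inr j)) := by
        intro j hj
        have := m.faceMap.injective (hc.face.unique hK' hj)
        simp at this
      rcases (m.new_tet i).vert_mem hc.face.exists_vert with rfl | rfl | rfl | rfl
      · exact hinr _ (m.new_face' i)
      · exact hinr _ (m.new_face i)
      · exact hz.1 rfl
      · exact hz.2 rfl
    · rw [extendFaces_inl, extendRotations_some_inl]
      obtain ⟨s, s', y, x, hh, hp, hp'⟩ := m.exists_isHingeAt_parent hK hK' hc.toIsHingeAt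
      have hedge : K.HasEdge s (K'.tail (m.edgeMap (some e))) (K'.head (m.edgeMap (some e))) e := by
        obtain ⟨-, n1, n2, -, -, n3⟩ := hh.tet.ne hK
        obtain ⟨-, -, m1, m2⟩ := hh.tet.exists_vert
        obtain ⟨ε, hε⟩ := exists_hasEdge m1 m2 n3
        have := m.edgeMap.injective (hc.edge.unique hK' (hp.edge _ _ _ n1.symm n2.symm hε))
        obtain rfl := Option.some_inj.1 this
        exact hε
      rcases m.ends_some hK hK' e with ⟨h1, h2⟩ | ⟨h1, h2⟩
      · have hs : m.edgeSign e = 1 := if_pos h1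
        rw [hs, one_smul]
        have hcr := hc.toIsHingeAt
        rw [h1, h2] at hedge hcr hh ⊢
        obtain ⟨v, hv⟩ := h.transition _ _ _ _ _ _ _ ⟨hh, hedge⟩
        exact ⟨v, isTransition_of_parents hK hK' hr hu hh hcr hp hp' hv⟩
      -- When the auxiliary direction of the edge is reversed, so is the revolution around it, and
      -- transitions change sign.
      · have hs : m.edgeSign e = -1 := if_neg (by rw [h1]; exact (tail_ne_head hK e).symm)
        rw [hs, neg_one_smul]
        have hcr := hc.toIsHingeAt
        rw [h1, h2] at hedge hcr hh ⊢
        have hedge' : K.HasEdge s' (K.tail e) (K.head e) e := by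
          obtain ⟨-, n1, n2, -⟩ := hh.tet.ne hK
          exact (hh.face.hasEdge hK hh.face' n1.symm n2.symm hedge).symm hK
        obtain ⟨v, hv⟩ := h.transition _ _ _ _ _ _ _ ⟨hh.reverse, hedge'⟩
        exact ⟨-v, isTransition_of_parents hK hK' hr hu hh hcr hp hp'
          (hv.reverse (hh.hingeRegular hK hr))⟩
  · intro e' f' hn
    obtain ⟨o, rfl⟩ := m.edgeMap.surjective e'
    obtain ⟨q, rfl⟩ := m.faceMap.surjective f'
    rcases q with f | i
    swap
    · simp
    rcases o with _ | e
    · simp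
    rw [extendRotations_some_inl, h.zero, smul_zero]
    rintro ⟨s, s', y, a, x, hc⟩
    apply hn
    obtain ⟨t, t', ht⟩ := exists_isHingeAt_hinge hK' (m.faceMap (Sum.inl f))
    obtain ⟨p, p', y', x', hh, hp, -⟩ := m.exists_isHingeAt_parent hK hK' ht
    obtain ⟨he, n1, n2⟩ := hc.hasEdge_of_hasFace hK hh.face
    have hv : ∀ w, (∃ i, K.vert p i = w) → w ≠ y' → w ≠ K'.hinge hK' (m.faceMap (Sum.inl f)) 0 := by
      intro w hw hwy
      obtain ⟨m1, m2, m3, -⟩ := ht.tet.ne hK'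
      rcases hh.tet.vert_mem hw with rfl | rfl | rfl | rfl
      · exact absurd rfl hwy
      · exact m1.symm
      · exact m2.symm
      · exact m3.symm
    exact isCrossing_of_hasEdge hK' ht.face (hv _ he.exists_vert.1 n1) (hv _ he.exists_vert.2 n2)
      (hp.edge _ _ _ n1 n2 he)

variable [Fintype F] [Fintype F'] [Finite V] [Finite T] [Finite T']

/-- If the lengths of the edges of `ABCDE` other than `DE` and the angle at `ABC` do not change,
then the deficits after the move are those before the move. -/
theorem deficit_extend (hK : K.IsClosedOrientedManifold) (hK' : K'.IsClosedOrientedManifold)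
    (hr : TetGeneric r) {dl : E → ℝ} {dϑ : F → ℝ}
    (hdl : ∀ t a b e, m.Removed t → K.HasEdge t a b e → dl e = 0) (hϑ : dϑ m.fABC = 0) :
    (∀ e, K'.deficit r (m.extendEdges dl) (m.extendFaces dϑ) (m.edgeMap (some e)) =
      m.edgeSign e • K.deficit r dl dϑ e) ∧
    K'.deficit r (m.extendEdges dl) (m.extendFaces dϑ) (m.edgeMap none) = 0 := by
  classical
  obtain ⟨u₀, hu₀⟩ := exists_length hK hr dl
  -- The removed tetrahedra may be kept at rest because none of their lengths changes. This is what
  -- allows new tetrahedra at rest to take their place.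
  let u : T → V → R4 := fun t => if m.Removed t then 0 else u₀ t
  have hu : ∀ t, m.Removed t → u t = 0 := fun t ht => if_pos ht
  have hul : ∀ t a b ε, K.HasEdge t a b ε → dLength (r a) (r b) (u t a) (u t b) = dl ε := by
    intro t a b ε hε
    by_cases ht : m.Removed t
    · rw [hu t ht, Pi.zero_apply, Pi.zero_apply, dLength_zero, hdl t a b ε ht hε]
    · simp only [u, if_neg ht]
      exact hu₀ t a b ε hε
  obtain ⟨W, hW⟩ := exists_isDeformation hK hr dϑ hul
  have hW' := m.isDeformation_extend hK hK' hr hW hdl hu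
  -- The two-face that disappears contributed nothing: both of its tetrahedra are at rest and its
  -- angle is constant, so zero is the transition.
  have hABC : ∀ e, W e m.fABC = 0 := by
    intro e
    by_cases hc : ∃ t t' z a d, K.IsCrossing e m.fABC t t' z a d
    swap
    · exact hW.zero e _ hc
    obtain ⟨t, t', z, a, d, hc⟩ := hc
    obtain ⟨v, hv⟩ := hW.transition _ _ _ _ _ _ _ hc
    refine (hv.unique (hc.hingeRegular hK hr) (hc.tet'.tetRegular hK hr) (w := 0) (R := 0) ?_).2
    rw [hu t (m.removed_of_hasFace hK hK' hc.face), hu t' (m.removed_of_hasFace hK hK' hc.face'),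
      hϑ]
    refine ⟨by simp, by simp, by simp, by simp, ?_⟩
    convert dHingeAngle_zero _
    ext k : 1
    fin_cases k <;> simp
  refine ⟨fun e => ?_, ?_⟩
  · rw [hW'.deficit_eq hK' hr, hW.deficit_eq hK hr, ← m.faceMap.sum_comp, Fintype.sum_sum_type,
      Fintype.sum_eq_add_sum_subtype_ne _ m.fABC, hABC, zero_add, Finset.smul_sum]
    simp
  · rw [hW'.deficit_eq hK' hr]
    simp

end Move23

end TetComplex

namespace TetComplex

variable {V E F T E' F' T' : Type*} {K : TetComplex V E F T} {K' : TetComplex V E' F' T'}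
  {r : V → R4}

/-! ### Displacements of the five vertices of the move -/

theorem displacement_eq (Y : V → R4) : displacement (fun c : V × Fin 4 => Y c.1 c.2) = Y := rfl

theorem HasEdge.dLength_ends {t : T} {a b : V} {e : E} (h : K.HasEdge t a b e)
    (hK : K.IsClosedOrientedManifold) (hr : TetGeneric r) (Y : V → R4) :
    dLength (r (K.tail e)) (r (K.head e)) (Y (K.tail e)) (Y (K.head e)) =
      dLength (r a) (r b) (Y a) (Y b) := by
  rcases h.ends hK with ⟨h1, h2⟩ | ⟨h1, h2⟩
  · rw [h1, h2]
  · rw [h1, h2, dLength_comm (h.point_ne hK hr)]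

theorem dHingeAngle_comp_motion {p : Fin 5 → V} (h : HingeRegular (r ∘ p)) {Y : V → R4} {v : R4}
    {S : Matrix (Fin 4) (Fin 4) ℝ} (hS : S.transpose = -S)
    (hY : ∀ k, Y (p k) = v + S.toEuclideanLin (r (p k))) : dHingeAngle (r ∘ p) (Y ∘ p) = 0 := by
  rw [show Y ∘ p = fun k => v + S.toEuclideanLin ((r ∘ p) k) from funext hY]
  exact dHingeAngle_motion h hS v

theorem dHingeAngle_comp_trans {z a b c d w : V} (h : HingeRegular (r ∘ ![z, a, b, c, d]))
    (h' : HingeRegular (r ∘ ![d, a, b, c, w])) (Y : V → R4) :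
    dHingeAngle (r ∘ ![z, a, b, c, w]) (Y ∘ ![z, a, b, c, w]) =
      dHingeAngle (r ∘ ![z, a, b, c, d]) (Y ∘ ![z, a, b, c, d]) +
        dHingeAngle (r ∘ ![d, a, b, c, w]) (Y ∘ ![d, a, b, c, w]) := by
  simp only [comp_vec_five] at h h' ⊢
  exact dHingeAngle_trans h h' _ _ _ _ _ _

/-- If a displacement preserves all edge lengths of a tetrahedron, then it is a motion there. -/
theorem HasTet.exists_motion {t : T} {a b c d : V} (h : K.HasTet t a b c d)
    (hK : K.IsClosedOrientedManifold) (hr : TetGeneric r) {Y : V → R4}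
    (hY : ∀ x y e, K.HasEdge t x y e → dLength (r x) (r y) (Y x) (Y y) = 0) :
    ∃ v S, S.transpose = -S ∧ ∀ x, (∃ i, K.vert t i = x) →
      Y x = v + Matrix.toEuclideanLin S (r x) := by
  have key : ∀ x y, (∃ i, K.vert t i = x) → (∃ i, K.vert t i = y) → x ≠ y →
      inner ℝ (r x - r y) (Y x - Y y) = 0 := by
    intro x y hx hy hxy
    obtain ⟨e, he⟩ := exists_hasEdge hx hy hxy
    have h0 := hY x y e he
    have hne := he.point_ne hK hr
    rw [dLength_eq hne, div_eq_zero_iff] at h0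
    exact h0.resolve_right (dist_ne_zero.2 hne)
  obtain ⟨n1, n2, n3, n4, n5, n6⟩ := h.ne hK
  obtain ⟨ha, hb, hc, hd⟩ := h.exists_vert
  obtain ⟨v, S, hS, h0, h1, h2, h3⟩ := (h.tetRegular hK hr).exists_motion
    (key a b ha hb n1) (key a c ha hc n2) (key a d ha hd n3) (key b c hb hc n4)
    (key b d hb hd n5) (key c d hc hd n6)
  refine ⟨v, S, hS, fun x hx => ?_⟩
  rcases h.vert_mem hx with rfl | rfl | rfl | rfl <;> assumption

namespace Move23

variable (m : K.Move23 K')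

theorem isHingeAt_fABC (hK : K.IsClosedOrientedManifold) (hK' : K'.IsClosedOrientedManifold) :
    K.IsHingeAt m.fABC m.tEABC m.tABCD m.vE (m.abc 0) (m.abc 1) (m.abc 2) m.vD :=
  ⟨(m.tABCD_ne_tEABC hK hK').symm, m.hEABC, m.hABCD, m.face_EABC, m.face_ABCD⟩

/-- The vertices `A, B, C, D, E`. -/
def IsVertex (x : V) : Prop :=
  (∃ i, K.vert m.tABCD i = x) ∨ ∃ i, K.vert m.tEABC i = x

theorem isVertex_removed {t : T} (ht : m.Removed t) {x : V} (hx : ∃ i, K.vert t i = x) :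
    m.IsVertex x := by
  rcases ht with rfl | rfl
  · exact Or.inl hx
  · exact Or.inr hx

theorem isVertex_new {i : Fin 3} {x : V} (hx : ∃ j, K'.vert (m.tetMap (Sum.inr i)) j = x) :
    m.IsVertex x := by
  obtain ⟨h1, h2, -, h4⟩ := (m.hasTet_tABCD i).exists_vert
  rcases (m.new_tet i).vert_mem hx with rfl | rfl | rfl | rfl
  · exact Or.inl h1
  · exact Or.inl h2
  · exact Or.inr m.hEABC.exists_vert.1
  · exact Or.inl h4

/-- The edges of `ABCDE` before the move, and the two-face `ABC`. -/
def Inner : E ⊕ F → Prop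
  | Sum.inl e => ∃ t a b, m.Removed t ∧ K.HasEdge t a b e
  | Sum.inr f => f = m.fABC

/-- The lengths make the displacement a motion on each of the two tetrahedra. These motions agree on
`ABC`, and since the angle there is constant, uniqueness of transitions makes them equal. -/
theorem exists_motion_of_inner (hK : K.IsClosedOrientedManifold)
    (hK' : K'.IsClosedOrientedManifold) (hr : TetGeneric r) {Y : V → R4}
    (hl : ∀ e, m.Inner (Sum.inl e) →
      dLength (r (K.tail e)) (r (K.head e)) (Y (K.tail e)) (Y (K.head e)) = 0)
    (hϑ : dHingeAngle (fun k => r (K.hinge hK m.fABC k)) (fun k => Y (K.hinge hK m.fABC k)) = 0) :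
    ∃ v S, S.transpose = -S ∧ ∀ x, m.IsVertex x → Y x = v + Matrix.toEuclideanLin S (r x) := by
  have hh := m.isHingeAt_fABC hK hK'
  rw [hh.dHingeAngle_eq hK] at hϑ
  have hl' : ∀ t, m.Removed t → ∀ x y e, K.HasEdge t x y e →
      dLength (r x) (r y) (Y x) (Y y) = 0 := fun t ht x y e he => by
    rw [← he.dLength_ends hK hr, hl e ⟨t, x, y, ht, he⟩]
  obtain ⟨v, S, hS, h1⟩ := m.hEABC.exists_motion hK hr (hl' _ (Or.inr rfl))
  obtain ⟨w, R, hR, h2⟩ := m.hABCD.exists_motion hK hr (hl' _ (Or.inl rfl))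
  obtain ⟨hE, hA, hB, hC⟩ := m.hEABC.exists_vert
  obtain ⟨kA, kB, kC, kD⟩ := m.hABCD.exists_vert
  have hd : ∀ x, (w - v) + (R - S).toEuclideanLin x =
      (w + R.toEuclideanLin x) - (v + S.toEuclideanLin x) := by
    intro x
    rw [map_sub, LinearMap.sub_apply]; abel
  have h0 : ∀ x, (∃ i, K.vert m.tEABC i = x) → (∃ i, K.vert m.tABCD i = x) →
      (w - v) + (R - S).toEuclideanLin (r x) = (0 : R4) - 0 := by
    intro x hx hx'
    rw [hd, ← h1 x hx, ← h2 x hx', sub_self, sub_zero]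
  have hreg := hh.hingeRegular hK hr
  have := IsTransition.unique hreg (m.hABCD.tetRegular hK hr) (u := 0) (u' := 0) (θ := 0)
    (v := w - v) (S := R - S) (w := 0) (R := 0) ⟨?_, h0 _ hA kA, h0 _ hB kB, h0 _ hC kC, ?_⟩
    ⟨by simp, by simp, by simp, by simp, ?_⟩
  · obtain ⟨e1, e2⟩ := this
    rw [sub_eq_zero] at e1 e2
    subst e1 e2
    refine ⟨w, R, hR, fun x hx => ?_⟩
    rcases hx with hx | hx
    · exact h2 x hx
    · exact h1 x hx
  · rw [Matrix.transpose_sub, hS, hR]; abel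
  · rw [← hϑ, ← dHingeAngle_add_motion hreg hS v]
    congr 1
    ext k : 1
    fin_cases k
    · exact (zero_add _).trans (h1 _ hE).symm
    · exact (zero_add _).trans (h1 _ hA).symm
    · exact (zero_add _).trans (h1 _ hB).symm
    · exact (zero_add _).trans (h1 _ hC).symm
    · change 0 + (w - v + (R - S).toEuclideanLin (r m.vD)) + (v + S.toEuclideanLin (r m.vD)) =
        Y m.vD
      rw [hd, h2 _ kD]; abel
  · convert dHingeAngle_zero _
    ext k : 1
    fin_cases k <;> simp

/-- Displace the two tetrahedra separately as the lengths require, then align them along `ABC` with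
the prescribed change of the angle. -/
theorem exists_displacement_of_inner (hK : K.IsClosedOrientedManifold)
    (hK' : K'.IsClosedOrientedManifold) (hr : TetGeneric r) (dl : E → ℝ) (θ : ℝ) :
    ∃ Y : V → R4, (∀ e, m.Inner (Sum.inl e) →
      dLength (r (K.tail e)) (r (K.head e)) (Y (K.tail e)) (Y (K.head e)) = dl e) ∧
    dHingeAngle (fun k => r (K.hinge hK m.fABC k)) (fun k => Y (K.hinge hK m.fABC k)) = θ := by
  classical
  have hh := m.isHingeAt_fABC hK hK'
  obtain ⟨u, hu⟩ := exists_length hK hr dl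
  obtain ⟨W, hW⟩ := exists_isDeformation hK hr (fun _ => θ) hu
  have hlen : ∀ x y, (∃ i, K.vert m.tEABC i = x) → (∃ i, K.vert m.tEABC i = y) → x ≠ y →
      x ≠ m.vE → y ≠ m.vE →
      inner ℝ (r x - r y) (u m.tEABC x - u m.tEABC y) =
        inner ℝ (r x - r y) (u m.tABCD x - u m.tABCD y) := by
    intro x y hx hy hxy hxz hyz
    obtain ⟨ε, hε⟩ := exists_hasEdge hx hy hxy
    rw [← dLength_eq_iff (hε.point_ne hK hr), hu _ _ _ _ hε,
      hu m.tABCD _ _ _ (hh.face.hasEdge hK hh.face' hxz hyz hε)]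
  obtain ⟨n1, n2, n3, n4, n5, n6⟩ := m.hEABC.ne hK
  obtain ⟨-, m1, m2, m3⟩ := m.hEABC.exists_vert
  obtain ⟨v, S, hS, s1, s2, s3, s4⟩ := exists_isTransition (hh.hingeRegular hK hr)
    (hh.tet'.tetRegular hK hr)
    (u := u m.tEABC ∘ ![m.vE, m.abc 0, m.abc 1, m.abc 2, m.vD])
    (u' := u m.tABCD ∘ ![m.vE, m.abc 0, m.abc 1, m.abc 2, m.vD])
    (hlen _ _ m1 m2 n4 n1.symm n2.symm) (hlen _ _ m1 m3 n5 n1.symm n3.symm)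
    (hlen _ _ m2 m3 n6 n2.symm n3.symm) θ
  -- The vertices of `EABC` keep their displacements, and `D` moves with the aligned tetrahedron
  -- `ABCD`. On `A, B, C` the two prescriptions coincide.
  let Y : V → R4 := fun x => if x = m.vD then u m.tABCD x + (v + S.toEuclideanLin (r x)) else
    u m.tEABC x
  have hYE : ∀ x, x ≠ m.vD → Y x = u m.tEABC x := fun x hx => if_neg hx
  have hYD : Y m.vD = u m.tABCD m.vD + (v + S.toEuclideanLin (r m.vD)) := if_pos rfl
  have hDE := m.vD_ne_vE hK'
  have hv : ∀ x, (∃ i, K.vert m.tABCD i = x) →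
      Y x = u m.tABCD x + (v + S.toEuclideanLin (r x)) := by
    intro x hx
    rcases m.hABCD.vert_mem hx with rfl | rfl | rfl | rfl
    · rw [hYE _ (m.abc_ne hK 0).1]; exact eq_add_of_sub_eq' s1.symm
    · rw [hYE _ (m.abc_ne hK 1).1]; exact eq_add_of_sub_eq' s2.symm
    · rw [hYE _ (m.abc_ne hK 2).1]; exact eq_add_of_sub_eq' s3.symm
    · exact hYD
  have hE : ∀ x, (∃ i, K.vert m.tEABC i = x) → x ≠ m.vD := by
    intro x hx
    rcases m.hEABC.vert_mem hx with rfl | rfl | rfl | rfl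
    · exact hDE.symm
    · exact (m.abc_ne hK 0).1
    · exact (m.abc_ne hK 1).1
    · exact (m.abc_ne hK 2).1
  refine ⟨Y, ?_, ?_⟩
  · rintro e ⟨t, a, b, rfl | rfl, he⟩ <;> rw [he.dLength_ends hK hr]
    · rw [hv a he.exists_vert.1, hv b he.exists_vert.2, dLength_add (he.point_ne hK hr),
        dLength_motion (he.point_ne hK hr) hS, add_zero, hu _ _ _ _ he]
    · rw [hYE a (hE a he.exists_vert.1), hYE b (hE b he.exists_vert.2), hu _ _ _ _ he]
  · rw [hh.dHingeAngle_eq hK, ← s4]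
    congr 1
    ext k : 1
    fin_cases k
    · exact hYE _ hDE.symm
    · exact hYE _ (m.abc_ne hK 0).1
    · exact hYE _ (m.abc_ne hK 1).1
    · exact hYE _ (m.abc_ne hK 2).1
    · exact hYD

/-- The change of the angle at an old two-face is the same before and after the move, if the
displacement is a motion on `A, B, C, D, E`. -/
theorem dHingeAngle_old (hK : K.IsClosedOrientedManifold) (hK' : K'.IsClosedOrientedManifold)
    (hr : TetGeneric r) {Y : V → R4} {v : R4} {S : Matrix (Fin 4) (Fin 4) ℝ}
    (hS : S.transpose = -S) (hY : ∀ x, m.IsVertex x → Y x = v + S.toEuclideanLin (r x))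
    (f : {f : F // f ≠ m.fABC}) :
    dHingeAngle (fun k => r (K'.hinge hK' (m.faceMap (Sum.inl f)) k))
      (fun k => Y (K'.hinge hK' (m.faceMap (Sum.inl f)) k)) =
    dHingeAngle (fun k => r (K.hinge hK f.1 k)) (fun k => Y (K.hinge hK f.1 k)) := by
  obtain ⟨t, t', h'⟩ := exists_isHingeAt_hinge hK' (m.faceMap (Sum.inl f))
  rw [h'.dHingeAngle_eq hK']
  generalize K'.hinge hK' (m.faceMap (Sum.inl f)) 0 = z at *
  generalize K'.hinge hK' (m.faceMap (Sum.inl f)) 1 = a at *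
  generalize K'.hinge hK' (m.faceMap (Sum.inl f)) 2 = b at *
  generalize K'.hinge hK' (m.faceMap (Sum.inl f)) 3 = c at *
  generalize K'.hinge hK' (m.faceMap (Sum.inl f)) 4 = d at *
  obtain ⟨s, s', y, x, h, hz, hd⟩ := m.exists_isHingeAt_parent hK hK' h'
  rw [h.dHingeAngle_eq hK]
  have ry := h.tetRegular hK hr
  have rx := h.tetRegular' hK hr
  have rz := h'.tetRegular hK' hr
  have rd := h'.tetRegular' hK' hr
  have key : ∀ {t z s y}, m.IsParent t z s y → K.HasTet s y a b c → K'.HasTet t z a b c →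
      z ≠ y → ∀ k, Y (![z, a, b, c, y] k) = v + S.toEuclideanLin (r (![z, a, b, c, y] k)) := by
    intro t z s y hp hs ht hzy
    rcases hp.cases with ⟨-, h⟩ | ⟨⟨i, rfl⟩, hrem⟩
    · exact absurd h hzy
    · obtain ⟨h1, h2, h3, h4⟩ := ht.exists_vert
      intro k
      fin_cases k
      · exact hY _ (m.isVertex_new h1)
      · exact hY _ (m.isVertex_new h2)
      · exact hY _ (m.isVertex_new h3)
      · exact hY _ (m.isVertex_new h4)
      · exact hY _ (m.isVertex_removed hrem hs.exists_vert.1)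
  have key' : ∀ {t z s y}, m.IsParent t z s y → K.HasTet s y a c b → K'.HasTet t z a c b →
      z ≠ y → ∀ k, Y (![y, a, b, c, z] k) = v + S.toEuclideanLin (r (![y, a, b, c, z] k)) := by
    intro t z s y hp hs ht hzy
    rcases hp.cases with ⟨-, h⟩ | ⟨⟨i, rfl⟩, hrem⟩
    · exact absurd h hzy
    · obtain ⟨h1, h2, h3, h4⟩ := ht.exists_vert
      intro k
      fin_cases k
      · exact hY _ (m.isVertex_removed hrem hs.exists_vert.1)
      · exact hY _ (m.isVertex_new h2)
      · exact hY _ (m.isVertex_new h4)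
      · exact hY _ (m.isVertex_new h3)
      · exact hY _ (m.isVertex_new h1)
  -- The outer vertices are exchanged one at a time. By additivity each exchange costs the change of
  -- angle of a hinge with all vertices among `A, B, C, D, E`, and this vanishes for a motion.
  have e1 : dHingeAngle (r ∘ ![z, a, b, c, d]) (Y ∘ ![z, a, b, c, d]) =
      dHingeAngle (r ∘ ![y, a, b, c, d]) (Y ∘ ![y, a, b, c, d]) := by
    by_cases hzy : z = y
    · rw [hzy]
    · rw [dHingeAngle_comp_trans (hingeRegular_comp rz ry) (hingeRegular_comp ry rd),
        dHingeAngle_comp_motion (hingeRegular_comp rz ry) hS (key hz h.tet h'.tet hzy), zero_add]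
  have e2 : dHingeAngle (r ∘ ![y, a, b, c, d]) (Y ∘ ![y, a, b, c, d]) =
      dHingeAngle (r ∘ ![y, a, b, c, x]) (Y ∘ ![y, a, b, c, x]) := by
    by_cases hdx : d = x
    · rw [hdx]
    · rw [dHingeAngle_comp_trans (hingeRegular_comp ry rx) (hingeRegular_comp rx rd),
        dHingeAngle_comp_motion (hingeRegular_comp rx rd) hS
          (key' hd h.reverse.tet h'.reverse.tet hdx), add_zero]
  rw [e1, e2]

/-- Both tetrahedra at a new two-face are new, so the whole hinge lies among the five points and
moves rigidly. -/
theorem dHingeAngle_new (hK' : K'.IsClosedOrientedManifold)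
    (hr : TetGeneric r) {Y : V → R4} {v : R4} {S : Matrix (Fin 4) (Fin 4) ℝ}
    (hS : S.transpose = -S) (hY : ∀ x, m.IsVertex x → Y x = v + S.toEuclideanLin (r x))
    (i : Fin 3) :
    dHingeAngle (fun k => r (K'.hinge hK' (m.faceMap (Sum.inr i)) k))
      (fun k => Y (K'.hinge hK' (m.faceMap (Sum.inr i)) k)) = 0 := by
  obtain ⟨t, t', h'⟩ := exists_isHingeAt_hinge hK' (m.faceMap (Sum.inr i))
  rw [h'.dHingeAngle_eq hK']
  refine dHingeAngle_comp_motion (h'.hingeRegular hK' hr) hS fun k => hY _ ?_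
  obtain ⟨j, rfl⟩ := m.new_of_hasFace_inr hK' h'.face
  obtain ⟨j', rfl⟩ := m.new_of_hasFace_inr hK' h'.face'
  obtain ⟨h1, h2, h3, h4⟩ := h'.tet.exists_vert
  fin_cases k
  · exact m.isVertex_new h1
  · exact m.isVertex_new h2
  · exact m.isVertex_new h3
  · exact m.isVertex_new h4
  · exact m.isVertex_new h'.tet'.exists_vert.2.2.2

theorem dLength_some (hK : K.IsClosedOrientedManifold) (hK' : K'.IsClosedOrientedManifold)
    (hr : TetGeneric r) (Y : V → R4) (e : E) :
    dLength (r (K'.tail (m.edgeMap (some e)))) (r (K'.head (m.edgeMap (some e))))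
      (Y (K'.tail (m.edgeMap (some e)))) (Y (K'.head (m.edgeMap (some e)))) =
    dLength (r (K.tail e)) (r (K.head e)) (Y (K.tail e)) (Y (K.head e)) := by
  obtain ⟨t, h⟩ := exists_hasEdge_tail_head hK e
  obtain ⟨t', h'⟩ := m.exists_edge_lift hK h
  exact h'.dLength_ends hK' hr Y

theorem dLength_none (hK' : K'.IsClosedOrientedManifold) (hr : TetGeneric r) (Y : V → R4) :
    dLength (r (K'.tail (m.edgeMap none))) (r (K'.head (m.edgeMap none)))
      (Y (K'.tail (m.edgeMap none))) (Y (K'.head (m.edgeMap none))) =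
    dLength (r m.vD) (r m.vE) (Y m.vD) (Y m.vE) :=
  (m.new_edge 0).dLength_ends hK' hr Y

/-- If the lengths of the nine edges do not change and the angle at `ABC` changes with speed one,
this determines the change of the length of `DE`. -/
theorem abs_dLength_none (hK : K.IsClosedOrientedManifold) (hK' : K'.IsClosedOrientedManifold)
    (hr : TetGeneric r) {Y : V → R4} (hl : ∀ e, m.Inner (Sum.inl e) →
      dLength (r (K.tail e)) (r (K.head e)) (Y (K.tail e)) (Y (K.head e)) = 0)
    (hϑ : dHingeAngle (fun k => r (K.hinge hK m.fABC k)) (fun k => Y (K.hinge hK m.fABC k)) = 1) :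
    |dLength (r m.vD) (r m.vE) (Y m.vD) (Y m.vE)| =
      |vol4 (r (m.abc 0) - r m.vE) (r (m.abc 1) - r m.vE) (r (m.abc 2) - r m.vE)
        (r m.vD - r m.vE)| /
      (√(gram2 (r (m.abc 1) - r (m.abc 0)) (r (m.abc 2) - r (m.abc 0))) *
        dist (r m.vD) (r m.vE)) := by
  classical
  have hh := m.isHingeAt_fABC hK hK'
  set J := planeRotation (r (m.abc 1) - r (m.abc 0)) (r (m.abc 2) - r (m.abc 0)) with hJ
  -- A model displacement: only `D` moves, rotating around `ABC` with unit speed. It has the same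
  -- nine length changes and the same angle change as `Y`, so `Y - Z` is a motion on the five points
  -- and `DE` may be computed from `Z`.
  let Z : V → R4 := Pi.single m.vD (J.toEuclideanLin (r m.vD - r (m.abc 0)))
  have hDE := m.vD_ne_vE hK'
  have hne : r m.vD ≠ r m.vE := (m.new_edge 0).point_ne hK' hr
  have hZ0 : ∀ x, x ≠ m.vD → Z x = 0 := fun x hx => Pi.single_eq_of_ne hx _
  have hZD : Z m.vD = J.toEuclideanLin (r m.vD - r (m.abc 0)) := Pi.single_eq_same _ _
  have hJS : J.transpose = -J := planeRotation_transpose _ _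
  have hZm : ∀ x, (∃ i, K.vert m.tABCD i = x) →
      Z x = -J.toEuclideanLin (r (m.abc 0)) + J.toEuclideanLin (r x) := by
    intro x hx
    have e : -J.toEuclideanLin (r (m.abc 0)) + J.toEuclideanLin (r x) =
        J.toEuclideanLin (r x - r (m.abc 0)) := by rw [map_sub]; abel
    rw [e]
    rcases m.hABCD.vert_mem hx with rfl | rfl | rfl | rfl
    · rw [hZ0 _ (m.abc_ne hK 0).1, sub_self, map_zero]
    · rw [hZ0 _ (m.abc_ne hK 1).1, hJ, planeRotation_left]
    · rw [hZ0 _ (m.abc_ne hK 2).1, hJ, planeRotation_right]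
    · exact hZD
  have hZE : ∀ x, (∃ i, K.vert m.tEABC i = x) → Z x = 0 := by
    intro x hx
    rcases m.hEABC.vert_mem hx with rfl | rfl | rfl | rfl
    · exact hZ0 _ hDE.symm
    · exact hZ0 _ (m.abc_ne hK 0).1
    · exact hZ0 _ (m.abc_ne hK 1).1
    · exact hZ0 _ (m.abc_ne hK 2).1
  have hsub : ∀ {x y : V}, r x ≠ r y → dLength (r x) (r y) ((Y - Z) x) ((Y - Z) y) =
      dLength (r x) (r y) (Y x) (Y y) - dLength (r x) (r y) (Z x) (Z y) := by
    intro x y hxy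
    rw [eq_sub_iff_add_eq, ← dLength_add hxy, Pi.sub_apply, Pi.sub_apply, sub_add_cancel,
      sub_add_cancel]
  have h1 : ∀ e, m.Inner (Sum.inl e) →
      dLength (r (K.tail e)) (r (K.head e)) ((Y - Z) (K.tail e)) ((Y - Z) (K.head e)) = 0 := by
    rintro e he
    have hne := (edgeLength_pos hK hr e)
    rw [hsub (dist_pos.1 hne), hl e he, zero_sub, neg_eq_zero]
    obtain ⟨t, a, b, rfl | rfl, he⟩ := he <;> rw [he.dLength_ends hK hr]
    · rw [hZm _ he.exists_vert.1, hZm _ he.exists_vert.2, dLength_motion (he.point_ne hK hr) hJS]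
    · rw [hZE _ he.exists_vert.1, hZE _ he.exists_vert.2, dLength_zero]
  have h2 : dHingeAngle (fun k => r (K.hinge hK m.fABC k))
      (fun k => (Y - Z) (K.hinge hK m.fABC k)) = 0 := by
    refine (dHingeAngle_sub _ (fun k => Y (K.hinge hK m.fABC k))
      (fun k => Z (K.hinge hK m.fABC k))).trans ?_
    rw [hϑ, hh.dHingeAngle_eq hK, sub_eq_zero,
      ← dHingeAngle_rotation (hh.hingeRegular hK hr)]
    congr 1
    ext k : 1
    fin_cases k
    · symm; simpa using hZ0 _ hDE.symm
    · symm; simpa using hZ0 _ (m.abc_ne hK 0).1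
    · symm; simpa using hZ0 _ (m.abc_ne hK 1).1
    · symm; simpa using hZ0 _ (m.abc_ne hK 2).1
    · symm; simpa [hJ] using hZD
  obtain ⟨v, S, hS, hm⟩ := m.exists_motion_of_inner hK hK' hr h1 h2
  have h0 := dLength_motion hne hS v
  rw [← hm _ (Or.inl m.hABCD.exists_vert.2.2.2), ← hm _ (Or.inr m.hEABC.exists_vert.1),
    hsub hne, sub_eq_zero] at h0
  rw [h0, hZD, hZ0 _ hDE.symm, dLength_eq hne, sub_zero, planeRotation_apply, inner_smul_right,
    inner_dualBivector]
  have hv : vol4 (r (m.abc 1) - r (m.abc 0)) (r (m.abc 2) - r (m.abc 0))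
      (r m.vD - r (m.abc 0)) (r m.vD - r m.vE) =
      -vol4 (r (m.abc 0) - r m.vE) (r (m.abc 1) - r m.vE) (r (m.abc 2) - r m.vE)
        (r m.vD - r m.vE) := by
    simp only [vol4_eq, PiLp.sub_apply]
    ring
  rw [hv, abs_div, abs_mul, abs_neg, abs_inv, abs_of_nonneg (Real.sqrt_nonneg _),
    abs_of_nonneg (dist_nonneg (x := r m.vD)), inv_mul_eq_div, div_div]

end Move23

end TetComplex

namespace TetComplex

variable {V E F T E' F' T' : Type*} {K : TetComplex V E F T} {K' : TetComplex V E' F' T'}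
  {r : V → R4}

namespace Move23

variable (m : K.Move23 K')

/-! ### The comparison of the spaces of lengths and angles -/

/-- The changes of lengths and angles after the move: the same as before for the old cells, and
zero for the new ones. -/
noncomputable def extendLin : (E ⊕ F → ℝ) →ₗ[ℝ] (E' ⊕ F' → ℝ) where
  toFun x := Sum.elim (m.extendEdges (x ∘ Sum.inl)) (m.extendFaces (x ∘ Sum.inr))
  map_add' x y := by
    ext q
    rcases q with e' | f'
    · obtain ⟨o, rfl⟩ := m.edgeMap.surjective e'
      cases o <;> simp
    · obtain ⟨s, rfl⟩ := m.faceMap.surjective f'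
      cases s <;> simp
  map_smul' s x := by
    ext q
    rcases q with e' | f'
    · obtain ⟨o, rfl⟩ := m.edgeMap.surjective e'
      cases o <;> simp
    · obtain ⟨s, rfl⟩ := m.faceMap.surjective f'
      cases s <;> simp

@[simp] theorem extendLin_some (x : E ⊕ F → ℝ) (e : E) :
    m.extendLin x (Sum.inl (m.edgeMap (some e))) = x (Sum.inl e) := m.extendEdges_some _ _

@[simp] theorem extendLin_none (x : E ⊕ F → ℝ) :
    m.extendLin x (Sum.inl (m.edgeMap none)) = 0 := m.extendEdges_none _

@[simp] theorem extendLin_old (x : E ⊕ F → ℝ) (f : {f : F // f ≠ m.fABC}) :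
    m.extendLin x (Sum.inr (m.faceMap (Sum.inl f))) = x (Sum.inr f.1) := m.extendFaces_inl _ _

@[simp] theorem extendLin_new (x : E ⊕ F → ℝ) (i : Fin 3) :
    m.extendLin x (Sum.inr (m.faceMap (Sum.inr i))) = 0 := m.extendFaces_inr _ _

/-- The edge `DE` takes the place of the two-face `ABC`. -/
noncomputable def cellEquiv [DecidableEq F] : (E ⊕ F) ⊕ Fin 3 ≃ E' ⊕ F' :=
  (Equiv.sumAssoc E F (Fin 3)).trans <|
    ((Equiv.refl E).sumCongr (((((Equiv.optionSubtypeNe m.fABC).symm.trans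
      (Equiv.optionEquivSumPUnit.{0} _)).trans (Equiv.sumComm _ _)).sumCongr
        (Equiv.refl (Fin 3))).trans (Equiv.sumAssoc _ _ _))).trans <|
    (Equiv.sumAssoc E PUnit.{1} _).symm.trans <|
    ((Equiv.optionEquivSumPUnit.{0} E).symm.trans m.edgeMap).sumCongr m.faceMap

@[simp] theorem cellEquiv_edge [DecidableEq F] (e : E) :
    m.cellEquiv (Sum.inl (Sum.inl e)) = Sum.inl (m.edgeMap (some e)) := rfl

@[simp] theorem cellEquiv_removed [DecidableEq F] :
    m.cellEquiv (Sum.inl (Sum.inr m.fABC)) = Sum.inl (m.edgeMap none) := by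
  simp [cellEquiv]

theorem cellEquiv_face [DecidableEq F] (f : {f : F // f ≠ m.fABC}) :
    m.cellEquiv (Sum.inl (Sum.inr f.1)) = Sum.inr (m.faceMap (Sum.inl f)) := by
  simp [cellEquiv, f.2]

@[simp] theorem cellEquiv_new [DecidableEq F] (i : Fin 3) :
    m.cellEquiv (Sum.inr i) = Sum.inr (m.faceMap (Sum.inr i)) := rfl

variable [Fintype V] [DecidableEq V] [DecidableEq E] [DecidableEq F]

/-- The section factors through the restriction to the inner components, so that it vanishes
whenever they do. Then every other basis vector is simply extended by zero, and the determinant can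
be read off. -/
theorem exists_section (hK : K.IsClosedOrientedManifold)
    (hK' : K'.IsClosedOrientedManifold) (hr : TetGeneric r) (g : E → Matrix (Fin 4) (Fin 4) ℝ) :
    ∃ σ : (E ⊕ F → ℝ) →ₗ[ℝ] (V × Fin 4 → ℝ),
      (∀ x q, m.Inner q → (K.complex hK r g).f₂.mulVec (σ x) q = x q) ∧
      ∀ x, (∀ q, m.Inner q → x q = 0) → σ x = 0 := by
  let ρ : (E ⊕ F → ℝ) →ₗ[ℝ] ({q // m.Inner q} → ℝ) := LinearMap.funLeft ℝ ℝ Subtype.val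
  let L := ρ ∘ₗ (K.complex hK r g).f₂.mulVecLin
  have hL : LinearMap.range L = ⊤ := by
    rw [LinearMap.range_eq_top]
    intro x
    classical
    let dl : E → ℝ := fun e => if h : m.Inner (Sum.inl e) then x ⟨_, h⟩ else 0
    obtain ⟨Y, hY, hθ⟩ := m.exists_displacement_of_inner hK hK' hr dl (x ⟨Sum.inr m.fABC, rfl⟩)
    refine ⟨fun c => Y c.1 c.2, ?_⟩
    ext ⟨q, hq⟩
    change (K.complex hK r g).f₂.mulVec (fun c => Y c.1 c.2) q = _
    rcases q with e | f
    · rw [complex_f₂_mulVec_inl, displacement_eq, hY e hq]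
      exact dif_pos hq
    · obtain rfl : f = m.fABC := hq
      rw [complex_f₂_mulVec_inr, displacement_eq, hθ]
  obtain ⟨s, hs⟩ := L.exists_rightInverse_of_surjective hL
  refine ⟨s ∘ₗ ρ, fun x q hq => ?_, fun x hx => ?_⟩
  · exact congrFun (LinearMap.congr_fun hs (ρ x)) ⟨q, hq⟩
  · have : ρ x = 0 := funext fun q => hx q.1 q.2
    rw [LinearMap.comp_apply, this, map_zero]

variable [DecidableEq E'] [DecidableEq F']

theorem f₂_mulVec_some (hK : K.IsClosedOrientedManifold) (hK' : K'.IsClosedOrientedManifold)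
    (hr : TetGeneric r) (g : E → Matrix (Fin 4) (Fin 4) ℝ) (g' : E' → Matrix (Fin 4) (Fin 4) ℝ)
    (y : V × Fin 4 → ℝ) (e : E) :
    (K'.complex hK' r g').f₂.mulVec y (Sum.inl (m.edgeMap (some e))) =
      (K.complex hK r g).f₂.mulVec y (Sum.inl e) := by
  rw [complex_f₂_mulVec_inl, complex_f₂_mulVec_inl, m.dLength_some hK hK' hr]

/-- Such a displacement is a motion on the five points, so `DE` and the new angles do not change,
and the old angles change as they did before the move. -/
theorem f₂_mulVec_of_inner (hK : K.IsClosedOrientedManifold) (hK' : K'.IsClosedOrientedManifold)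
    (hr : TetGeneric r) (g : E → Matrix (Fin 4) (Fin 4) ℝ) (g' : E' → Matrix (Fin 4) (Fin 4) ℝ)
    {y : V × Fin 4 → ℝ} (hy : ∀ q, m.Inner q → (K.complex hK r g).f₂.mulVec y q = 0) :
    (K'.complex hK' r g').f₂.mulVec y = m.extendLin ((K.complex hK r g).f₂.mulVec y) := by
  have hl : ∀ e, m.Inner (Sum.inl e) → dLength (r (K.tail e)) (r (K.head e))
      (displacement y (K.tail e)) (displacement y (K.head e)) = 0 := fun e he => by
    rw [← complex_f₂_mulVec_inl hK g, hy _ he]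
  have hϑ := hy (Sum.inr m.fABC) rfl
  rw [complex_f₂_mulVec_inr] at hϑ
  obtain ⟨v, S, hS, h⟩ := m.exists_motion_of_inner hK hK' hr hl hϑ
  ext q
  rcases q with e' | f'
  · obtain ⟨o, rfl⟩ := m.edgeMap.surjective e'
    rcases o with _ | e
    · rw [extendLin_none, complex_f₂_mulVec_inl, m.dLength_none hK' hr,
        h _ (Or.inl m.hABCD.exists_vert.2.2.2), h _ (Or.inr m.hEABC.exists_vert.1),
        dLength_motion ((m.new_edge 0).point_ne hK' hr) hS]
    · rw [extendLin_some, m.f₂_mulVec_some hK hK' hr g g']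
  · obtain ⟨s, rfl⟩ := m.faceMap.surjective f'
    rcases s with f | i
    · rw [extendLin_old, complex_f₂_mulVec_inr, complex_f₂_mulVec_inr,
        m.dHingeAngle_old hK hK' hr hS h]
    · rw [extendLin_new, complex_f₂_mulVec_inr, m.dHingeAngle_new hK' hr hS h]

/-- The comparison map from the changes of lengths and angles before the move to those after it. -/
noncomputable def transferLin (hK : K.IsClosedOrientedManifold) (hK' : K'.IsClosedOrientedManifold)
    (r : V → R4) (g : E → Matrix (Fin 4) (Fin 4) ℝ) (g' : E' → Matrix (Fin 4) (Fin 4) ℝ)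
    (σ : (E ⊕ F → ℝ) →ₗ[ℝ] (V × Fin 4 → ℝ)) : (E ⊕ F → ℝ) →ₗ[ℝ] (E' ⊕ F' → ℝ) :=
  m.extendLin + ((K'.complex hK' r g').f₂.mulVecLin -
    m.extendLin ∘ₗ (K.complex hK r g).f₂.mulVecLin) ∘ₗ σ

theorem transferLin_apply (hK : K.IsClosedOrientedManifold) (hK' : K'.IsClosedOrientedManifold)
    (g : E → Matrix (Fin 4) (Fin 4) ℝ) (g' : E' → Matrix (Fin 4) (Fin 4) ℝ)
    (σ : (E ⊕ F → ℝ) →ₗ[ℝ] (V × Fin 4 → ℝ)) (x : E ⊕ F → ℝ) :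
    m.transferLin hK hK' r g g' σ x = m.extendLin x + ((K'.complex hK' r g').f₂.mulVec (σ x) -
      m.extendLin ((K.complex hK r g).f₂.mulVec (σ x))) := rfl

/-- The displacements `y` and `σ (f₂ y)` have the same inner components, so `f₂_mulVec_of_inner`
applies to their difference. This is exactly the defect of commutation. -/
theorem transferLin_f₂ (hK : K.IsClosedOrientedManifold) (hK' : K'.IsClosedOrientedManifold)
    (hr : TetGeneric r) (g : E → Matrix (Fin 4) (Fin 4) ℝ) (g' : E' → Matrix (Fin 4) (Fin 4) ℝ)
    {σ : (E ⊕ F → ℝ) →ₗ[ℝ] (V × Fin 4 → ℝ)}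
    (hσ : ∀ x q, m.Inner q → (K.complex hK r g).f₂.mulVec (σ x) q = x q) (y : V × Fin 4 → ℝ) :
    m.transferLin hK hK' r g g' σ ((K.complex hK r g).f₂.mulVec y) =
      (K'.complex hK' r g').f₂.mulVec y := by
  set z := σ ((K.complex hK r g).f₂.mulVec y) with hz
  have h := m.f₂_mulVec_of_inner hK hK' hr g g' (y := y - z) fun q hq => by
    rw [Matrix.mulVec_sub, Pi.sub_apply, hz, hσ _ q hq, sub_self]
  rw [Matrix.mulVec_sub, Matrix.mulVec_sub, map_sub] at h
  rw [transferLin_apply, ← hz, ← sub_eq_zero]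
  rw [← sub_eq_zero] at h
  rw [← neg_eq_zero, ← h]
  abel

/-- The unit vectors of the angles at the new two-faces. -/
def newFaces : Matrix (E' ⊕ F') (Fin 3) ℝ :=
  Matrix.of fun q i => if q = Sum.inr (m.faceMap (Sum.inr i)) then 1 else 0

/-- The comparison matrix of the spaces of lengths and angles. -/
noncomputable def transferMatrix [Fintype E] [Fintype F] (hK : K.IsClosedOrientedManifold)
    (hK' : K'.IsClosedOrientedManifold) (r : V → R4) (g : E → Matrix (Fin 4) (Fin 4) ℝ)
    (g' : E' → Matrix (Fin 4) (Fin 4) ℝ) (σ : (E ⊕ F → ℝ) →ₗ[ℝ] (V × Fin 4 → ℝ)) :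
    Matrix (E' ⊕ F') ((E ⊕ F) ⊕ Fin 3) ℝ :=
  Matrix.fromCols (LinearMap.toMatrix' (m.transferLin hK hK' r g g' σ)) m.newFaces

theorem f₂_eq_transferMatrix_mul [Fintype E] [Fintype F]
    (hK : K.IsClosedOrientedManifold)
    (hK' : K'.IsClosedOrientedManifold)
    (hr : TetGeneric r) (g : E → Matrix (Fin 4) (Fin 4) ℝ) (g' : E' → Matrix (Fin 4) (Fin 4) ℝ)
    {σ : (E ⊕ F → ℝ) →ₗ[ℝ] (V × Fin 4 → ℝ)}
    (hσ : ∀ x q, m.Inner q → (K.complex hK r g).f₂.mulVec (σ x) q = x q) :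
    (K'.complex hK' r g').f₂ = m.transferMatrix hK hK' r g g' σ *
      (Matrix.fromRows (K.complex hK r g).f₂ 0 : Matrix ((E ⊕ F) ⊕ Fin 3) (V × Fin 4) ℝ) := by
  rw [transferMatrix, Matrix.fromCols_mul_fromRows, Matrix.mul_zero, add_zero]
  refine Matrix.ext_of_mulVec_single fun c => ?_
  rw [← Matrix.mulVec_mulVec, LinearMap.toMatrix'_mulVec, m.transferLin_f₂ hK hK' hr g g' hσ]

/-- Old lengths are preserved and the added columns are unit vectors, so the matrix is block
triangular with identity blocks. In the block of two-faces only the column of `ABC` differs from the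
identity, and its diagonal entry lies in the row of `DE`. -/
theorem det_transferMatrix [Fintype E] [Fintype F] (hK : K.IsClosedOrientedManifold)
    (hK' : K'.IsClosedOrientedManifold) (hr : TetGeneric r)
    (g : E → Matrix (Fin 4) (Fin 4) ℝ) (g' : E' → Matrix (Fin 4) (Fin 4) ℝ)
    {σ : (E ⊕ F → ℝ) →ₗ[ℝ] (V × Fin 4 → ℝ)}
    (hσ' : ∀ x, (∀ q, m.Inner q → x q = 0) → σ x = 0) :
    ((m.transferMatrix hK hK' r g g' σ).submatrix m.cellEquiv id).det =
      (K'.complex hK' r g').f₂.mulVec (σ (Pi.single (Sum.inr m.fABC) 1))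
        (Sum.inl (m.edgeMap none)) := by
  set L := m.transferLin hK hK' r g g' σ with hL
  have hf : ∀ f, f ≠ m.fABC → L (Pi.single (Sum.inr f) 1) =
      m.extendLin (Pi.single (Sum.inr f) 1) := fun f hf => by
    have h : ∀ q, m.Inner q → (Pi.single (Sum.inr f) 1 : E ⊕ F → ℝ) q = 0 := fun q hq => by
      refine Pi.single_eq_of_ne ?_ _
      rintro rfl
      exact hf hq
    rw [hL, transferLin_apply, hσ' _ h, Matrix.mulVec_zero, Matrix.mulVec_zero, map_zero,
      sub_zero, add_zero]
  let D : Matrix F F ℝ := (1 : Matrix F F ℝ).updateCol m.fABC fun f =>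
    L (Pi.single (Sum.inr m.fABC) 1) (m.cellEquiv (Sum.inl (Sum.inr f)))
  have key : (m.transferMatrix hK hK' r g g' σ).submatrix m.cellEquiv id =
      Matrix.fromBlocks (Matrix.fromBlocks 1 0 (Matrix.of fun f e =>
        L (Pi.single (Sum.inl e) 1) (m.cellEquiv (Sum.inl (Sum.inr f)))) D) 0
        (Matrix.of fun i q => L (Pi.single q 1) (Sum.inr (m.faceMap (Sum.inr i)))) 1 := by
    have hnew : ∀ q : E ⊕ F, ∀ i, m.newFaces (m.cellEquiv (Sum.inl q)) i = 0 := fun q i => by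
      rw [newFaces, Matrix.of_apply, if_neg]
      rw [← m.cellEquiv_new, m.cellEquiv.apply_eq_iff_eq]
      exact Sum.inl_ne_inr
    have hedge : ∀ q e, L (Pi.single q 1) (Sum.inl (m.edgeMap (some e))) =
        Pi.single (M := fun _ => ℝ) q (1 : ℝ) (Sum.inl e) := fun q e => by
      rw [hL, transferLin_apply, Pi.add_apply, Pi.sub_apply, extendLin_some, extendLin_some,
        m.f₂_mulVec_some hK hK' hr g g', sub_self, add_zero]
    ext p q
    rcases q with q | i
    · rw [Matrix.submatrix_apply, transferMatrix, id, Matrix.fromCols_apply_inl,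
        LinearMap.toMatrix'_apply]
      rcases p with (e | f) | i
      · rcases q with e' | f
        · rw [cellEquiv_edge, ← hL, hedge]
          simp [Pi.single_apply, Matrix.one_apply]
        · rw [cellEquiv_edge, ← hL, hedge]
          simp
      · rcases q with e' | f'
        · rfl
        · change L (Pi.single (Sum.inr f') 1) _ = D f f'
          rcases eq_or_ne f' m.fABC with rfl | hf'
          · simp [D]
          · have hD : D f f' = (1 : Matrix F F ℝ) f f' := Matrix.updateCol_ne hf'
            rw [hf f' hf', hD]
            rcases eq_or_ne f m.fABC with rfl | hf''
            · rw [cellEquiv_removed, extendLin_none, Matrix.one_apply_ne hf'.symm]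
            · rw [m.cellEquiv_face ⟨f, hf''⟩, extendLin_old]
              simp [Pi.single_apply, Matrix.one_apply]
      · rfl
    · rw [Matrix.submatrix_apply, transferMatrix, id, Matrix.fromCols_apply_inr]
      rcases p with p | j
      · rw [hnew]
        rfl
      · simp [newFaces, Matrix.one_apply, eq_comm]
  rw [key, Matrix.det_fromBlocks_zero₁₂, Matrix.det_fromBlocks_zero₁₂, Matrix.det_one,
    Matrix.det_one, one_mul, mul_one]
  -- By Cramer's rule for the identity matrix, replacing one column leaves the entry in that
  -- position as the determinant.
  change ((1 : Matrix F F ℝ).updateCol m.fABC _).det = _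
  rw [← Matrix.cramer_apply, Matrix.cramer_one, Module.End.one_apply, cellEquiv_removed, hL,
    transferLin_apply, Pi.add_apply, Pi.sub_apply, extendLin_none, extendLin_none, sub_zero,
    zero_add]

theorem abs_det_transferMatrix [Fintype E] [Fintype F] (hK : K.IsClosedOrientedManifold)
    (hK' : K'.IsClosedOrientedManifold) (hr : TetGeneric r)
    (g : E → Matrix (Fin 4) (Fin 4) ℝ) (g' : E' → Matrix (Fin 4) (Fin 4) ℝ)
    {σ : (E ⊕ F → ℝ) →ₗ[ℝ] (V × Fin 4 → ℝ)}
    (hσ : ∀ x q, m.Inner q → (K.complex hK r g).f₂.mulVec (σ x) q = x q)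
    (hσ' : ∀ x, (∀ q, m.Inner q → x q = 0) → σ x = 0) :
    |((m.transferMatrix hK hK' r g g' σ).submatrix m.cellEquiv id).det| =
      |vol4 (r (m.abc 0) - r m.vE) (r (m.abc 1) - r m.vE) (r (m.abc 2) - r m.vE)
        (r m.vD - r m.vE)| / (√(gram2 (r (m.abc 1) - r (m.abc 0)) (r (m.abc 2) - r (m.abc 0))) *
          dist (r m.vD) (r m.vE)) := by
  rw [m.det_transferMatrix hK hK' hr g g' hσ', complex_f₂_mulVec_inl, m.dLength_none hK' hr,
    m.abs_dLength_none hK hK' hr]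
  · intro e he
    rw [← complex_f₂_mulVec_inl hK g, hσ _ _ he]
    exact Pi.single_eq_of_ne (by simp) _
  · rw [← complex_f₂_mulVec_inr hK g, hσ _ (Sum.inr m.fABC) rfl, Pi.single_eq_same]

end Move23

end TetComplex

/-! ### Triangles under permutation of their vertices -/

theorem gram2_symm (b c : R4) : gram2 c b = gram2 b c := by
  simp only [gram2, R4.inner_eq]
  ring

theorem planeRotation_swap (b c : R4) : planeRotation c b = -planeRotation b c := by
  rw [planeRotation, planeRotation, gram2_symm, ← smul_neg]
  congr 1
  ext i j
  fin_cases i <;> fin_cases j <;> simp [dualBivector] <;> ring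

theorem gram2_cyclic (a b c : R4) : gram2 (b - a) (c - a) = gram2 (a - c) (b - c) := by
  simp only [gram2, R4.inner_eq, PiLp.sub_apply]
  ring

theorem planeRotation_cyclic (a b c : R4) :
    planeRotation (b - a) (c - a) = planeRotation (a - c) (b - c) := by
  rw [planeRotation, planeRotation, gram2_cyclic]
  congr 1
  ext i j
  fin_cases i <;> fin_cases j <;> simp [dualBivector] <;> ring

namespace TetComplex

variable {V E F T E' F' T' : Type*} {K : TetComplex V E F T} {K' : TetComplex V E' F' T'}
  {r : V → R4}

theorem complex_f₃_face [DecidableEq V] [DecidableEq E] [DecidableEq F] (hK : K.IsClosedOrientedManifold)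
    (g : E → Matrix (Fin 4) (Fin 4) ℝ) (e : E) (k : Fin 3) (f : F) :
    (K.complex hK r g).f₃ (e, k) (Sum.inr f) =
      rotationComponents (g e) (K.deficit r 0 (Pi.single f 1) e) k := by
  simp only [complex, Matrix.of_apply]
  congr 3
  ext f'
  simp [Pi.single_apply]

section

variable [Finite V] [Finite T] [Fintype F] [DecidableEq F]

/-! ### Deficit angles when the angle at a single two-face changes -/

theorem deficit_single_of_isCrossing (hK : K.IsClosedOrientedManifold) (hr : TetGeneric r) {e : E}
    {f : F} {t t' : T} {z a d : V} (h : K.IsCrossing e f t t' z a d) :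
    K.deficit r 0 (Pi.single f 1) e = planeRotation (r (K.tail e) - r a) (r (K.head e) - r a) := by
  obtain ⟨W, hW, h0, h1⟩ := isDeformation_single hK hr f
  rw [← h1 e t t' z a d h, ← Finset.sum_eq_single_of_mem f (Finset.mem_univ f) fun f' _ hf =>
    h0 e f' hf, ← hW.deficit_eq hK hr]
  congr
  funext
  exact Subsingleton.elim _ _

theorem deficit_single_eq_zero (hK : K.IsClosedOrientedManifold) (hr : TetGeneric r) {e : E}
    {f : F} (h : ¬ ∃ t t' z a d, K.IsCrossing e f t t' z a d) :
    K.deficit r 0 (Pi.single f 1) e = 0 := by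
  obtain ⟨W, hW, h0, -⟩ := isDeformation_single hK hr f
  rw [← hW.zero e f h, ← Finset.sum_eq_single_of_mem f (Finset.mem_univ f) fun f' _ hf =>
    h0 e f' hf, ← hW.deficit_eq hK hr]
  congr
  funext
  exact Subsingleton.elim _ _

/-- The contribution `±1` of an edge from `a` to `b` at the vertex `x`. -/
def boundarySign [DecidableEq V] (a b x : V) : ℝ := (if a = x then 1 else 0) - if b = x then 1 else 0

/-- If the auxiliary direction of the edge is opposite to `a → b`, the rotation and the boundary
sign both change sign, so the product does not depend on the direction. -/
theorem boundarySign_smul_deficit_single [DecidableEq V] (hK : K.IsClosedOrientedManifold)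
    (hr : TetGeneric r) {e : E}
    {f : F} {t t' : T} {z a b c d : V} (h : K.IsHingeAt f t t' z a b c d) (he : K.HasEdge t a b e)
    (x : V) :
    boundarySign (K.tail e) (K.head e) x • K.deficit r 0 (Pi.single f 1) e =
      boundarySign a b x • planeRotation (r a - r c) (r b - r c) := by
  rcases he.ends hK with ⟨h1, h2⟩ | ⟨h1, h2⟩
  · have hc : K.IsCrossing e f t t' z c d :=
      { toIsHingeAt := by rw [h1, h2]; exact h.rotate.rotate
        edge := by rwa [h1, h2] }
    rw [deficit_single_of_isCrossing hK hr hc, h1, h2]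
  · obtain ⟨n1, n2, -⟩ := h.tet.ne hK
    have hc : K.IsCrossing e f t' t d c z :=
      { toIsHingeAt := by rw [h1, h2]; exact h.reverse.rotate
        edge := by
          rw [h1, h2]
          exact (h.face.hasEdge hK h.face' n1.symm n2.symm he).symm hK }
    rw [deficit_single_of_isCrossing hK hr hc, h1, h2, planeRotation_swap, smul_neg, ← neg_smul]
    congr 1
    simp [boundarySign]

/-- The boundary of the infinitesimal rotations produced by a single two-face vanishes. -/
theorem sum_boundarySign_smul_deficit_single [DecidableEq V] [Fintype E]
    (hK : K.IsClosedOrientedManifold) (hr : TetGeneric r) (f : F) (x : V) :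
    ∑ e, boundarySign (K.tail e) (K.head e) x • K.deficit r 0 (Pi.single f 1) e = 0 := by
  classical
  obtain ⟨t, t', z, a, b, c, d, h⟩ : ∃ t t' z a b c d, K.IsHingeAt f t t' z a b c d := by
    obtain ⟨q, t, t', h1, h2, h3, h4, h5⟩ := hK.exists_isHinge f
    exact ⟨t, t', _, _, _, _, _, h1, h2, h3, h4, h5⟩
  have ht := h.tet
  have hz := h.face
  obtain ⟨va, vb, vc⟩ := ht.exists_vert.2
  obtain ⟨-, -, -, nab, nac, nbc⟩ := ht.ne hK
  obtain ⟨e₁, h₁⟩ := exists_hasEdge va vb nab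
  obtain ⟨e₂, h₂⟩ := exists_hasEdge vb vc nbc
  obtain ⟨e₃, h₃⟩ := exists_hasEdge vc va nac.symm
  have n12 : e₁ ≠ e₂ := by
    rintro rfl
    rcases h₁.ends hK with ⟨p1, p2⟩ | ⟨p1, p2⟩ <;> rcases h₂.ends hK with ⟨q1, q2⟩ | ⟨q1, q2⟩ <;>
      simp_all
  have n13 : e₁ ≠ e₃ := by
    rintro rfl
    rcases h₁.ends hK with ⟨p1, p2⟩ | ⟨p1, p2⟩ <;> rcases h₃.ends hK with ⟨q1, q2⟩ | ⟨q1, q2⟩ <;>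
      simp_all
  have n23 : e₂ ≠ e₃ := by
    rintro rfl
    rcases h₂.ends hK with ⟨p1, p2⟩ | ⟨p1, p2⟩ <;> rcases h₃.ends hK with ⟨q1, q2⟩ | ⟨q1, q2⟩ <;>
      simp_all
  -- Only the three sides of the triangle are involved: around any other edge the two-face is not
  -- crossed.
  have hmem : ∀ e, e ∉ ({e₁, e₂, e₃} : Finset E) →
      boundarySign (K.tail e) (K.head e) x • K.deficit r 0 (Pi.single f 1) e = 0 := by
    intro e he
    rw [deficit_single_eq_zero hK hr, smul_zero]
    rintro ⟨s, s', y, p, w, hc⟩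
    obtain ⟨h', hy1, hy2⟩ := hc.hasEdge_of_hasFace hK hz
    apply he
    have hs := h'.ne hK
    have key : ∀ {u v}, (u = a ∨ u = b ∨ u = c) → (v = a ∨ v = b ∨ v = c) → u ≠ v →
        K.HasEdge t u v e → e ∈ ({e₁, e₂, e₃} : Finset E) := by
      rintro u v (rfl | rfl | rfl) (rfl | rfl | rfl) huv h
      · exact absurd rfl huv
      · simp [h.unique hK h₁]
      · simp [(h.symm hK).unique hK h₃]
      · simp [(h.symm hK).unique hK h₁]
      · exact absurd rfl huv
      · simp [h.unique hK h₂]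
      · simp [h.unique hK h₃]
      · simp [(h.symm hK).unique hK h₂]
      · exact absurd rfl huv
    exact key ((ht.vert_mem h'.exists_vert.1).resolve_left hy1)
      ((ht.vert_mem h'.exists_vert.2).resolve_left hy2) hs h'
  rw [← Finset.sum_subset (Finset.subset_univ _) fun e _ he => hmem e he,
    Finset.sum_insert (by simp [n12, n13]), Finset.sum_insert (by simp [n23]),
    Finset.sum_singleton, boundarySign_smul_deficit_single hK hr h h₁,
    boundarySign_smul_deficit_single hK hr h.rotate h₂,
    boundarySign_smul_deficit_single hK hr h.rotate.rotate h₃, planeRotation_cyclic (r a),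
    planeRotation_cyclic (r b) (r c), planeRotation_cyclic (r a), ← add_smul, ← add_smul]
  simp [boundarySign]

variable [DecidableEq V] [DecidableEq E]

/-- The rotations around the three sides, each side directed along the cycle, are equal by
`planeRotation_cyclic`, so their contributions cancel at every vertex. -/
theorem complex_f₄_face [Fintype E] (hK : K.IsClosedOrientedManifold) (hr : TetGeneric r)
    {g : E → Matrix (Fin 4) (Fin 4) ℝ} (hg : K.IsFrame r g) (f : F) :
    (K.complex hK r g).f₄.mulVec (fun p => (K.complex hK r g).f₃ p (Sum.inr f)) = 0 := by
  ext ⟨x, p⟩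
  have h := congrFun (congrFun (sum_boundarySign_smul_deficit_single hK hr f x) p.1.1) p.1.2
  rw [Matrix.sum_apply] at h
  rw [complex_f₄_mulVec, Pi.zero_apply]
  refine Eq.trans (Finset.sum_congr rfl fun e _ => ?_) h
  have h' : (fun k => (K.complex hK r g).f₃ (e, k) (Sum.inr f)) =
      rotationComponents (g e) (K.deficit r 0 (Pi.single f 1) e) :=
    funext fun k => complex_f₃_face hK g e k f
  rw [h', deficit_eq_rotationOfComponents hK hr hg]
  rfl

end

end TetComplex

namespace TetComplex

variable {V E F T E' F' T' : Type*} {K : TetComplex V E F T} {K' : TetComplex V E' F' T'}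
  {r : V → R4} {g : E → Matrix (Fin 4) (Fin 4) ℝ} {g' : E' → Matrix (Fin 4) (Fin 4) ℝ}

namespace Move23

variable (m : K.Move23 K')

theorem edgeLength_some (hK : K.IsClosedOrientedManifold) (hK' : K'.IsClosedOrientedManifold)
    (e : E) : K'.edgeLength r (m.edgeMap (some e)) = K.edgeLength r e := by
  rcases m.ends_some hK hK' e with ⟨h1, h2⟩ | ⟨h1, h2⟩ <;> rw [edgeLength, edgeLength, h1, h2]
  exact dist_comm _ _

theorem edgeLength_none (hK' : K'.IsClosedOrientedManifold) :
    K'.edgeLength r (m.edgeMap none) = dist (r m.vD) (r m.vE) := by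
  rcases m.ends_none hK' with ⟨h1, h2⟩ | ⟨h1, h2⟩ <;> rw [edgeLength, h1, h2]
  exact dist_comm _ _

theorem edgeSign_cases (hK : K.IsClosedOrientedManifold) (hK' : K'.IsClosedOrientedManifold)
    (e : E) :
    (K'.tail (m.edgeMap (some e)) = K.tail e ∧ K'.head (m.edgeMap (some e)) = K.head e ∧
      m.edgeSign e = 1) ∨
    (K'.tail (m.edgeMap (some e)) = K.head e ∧ K'.head (m.edgeMap (some e)) = K.tail e ∧
      m.edgeSign e = -1) := by
  rcases m.ends_some hK hK' e with ⟨h1, h2⟩ | ⟨h1, h2⟩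
  · exact Or.inl ⟨h1, h2, if_pos h1⟩
  · exact Or.inr ⟨h1, h2, if_neg (by rw [h1]; exact (tail_ne_head hK e).symm)⟩

theorem abs_edgeSign (e : E) : |m.edgeSign e| = 1 := by
  rw [edgeSign]
  split_ifs <;> simp

/-- Both first axes are unit vectors along the same segment; they can differ only by the chosen
direction. -/
theorem frame_some (hK : K.IsClosedOrientedManifold) (hK' : K'.IsClosedOrientedManifold)
    (hr : TetGeneric r) (hg : K.IsFrame r g) (hg' : K'.IsFrame r g') (e : E) (i : Fin 4) :
    g' (m.edgeMap (some e)) i 0 = m.edgeSign e * g e i 0 := by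
  refine mul_left_cancel₀ (edgeLength_pos hK hr e).ne' ?_
  have h' := (hg' (m.edgeMap (some e))).2 i
  rw [m.edgeLength_some hK hK'] at h'
  rw [h', mul_left_comm, (hg e).2 i]
  rcases m.edgeSign_cases hK hK' e with ⟨h1, h2, h3⟩ | ⟨h1, h2, h3⟩ <;> rw [h1, h2, h3] <;> ring

/-! ### The comparison of the spaces of infinitesimal rotations -/

variable [DecidableEq E']

/-- The rotations around the old edges in the coordinates after the move. -/
noncomputable def oldRotations (g : E → Matrix (Fin 4) (Fin 4) ℝ)
    (g' : E' → Matrix (Fin 4) (Fin 4) ℝ) : Matrix (E' × Fin 3) (E × Fin 3) ℝ :=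
  Matrix.of fun p q =>
    if p.1 = m.edgeMap (some q.1) then frameMatrix (g q.1) (g' p.1) p.2 q.2 else 0

theorem oldRotations_mulVec_some [Fintype E] (w : E × Fin 3 → ℝ) (e : E) (k : Fin 3) :
    (m.oldRotations g g').mulVec w (m.edgeMap (some e), k) =
      (frameMatrix (g e) (g' (m.edgeMap (some e)))).mulVec (fun l => w (e, l)) k := by
  rw [Matrix.mulVec, dotProduct, Fintype.sum_prod_type,
    Finset.sum_eq_single_of_mem e (Finset.mem_univ e)]
  · simp [oldRotations, Matrix.mulVec, dotProduct]
  · intro e' _ h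
    simp [oldRotations, h.symm]

theorem oldRotations_mulVec_none [Fintype E] (w : E × Fin 3 → ℝ) (k : Fin 3) :
    (m.oldRotations g g').mulVec w (m.edgeMap none, k) = 0 := by
  simp [oldRotations, Matrix.mulVec, dotProduct]

variable [DecidableEq V] [DecidableEq E] [DecidableEq F] [DecidableEq F']

/-- The rotations produced by the angles at the new two-faces. -/
noncomputable def newRotations (hK' : K'.IsClosedOrientedManifold) (r : V → R4)
    (g' : E' → Matrix (Fin 4) (Fin 4) ℝ) : Matrix (E' × Fin 3) (Fin 3) ℝ :=
  Matrix.of fun p i => (K'.complex hK' r g').f₃ p (Sum.inr (m.faceMap (Sum.inr i)))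

/-- The comparison matrix of the spaces of infinitesimal rotations. -/
noncomputable def rotationMatrix (hK' : K'.IsClosedOrientedManifold) (r : V → R4)
    (g : E → Matrix (Fin 4) (Fin 4) ℝ) (g' : E' → Matrix (Fin 4) (Fin 4) ℝ) :
    Matrix (E' × Fin 3) ((E × Fin 3) ⊕ Fin 3) ℝ :=
  Matrix.fromCols (m.oldRotations g g') (m.newRotations hK' r g')

section

variable [Fintype V] [Fintype E] [Fintype E'] [Fintype F'] [Finite T']

/-- Split `x` into `f₂ (σ x)` and a remainder with vanishing inner components. The first part has no
deficits before or after the move, and for the second `deficit_extend` gives the old rotations up to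
direction; the frame matrices turn them into components. -/
theorem f₃_transferLin [Fintype F] [Finite T] (hK : K.IsClosedOrientedManifold) (hK' : K'.IsClosedOrientedManifold)
    (hr : TetGeneric r) (hg : K.IsFrame r g) (hg' : K'.IsFrame r g')
    {σ : (E ⊕ F → ℝ) →ₗ[ℝ] (V × Fin 4 → ℝ)}
    (hσ : ∀ x q, m.Inner q → (K.complex hK r g).f₂.mulVec (σ x) q = x q) (x : E ⊕ F → ℝ) :
    (K'.complex hK' r g').f₃.mulVec (m.transferLin hK hK' r g g' σ x) =
      (m.oldRotations g g').mulVec ((K.complex hK r g).f₃.mulVec x) := by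
  set y := x - (K.complex hK r g).f₂.mulVec (σ x) with hy
  have h1 : m.transferLin hK hK' r g g' σ x =
      m.extendLin y + (K'.complex hK' r g').f₂.mulVec (σ x) := by
    rw [transferLin_apply, hy, map_sub]
    abel
  have h2 : (K.complex hK r g).f₃.mulVec x = (K.complex hK r g).f₃.mulVec y := by
    rw [hy, Matrix.mulVec_sub, complex_f₃_mul_f₂ hK hr, sub_zero]
  have hy0 : ∀ q, m.Inner q → y q = 0 := fun q hq => by
    rw [hy, Pi.sub_apply, hσ x q hq, sub_self]
  obtain ⟨d1, d2⟩ := m.deficit_extend hK hK' hr (dl := y ∘ Sum.inl) (dϑ := y ∘ Sum.inr)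
    (fun t a b e ht he => hy0 _ ⟨t, a, b, ht, he⟩) (hy0 _ rfl)
  rw [h1, h2, Matrix.mulVec_add, complex_f₃_mul_f₂ hK' hr, add_zero]
  ext ⟨e', k⟩
  obtain ⟨o, rfl⟩ := m.edgeMap.surjective e'
  rw [complex_f₃_mulVec hK' hr]
  rcases o with _ | e
  · rw [oldRotations_mulVec_none]
    refine (congrArg (fun B => rotationComponents _ B k) d2).trans ?_
    fin_cases k <;> simp [rotationComponents]
  · rw [oldRotations_mulVec_some]
    refine (congrArg (fun B => rotationComponents _ B k) (d1 e)).trans ?_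
    rw [← deficit_eq_rotationOfComponents hK hr hg, rotationComponents_smul_rotationOfComponents
      (hg e).1 (hg' _).1 (m.frame_some hK hK' hr hg hg' e)]
    congr 2
    ext l
    rw [complex_f₃_mulVec hK hr]

theorem f₃_mul_transferMatrix [Fintype F] [Finite T] (hK : K.IsClosedOrientedManifold)
    (hK' : K'.IsClosedOrientedManifold) (hr : TetGeneric r) (hg : K.IsFrame r g)
    (hg' : K'.IsFrame r g') {σ : (E ⊕ F → ℝ) →ₗ[ℝ] (V × Fin 4 → ℝ)}
    (hσ : ∀ x q, m.Inner q → (K.complex hK r g).f₂.mulVec (σ x) q = x q) :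
    (K'.complex hK' r g').f₃ * m.transferMatrix hK hK' r g g' σ =
      m.rotationMatrix hK' r g g' * (Matrix.fromBlocks (K.complex hK r g).f₃ 0 0 1 :
        Matrix ((E × Fin 3) ⊕ Fin 3) ((E ⊕ F) ⊕ Fin 3) ℝ) := by
  have h1 : (K'.complex hK' r g').f₃ * LinearMap.toMatrix' (m.transferLin hK hK' r g g' σ) =
      m.oldRotations g g' * (K.complex hK r g).f₃ := by
    refine Matrix.ext_of_mulVec_single fun q => ?_
    rw [← Matrix.mulVec_mulVec, ← Matrix.mulVec_mulVec, LinearMap.toMatrix'_mulVec,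
      m.f₃_transferLin hK hK' hr hg hg' hσ]
  have h2 : (K'.complex hK' r g').f₃ * m.newFaces = m.newRotations hK' r g' := by
    ext p i
    rw [Matrix.mul_apply]
    simp [newFaces, newRotations]
  rw [transferMatrix, rotationMatrix, Matrix.mul_fromCols, Matrix.fromCols_mul_fromBlocks, h1, h2,
    Matrix.mul_zero, Matrix.mul_zero, add_zero, zero_add, Matrix.mul_one]

/-- An old edge may be reversed by the move, but then both its rotation and its boundary signs are
reversed. The old rotations have no component at `DE`, and the added columns are images of single
two-faces, which `f₄` kills. -/
theorem f₄_mul_rotationMatrix (hK : K.IsClosedOrientedManifold)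
    (hK' : K'.IsClosedOrientedManifold) (hr : TetGeneric r) (hg : K.IsFrame r g)
    (hg' : K'.IsFrame r g') :
    (K'.complex hK' r g').f₄ * m.rotationMatrix hK' r g g' =
      Matrix.fromCols (K.complex hK r g).f₄ 0 := by
  have h1 : (K'.complex hK' r g').f₄ * m.oldRotations g g' = (K.complex hK r g).f₄ := by
    refine Matrix.ext_of_mulVec_single fun q => ?_
    set w : E × Fin 3 → ℝ := Pi.single q 1
    rw [← Matrix.mulVec_mulVec]
    ext ⟨x, p⟩
    rw [complex_f₄_mulVec, complex_f₄_mulVec, ← m.edgeMap.sum_comp, Fintype.sum_option]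
    have hz : rotationOfComponents (g' (m.edgeMap none))
        (fun k => (m.oldRotations g g').mulVec w (m.edgeMap none, k)) = 0 := by
      have : (fun k => (m.oldRotations g g').mulVec w (m.edgeMap none, k)) = (0 : ℝ) • 0 := by
        ext k
        rw [oldRotations_mulVec_none]
        simp
      rw [this, rotationOfComponents_smul, zero_smul]
    rw [hz, Matrix.zero_apply, mul_zero, zero_add]
    refine Finset.sum_congr rfl fun e _ => ?_
    set c : Fin 3 → ℝ := fun l => w (e, l) with hc
    have h0 : (m.edgeSign e • rotationOfComponents (g e) c).transpose =
        -(m.edgeSign e • rotationOfComponents (g e) c) := by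
      rw [rotationOfComponents_eq (hg e).1, Matrix.transpose_smul, dualBivector_transpose, smul_neg]
    have h0' : (m.edgeSign e • rotationOfComponents (g e) c).toEuclideanLin
        ((g' (m.edgeMap (some e))).toEuclideanLin (EuclideanSpace.single 0 1)) = 0 := by
      have : (g' (m.edgeMap (some e))).toEuclideanLin (EuclideanSpace.single 0 1) =
          m.edgeSign e • (g e).toEuclideanLin (EuclideanSpace.single 0 1) := by
        ext i
        simp [Matrix.toLpLin_apply, m.frame_some hK hK' hr hg hg' e]
      rw [this, map_smul, map_smul, LinearMap.smul_apply, rotationOfComponents_eq (hg e).1,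
        dualBivector_right, smul_zero, smul_zero]
    have h2 : rotationOfComponents (g' (m.edgeMap (some e)))
        (fun k => (m.oldRotations g g').mulVec w (m.edgeMap (some e), k)) =
          m.edgeSign e • rotationOfComponents (g e) c := by
      rw [← rotationOfComponents_rotationComponents (hg' (m.edgeMap (some e))).1 h0 h0',
        rotationComponents_smul_rotationOfComponents (hg e).1 (hg' _).1
          (m.frame_some hK hK' hr hg hg' e)]
      congr 1
      ext k
      rw [oldRotations_mulVec_some]
    rw [h2, Matrix.smul_apply, smul_eq_mul, ← mul_assoc]
    congr 1
    rcases m.edgeSign_cases hK hK' e with ⟨k1, k2, k3⟩ | ⟨k1, k2, k3⟩ <;> rw [k1, k2, k3] <;> ring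
  have h2 : (K'.complex hK' r g').f₄ * m.newRotations hK' r g' = 0 := by
    ext p i
    exact congrFun (complex_f₄_face hK' hr hg' (m.faceMap (Sum.inr i))) p
  rw [rotationMatrix, Matrix.mul_fromCols, h1, h2]

end

end Move23

end TetComplex

/-! ### Volumes and rotations in the frame of the new edge -/

theorem dualBivector_sub (b c : R4) : dualBivector b (c - b) = dualBivector b c := by
  ext i j
  fin_cases i <;> fin_cases j <;> simp [dualBivector] <;> ring

theorem vol4_neg_neg_neg (a b c d : R4) : vol4 (-a) (-b) (-c) d = -vol4 a b c d := by
  simp only [vol4_eq, PiLp.neg_apply]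
  ring

theorem vol4_sub_sub_sub_neg (a b c d : R4) :
    vol4 (d - a) (d - b) (d - c) (-d) = vol4 a b c d := by
  simp only [vol4_eq, PiLp.neg_apply, PiLp.sub_apply]
  ring

theorem triangleArea_eq (a b c : R4) : 2 * triangleArea a b c = √(gram2 (b - a) (c - a)) := by
  have h := InnerProductGeometry.sin_angle_mul_norm_mul_norm (b - a) (c - a)
  have h' : gram2 (b - a) (c - a) = inner ℝ (b - a) (b - a) * inner ℝ (c - a) (c - a) -
      inner ℝ (b - a) (c - a) * inner ℝ (b - a) (c - a) := by
    rw [gram2]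
    ring
  rw [h', ← h, triangleArea, EuclideanGeometry.angle, dist_comm a b, dist_comm a c, dist_eq_norm,
    dist_eq_norm]
  simp only [vsub_eq_sub]
  ring

/-- The volume spanned by three vectors and a vector of length `l` along the first axis of a
positively oriented orthonormal frame. -/
theorem vol4_eq_mul_det {g : Matrix (Fin 4) (Fin 4) ℝ}
    (hg : g ∈ Matrix.specialOrthogonalGroup (Fin 4) ℝ) (b : Fin 3 → R4) {c : R4} {l : ℝ}
    (hc : g.transpose.toEuclideanLin c = l • EuclideanSpace.single 0 1) :
    vol4 (b 0) (b 1) (b 2) c =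
      -(l * (Matrix.of fun k i : Fin 3 => g.transpose.toEuclideanLin (b i) k.succ).det) := by
  obtain ⟨-, -, h3⟩ := orthogonal_of_mem hg
  have h := vol4_toEuclideanLin g.transpose (b 0) (b 1) (b 2) c
  rw [Matrix.det_transpose, h3, one_mul, hc] at h
  rw [← h, vol4_eq, Matrix.det_fin_three]
  simp
  ring

namespace TetComplex

variable {V E F T E' F' T' : Type*} {K : TetComplex V E F T} {K' : TetComplex V E' F' T'}
  {r : V → R4} {g : E → Matrix (Fin 4) (Fin 4) ℝ} {g' : E' → Matrix (Fin 4) (Fin 4) ℝ}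

namespace Move23

variable (m : K.Move23 K')

/-- The `i`-th new two-face separates the new tetrahedra with indices `i` and `i + 2`. The auxiliary
direction of `DE` decides which of them comes first. -/
theorem exists_isCrossing_new
    (hK' : K'.IsClosedOrientedManifold) (i : Fin 3) :
    ∃ t t' z d, K'.IsCrossing (m.edgeMap none) (m.faceMap (Sum.inr i)) t t' z (m.abc i) d := by
  have hne : m.tetMap (Sum.inr i) ≠ m.tetMap (Sum.inr (i + 2)) := by
    intro h
    have := Sum.inr_injective (m.tetMap.injective h)
    exact (show ∀ i : Fin 3, i ≠ i + 2 by decide) i this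
  have h := (m.new_face i).isHingeAt hK' (m.new_face'' i) hne (m.new_tet i).swap_swap
  rcases m.ends_none hK' with ⟨h1, h2⟩ | ⟨h1, h2⟩
  · exact ⟨m.tetMap (Sum.inr i), m.tetMap (Sum.inr (i + 2)), m.abc (i + 1), m.abc (i + 2),
      { toIsHingeAt := by rwa [h1, h2], edge := by rw [h1, h2]; exact m.new_edge i }⟩
  · exact ⟨m.tetMap (Sum.inr (i + 2)), m.tetMap (Sum.inr i), m.abc (i + 2), m.abc (i + 1),
      { toIsHingeAt := by rw [h1, h2]; exact h.reverse
        edge := by rw [h1, h2]; exact (m.new_edge (i + 2)).symm hK' }⟩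

/-- The new edge `DE` carries the three additional rotations. -/
noncomputable def rotationEquiv : (E × Fin 3) ⊕ Fin 3 ≃ E' × Fin 3 :=
  ((Equiv.refl (E × Fin 3)).sumCongr (Equiv.punitProd.{_, 0} (Fin 3)).symm).trans <|
    (Equiv.sumProdDistrib E PUnit.{1} (Fin 3)).symm.trans <|
    ((Equiv.optionEquivSumPUnit.{0} E).symm.trans m.edgeMap).prodCongr (Equiv.refl (Fin 3))

theorem rotationEquiv_inl (p : E × Fin 3) :
    m.rotationEquiv (Sum.inl p) = (m.edgeMap (some p.1), p.2) := rfl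

theorem rotationEquiv_inr (i : Fin 3) : m.rotationEquiv (Sum.inr i) = (m.edgeMap none, i) := rfl

variable [DecidableEq E'] [DecidableEq V] [DecidableEq F']

/-- The rotation around the triangle on `abc i` and `DE` is, up to the factor `1 / (2S)`, dual to an
edge vector `b i` and the vector of `DE`. Its components are therefore `l / (2S)` times the
coordinates of `b i` orthogonal to `DE`. The determinant of these coordinates is, up to sign, the
four-dimensional volume divided by `l`, which leaves the power `l²`. -/
theorem abs_det_newRotations [Finite V] [Finite T'] [Fintype F']
    (hK' : K'.IsClosedOrientedManifold) (hr : TetGeneric r) (hg' : K'.IsFrame r g') :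
    |(Matrix.of fun k i : Fin 3 => m.newRotations hK' r g' (m.edgeMap none, k) i).det| =
      dist (r m.vD) (r m.vE) ^ 2 *
        |vol4 (r (m.abc 0) - r m.vE) (r (m.abc 1) - r m.vE) (r (m.abc 2) - r m.vE)
          (r m.vD - r m.vE)| /
        ∏ i, √(gram2 (r m.vD - r (m.abc i)) (r m.vE - r (m.abc i))) := by
  set ε := m.edgeMap none with hε
  set l := K'.edgeLength r ε with hl
  have hl0 : 0 < l := edgeLength_pos hK' hr ε
  let b : Fin 3 → R4 := fun i => r (K'.tail ε) - r (m.abc i)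
  let s : Fin 3 → ℝ := fun i => √(gram2 (r m.vD - r (m.abc i)) (r m.vE - r (m.abc i)))
  obtain ⟨-, o2, -⟩ := orthogonal_of_mem (hg' ε).1
  have hc : (g' ε).transpose.toEuclideanLin (r (K'.head ε) - r (K'.tail ε)) =
      l • EuclideanSpace.single 0 1 := by
    rw [hg'.direction, map_smul, ← toEuclideanLin_mul, o2]
    simp [hl]
  have key : (Matrix.of fun k i : Fin 3 => m.newRotations hK' r g' (ε, k) i) =
      Matrix.of fun k i => ((s i)⁻¹ * l) *
        (Matrix.of fun k i : Fin 3 => (g' ε).transpose.toEuclideanLin (b i) k.succ) k i := by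
    ext k i
    obtain ⟨t, t', z, d, h⟩ := m.exists_isCrossing_new hK' i
    have hs : √(gram2 (r (K'.tail ε) - r (m.abc i)) (r (K'.head ε) - r (m.abc i))) = s i := by
      rcases m.ends_none hK' with ⟨h1, h2⟩ | ⟨h1, h2⟩ <;> rw [hε, h1, h2]
      rw [gram2_symm]
    have hsub : r (K'.head ε) - r (m.abc i) - b i = r (K'.head ε) - r (K'.tail ε) :=
      sub_sub_sub_cancel_right _ _ _
    rw [Matrix.of_apply, Matrix.of_apply, newRotations, Matrix.of_apply, complex_f₃_face,
      deficit_single_of_isCrossing hK' hr h, planeRotation, hs, rotationComponents_smul,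
      Pi.smul_apply, smul_eq_mul, ← dualBivector_sub, hsub,
      rotationComponents_dualBivector (hg' ε).1 hc, mul_assoc]
    rfl
  have hvol := vol4_eq_mul_det (hg' ε).1 b hc
  have hv : |vol4 (b 0) (b 1) (b 2) (r (K'.head ε) - r (K'.tail ε))| =
      |vol4 (r (m.abc 0) - r m.vE) (r (m.abc 1) - r m.vE) (r (m.abc 2) - r m.vE)
        (r m.vD - r m.vE)| := by
    simp only [b]
    rcases m.ends_none hK' with ⟨h1, h2⟩ | ⟨h1, h2⟩ <;> rw [hε, h1, h2]
    · rw [← vol4_sub_sub_sub_neg (r (m.abc 0) - r m.vE), sub_sub_sub_cancel_right, sub_sub_sub_cancel_right,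
        sub_sub_sub_cancel_right, neg_sub]
    · rw [← neg_sub (r (m.abc 0)), ← neg_sub (r (m.abc 1)), ← neg_sub (r (m.abc 2)),
        vol4_neg_neg_neg, abs_neg]
  rw [← hv, hvol, abs_neg, abs_mul, abs_of_pos hl0, key, Matrix.det_mul_row, abs_mul,
    Finset.abs_prod, ← m.edgeLength_none hK', ← hε, ← hl]
  have hprod : ∏ i, |(s i)⁻¹ * l| = l ^ 3 / ∏ i, s i := by
    rw [Fin.prod_univ_three, Fin.prod_univ_three, abs_of_nonneg (by positivity),
      abs_of_nonneg (by positivity), abs_of_nonneg (by positivity)]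
    simp only [div_eq_mul_inv, mul_inv]
    ring
  rw [hprod]
  ring

/-- The matrix is block triangular: old rotations have no component at `DE`, and between old edges
it is block diagonal with changes of frame of determinant `±1`. -/
theorem abs_det_rotationMatrix [Fintype E] [DecidableEq E]
    (hK : K.IsClosedOrientedManifold)
    (hK' : K'.IsClosedOrientedManifold) (hr : TetGeneric r) (hg : K.IsFrame r g)
    (hg' : K'.IsFrame r g') :
    |((m.rotationMatrix hK' r g g').submatrix m.rotationEquiv id).det| =
      |(Matrix.of fun k i : Fin 3 => m.newRotations hK' r g' (m.edgeMap none, k) i).det| := by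
  let A := (Matrix.blockDiagonal fun e : E => frameMatrix (g e) (g' (m.edgeMap (some e)))).submatrix
    (Equiv.prodComm E (Fin 3)) (Equiv.prodComm E (Fin 3))
  have key : (m.rotationMatrix hK' r g g').submatrix m.rotationEquiv id =
      Matrix.fromBlocks A (Matrix.of fun p i => m.newRotations hK' r g' (m.edgeMap (some p.1), p.2) i)
        0 (Matrix.of fun k i : Fin 3 => m.newRotations hK' r g' (m.edgeMap none, k) i) := by
    ext (⟨e, k⟩ | k) (⟨e', k'⟩ | k')
    · simp only [Matrix.submatrix_apply, rotationMatrix, id, Matrix.fromCols_apply_inl,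
        rotationEquiv_inl, Matrix.fromBlocks_apply₁₁, A, oldRotations, Matrix.of_apply,
        Matrix.blockDiagonal_apply, Equiv.prodComm_apply, Prod.swap_prod_mk,
        EmbeddingLike.apply_eq_iff_eq, Option.some.injEq]
      split_ifs with h
      · rw [h]
      · rfl
    · rfl
    · simp [rotationMatrix, rotationEquiv_inr, oldRotations]
    · rfl
  have hA : |A.det| = 1 := by
    rw [Matrix.det_submatrix_equiv_self, Matrix.det_blockDiagonal, Finset.abs_prod]
    exact Finset.prod_eq_one fun e _ => abs_det_frameMatrix (hg e).1 (hg' _).1 (m.abs_edgeSign e)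
      (m.frame_some hK hK' hr hg hg' e)
  rw [key, Matrix.det_fromBlocks_zero₂₁, abs_mul, hA, one_mul]

end Move23

end TetComplex

namespace TetComplex

variable {V E F T E' F' T' : Type*} {K : TetComplex V E F T} {K' : TetComplex V E' F' T'}
  {r : V → R4} {g : E → Matrix (Fin 4) (Fin 4) ℝ} {g' : E' → Matrix (Fin 4) (Fin 4) ℝ}

/-! ### Areas and weights -/

theorem IsHingeAt.faceArea_eq (hK : K.IsClosedOrientedManifold) {f : F} {t t' : T} {z a b c d : V}
    (h : K.IsHingeAt f t t' z a b c d) :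
    2 * K.faceArea hK r f = √(gram2 (r b - r a) (r c - r a)) := by
  obtain ⟨s, s', h'⟩ := exists_isHingeAt_hinge hK f
  rw [faceArea, triangleArea_eq]
  refine (h.induction hK h' (P := fun _ x y w _ => √(gram2 (r y - r x) (r w - r x)) =
    √(gram2 (r b - r a) (r c - r a))) ?_ ?_ rfl)
  · rintro - x y w - h
    rw [← h, gram2_cyclic, gram2_cyclic, gram2_cyclic]
  · rintro - x y w - h
    rw [← h, gram2_symm]

theorem faceArea_pos (hK : K.IsClosedOrientedManifold) (hr : TetGeneric r) (f : F) :
    0 < 2 * K.faceArea hK r f := by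
  obtain ⟨s, s', h⟩ := exists_isHingeAt_hinge hK f
  rw [h.faceArea_eq hK]
  exact Real.sqrt_pos.2 (h.tetRegular hK hr).gram_pos.1

namespace Move23

variable (m : K.Move23 K')

theorem two_mul_faceArea_old (hK : K.IsClosedOrientedManifold) (hK' : K'.IsClosedOrientedManifold)
    (f : {f : F // f ≠ m.fABC}) :
    2 * K'.faceArea hK' r (m.faceMap (Sum.inl f)) = 2 * K.faceArea hK r f := by
  obtain ⟨t, t', h'⟩ := exists_isHingeAt_hinge hK' (m.faceMap (Sum.inl f))
  obtain ⟨s, s', y, x, h, -⟩ := m.exists_isHingeAt_parent hK hK' h'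
  rw [h.faceArea_eq hK, h'.faceArea_eq hK']

theorem two_mul_faceArea_new (hK' : K'.IsClosedOrientedManifold) (i : Fin 3) :
    2 * K'.faceArea hK' r (m.faceMap (Sum.inr i)) =
      √(gram2 (r m.vD - r (m.abc i)) (r m.vE - r (m.abc i))) := by
  obtain ⟨t, t', z, d, h⟩ := m.exists_isCrossing_new hK' i
  rw [h.faceArea_eq hK']
  rcases m.ends_none hK' with ⟨h1, h2⟩ | ⟨h1, h2⟩ <;> rw [h1, h2]
  rw [gram2_symm]

theorem factor_eq : m.factor r =
    (∏ i, √(gram2 (r m.vD - r (m.abc i)) (r m.vE - r (m.abc i)))) /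
      (dist (r m.vD) (r m.vE) ^ 3 *
        √(gram2 (r (m.abc 1) - r (m.abc 0)) (r (m.abc 2) - r (m.abc 0)))) := by
  rw [factor, triangleArea_eq, triangleArea_eq, triangleArea_eq, triangleArea_eq,
    Fin.prod_univ_three]

variable [Fintype E] [Fintype F] [Fintype E'] [Fintype F']

/-- All common cells contribute equally to both weights; what remains is the length of `DE`, the
area of `ABC` and the three new areas. -/
theorem weight_mul_factor (hK : K.IsClosedOrientedManifold) (hK' : K'.IsClosedOrientedManifold)
    (hr : TetGeneric r) : m.factor r * K'.weight hK' r = K.weight hK r := by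
  classical
  have hl : ∏ e, K'.edgeLength r e ^ 3 =
      dist (r m.vD) (r m.vE) ^ 3 * ∏ e, K.edgeLength r e ^ 3 := by
    rw [← m.edgeMap.prod_comp, Fintype.prod_option, m.edgeLength_none hK']
    congr 1
    exact Finset.prod_congr rfl fun e _ => by rw [m.edgeLength_some hK hK']
  have hf : ∏ f, (2 * K'.faceArea hK' r f) =
      (∏ f : {f // f ≠ m.fABC}, (2 * K.faceArea hK r f)) *
        ∏ i, √(gram2 (r m.vD - r (m.abc i)) (r m.vE - r (m.abc i))) := by
    rw [← m.faceMap.prod_comp, Fintype.prod_sum_type]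
    congr 1
    · exact Finset.prod_congr rfl fun f _ => m.two_mul_faceArea_old hK hK' f
    · exact Finset.prod_congr rfl fun i _ => m.two_mul_faceArea_new hK' i
  have hf' : ∏ f, (2 * K.faceArea hK r f) =
      √(gram2 (r (m.abc 1) - r (m.abc 0)) (r (m.abc 2) - r (m.abc 0))) *
        ∏ f : {f // f ≠ m.fABC}, (2 * K.faceArea hK r f) := by
    rw [Fintype.prod_eq_mul_prod_subtype_ne _ m.fABC, (m.isHingeAt_fABC hK hK').faceArea_eq hK]
  have h1 : dist (r m.vD) (r m.vE) ≠ 0 := by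
    rw [← m.edgeLength_none hK']
    exact (edgeLength_pos hK' hr _).ne'
  have h2 : √(gram2 (r (m.abc 1) - r (m.abc 0)) (r (m.abc 2) - r (m.abc 0))) ≠ 0 := by
    rw [← (m.isHingeAt_fABC hK hK').faceArea_eq hK]
    exact (faceArea_pos hK hr _).ne'
  have h3 : ∏ i, √(gram2 (r m.vD - r (m.abc i)) (r m.vE - r (m.abc i))) ≠ 0 :=
    Finset.prod_ne_zero_iff.2 fun i _ => by
      rw [← m.two_mul_faceArea_new hK' i]
      exact (faceArea_pos hK' hr _).ne'
  have h4 : ∏ f : {f // f ≠ m.fABC}, (2 * K.faceArea hK r f) ≠ 0 :=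
    Finset.prod_ne_zero_iff.2 fun f _ => (faceArea_pos hK hr _).ne'
  rw [m.factor_eq, weight, weight, hl, hf, hf']
  field_simp

end Move23

end TetComplex

/-! ### Comparison of the two torsions -/

theorem theorem2 {V E F T E' F' T' : Type*}
    [Fintype V] [DecidableEq V] [Fintype E] [DecidableEq E] [Fintype F] [DecidableEq F] [Finite T]
    [Fintype E'] [DecidableEq E'] [Fintype F'] [DecidableEq F'] [Finite T']
    (K : TetComplex V E F T) (hK : K.IsClosedOrientedManifold)
    (K' : TetComplex V E' F' T') (hK' : K'.IsClosedOrientedManifold)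
    (m : K.Move23 K')
    (r : V → R4) (hr : TetComplex.GeneralPosition r)
    (g : E → Matrix (Fin 4) (Fin 4) ℝ) (hg : K.IsFrame r g)
    (g' : E' → Matrix (Fin 4) (Fin 4) ℝ) (hg' : K'.IsFrame r g') :
    ((K.complex hK r g).IsAcyclic ↔ (K'.complex hK' r g').IsAcyclic) ∧
    ((K.complex hK r g).IsAcyclic →
      Nonempty (K.complex hK r g).TauChain ∧ Nonempty (K'.complex hK' r g').TauChain ∧
      ∀ (c : (K.complex hK r g).TauChain) (c' : (K'.complex hK' r g').TauChain),
        |c'.torsion| = |c.torsion| * m.factor r ∧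
        |c'.torsion| * K'.weight hK' r = |c.torsion| * K.weight hK r) := by
  -- The five vertices of the move are different, as `D ≠ E` is forced by the new tetrahedra. They
  -- supply the quintuple needed to extract information from general position.
  have hT := hr.tetGeneric (m.injective_five hK hK')
  have hv : vol4 (r (m.abc 0) - r m.vE) (r (m.abc 1) - r m.vE) (r (m.abc 2) - r m.vE)
      (r m.vD - r m.vE) ≠ 0 := by
    simpa using hr.vol4_ne_zero (m.injective_five hK hK')
  obtain ⟨σ, hσ, hσ'⟩ := m.exists_section hK hK' hT g
  have d2 := m.abs_det_transferMatrix hK hK' hT g g' hσ hσ'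
  have d3 := (m.abs_det_rotationMatrix hK hK' hT hg hg').trans (m.abs_det_newRotations hK' hT hg')
  have h1 : dist (r m.vD) (r m.vE) ≠ 0 := by
    rw [← m.edgeLength_none hK']
    exact (TetComplex.edgeLength_pos hK' hT _).ne'
  have h2 : √(gram2 (r (m.abc 1) - r (m.abc 0)) (r (m.abc 2) - r (m.abc 0))) ≠ 0 := by
    rw [← (m.isHingeAt_fABC hK hK').faceArea_eq hK]
    exact (TetComplex.faceArea_pos hK hT _).ne'
  have h3 : ∏ i, √(gram2 (r m.vD - r (m.abc i)) (r m.vE - r (m.abc i))) ≠ 0 :=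
    Finset.prod_ne_zero_iff.2 fun i _ => by
      rw [← m.two_mul_faceArea_new hK' i]
      exact (TetComplex.faceArea_pos hK' hT _).ne'
  have hv' := abs_ne_zero.2 hv
  -- The outer maps `f₁` and `f₅` depend only on the vertices and their coordinates, which explains
  -- the two `rfl`.
  obtain ⟨hiff, htau⟩ := BasedComplex.compare_of_stable_iso (K.complex hK r g)
    (K'.complex hK' r g') (m.transferMatrix hK hK' r g g' σ) (m.rotationMatrix hK' r g g')
    m.cellEquiv m.rotationEquiv rfl (m.f₂_eq_transferMatrix_mul hK hK' hT g g' hσ)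
    (m.f₃_mul_transferMatrix hK hK' hT hg hg' hσ) (m.f₄_mul_rotationMatrix hK hK' hT hg hg') rfl
    (by
      rw [← abs_ne_zero, d2]
      exact div_ne_zero hv' (mul_ne_zero h2 h1))
    (by
      rw [← abs_ne_zero, d3]
      exact div_ne_zero (mul_ne_zero (pow_ne_zero 2 h1) hv') h3)
  refine ⟨hiff, fun hX => ?_⟩
  obtain ⟨n, n', h⟩ := htau hX
  refine ⟨n, n', fun c c' => ?_⟩
  have hc : |c'.torsion| = |c.torsion| * m.factor r := by
    -- The volume of the five points occurs in both determinants and cancels in their quotient;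
    -- general position makes it nonzero.
    rw [h c c', d2, d3, m.factor_eq]
    congr 1
    field_simp
  exact ⟨hc, by rw [hc, mul_assoc, m.weight_mul_factor hK hK' hT]⟩
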